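/- Let $M$ be a $d$-dimensional (Hausdorff, second countable) smooth manifold without boundary, let $\mu$ be a probability measure on $M$ with smooth positive density with respect to Lebesgue measure in charts (equivalently, with respect to the volume of a Riemannian metric on $M$), and let $X_1,\dots,X_k$ be smooth vector fields on $M$. (H\"ormander's bracket condition is not needed.) Let $\nabla$ be the $L^2(\mu)$-closure of $f\mapsto(X_1f,\dots,X_kf)$ on $C_c^\infty(M)$, let $L=-\nabla^*\nabla=-\sum_i X_i^*X_i$ be the associated self-adjoint sub-Laplacian on $L^2(M,\mu)$, and write $\Gamma(f,f)=\sum_i|X_if|^2$. Assume that the semigroup $e^{tL}$ is Markov, i.e. $e^{tL}1=1$, equivalently $1\in\mathrm{dom}(L)$ and $L1=0$ (automatic when $M$ is compact). Operators and vector fields act entrywise on matrix-valued functions. Let $P:L^\infty(M,\mu)\to L^\infty(M,\mu)$ be a Markov map (linear, $P1=1$, $Pf\ge0$ if $f\ge 0$) with $\int Pf\,d\mu=\int f\,d\mu$, extended continuously to $L^2(M,\mu)$, and let $C$ be a constant such that $$\Gamma(Pf,Pf)\le C\,P\,\Gamma(f,f)\quad\text{a.e., for all scalar } f\in C_c^\infty(M).$$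 Suppose moreover that $[P,L]=0$, i.e. $f\in\mathrm{dom}(L)$ implies $Pf\in\mathrm{dom}(L)$ and $LPf=PLf$. Let $P^\dagger$ be the adjoint of $P$, acting on $L^1$ by $\langle F,P^\dagger h\rangle=\langle PF,h\rangle$ for $F\in L^\infty$. Let $\rho:M\to \mathbb M_n(\mathbb C)$ be a matrix-valued density, i.e. $\rho\ge0$ a.e., $\rho\in L^1$ and $\int\mathrm{tr}\,\rho\,d\mu=1$. Its Fisher information is $$I(\rho)=\int_0^\infty\sum_{i=1}^k\int_M\mathrm{tr}\Big((X_i\rho)^*(\rho+s\mathbf 1)^{-1}(X_i\rho)(\rho+s\mathbf 1)^{-1}\Big)d\mu\,ds\in[0,\infty]$$ with weak derivatives $X_i\rho\in L^1$, and $I(\rho)=\infty$ if $\rho$ has no such weak derivatives. Then $P^\dagger\rho$ exists, is a matrix-valued density, and $$I(P^\dagger\rho)\le C\,I(\rho)$$ (with the conventions $0\cdot\infty=0$, and $C$ replaced by $\max(C,0)$ on the right-hand side). Moreover, if $\rho\in\mathrm{dom}(L)$ and $\rho\ge\delta\mathbf 1$ a.e. for some $\delta>0$, then $P^\dagger\rho\in\mathrm{dom}(L)$,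 the functions $\mathrm{tr}((L\rho)\ln\rho)$ and $\mathrm{tr}((LP^\dagger\rho)\ln P^\dagger\rho)$ are integrable, and $$-\int_M\mathrm{tr}\big((LP^\dagger\rho)\ln P^\dagger\rho\big)\,d\mu\le C\Big(-\int_M\mathrm{tr}\big((L\rho)\ln\rho\big)\,d\mu\Big).$$ -/

import Mathlib

open MeasureTheory Filter Topology
open scoped Manifold ContDiff ENNReal ComplexOrder ComplexConjugate

noncomputable section

namespace SubLaplacian

variable {d k n : ℕ} {M : Type*} [TopologicalSpace M] [ChartedSpace (EuclideanSpace ℝ (Fin d)) M]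

/-- A vector field on the manifold `M` (a section of the tangent bundle). -/
abbrev VField (d : ℕ) (M : Type*) [TopologicalSpace M]
    [ChartedSpace (EuclideanSpace ℝ (Fin d)) M] : Type _ :=
  (x : M) → TangentSpace (𝓡 d) x

/-- The vector field `V` is smooth. -/
def IsSmoothField [IsManifold (𝓡 d) ∞ M] (V : VField d M) : Prop :=
  ContMDiff (𝓡 d) (𝓡 d).tangent ∞ (fun x => (⟨x, V x⟩ : TangentBundle (𝓡 d) M))

/-- `f ∈ C_c^∞(M)`, complex valued. -/
def IsTest (d : ℕ) {M : Type*} [TopologicalSpace M] [ChartedSpace (EuclideanSpace ℝ (Fin d)) M]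
    (f : M → ℂ) : Prop :=
  ContMDiff (𝓡 d) 𝓘(ℝ, ℂ) ∞ f ∧ HasCompactSupport f

/-- The derivative `V f` of a function `f` along the vector field `V`. -/
def lieD (V : VField d M) (f : M → ℂ) : M → ℂ :=
  fun x => (mfderiv (𝓡 d) 𝓘(ℝ, ℂ) f x : TangentSpace (𝓡 d) x → ℂ) (V x)

/-- The carré du champ `Γ(f,f) = ∑ i, |X i f|²` of a smooth function. -/
def carre (X : Fin k → VField d M) (f : M → ℂ) : M → ℝ :=
  fun x => ∑ i, ‖lieD (X i) f x‖ ^ 2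

variable [MeasurableSpace M]

/-- `μ` has a smooth positive density with respect to Lebesgue measure in every chart
(equivalently, with respect to the volume of any Riemannian metric on `M`). -/
def IsSmoothMeasure (d : ℕ) {M : Type*} [TopologicalSpace M]
    [ChartedSpace (EuclideanSpace ℝ (Fin d)) M] [MeasurableSpace M] (μ : Measure M) : Prop :=
  ∀ x : M, ∃ m : EuclideanSpace ℝ (Fin d) → ℝ,
    ContDiffOn ℝ ∞ m (chartAt (EuclideanSpace ℝ (Fin d)) x).target ∧
    (∀ y ∈ (chartAt (EuclideanSpace ℝ (Fin d)) x).target, 0 < m y) ∧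
    ∀ s ⊆ (chartAt (EuclideanSpace ℝ (Fin d)) x).source, MeasurableSet s →
      μ s = ∫⁻ y in chartAt (EuclideanSpace ℝ (Fin d)) x '' s, ENNReal.ofReal (m y)

/-- `V^* φ = ψ`, where `V^*` is the adjoint of `V` with respect to `μ`:
`⟨ψ, η⟩ = ⟨φ, V η⟩` for all test functions `η`.  For a smooth field and a smooth measure every test
function `φ` has exactly one such `ψ`, namely `ψ = - V φ - div_μ(V) φ`. -/
def IsFormalAdjoint (μ : Measure M) (V : VField d M) (φ ψ : M → ℂ) : Prop :=
  IsTest d ψ ∧ ∀ η, IsTest d η → ∫ x, conj (ψ x) * η x ∂μ = ∫ x, conj (φ x) * lieD V η x ∂μ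

/-- `G = (X 1 f, …, X k f)` in the weak sense, all functions being in `L¹(M, μ)`. -/
def IsWeakGrad (μ : Measure M) (X : Fin k → VField d M) (f : M → ℂ) (G : Fin k → M → ℂ) : Prop :=
  Integrable f μ ∧ ∀ i, Integrable (G i) μ ∧
    ∀ φ ψ, IsTest d φ → IsFormalAdjoint μ (X i) φ ψ →
      ∫ x, conj (φ x) * G i x ∂μ = ∫ x, conj (ψ x) * f x ∂μ

/-- `f` is in the domain of the `L²`-closure `∇` of `(X 1, …, X k)` on `C_c^∞(M)`, and `∇ f = G`. -/
def IsClosedGrad (μ : Measure M) (X : Fin k → VField d M) (f : M → ℂ) (G : Fin k → M → ℂ) : Prop :=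
  MemLp f 2 μ ∧ (∀ i, MemLp (G i) 2 μ) ∧
    ∃ u : ℕ → M → ℂ, (∀ m, IsTest d (u m)) ∧
      Tendsto (fun m => eLpNorm (u m - f) 2 μ) atTop (𝓝 0) ∧
      ∀ i, Tendsto (fun m => eLpNorm (lieD (X i) (u m) - G i) 2 μ) atTop (𝓝 0)

/-- The graph of the sub-Laplacian `L = - ∑ i, (X i)^* (X i) = - ∇^* ∇`, as a self-adjoint operator
on `L²(M, μ)`: `f ∈ dom L` and `L f = u`. -/
def IsSubLaplacian (μ : Measure M) (X : Fin k → VField d M) (f u : M → ℂ) : Prop :=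
  MemLp u 2 μ ∧ ∃ G, IsClosedGrad μ X f G ∧
    ∀ φ, IsTest d φ →
      ∑ i, ∫ x, conj (lieD (X i) φ x) * G i x ∂μ = - ∫ x, conj (φ x) * u x ∂μ

/-- The semigroup `e^{tL}` is conservative (`e^{tL} 1 = 1`), that is, `1 ∈ dom L` and `L 1 = 0`.
This is automatic if `M` is compact. -/
def IsConservative (μ : Measure M) (X : Fin k → VField d M) : Prop :=
  IsSubLaplacian μ X (fun _ => 1) (fun _ => 0)

/-- `P : L^∞(M, μ) → L^∞(M, μ)` is a Markov map (unital and positivity preserving) that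
preserves `μ`. -/
structure IsMarkovMap (μ : Measure M) (P : Lp ℂ ∞ μ →ₗ[ℂ] Lp ℂ ∞ μ) : Prop where
  unital : ∀ f : Lp ℂ ∞ μ, f =ᵐ[μ] (fun _ => (1 : ℂ)) → P f =ᵐ[μ] (fun _ => (1 : ℂ))
  positive : ∀ f : Lp ℂ ∞ μ, (∀ᵐ x ∂μ, 0 ≤ f x) → ∀ᵐ x ∂μ, 0 ≤ P f x
  preserves : ∀ f : Lp ℂ ∞ μ, ∫ x, P f x ∂μ = ∫ x, f x ∂μ

/-- The gradient estimate `Γ(P f, P f) ≤ C P Γ(f, f)` for all scalar `f ∈ C_c^∞(M)`.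
The gradient of `P f` is the weak one, since smoothness of `P f` is not presupposed. -/
def GradientEstimate (μ : Measure M) (X : Fin k → VField d M) (P : Lp ℂ ∞ μ →ₗ[ℂ] Lp ℂ ∞ μ)
    (C : ℝ) : Prop :=
  ∀ f, IsTest d f → ∀ F S : Lp ℂ ∞ μ, F =ᵐ[μ] f → S =ᵐ[μ] (fun x => (carre X f x : ℂ)) →
    ∃ G, IsWeakGrad μ X (P F) G ∧ ∀ᵐ x ∂μ, ∑ i, ‖G i x‖ ^ 2 ≤ C * (P S x).re

/-- `P f = g` for the continuous extension of `P` from `L^∞(M, μ)` to `L²(M, μ)`. -/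
def IsExtension (μ : Measure M) (P : Lp ℂ ∞ μ →ₗ[ℂ] Lp ℂ ∞ μ) (f g : M → ℂ) : Prop :=
  MemLp f 2 μ ∧ MemLp g 2 μ ∧ ∃ F : ℕ → Lp ℂ ∞ μ,
    Tendsto (fun m => eLpNorm (⇑(F m) - f) 2 μ) atTop (𝓝 0) ∧
    Tendsto (fun m => eLpNorm (⇑(P (F m)) - g) 2 μ) atTop (𝓝 0)

/-- `[P, L] = 0`: the bounded operator `P` on `L²(M, μ)` maps `dom L` to itself and
`L P f = P L f` for all `f ∈ dom L`. -/
def Commutes (μ : Measure M) (X : Fin k → VField d M) (P : Lp ℂ ∞ μ →ₗ[ℂ] Lp ℂ ∞ μ) : Prop :=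
  ∀ f u g v, IsSubLaplacian μ X f u → IsExtension μ P f g → IsExtension μ P u v →
    IsSubLaplacian μ X g v

/-- `ρ : M → M_n(ℂ)` is a matrix-valued density: `ρ ≥ 0` and `∫ tr ρ dμ = 1`. -/
structure IsMatrixDensity (μ : Measure M) (ρ : M → Matrix (Fin n) (Fin n) ℂ) : Prop where
  posSemidef : ∀ᵐ x ∂μ, (ρ x).PosSemidef
  integrable : ∀ a b, Integrable (fun x => ρ x a b) μ
  trace_one : ∫ x, (ρ x).trace ∂μ = 1

/-- `σ = P^† ρ`, the adjoint of `P` acting entrywise on a matrix-valued `L¹` function: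
`⟨F, σ_ab⟩ = ⟨P F, ρ_ab⟩` for all `F ∈ L^∞(M, μ)`. -/
def IsAdjointImage (μ : Measure M) (P : Lp ℂ ∞ μ →ₗ[ℂ] Lp ℂ ∞ μ)
    (ρ σ : M → Matrix (Fin n) (Fin n) ℂ) : Prop :=
  ∀ a b, Integrable (fun x => σ x a b) μ ∧
    ∀ F : Lp ℂ ∞ μ, ∫ x, conj (F x) * σ x a b ∂μ = ∫ x, conj (P F x) * ρ x a b ∂μ

/-- `G = ∇ ρ` entrywise, in the weak sense. -/
def IsMatrixWeakGrad (μ : Measure M) (X : Fin k → VField d M)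
    (ρ : M → Matrix (Fin n) (Fin n) ℂ) (G : Fin k → M → Matrix (Fin n) (Fin n) ℂ) : Prop :=
  ∀ a b, IsWeakGrad μ X (fun x => ρ x a b) (fun i x => G i x a b)

/-- `u = L ρ` entrywise. -/
def IsMatrixSubLaplacian (μ : Measure M) (X : Fin k → VField d M)
    (ρ u : M → Matrix (Fin n) (Fin n) ℂ) : Prop :=
  ∀ a b, IsSubLaplacian μ X (fun x => ρ x a b) (fun x => u x a b)

/-- The Fisher information
`I(ρ) = ∫_0^∞ ⟨∇ρ, (ρ + s 1)⁻¹ (∇ρ) (ρ + s 1)⁻¹⟩_tr ds ∈ [0, ∞]` of a matrix-valued density.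
The weak gradient is unique up to null sets, so the infimum only has the effect that `I(ρ) = ∞` if
`ρ` has no weak gradient in `L¹`. -/
def fisherInfo (μ : Measure M) (X : Fin k → VField d M)
    (ρ : M → Matrix (Fin n) (Fin n) ℂ) : ℝ≥0∞ :=
  ⨅ (G : Fin k → M → Matrix (Fin n) (Fin n) ℂ) (_ : IsMatrixWeakGrad μ X ρ G),
    ∫⁻ s in Set.Ioi (0 : ℝ), ∑ i, ∫⁻ x, ENNReal.ofReal
      (((G i x).conjTranspose * (ρ x + (s : ℂ) • (1 : Matrix (Fin n) (Fin n) ℂ))⁻¹ * G i x *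
        (ρ x + (s : ℂ) • (1 : Matrix (Fin n) (Fin n) ℂ))⁻¹).trace.re) ∂μ

/-- The function `tr((L ρ) ln ρ)`, where `u = L ρ` and `ln` is the matrix logarithm. -/
def traceMulLog (u ρ : M → Matrix (Fin n) (Fin n) ℂ) : M → ℂ :=
  fun x => (u x * cfc Real.log (ρ x)).trace

/-- `ρ ≥ δ 1` almost everywhere, for some `δ > 0`. -/
def IsUniformlyPositive (μ : Measure M) (ρ : M → Matrix (Fin n) (Fin n) ℂ) : Prop :=
  ∃ δ : ℝ, 0 < δ ∧ ∀ᵐ x ∂μ, (ρ x - (δ : ℂ) • (1 : Matrix (Fin n) (Fin n) ℂ)).PosSemidef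

end SubLaplacian

end

set_option linter.unusedSectionVars false

/-! In an eigenbasis of `A` with eigenvalues `a p`, the Fisher density of `(A, G)` is `∑ κ(a p, a q)
|G p q|²`, where `κ(a, b) = ∫_0^∞ ds / ((a + s)(b + s)) = ∫_0^1 dw / (w a + (1 - w) b)` is the
inverse of the logarithmic mean. Its dual quadratic form is `Q_A(V) = ∑ κ(a p, a q)⁻¹ |V p q|²`, and
Young's inequality gives `2 Re tr(V* G) ≤ t I_A(G) + t⁻¹ Q_A(V)` for every `t > 0`.

The form `Q_A` is concave in `A` and has explicit linear majorants. If `V = ∫_0^1 v_w dw`, the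
Cauchy–Schwarz inequality with weight `w a p + (1 - w) a q` yields `Q_A(V) ≤ tr(A N)` with `N = ∫ (w
v_w v_w* + (1 - w) v_w* v_w) dw`, for all positive `A` at once. When `v_w` solves the Sylvester
equation `w B v + (1 - w) v B = H`, the matrix `V` is the derivative of the logarithm at `B` in
direction `H`, and at `A = B` the bound is an equality whose value is the Fisher density of `(B,
H)`. The relation "`Q_A(V) ≤ tr(A N)` for all `A`" is `Dominates V N`; see `dominates_logDeriv` and
`trace_mul_dualN_self`.

The scalar gradient estimate carries this relation through `P`: for a fixed eigenbasis and fixed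
weights, `Q_A(∇f)` is a positive combination of scalar carrés du champ of linear combinations of the
entries of `f`, so `Dominates (∇f) N` implies `Dominates (∇Pf) (C P N)`
(`GradientEstimate.dominates`). Let `σ = P^† ρ`, and let `f` approximate `ln σ` in the graph norm.
Then `2 ∫ Re tr((∇f)* ∇σ) = 2 ∫ Re tr((∇Pf)* ∇ρ) ≤ t I(ρ) + t⁻¹ C ∫ tr(ρ P N) = t I(ρ) + t⁻¹ C ∫
tr(σ N)`. In the limit the left side is `2 I(σ)` and the last integral is `I(σ)`, so `t = C` gives
`I(σ) ≤ C I(ρ)` (`IsNice.pairing_le`, `IsNice.fisherReal_le`).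

The first equality is where `[P, L] = 0` enters. By the gradient estimate `P` is bounded on the
graph of the closed gradient. Its adjoint there is identified with `P^†` by testing against `(1 -
L)⁻¹ g`, because `P` commutes with this resolvent (`exists_adjoint_graph`).

The remaining work is regularity. Friedrichs' commutator lemma in charts (`exists_friedrichs`) shows
that localised weakly differentiable functions are limits of test functions, which gives the chain
rule for matrix resolvents and then for the logarithm. Conservativeness supplies cutoffs, so bounded
functions with square integrable weak gradient lie in the closed domain. A general density of finite
Fisher information is replaced by its Yosida approximation `R ρ (ρ + R)⁻¹ + ε`, which is bounded
above and below and, by a change of variables in `s`, has no larger Fisher information. The limit is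
taken by lower semicontinuity, again from duality (`exists_weakGrad_of_fisherReal_le`).

For `ρ` bounded below and in the domain of `L`, integration by parts against `ln ρ` turns the
entropy production into the Fisher information. Constants `C ≤ 0` are treated apart: then the
relevant gradients vanish. -/

namespace SubLaplacian

noncomputable section

variable {d k n : ℕ} {ι : Type*} {l : Filter ι} {p : ℝ≥0∞}

local notation "𝔼" => EuclideanSpace ℝ (Fin d)
local notation "𝔠" => chartAt (EuclideanSpace ℝ (Fin d))
local notation "𝕄" => Matrix (Fin n) (Fin n) ℂ
local notation "𝕌" => Matrix.unitaryGroup (Fin n) ℂ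
local notation:max "↟" f:max => fun x => ((f x : ℝ) : ℂ)
local notation "Smooth" => ContMDiff (𝓡 d) 𝓘(ℝ, ℂ) ∞

/-! ### Translations, divergence and Friedrichs' lemma in Euclidean space. -/

section Euclidean
variable {g : EuclideanSpace ℝ (Fin d) → ℂ} {η : EuclideanSpace ℝ (Fin d) → ℝ}
  {V : EuclideanSpace ℝ (Fin d) → EuclideanSpace ℝ (Fin d)}

theorem tendsto_eLpNorm_translate_sub [Fact (1 ≤ p)] (hp : p ≠ ⊤) (hg : MemLp g p volume) :
    Tendsto (fun z : 𝔼 => eLpNorm (fun x => g (x - z) - g x) p volume) (𝓝 0) (𝓝 0) := by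
  let T : 𝔼 → C(𝔼, 𝔼) := fun z => ⟨fun x => x - z, by fun_prop⟩
  have hT : Continuous T := by
    apply ContinuousMap.continuous_of_continuous_uncurry
    show Continuous (fun q : 𝔼 × 𝔼 => q.2 - q.1)
    fun_prop
  have hmp : ∀ z, MeasurePreserving (T z) volume volume := fun z =>
    measurePreserving_sub_right volume z
  have h1 : Tendsto (fun z => Lp.compMeasurePreserving (T z) (hmp z) hg.toLp) (𝓝 0)
      (𝓝 (Lp.compMeasurePreserving (T 0) (hmp 0) hg.toLp)) :=
    Filter.Tendsto.compMeasurePreservingLp tendsto_const_nhds (hT.tendsto 0) hmp (hmp 0) hp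
  rw [tendsto_iff_edist_tendsto_0] at h1
  refine h1.congr fun z => ?_
  rw [Lp.edist_def]
  apply eLpNorm_congr_ae
  have e1 := Lp.coeFn_compMeasurePreserving hg.toLp (hmp z)
  have e2 := Lp.coeFn_compMeasurePreserving hg.toLp (hmp 0)
  have e3 := (hmp z).quasiMeasurePreserving.ae_eq_comp hg.coeFn_toLp
  have e4 := (hmp 0).quasiMeasurePreserving.ae_eq_comp hg.coeFn_toLp
  filter_upwards [e1, e2, e3, e4] with x h1 h2 h3 h4
  simp only [Pi.sub_apply, h1, h2, h3, h4]
  simp [T]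

/-- Jensen's inequality for the measure `K m dz` bounds the `p`-th power of the norm of `R m` by an
average of those of `g (· - z) - g` over `‖z‖ ≤ r m`, and these tend to zero by continuity of
translations. The lemma serves mollification and the Friedrichs commutator alike. -/
theorem tendsto_eLpNorm_of_le_lintegral_translate [Fact (1 ≤ p)]
    (hp : p ≠ ⊤) (hg : MemLp g p volume) {K : ℕ → 𝔼 → ℝ≥0∞} (hKm : ∀ m, Measurable (K m))
    {r : ℕ → ℝ} (hr : Tendsto r atTop (𝓝 0)) (hKs : ∀ m z, K m z ≠ 0 → ‖z‖ ≤ r m)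
    {c : ℝ≥0∞} (hc : c ≠ ⊤) (hKc : ∀ m, ∫⁻ z, K m z ≤ c) {R : ℕ → 𝔼 → ℂ}
    (hR : ∀ m x, ‖R m x‖ₑ ≤ ∫⁻ y, K m (x - y) * ‖g y - g x‖ₑ) :
    Tendsto (fun m => eLpNorm (R m) p volume) atTop (𝓝 0) := by
  have hp1 : 1 ≤ p := Fact.out
  have hp0 : p ≠ 0 := (one_pos.trans_le hp1).ne'
  set q := p.toReal with hq
  have hq1 : 1 ≤ q := by rw [hq, ← ENNReal.toReal_one]; exact ENNReal.toReal_mono hp hp1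
  have hq0 : 0 < q := by linarith
  have hjm : AEStronglyMeasurable (fun w : 𝔼 × 𝔼 => g (w.1 - w.2) - g w.1)
      (volume.prod volume) := by
    refine AEStronglyMeasurable.sub ?_ ?_
    · exact hg.1.comp_quasiMeasurePreserving
        (quasiMeasurePreserving_sub_of_right_invariant volume volume)
    · exact hg.1.comp_fst
  -- Jensen
  have key : ∀ m, ∀ ε : ℝ≥0∞, (∀ z, ‖z‖ ≤ r m → eLpNorm (fun x => g (x - z) - g x) p volume ≤ ε) →
      eLpNorm (R m) p volume ≤ c * ε := by
    intro m ε hε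
    have hfin : ∫⁻ z, K m z ≠ ⊤ := ((hKc m).trans_lt hc.lt_top).ne
    have J : ∀ᵐ x, ‖R m x‖ₑ ^ q ≤ c ^ (q - 1) * ∫⁻ z, K m z * ‖g (x - z) - g x‖ₑ ^ q := by
      filter_upwards [hjm.prodMk_left] with x hx
      have h1 : ‖R m x‖ₑ ≤ ∫⁻ z, K m z * ‖g (x - z) - g x‖ₑ := by
        refine (hR m x).trans_eq ?_
        rw [← lintegral_sub_left_eq_self _ x]
        simp
      set ν := volume.withDensity (K m)
      have hνu : ν Set.univ ≤ c := by simpa [ν] using hKc m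
      have hac : ν ≪ volume := withDensity_absolutelyContinuous _ _
      have h2 := eLpNorm'_le_eLpNorm'_mul_rpow_measure_univ (μ := ν) (p := 1) (q := q) one_pos hq1
        (hx.mono_ac hac)
      have e1 : ∫⁻ z, ‖g (x - z) - g x‖ₑ ∂ν = ∫⁻ z, K m z * ‖g (x - z) - g x‖ₑ := by
        rw [lintegral_withDensity_eq_lintegral_mul₀ (hKm m).aemeasurable hx.enorm]; rfl
      have e2 : ∫⁻ z, ‖g (x - z) - g x‖ₑ ^ q ∂ν = ∫⁻ z, K m z * ‖g (x - z) - g x‖ₑ ^ q := by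
        rw [lintegral_withDensity_eq_lintegral_mul₀ (hKm m).aemeasurable (hx.enorm.pow_const q)]; rfl
      simp only [eLpNorm', ENNReal.rpow_one, div_one, e1, e2] at h2
      calc ‖R m x‖ₑ ^ q ≤ (∫⁻ z, K m z * ‖g (x - z) - g x‖ₑ) ^ q := by gcongr
        _ ≤ ((∫⁻ z, K m z * ‖g (x - z) - g x‖ₑ ^ q) ^ (1 / q) * ν Set.univ ^ (1 - 1 / q)) ^ q := by
            gcongr
        _ = (∫⁻ z, K m z * ‖g (x - z) - g x‖ₑ ^ q) * ν Set.univ ^ (q - 1) := by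
            rw [ENNReal.mul_rpow_of_nonneg _ _ hq0.le, ← ENNReal.rpow_mul, ← ENNReal.rpow_mul]
            congr 2
            · rw [one_div_mul_cancel hq0.ne', ENNReal.rpow_one]
            · field_simp
        _ ≤ _ := by rw [mul_comm]; gcongr
    have e3 : eLpNorm (R m) p volume ^ q ≤ (c * ε) ^ q := by
      rw [eLpNorm_eq_lintegral_rpow_enorm_toReal hp0 hp, ← ENNReal.rpow_mul,
        one_div_mul_cancel hq0.ne', ENNReal.rpow_one]
      calc ∫⁻ x, ‖R m x‖ₑ ^ q ≤ ∫⁻ x, c ^ (q - 1) * ∫⁻ z, K m z * ‖g (x - z) - g x‖ₑ ^ q :=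
            lintegral_mono_ae J
        _ = c ^ (q - 1) * ∫⁻ x, ∫⁻ z, K m z * ‖g (x - z) - g x‖ₑ ^ q := by
            rw [lintegral_const_mul' _ _ (ENNReal.rpow_ne_top_of_nonneg (by linarith) hc)]
        _ = c ^ (q - 1) * ∫⁻ z, K m z * ∫⁻ x, ‖g (x - z) - g x‖ₑ ^ q := by
            rw [lintegral_lintegral_swap]
            · congr 1
              refine lintegral_congr_ae ?_
              filter_upwards [hjm.prod_swap.prodMk_left] with z hz
              rw [lintegral_const_mul'']
              exact hz.enorm.pow_const q
            · exact ((hKm m).comp measurable_snd).aemeasurable.mul (hjm.enorm.pow_const q)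
        _ ≤ c ^ (q - 1) * ∫⁻ z, K m z * ε ^ q := by
            refine mul_le_mul' le_rfl (lintegral_mono fun z => ?_)
            by_cases hz : K m z = 0
            · simp [hz]
            · gcongr
              have := hε z (hKs m z hz)
              rw [eLpNorm_eq_lintegral_rpow_enorm_toReal hp0 hp] at this
              have := ENNReal.rpow_le_rpow this hq0.le
              rwa [← ENNReal.rpow_mul, one_div_mul_cancel hq0.ne', ENNReal.rpow_one] at this
        _ = c ^ (q - 1) * ((∫⁻ z, K m z) * ε ^ q) := by rw [lintegral_mul_const _ (hKm m)]
        _ ≤ c ^ (q - 1) * (c * ε ^ q) := by gcongr; exact hKc m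
        _ = (c * ε) ^ q := by
            rw [ENNReal.mul_rpow_of_nonneg _ _ hq0.le, ← mul_assoc]
            congr 1
            nth_rw 2 [← ENNReal.rpow_one c]
            rw [← ENNReal.rpow_add_of_nonneg _ _ (by linarith) zero_le_one]; simp
    exact (ENNReal.rpow_le_rpow_iff hq0).1 e3
  rw [ENNReal.tendsto_nhds_zero]
  intro ε hε
  obtain ⟨ε', hε', hε'c⟩ : ∃ ε' : ℝ≥0∞, 0 < ε' ∧ c * ε' ≤ ε := by
    rcases eq_or_ne ε ⊤ with rfl | hεt
    · exact ⟨1, one_pos, le_top⟩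
    -- Dividing by `c + 1` instead of `c` covers `c = 0`.
    · refine ⟨ε / (c + 1), ENNReal.div_pos hε.ne' (by simp [hc]), ?_⟩
      calc c * (ε / (c + 1)) ≤ (c + 1) * (ε / (c + 1)) := by gcongr; exact le_self_add
        _ ≤ ε := ENNReal.mul_div_le
  have hev := (tendsto_eLpNorm_translate_sub hp hg).eventually (ge_mem_nhds hε')
  obtain ⟨ρ, hρ, hball⟩ := Metric.eventually_nhds_iff.1 hev
  filter_upwards [hr.eventually (gt_mem_nhds hρ)] with m hm
  refine (key m ε' fun z hz => hball ?_).trans hε'c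
  simpa using hz.trans_lt hm

/-- The divergence of a vector field on Euclidean space. -/
def euclDiv (V : 𝔼 → 𝔼) (y : 𝔼) : ℝ := ∑ j, (fderiv ℝ V y (EuclideanSpace.single j 1)) j

theorem integrable_of_continuousOn_tsupport {F : Type*} [NormedAddCommGroup F] {b : 𝔼 → F}
    {T K : Set 𝔼} (hK : IsCompact K) (hKT : K ⊆ T) (hb : ContinuousOn b T)
    (hab : ∀ y, y ∉ K → b y = 0) : Integrable b := by
  rw [← integrableOn_iff_integrable_of_support_subset (s := K)]
  · exact (hb.mono hKT).integrableOn_compact hK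
  · intro y hy
    by_contra h
    exact hy (hab y h)

theorem fderiv_eq_sum_single {F : Type*} [NormedAddCommGroup F] [NormedSpace ℝ F] (A : 𝔼 →L[ℝ] F)
    (v : 𝔼) : A v = ∑ j, v j • A (EuclideanSpace.single j 1) := by
  conv_lhs => rw [← (EuclideanSpace.basisFun (Fin d) ℝ).sum_repr v]
  simp

/-- The divergence theorem for the field `a V`, obtained by integrating by parts in each coordinate.
Regularity of `V` is asked only on an open set containing the support of `a`, because coordinate
fields make sense only on a chart target. -/
theorem integral_fderiv_add_euclDiv {a : 𝔼 → ℂ} {T : Set 𝔼} (hT : IsOpen T) (ha : ContDiff ℝ 1 a)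
    (hac : HasCompactSupport a) (haT : tsupport a ⊆ T) (hV : ContDiffOn ℝ 1 V T) :
    ∫ y, (fderiv ℝ a y (V y) + (euclDiv V y : ℂ) * a y) = 0 := by
  have hVj : ∀ j, ContDiffOn ℝ 1 (fun y => (V y) j) T := fun j => by
    exact (EuclideanSpace.proj (𝕜 := ℝ) j).contDiff.comp_contDiffOn hV
  have hVd : ∀ y ∈ T, DifferentiableAt ℝ V y := fun y hy =>
    (hV.differentiableOn one_ne_zero).differentiableAt (hT.mem_nhds hy)
  have hfV : ContinuousOn (fun y => fderiv ℝ V y) T := hV.continuousOn_fderiv_of_isOpen hT le_rfl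
  have hfa : Continuous (fderiv ℝ a) := ha.continuous_fderiv one_ne_zero
  have hz : ∀ y, y ∉ tsupport a → a y = 0 := fun y hy => image_eq_zero_of_notMem_tsupport hy
  have hz' : ∀ y, y ∉ tsupport a → fderiv ℝ a y = 0 := fun y hy => by
    by_contra h
    exact hy (support_fderiv_subset ℝ h)
  have hcV : ∀ j, ContinuousOn (fun y => (((V y) j : ℝ) : ℂ)) T := fun j =>
    Complex.continuous_ofReal.comp_continuousOn (hVj j).continuousOn
  have hdj : ∀ j, ∀ y ∈ T, fderiv ℝ (fun y => (((V y) j : ℝ) : ℂ)) y (EuclideanSpace.single j 1)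
      = (((fderiv ℝ V y (EuclideanSpace.single j 1)) j : ℝ) : ℂ) := fun j y hy => by
    have h1 : HasFDerivAt (fun y => (((V y) j : ℝ) : ℂ))
        ((Complex.ofRealCLM.comp (EuclideanSpace.proj (𝕜 := ℝ) j)).comp (fderiv ℝ V y)) y :=
      ((Complex.ofRealCLM.comp (EuclideanSpace.proj (𝕜 := ℝ) j)).hasFDerivAt).comp y
        (hVd y hy).hasFDerivAt
    rw [h1.fderiv]; rfl
  have I1 : ∀ j, Integrable (fun y => fderiv ℝ a y (EuclideanSpace.single j 1) * (((V y) j : ℝ) : ℂ)) :=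
    fun j => integrable_of_continuousOn_tsupport hac haT
      (((hfa.clm_apply continuous_const).continuousOn).mul (hcV j)) (fun y hy => by simp [hz' y hy])
  have I2 : ∀ j, Integrable (fun y => a y *
      (((fderiv ℝ V y (EuclideanSpace.single j 1)) j : ℝ) : ℂ)) := fun j => by
    refine integrable_of_continuousOn_tsupport hac haT
      (ha.continuous.continuousOn.mul ?_) (fun y hy => by simp [hz y hy])
    refine Complex.continuous_ofReal.comp_continuousOn ?_
    exact (EuclideanSpace.proj (𝕜 := ℝ) j).continuous.comp_continuousOn
      (hfV.clm_apply continuousOn_const)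
  have I2' : ∀ j, (fun y => a y * fderiv ℝ (fun y => (((V y) j : ℝ) : ℂ)) y
      (EuclideanSpace.single j 1)) = (fun y => a y *
      (((fderiv ℝ V y (EuclideanSpace.single j 1)) j : ℝ) : ℂ)) := fun j => by
    funext y
    by_cases hy : y ∈ tsupport a
    · rw [hdj j y (haT hy)]
    · simp [hz y hy]
  have I3 : ∀ j, Integrable (fun y => a y * (((V y) j : ℝ) : ℂ)) := fun j =>
    integrable_of_continuousOn_tsupport hac haT
      (ha.continuous.continuousOn.mul (hcV j)) (fun y hy => by simp [hz y hy])
  have ibp : ∀ j, ∫ y, (a y * (((fderiv ℝ V y (EuclideanSpace.single j 1)) j : ℝ) : ℂ)) =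
      -∫ y, fderiv ℝ a y (EuclideanSpace.single j 1) * (((V y) j : ℝ) : ℂ) := fun j => by
    rw [← I2' j]
    refine integral_mul_fderiv_eq_neg_fderiv_mul_of_integrable (I1 j) ((I2' j) ▸ I2 j) (I3 j)
      (fun y _ => (ha.differentiable one_ne_zero) y) (fun y hy => ?_)
    exact (Complex.ofRealCLM.differentiableAt.comp y
      ((EuclideanSpace.proj (𝕜 := ℝ) j).differentiableAt.comp y (hVd y (haT hy))) :)
  have e : (fun y => fderiv ℝ a y (V y) + (euclDiv V y : ℂ) * a y) = fun y =>
      ∑ j, (fderiv ℝ a y (EuclideanSpace.single j 1) * (((V y) j : ℝ) : ℂ) +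
        a y * (((fderiv ℝ V y (EuclideanSpace.single j 1)) j : ℝ) : ℂ)) := by
    funext y
    rw [fderiv_eq_sum_single (fderiv ℝ a y) (V y), Finset.sum_add_distrib, euclDiv,
      ← Finset.mul_sum]
    push_cast
    congr 1
    · refine Finset.sum_congr rfl fun j _ => ?_
      rw [Complex.real_smul, mul_comm]
    · rw [mul_comm]
  have hs := integral_finsetSum Finset.univ fun j _ => (I1 j).add (I2 j)
  simp only [Pi.add_apply] at hs
  rw [e, hs]
  refine Finset.sum_eq_zero fun j _ => ?_
  rw [integral_add (I1 j) (I2 j), ibp j, add_neg_cancel]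

/-! ### Mollifiers and the Friedrichs commutator. -/

/-- A sequence of standard mollifiers. -/
structure IsMollifier (η : ℕ → 𝔼 → ℝ) : Prop where
  smooth : ∀ m, ContDiff ℝ ∞ (η m)
  nonneg : ∀ m z, 0 ≤ η m z
  support : ∀ m z, η m z ≠ 0 → ‖z‖ ≤ 1 / ((m : ℝ) + 1)
  integral : ∀ m, ∫ z, η m z = 1
  bound : ∃ c : ℝ, ∀ m, ∫ z, ‖z‖ * ‖fderiv ℝ (η m) z‖ = c

theorem IsMollifier.hasCompactSupport {η : ℕ → 𝔼 → ℝ} (h : IsMollifier η) (m : ℕ) :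
    HasCompactSupport (η m) :=
  HasCompactSupport.of_support_subset_isCompact (isCompact_closedBall 0 (1 / ((m : ℝ) + 1)))
    fun z hz => by simpa using h.support m z hz

-- In the rescaling `z ↦ (m + 1)^d φ ((m + 1) z)` the factor `m + 1` gained by the derivative is
-- compensated by `‖z‖`, so the first moment of the gradient does not depend on `m`. This uniformity
-- is what keeps the commutator kernels bounded.
variable (d) in
theorem exists_isMollifier : ∃ η : ℕ → 𝔼 → ℝ, IsMollifier η := by
  let b : ContDiffBump (0 : 𝔼) := ⟨1 / 2, 1, by norm_num, by norm_num⟩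
  let φ : 𝔼 → ℝ := b.normed volume
  have hφ : ContDiff ℝ ∞ φ := b.contDiff_normed
  have hpos : ∀ m : ℕ, (0 : ℝ) < (m : ℝ) + 1 := fun m => by positivity
  have hsm : ∀ m : ℕ, ContDiff ℝ ∞ (fun z => ((m : ℝ) + 1) ^ d * φ (((m : ℝ) + 1) • z)) :=
    fun m => contDiff_const.mul (hφ.comp (contDiff_const_smul _))
  have hscale : ∀ (m : ℕ) (F : 𝔼 → ℝ), ∫ z, ((m : ℝ) + 1) ^ d * F (((m : ℝ) + 1) • z)
      = ∫ z, F z := fun m F => by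
    rw [integral_const_mul, Measure.integral_comp_smul]
    simp only [finrank_euclideanSpace, Fintype.card_fin, smul_eq_mul]
    rw [abs_of_pos (by have := hpos m; positivity), ← mul_assoc,
      mul_inv_cancel₀ (pow_ne_zero _ (hpos m).ne'), one_mul]
  refine ⟨fun m z => ((m : ℝ) + 1) ^ d * φ (((m : ℝ) + 1) • z), hsm, ?_, ?_, ?_,
    ∫ z, ‖z‖ * ‖fderiv ℝ φ z‖, ?_⟩
  · intro m z
    have := b.nonneg_normed (μ := volume) (((m : ℝ) + 1) • z)
    have := hpos m
    positivity
  · intro m z hz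
    have h1 : ((m : ℝ) + 1) • z ∈ Function.support φ := by
      intro h; exact hz (by simp only [h, mul_zero])
    rw [ContDiffBump.support_normed_eq] at h1
    have h2 : ‖((m : ℝ) + 1) • z‖ < 1 := by simpa [b] using h1
    rw [norm_smul, Real.norm_of_nonneg (hpos m).le] at h2
    rw [le_div_iff₀ (hpos m), mul_comm]
    exact h2.le
  · intro m
    rw [hscale m φ]
    exact b.integral_normed
  · intro m
    rw [← hscale m (fun z => ‖z‖ * ‖fderiv ℝ φ z‖)]
    congr 1
    funext z
    have h1 : HasFDerivAt (fun z => ((m : ℝ) + 1) ^ d * φ (((m : ℝ) + 1) • z))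
        (((m : ℝ) + 1) ^ d • ((fderiv ℝ φ (((m : ℝ) + 1) • z)).comp
          (((m : ℝ) + 1) • ContinuousLinearMap.id ℝ 𝔼))) z := by
      refine HasFDerivAt.const_mul ?_ _
      exact ((hφ.differentiable (by simp) _).hasFDerivAt).comp z
        ((hasFDerivAt_id z).const_smul ((m : ℝ) + 1))
    rw [h1.fderiv]
    simp only [ContinuousLinearMap.comp_smul, ContinuousLinearMap.comp_id, norm_smul,
      Real.norm_of_nonneg (hpos m).le, norm_pow]
    ring

/-- The mollification of `g`. -/
def mollify (η : 𝔼 → ℝ) (g : 𝔼 → ℂ) (x : 𝔼) : ℂ := ∫ y, η (x - y) • g y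

theorem mollify_eq_convolution (η : 𝔼 → ℝ) (g : 𝔼 → ℂ) :
    mollify η g = convolution g η (ContinuousLinearMap.lsmul ℝ ℝ (E := ℂ)).flip volume := by
  funext x
  simp [mollify, convolution]

theorem contDiff_mollify (h : ContDiff ℝ ∞ η) (hc : HasCompactSupport η) (hg : Integrable g) : ContDiff ℝ ∞ (mollify η g) := by
  rw [mollify_eq_convolution]
  exact hc.contDiff_convolution_right _ hg.locallyIntegrable (n := ⊤) h

theorem fderiv_mollify (h : ContDiff ℝ ∞ η) (hc : HasCompactSupport η) (hg : Integrable g) (x v : 𝔼) :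
    fderiv ℝ (mollify η g) x v = ∫ y, (fderiv ℝ η (x - y) v) • g y := by
  rw [mollify_eq_convolution, (hc.hasFDerivAt_convolution_right _ hg.locallyIntegrable
    (h.of_le (by exact_mod_cast le_top)) x).fderiv, convolution_precompR_apply _ hg.locallyIntegrable (hc.fderiv ℝ)
      (h.continuous_fderiv (by simp))]
  simp [convolution]

/-- The weak formulation of `V g = h` in Euclidean space. -/
def IsEuclWeakDeriv (V : 𝔼 → 𝔼) (g h : 𝔼 → ℂ) : Prop :=
  ∀ ζ : 𝔼 → ℝ, ContDiff ℝ ∞ ζ → HasCompactSupport ζ →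
    ∫ y, (fderiv ℝ ζ y (V y) + euclDiv V y * ζ y) • g y = -∫ y, ζ y • h y

theorem integrable_smul_of_continuous {k : 𝔼 → ℝ} (hk : Continuous k) (hc : HasCompactSupport k)
    (hg : Integrable g) : Integrable (fun y => k y • g y) := by
  obtain ⟨c, hc⟩ := hk.bounded_above_of_compact_support hc
  exact hg.bdd_smul c hk.aestronglyMeasurable (ae_of_all _ hc)

/-- The Friedrichs commutator as an integral operator annihilating constants. -/
theorem fderiv_mollify_sub_mollify (hV : ContDiff ℝ ∞ V) (h : ContDiff ℝ ∞ η) (hc : HasCompactSupport η)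
    {g g' : 𝔼 → ℂ} (hg : Integrable g) (hw : IsEuclWeakDeriv V g g') (x : 𝔼) :
    fderiv ℝ (mollify η g) x (V x) - mollify η g' x =
      ∫ y, (fderiv ℝ η (x - y) (V x - V y) + euclDiv V y * η (x - y)) • (g y - g x) := by
  set ζ : 𝔼 → ℝ := fun y => η (x - y) with hζ
  have hζs : ContDiff ℝ ∞ ζ := h.comp (contDiff_const.sub contDiff_id)
  have hζc : HasCompactSupport ζ := hc.comp_homeomorph (Homeomorph.subLeft x)
  have hζd : ∀ y v, fderiv ℝ ζ y v = -fderiv ℝ η (x - y) v := fun y v => by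
    have h1 : HasFDerivAt ζ ((fderiv ℝ η (x - y)).comp (-ContinuousLinearMap.id ℝ 𝔼)) y :=
      (h.differentiable (by simp) _).hasFDerivAt.comp y ((hasFDerivAt_id y).const_sub x)
    rw [h1.fderiv]; simp
  have hDc : Continuous (euclDiv V) := by
    unfold euclDiv
    have := hV.continuous_fderiv (by simp)
    fun_prop
  have hfη : Continuous (fun y => fderiv ℝ η (x - y)) :=
    (h.continuous_fderiv (by simp)).comp (by fun_prop)
  have hfc : HasCompactSupport (fun y => fderiv ℝ η (x - y)) :=
    (hc.fderiv ℝ).comp_homeomorph (Homeomorph.subLeft x)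
  have c1 : Continuous (fun y => fderiv ℝ η (x - y) (V x)) := hfη.clm_apply continuous_const
  have c2 : Continuous (fun y => fderiv ℝ η (x - y) (V y)) := hfη.clm_apply hV.continuous
  have c3 : Continuous (fun y => euclDiv V y * ζ y) := hDc.mul hζs.continuous
  have s1 : HasCompactSupport (fun y => fderiv ℝ η (x - y) (V x)) :=
    hfc.mono (fun y hy hn => hy (by simp only [hn]; simp))
  have s2 : HasCompactSupport (fun y => fderiv ℝ η (x - y) (V y)) :=
    hfc.mono (fun y hy hn => hy (by simp only [hn]; simp))
  have s3 : HasCompactSupport (fun y => euclDiv V y * ζ y) := hζc.mul_left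
  have I1 := integrable_smul_of_continuous c1 s1 hg
  have I2 := integrable_smul_of_continuous c2 s2 hg
  have I3 := integrable_smul_of_continuous c3 s3 hg
  have e1 : fderiv ℝ (mollify η g) x (V x) - mollify η g' x =
      ∫ y, (fderiv ℝ η (x - y) (V x - V y) + euclDiv V y * η (x - y)) • g y := by
    have h2 := hw ζ hζs hζc
    have h3 : mollify η g' x = ∫ y, ζ y • g' y := rfl
    rw [h3, ← neg_eq_iff_eq_neg.2 h2, fderiv_mollify h hc hg, sub_neg_eq_add]
    simp only [hζd]
    rw [← integral_add I1]
    · congr 1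
      funext y
      simp only [map_sub, hζ, ← add_smul]
      congr 1; ring
    · refine (I3.sub I2).congr (ae_of_all _ fun y => ?_)
      simp only [Pi.sub_apply, ← sub_smul]; congr 1; ring
  -- The kernel is the divergence of `y ↦ η (x - y) (V y - V x)`, so its integral vanishes and `g y`
  -- may be replaced by `g y - g x`.
  have e2 : ∫ y, (fderiv ℝ η (x - y) (V x - V y) + euclDiv V y * η (x - y)) = 0 := by
    set W : 𝔼 → 𝔼 := fun y => V y - V x with hW
    have hWs : ContDiff ℝ ∞ W := hV.sub contDiff_const
    have hWd : ∀ y, euclDiv W y = euclDiv V y := fun y => by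
      unfold euclDiv
      rw [hW, fderiv_sub_const]
    have := integral_fderiv_add_euclDiv (a := fun y => (ζ y : ℂ)) (V := W) isOpen_univ
      (Complex.ofRealCLM.contDiff.comp (hζs.of_le (by simp)))
      (hζc.comp_left (g := ((↑) : ℝ → ℂ)) rfl) (Set.subset_univ _) (hWs.of_le (by simp)).contDiffOn
    have h4 : ∀ y v, fderiv ℝ (fun y => (ζ y : ℂ)) y v = ((fderiv ℝ ζ y v : ℝ) : ℂ) :=
      fun y v => by
        have h1 : HasFDerivAt (fun y => (ζ y : ℂ)) (Complex.ofRealCLM.comp (fderiv ℝ ζ y)) y :=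
          Complex.ofRealCLM.hasFDerivAt.comp y (hζs.differentiable (by simp) y).hasFDerivAt
        rw [h1.fderiv]; rfl
    simp only [h4, hWd, hζd, ← Complex.ofReal_mul, ← Complex.ofReal_add] at this
    rw [integral_complex_ofReal, Complex.ofReal_eq_zero] at this
    rw [← this]
    congr 1
    funext y
    simp only [hW, map_sub, hζ]; ring
  rw [e1]
  have I4 : Integrable (fun y => (fderiv ℝ η (x - y) (V x - V y) + euclDiv V y * η (x - y)) • g y) := by
    refine ((I1.sub I2).add I3).congr (ae_of_all _ fun y => ?_)
    simp only [Pi.sub_apply, Pi.add_apply, map_sub, hζ, ← sub_smul, ← add_smul]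
  have I5 : Integrable (fun y => (fderiv ℝ η (x - y) (V x - V y) + euclDiv V y * η (x - y))) := by
    have := ((c1.sub c2).add c3).integrable_of_hasCompactSupport (μ := volume)
      ((s1.sub s2).add s3)
    refine this.congr (ae_of_all _ fun y => ?_)
    simp [hζ]
  simp only [smul_sub]
  rw [integral_sub I4 (I5.smul_const _), integral_smul_const, e2, zero_smul, sub_zero]

theorem IsMollifier.tendsto_mollify {η : ℕ → 𝔼 → ℝ} (hη : IsMollifier η)
    [Fact (1 ≤ p)] (hp : p ≠ ⊤) (hg : Integrable g) (hgp : MemLp g p) :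
    Tendsto (fun m => eLpNorm (mollify (η m) g - g) p volume) atTop (𝓝 0) := by
  refine tendsto_eLpNorm_of_le_lintegral_translate hp hgp (K := fun m z => ‖η m z‖ₑ)
    (fun m => (hη.smooth m).continuous.enorm.measurable) tendsto_one_div_add_atTop_nhds_zero_nat
    (fun m z hz => hη.support m z (by simpa using hz)) (c := 1) ENNReal.one_ne_top
    (fun m => ?_) (fun m x => ?_)
  · have h1 := ofReal_integral_eq_lintegral_ofReal (μ := volume)
      ((hη.smooth m).continuous.integrable_of_hasCompactSupport (hη.hasCompactSupport m))
      (ae_of_all _ (hη.nonneg m))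
    rw [hη.integral m, ENNReal.ofReal_one] at h1
    rw [h1]
    exact (lintegral_congr fun z => Real.enorm_of_nonneg (hη.nonneg m z)).le
  · have hi : ∫ y, η m (x - y) = 1 := by
      rw [integral_sub_left_eq_self (fun z => η m z) volume x, hη.integral m]
    have cζ : Continuous (fun y => η m (x - y)) := (hη.smooth m).continuous.comp (by fun_prop)
    have sζ : HasCompactSupport (fun y => η m (x - y)) :=
      (hη.hasCompactSupport m).comp_homeomorph (Homeomorph.subLeft x)
    have e : (mollify (η m) g - g) x = ∫ y, η m (x - y) • (g y - g x) := by
      simp only [smul_sub, Pi.sub_apply]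
      rw [integral_sub (integrable_smul_of_continuous cζ sζ hg)
        ((cζ.integrable_of_hasCompactSupport (μ := volume) sζ).smul_const _), integral_smul_const, hi, one_smul]
      rfl
    rw [e]
    refine (enorm_integral_le_lintegral_enorm _).trans_eq (lintegral_congr fun y => ?_)
    rw [enorm_smul]

/-- Friedrichs' lemma. With `Λ` a Lipschitz constant of `V` and `D` a bound for its divergence, the
commutator kernel is at most `Λ ‖z‖ ‖∇η z‖ + D η z`, whose mass is bounded uniformly in the scale.
The commutator therefore tends to zero, and the mollification of `g'` tends to `g'`. -/
theorem IsMollifier.tendsto_fderiv_mollify {η : ℕ → 𝔼 → ℝ} (hη : IsMollifier η)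
    [Fact (1 ≤ p)] (hp : p ≠ ⊤) (hV : ContDiff ℝ ∞ V)
    (hVc : HasCompactSupport V) {g g' : 𝔼 → ℂ} (hg : Integrable g) (hgp : MemLp g p)
    (hg' : Integrable g') (hgp' : MemLp g' p) (hw : IsEuclWeakDeriv V g g') :
    Tendsto (fun m => eLpNorm (fun x => fderiv ℝ (mollify (η m) g) x (V x) - g' x) p volume)
      atTop (𝓝 0) := by
  have hp1 : 1 ≤ p := Fact.out
  obtain ⟨Λ, hΛ⟩ := (hV.of_le (m := 1) (by simp)).lipschitzWith_of_hasCompactSupport hVc one_ne_zero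
  have hDc : Continuous (euclDiv V) := by
    unfold euclDiv
    have := hV.continuous_fderiv (by simp)
    fun_prop
  have hDs : HasCompactSupport (euclDiv V) :=
    (hVc.fderiv ℝ).mono (fun y hy hn => hy (by simp [euclDiv, hn]))
  obtain ⟨D, hD⟩ := hDc.bounded_above_of_compact_support hDs
  have hD0 : 0 ≤ D := (norm_nonneg _).trans (hD 0)
  obtain ⟨b, hb⟩ := hη.bound
  have hηi : ∀ m, Integrable (η m) := fun m =>
    (hη.smooth m).continuous.integrable_of_hasCompactSupport (hη.hasCompactSupport m)
  have hfc : ∀ m, Continuous (fderiv ℝ (η m)) := fun m => (hη.smooth m).continuous_fderiv (by simp)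
  have hfi : ∀ m, Integrable (fun z => ‖z‖ * ‖fderiv ℝ (η m) z‖) := fun m =>
    (continuous_norm.mul (hfc m).norm).integrable_of_hasCompactSupport
      (((hη.hasCompactSupport m).fderiv ℝ).norm.mul_left)
  let K : ℕ → 𝔼 → ℝ := fun m z => Λ * (‖z‖ * ‖fderiv ℝ (η m) z‖) + D * η m z
  have hKc : ∀ m, Continuous (K m) := fun m => by
    have := hfc m
    have := (hη.smooth m).continuous
    fun_prop
  have hK0 : ∀ m z, 0 ≤ K m z := fun m z => by
    have := hη.nonneg m z
    positivity
  have T1 : Tendsto (fun m => eLpNorm (fun x => fderiv ℝ (mollify (η m) g) x (V x) -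
      mollify (η m) g' x) p volume) atTop (𝓝 0) := by
    refine tendsto_eLpNorm_of_le_lintegral_translate hp hgp (K := fun m z => ENNReal.ofReal (K m z))
      (fun m => (hKc m).measurable.ennreal_ofReal) tendsto_one_div_add_atTop_nhds_zero_nat
      (fun m z hz => ?_) (c := ENNReal.ofReal (Λ * b + D)) ENNReal.ofReal_ne_top
      (fun m => ?_) (fun m x => ?_)
    · by_contra hcon
      have h1 : z ∉ tsupport (η m) := by
        have : tsupport (η m) ⊆ Metric.closedBall 0 (1 / ((m : ℝ) + 1)) :=
          closure_minimal (fun z hz => by simpa using hη.support m z hz) Metric.isClosed_closedBall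
        intro h; exact hcon (by simpa using this h)
      have h2 : fderiv ℝ (η m) z = 0 := by by_contra h; exact h1 (support_fderiv_subset ℝ h)
      apply hz
      simp [K, h2, image_eq_zero_of_notMem_tsupport h1]
    · have hKi : Integrable (K m) := ((hfi m).const_mul (Λ : ℝ)).add ((hηi m).const_mul D)
      rw [← ofReal_integral_eq_lintegral_ofReal hKi (ae_of_all _ (hK0 m))]
      apply ENNReal.ofReal_le_ofReal
      rw [integral_add ((hfi m).const_mul _) ((hηi m).const_mul _), integral_const_mul,
        integral_const_mul, hb m, hη.integral m, mul_one]
    · rw [fderiv_mollify_sub_mollify hV (hη.smooth m) (hη.hasCompactSupport m) hg hw]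
      refine (enorm_integral_le_lintegral_enorm _).trans (lintegral_mono fun y => ?_)
      rw [enorm_smul]
      gcongr
      rw [← ofReal_norm]
      apply ENNReal.ofReal_le_ofReal
      refine (norm_add_le _ _).trans (add_le_add ?_ ?_)
      · calc ‖fderiv ℝ (η m) (x - y) (V x - V y)‖ ≤ ‖fderiv ℝ (η m) (x - y)‖ * ‖V x - V y‖ :=
            ContinuousLinearMap.le_opNorm _ _
          _ ≤ ‖fderiv ℝ (η m) (x - y)‖ * (Λ * ‖x - y‖) := by gcongr; exact hΛ.norm_sub_le x y
          _ = _ := by ring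
      · rw [norm_mul, Real.norm_of_nonneg (hη.nonneg m _)]
        gcongr
        · exact hη.nonneg m _
        · exact hD y
  have T2 := hη.tendsto_mollify hp hg' hgp'
  have T3 := T1.add T2
  rw [add_zero] at T3
  refine tendsto_of_tendsto_of_tendsto_of_le_of_le tendsto_const_nhds T3 (fun _ => zero_le) fun m => ?_
  have cm := (contDiff_mollify (hη.smooth m) (hη.hasCompactSupport m) hg)
  have cm' := (contDiff_mollify (hη.smooth m) (hη.hasCompactSupport m) hg').continuous
  have hcd : Continuous (fun x => fderiv ℝ (mollify (η m) g) x (V x)) :=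
    (cm.continuous_fderiv (by simp)).clm_apply hV.continuous
  refine le_trans (le_of_eq ?_) (eLpNorm_add_le (hcd.sub cm').aestronglyMeasurable
    (cm'.aestronglyMeasurable.sub hgp'.1) hp1)
  congr 1
  funext x
  simp

end Euclidean

/-! ### Functions and vector fields in charts. -/

section Manifold
variable {M : Type*} [TopologicalSpace M] [ChartedSpace (EuclideanSpace ℝ (Fin d)) M]
  {V : VField d M} {x₀ x : M} {f : M → ℂ} {χ : M → ℝ}

/-- The coordinate representation of a vector field in the chart at `x₀`. -/
def chartField (V : VField d M) (x₀ : M) (y : 𝔼) : 𝔼 :=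
  (mfderiv (𝓡 d) 𝓘(ℝ, 𝔼) (𝔠 x₀) ((𝔠 x₀).symm y) :
    TangentSpace (𝓡 d) ((𝔠 x₀).symm y) → 𝔼) (V ((𝔠 x₀).symm y))

variable [IsManifold (𝓡 d) ∞ M]

theorem contMDiffOn_chart_infty (x₀ : M) : ContMDiffOn (𝓡 d) 𝓘(ℝ, 𝔼) ∞ (𝔠 x₀) (𝔠 x₀).source :=
  contMDiffOn_chart

theorem contMDiffOn_chart_symm_infty (x₀ : M) :
    ContMDiffOn 𝓘(ℝ, 𝔼) (𝓡 d) ∞ (𝔠 x₀).symm (𝔠 x₀).target :=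
  contMDiffOn_chart_symm

/-- The derivative of the chart agrees with the coordinate change of the tangent bundle, so
smoothness can be read off in the trivialization at `x₀`. -/
theorem contDiffOn_chartField (hV : IsSmoothField V) (x₀ : M) :
    ContDiffOn ℝ ∞ (chartField V x₀) (𝔠 x₀).target := by
  have : IsManifold (𝓡 d) 1 M := IsManifold.of_le (n := ∞) (by simp)
  rw [← contMDiffOn_iff_contDiffOn]
  have h1 : ContMDiffOn (𝓡 d) 𝓘(ℝ, 𝔼) ∞
      (fun x => (trivializationAt 𝔼 (TangentSpace (𝓡 d)) x₀ ⟨x, V x⟩).2)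
      (𝔠 x₀).source := by
    intro x hx
    have := ((trivializationAt 𝔼 (TangentSpace (𝓡 d) (M := M)) x₀).contMDiffAt_section_iff
      (IB := 𝓡 d) (n := ∞) (s := V) (x₀ := x) (by simpa using hx)).1 (hV x)
    exact this.contMDiffWithinAt
  have h2 := h1.comp (contMDiffOn_chart_symm_infty x₀)
    (fun y hy => (𝔠 x₀).map_target hy)
  refine h2.congr fun y hy => ?_
  have hx := (𝔠 x₀).map_target hy
  have h3 := mfderiv_chartAt_eq_tangentCoordChange (I := 𝓡 d) (y := x₀)
    (x := (𝔠 x₀).symm y) (by simpa using hx)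
  simp only [chartField, Function.comp]
  exact congrArg (fun A => A (V ((𝔠 x₀).symm y))) h3

theorem lieD_chart (hx : x ∈ (𝔠 x₀).source) {F : 𝔼 → ℂ} (hF : DifferentiableAt ℝ F (𝔠 x₀ x))
    (hfF : f =ᶠ[𝓝 x] F ∘ 𝔠 x₀) : lieD V f x = fderiv ℝ F (𝔠 x₀ x) (chartField V x₀ (𝔠 x₀ x)) := by
  have h1 : MDifferentiableAt (𝓡 d) 𝓘(ℝ, 𝔼) (𝔠 x₀) x :=
    ((contMDiffOn_chart_infty x₀).contMDiffAt
      ((𝔠 x₀).open_source.mem_nhds hx)).mdifferentiableAt (by simp)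
  have h2 := mfderiv_comp (I := 𝓡 d) (I' := 𝓘(ℝ, 𝔼)) (I'' := 𝓘(ℝ, ℂ)) x hF.mdifferentiableAt h1
  rw [← hfF.mfderiv_eq] at h2
  unfold lieD chartField
  rw [(𝔠 x₀).left_inv hx, h2, mfderiv_eq_fderiv]
  rfl

theorem contDiffOn_comp_chart_symm (hf : Smooth f) (x₀ : M) :
    ContDiffOn ℝ ∞ (f ∘ (𝔠 x₀).symm) (𝔠 x₀).target := by
  rw [← contMDiffOn_iff_contDiffOn]
  exact hf.comp_contMDiffOn (contMDiffOn_chart_symm_infty x₀)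

theorem eventuallyEq_chart_comp (f : M → ℂ) (hx : x ∈ (𝔠 x₀).source) :
    f =ᶠ[𝓝 x] (f ∘ (𝔠 x₀).symm) ∘ 𝔠 x₀ := by
  filter_upwards [(𝔠 x₀).open_source.mem_nhds hx] with z hz
  simp [(𝔠 x₀).left_inv hz]

theorem lieD_chart' (hx : x ∈ (𝔠 x₀).source) (hf : Smooth f) :
    lieD V f x = fderiv ℝ (f ∘ (𝔠 x₀).symm) (𝔠 x₀ x) (chartField V x₀ (𝔠 x₀ x)) := by
  refine lieD_chart hx ?_ (eventuallyEq_chart_comp f hx)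
  have ht := (𝔠 x₀).map_source hx
  exact ((contDiffOn_comp_chart_symm hf x₀).differentiableOn (by simp)).differentiableAt
    ((𝔠 x₀).open_target.mem_nhds ht)

open scoped Classical in
/-- The function on `M` with coordinate representation `F` in the chart at `x₀`, extended by zero. -/
def chartLift (x₀ : M) (F : 𝔼 → ℂ) (x : M) : ℂ := if x ∈ (𝔠 x₀).source then F (𝔠 x₀ x) else 0

theorem chartLift_of_mem (hx : x ∈ (𝔠 x₀).source) (F : 𝔼 → ℂ) :
    chartLift x₀ F x = F (𝔠 x₀ x) := if_pos hx

theorem chartLift_of_notMem (hx : x ∉ (𝔠 x₀).source) (F : 𝔼 → ℂ) :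
    chartLift x₀ F x = 0 := if_neg hx

theorem chartLift_symm {x₀ : M} {y : 𝔼} (hy : y ∈ (𝔠 x₀).target) (F : 𝔼 → ℂ) :
    chartLift x₀ F ((𝔠 x₀).symm y) = F y := by
  rw [chartLift_of_mem ((𝔠 x₀).map_target hy), (𝔠 x₀).right_inv hy]

theorem chartLift_eventuallyEq (hx : x ∈ (𝔠 x₀).source) (F : 𝔼 → ℂ) :
    chartLift x₀ F =ᶠ[𝓝 x] F ∘ 𝔠 x₀ := by
  filter_upwards [(𝔠 x₀).open_source.mem_nhds hx] with z hz
  exact chartLift_of_mem hz F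

theorem isCompact_chart_symm_image {x₀ : M} {K : Set 𝔼} (hK : IsCompact K)
    (hKT : K ⊆ (𝔠 x₀).target) : IsCompact ((𝔠 x₀).symm '' K) :=
  hK.image_of_continuousOn ((𝔠 x₀).continuousOn_symm.mono hKT)

theorem chartLift_eq_zero {F : 𝔼 → ℂ} {K : Set 𝔼} (hF0 : ∀ y, y ∉ K → F y = 0)
    (hx : x ∉ (𝔠 x₀).symm '' K) : chartLift x₀ F x = 0 := by
  by_cases h : x ∈ (𝔠 x₀).source
  · rw [chartLift_of_mem h]
    exact hF0 _ fun hk => hx ⟨_, hk, (𝔠 x₀).left_inv h⟩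
  · exact chartLift_of_notMem h F

variable [T2Space M]

theorem tsupport_chartLift_subset {x₀ : M} {F : 𝔼 → ℂ} {K : Set 𝔼} (hK : IsCompact K)
    (hKT : K ⊆ (𝔠 x₀).target) (hF0 : ∀ y, y ∉ K → F y = 0) :
    tsupport (chartLift x₀ F) ⊆ (𝔠 x₀).symm '' K := by
  refine closure_minimal (fun x hx => ?_) (isCompact_chart_symm_image hK hKT).isClosed
  by_contra h
  exact hx (chartLift_eq_zero hF0 h)

theorem symm_image_subset_source {x₀ : M} {K : Set 𝔼} (hKT : K ⊆ (𝔠 x₀).target) :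
    (𝔠 x₀).symm '' K ⊆ (𝔠 x₀).source := by
  rintro _ ⟨y, hy, rfl⟩
  exact (𝔠 x₀).map_target (hKT hy)

/-- In a Hausdorff space the compact image of `K` is closed, so the extension by zero vanishes near
every point outside the chart domain. -/
theorem isTest_chartLift {x₀ : M} {F : 𝔼 → ℂ} {K : Set 𝔼} (hK : IsCompact K)
    (hKT : K ⊆ (𝔠 x₀).target) (hF0 : ∀ y, y ∉ K → F y = 0)
    (hF : ContDiffOn ℝ ∞ F (𝔠 x₀).target) : IsTest d (chartLift x₀ F) := by
  refine ⟨fun x => ?_, HasCompactSupport.of_support_subset_isCompact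
    (isCompact_chart_symm_image hK hKT) fun x hx => ?_⟩
  · by_cases hx : x ∈ (𝔠 x₀).source
    · refine ContMDiffAt.congr_of_eventuallyEq ?_ (chartLift_eventuallyEq hx F)
      refine ContMDiffAt.comp x (I' := 𝓘(ℝ, 𝔼)) ?_ ((contMDiffOn_chart_infty x₀).contMDiffAt
        ((𝔠 x₀).open_source.mem_nhds hx))
      exact (hF.contDiffAt ((𝔠 x₀).open_target.mem_nhds
        ((𝔠 x₀).map_source hx))).contMDiffAt
    · have h0 : chartLift x₀ F =ᶠ[𝓝 x] fun _ => 0 := by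
        filter_upwards [(isCompact_chart_symm_image hK hKT).isClosed.isOpen_compl.mem_nhds
          (fun h => hx (symm_image_subset_source hKT h))] with z hz
        exact chartLift_eq_zero hF0 hz
      exact ContMDiffAt.congr_of_eventuallyEq contMDiffAt_const h0
  · by_contra h
    exact hx (chartLift_eq_zero hF0 h)

theorem lieD_chartLift (hx : x ∈ (𝔠 x₀).source) {F : 𝔼 → ℂ} (hF : ContDiffOn ℝ ∞ F (𝔠 x₀).target) :
    lieD V (chartLift x₀ F) x = fderiv ℝ F (𝔠 x₀ x) (chartField V x₀ (𝔠 x₀ x)) := by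
  refine lieD_chart hx ?_ (chartLift_eventuallyEq hx F)
  exact (hF.differentiableOn (by simp)).differentiableAt
    ((𝔠 x₀).open_target.mem_nhds ((𝔠 x₀).map_source hx))

/-! ### The measure in a chart. -/

section Charts
variable [SigmaCompactSpace M] [MeasurableSpace M] [BorelSpace M] {μ : Measure M}
  {m : EuclideanSpace ℝ (Fin d) → ℝ}

/-- The image of the measure in the chart at `x₀`. -/
def chartMeasure (x₀ : M) (m : 𝔼 → ℝ) : Measure 𝔼 :=
  (volume.restrict (𝔠 x₀).target).withDensity (fun y => ENNReal.ofReal (m y))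

/-- `m` is the density of `μ` in the chart at `x₀`. -/
structure IsChartDensity (μ : Measure M) (x₀ : M) (m : 𝔼 → ℝ) : Prop where
  smooth : ContDiffOn ℝ ∞ m (𝔠 x₀).target
  pos : ∀ y ∈ (𝔠 x₀).target, 0 < m y
  apply : ∀ s ⊆ (𝔠 x₀).source, MeasurableSet s → μ s = ∫⁻ y in 𝔠 x₀ '' s, ENNReal.ofReal (m y)

theorem IsSmoothMeasure.exists_isChartDensity {μ : Measure M} (hμ : IsSmoothMeasure d μ) (x₀ : M) :
    ∃ m, IsChartDensity (d := d) μ x₀ m :=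
  let ⟨m, h1, h2, h3⟩ := hμ x₀
  ⟨m, h1, h2, h3⟩

variable (hm : IsChartDensity μ x₀ m)

theorem aemeasurable_chart_symm (x₀ : M) (m : 𝔼 → ℝ) :
    AEMeasurable (𝔠 x₀).symm (chartMeasure x₀ m) :=
  ((𝔠 x₀).continuousOn_symm.aemeasurable
    (𝔠 x₀).open_target.measurableSet).mono_ac (withDensity_absolutelyContinuous _ _)

include hm

theorem IsChartDensity.map_chart_symm :
    Measure.map (𝔠 x₀).symm (chartMeasure x₀ m) = μ.restrict (𝔠 x₀).source := by
  ext B hB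
  rw [Measure.map_apply_of_aemeasurable (aemeasurable_chart_symm x₀ m) hB, Measure.restrict_apply hB,
    hm.apply _ Set.inter_subset_right (hB.inter (𝔠 x₀).open_source.measurableSet),
    chartMeasure, withDensity_apply', Measure.restrict_restrict'
      (𝔠 x₀).open_target.measurableSet, Set.inter_comm B,
      (𝔠 x₀).image_source_inter_eq', Set.inter_comm]

theorem IsChartDensity.aemeasurable :
    AEMeasurable (fun y => ENNReal.ofReal (m y))
      (volume.restrict (𝔠 x₀).target) :=
  (hm.smooth.continuousOn.aemeasurable (𝔠 x₀).open_target.measurableSet).ennreal_ofReal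

theorem IsChartDensity.integral_eq
    (hf : AEStronglyMeasurable f μ) (hf0 : ∀ x, x ∉ (𝔠 x₀).source → f x = 0) :
    ∫ x, f x ∂μ = ∫ y in (𝔠 x₀).target, m y • f ((𝔠 x₀).symm y) := by
  rw [← setIntegral_eq_integral_of_forall_compl_eq_zero hf0, ← hm.map_chart_symm,
    integral_map (aemeasurable_chart_symm x₀ m) (by rw [hm.map_chart_symm]; exact hf.restrict),
    chartMeasure, integral_withDensity_eq_integral_toReal_smul₀ hm.aemeasurable (by simp)]
  refine setIntegral_congr_fun (𝔠 x₀).open_target.measurableSet fun y hy => ?_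
  simp only [ENNReal.toReal_ofReal (hm.pos y hy).le]

/-- A positive continuous density is bounded above and away from zero on a compact set. Hence `L^p`
norms for `μ` and for Lebesgue measure are comparable on functions supported there. -/
theorem IsChartDensity.exists_le {K : Set 𝔼} (hK : IsCompact K) (hKT : K ⊆ (𝔠 x₀).target) :
    ∃ c : ℝ≥0∞, c ≠ ⊤ ∧ (chartMeasure x₀ m).restrict K ≤ c • volume ∧
      volume.restrict K ≤ c • chartMeasure x₀ m := by
  obtain ⟨c₁, hc₁⟩ := hK.exists_bound_of_continuousOn (hm.smooth.continuousOn.mono hKT)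
  have hinv : ContinuousOn (fun y => (m y)⁻¹) K :=
    (hm.smooth.continuousOn.mono hKT).inv₀ fun y hy => (hm.pos y (hKT hy)).ne'
  obtain ⟨c₂, hc₂⟩ := hK.exists_bound_of_continuousOn hinv
  refine ⟨ENNReal.ofReal (max c₁ c₂), ENNReal.ofReal_ne_top, ?_, ?_⟩
  · refine Measure.le_iff.2 fun B hB => ?_
    rw [Measure.restrict_apply hB, chartMeasure, withDensity_apply', Measure.restrict_restrict'
      (𝔠 x₀).open_target.measurableSet, Measure.smul_apply, smul_eq_mul]
    calc ∫⁻ y in B ∩ K ∩ (𝔠 x₀).target, ENNReal.ofReal (m y)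
        ≤ ∫⁻ y in B ∩ K ∩ (𝔠 x₀).target, ENNReal.ofReal (max c₁ c₂) := by
          refine setLIntegral_mono' ((hB.inter hK.measurableSet).inter
            (𝔠 x₀).open_target.measurableSet) fun y hy => ?_
          exact ENNReal.ofReal_le_ofReal (((le_abs_self _).trans (hc₁ y hy.1.2)).trans
            (le_max_left _ _))
      _ ≤ _ := by
          rw [setLIntegral_const]
          gcongr
          exact Set.inter_subset_left.trans Set.inter_subset_left
  · refine Measure.le_iff.2 fun B hB => ?_
    rw [Measure.restrict_apply hB, Measure.smul_apply, chartMeasure, withDensity_apply _ hB,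
      Measure.restrict_restrict hB, smul_eq_mul, ← lintegral_const_mul'' _
      (hm.aemeasurable.mono_measure (Measure.restrict_mono Set.inter_subset_right le_rfl))]
    calc volume (B ∩ K) = ∫⁻ y in B ∩ K, 1 := by simp
      _ ≤ ∫⁻ y in B ∩ K, ENNReal.ofReal (max c₁ c₂) * ENNReal.ofReal (m y) := by
          refine setLIntegral_mono' (hB.inter hK.measurableSet) fun y hy => ?_
          have hp := hm.pos y (hKT hy.2)
          have h2 := (le_abs_self _).trans (hc₂ y hy.2)
          rw [← ENNReal.ofReal_mul' hp.le, ← ENNReal.ofReal_one]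
          apply ENNReal.ofReal_le_ofReal
          calc 1 = (m y)⁻¹ * m y := (inv_mul_cancel₀ hp.ne').symm
            _ ≤ _ := by gcongr; exact h2.trans (le_max_right _ _)
      _ ≤ _ := lintegral_mono_set (Set.inter_subset_inter_right _ hKT)

/-! ### Calculus of test functions. -/

section TestFunctions

omit hm

theorem contMDiff_comp_contDiff {F G : Type*} [NormedAddCommGroup F] [NormedSpace ℝ F]
    [NormedAddCommGroup G] [NormedSpace ℝ G] {Φ : F → G} (hΦ : ContDiff ℝ ∞ Φ) {f : M → F}
    (hf : ContMDiff (𝓡 d) 𝓘(ℝ, F) ∞ f) : ContMDiff (𝓡 d) 𝓘(ℝ, G) ∞ (fun x => Φ (f x)) :=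
  hΦ.contMDiff.comp hf

theorem contMDiff_mul {f g : M → ℂ} (hf : Smooth f)
    (hg : Smooth g) : Smooth (fun x => f x * g x) := by
  have h : ContDiff ℝ ∞ (fun q : ℂ × ℂ => q.1 * q.2) := contDiff_fst.mul contDiff_snd
  exact contMDiff_comp_contDiff (f := fun x => (f x, g x)) h (hf.prodMk_space hg)

theorem contMDiff_conj (hf : Smooth f) : Smooth (fun x => conj (f x)) :=
  contMDiff_comp_contDiff (Φ := fun z : ℂ => conj z) Complex.conjCLE.contDiff hf

namespace IsTest

variable {f g : M → ℂ}

theorem continuous (hf : IsTest d f) : Continuous f := hf.1.continuous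

theorem mul_left (hf : IsTest d f) (hg : Smooth g) : IsTest d (fun x => g x * f x) :=
  ⟨contMDiff_mul hg hf.1, hf.2.mul_left⟩

theorem mul (hf : IsTest d f) (hg : IsTest d g) : IsTest d (fun x => f x * g x) := hg.mul_left hf.1

theorem star (hf : IsTest d f) : IsTest d (fun x => conj (f x)) :=
  ⟨contMDiff_conj hf.1, hf.2.comp_left (g := fun z : ℂ => (starRingEnd ℂ) z) (by simp)⟩

theorem add (hf : IsTest d f) (hg : IsTest d g) : IsTest d (f + g) := ⟨hf.1.add hg.1, hf.2.add hg.2⟩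

theorem const_mul (hf : IsTest d f) (c : ℂ) : IsTest d (fun x => c * f x) :=
  hf.mul_left contMDiff_const

theorem zero : IsTest d (0 : M → ℂ) := ⟨contMDiff_const, HasCompactSupport.zero⟩

theorem sub (hf : IsTest d f) (hg : IsTest d g) : IsTest d (f - g) := by
  convert hf.add (hg.const_mul (-1)) using 1
  ext x; simp [sub_eq_add_neg]

theorem sum {s : Finset ι} {f : ι → M → ℂ} (hf : ∀ i ∈ s, IsTest d (f i)) :
    IsTest d (fun x => ∑ i ∈ s, f i x) := by
  classical
  induction s using Finset.induction_on with
  | empty => simpa using! (zero : IsTest d (0 : M → ℂ))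
  | insert a s ha ih =>
    have h1 := (hf a (Finset.mem_insert_self a s)).add
      (ih fun i hi => hf i (Finset.mem_insert_of_mem hi))
    convert h1 using 1
    funext x
    simp [Finset.sum_insert ha]

theorem memLp [IsFiniteMeasure μ] (hf : IsTest d f) (p : ℝ≥0∞) : MemLp f p μ := by
  obtain ⟨c, hc⟩ := hf.continuous.bounded_above_of_compact_support hf.2
  exact MemLp.of_bound hf.continuous.aestronglyMeasurable c (ae_of_all _ hc)

theorem integrable [IsFiniteMeasure μ]
    (hf : IsTest d f) : Integrable f μ := memLp_one_iff_integrable.1 (hf.memLp 1)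

theorem exists_bound (hf : IsTest d f) : ∃ c, ∀ x, ‖f x‖ ≤ c :=
  hf.continuous.bounded_above_of_compact_support hf.2

end IsTest

variable {f g : M → ℂ} (V : VField d M)

theorem differentiableAt_comp_chart_symm (hf : Smooth f) (hx : x ∈ (𝔠 x₀).source) :
    DifferentiableAt ℝ (f ∘ (𝔠 x₀).symm) (𝔠 x₀ x) :=
  ((contDiffOn_comp_chart_symm hf x₀).differentiableOn (by simp)).differentiableAt
    ((𝔠 x₀).open_target.mem_nhds ((𝔠 x₀).map_source hx))

theorem lieD_mul (hf : Smooth f) (hg : Smooth g) (x : M) :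
    lieD V (fun x => f x * g x) x = lieD V f x * g x + f x * lieD V g x := by
  have hx := mem_chart_source 𝔼 x
  rw [lieD_chart' hx hf, lieD_chart' hx hg, lieD_chart' hx (contMDiff_mul hf hg)]
  have e : ((fun x => f x * g x) ∘ (𝔠 x).symm) = (f ∘ (𝔠 x).symm) * (g ∘ (𝔠 x).symm) := rfl
  rw [e, fderiv_mul (differentiableAt_comp_chart_symm hf hx) (differentiableAt_comp_chart_symm hg hx)]
  simp only [Function.comp, add_apply, smul_apply, (𝔠 x).left_inv hx, smul_eq_mul]
  ring

theorem lieD_add (hf : Smooth f) (hg : Smooth g) (x : M) :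
    lieD V (f + g) x = lieD V f x + lieD V g x := by
  have hx := mem_chart_source 𝔼 x
  rw [lieD_chart' hx hf, lieD_chart' hx hg, lieD_chart' hx (hf.add hg)]
  have e : ((f + g) ∘ (𝔠 x).symm) = (f ∘ (𝔠 x).symm) + (g ∘ (𝔠 x).symm) := rfl
  rw [e, fderiv_add (differentiableAt_comp_chart_symm hf hx) (differentiableAt_comp_chart_symm hg hx)]
  rfl

theorem lieD_clm (A : ℂ →L[ℝ] ℂ) (hf : Smooth f) (x : M) :
    lieD V (fun x => A (f x)) x = A (lieD V f x) := by
  have hx := mem_chart_source 𝔼 x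
  rw [lieD_chart' hx hf, lieD_chart' hx (contMDiff_comp_contDiff A.contDiff hf)]
  have e : HasFDerivAt ((fun x => A (f x)) ∘ (𝔠 x).symm)
    (A.comp (fderiv ℝ (f ∘ (𝔠 x).symm) (𝔠 x x))) (𝔠 x x) :=
    A.hasFDerivAt.comp _ (differentiableAt_comp_chart_symm hf hx).hasFDerivAt
  rw [e.fderiv]; rfl

theorem lieD_conj (hf : Smooth f) (x : M) : lieD V (fun x => conj (f x)) x = conj (lieD V f x) :=
  lieD_clm V (Complex.conjCLE : ℂ →L[ℝ] ℂ) hf x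

theorem lieD_const_mul (c : ℂ) (hf : Smooth f) (x : M) :
    lieD V (fun x => c * f x) x = c * lieD V f x :=
  lieD_clm V (ContinuousLinearMap.mul ℝ ℂ c) hf x

theorem lieD_sum (s : Finset ι) {f : ι → M → ℂ} (hf : ∀ i ∈ s, Smooth (f i)) (x : M) :
    lieD V (fun x => ∑ i ∈ s, f i x) x = ∑ i ∈ s, lieD V (f i) x := by
  classical
  induction s using Finset.induction_on with
  | empty => 
    have := lieD_const_mul V (f := fun _ : M => (0 : ℂ)) 0 contMDiff_const x
    simpa using this
  | insert a s ha ih =>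
    have h2 := fun i hi => hf i (Finset.mem_insert_of_mem hi)
    have e : (fun x => ∑ i ∈ insert a s, f i x) = f a + fun x => ∑ i ∈ s, f i x := by
      funext x; simp [Finset.sum_insert ha]
    have hs : Smooth (fun x => ∑ i ∈ s, f i x) := contMDiff_finsetSum h2
    rw [e, lieD_add V (hf a (Finset.mem_insert_self a s)) hs, ih h2, Finset.sum_insert ha]

theorem lieD_congr {x : M} (h : f =ᶠ[𝓝 x] g) : lieD V f x = lieD V g x := by
  unfold lieD; rw [h.mfderiv_eq]; rfl

theorem lieD_const (c : ℂ) (x : M) : lieD V (fun _ : M => c) x = 0 := by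
  unfold lieD; rw [mfderiv_const]; rfl

theorem lieD_eq_zero_of_notMem_tsupport {x : M} (hx : x ∉ tsupport f) : lieD V f x = 0 := by
  rw [lieD_congr V (notMem_tsupport_iff_eventuallyEq.1 hx)]
  exact lieD_const V 0 x

theorem IsTest.lieD {V : VField d M} (hV : IsSmoothField V) (hf : IsTest d f) :
    IsTest d (lieD V f) := by
  refine ⟨fun x => ?_, hf.2.mono' fun x hx => ?_⟩
  · have hx := mem_chart_source 𝔼 x
    have h1 : SubLaplacian.lieD V f =ᶠ[𝓝 x] (fun y => fderiv ℝ (f ∘ (𝔠 x).symm) y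
        (chartField V x y)) ∘ 𝔠 x := by
      filter_upwards [(𝔠 x).open_source.mem_nhds hx] with z hz
      exact lieD_chart' hz hf.1
    refine ContMDiffAt.congr_of_eventuallyEq ?_ h1
    have ht := (𝔠 x).open_target
    refine ContMDiffAt.comp x (I' := 𝓘(ℝ, 𝔼)) ?_ ((contMDiffOn_chart_infty x).contMDiffAt
        ((𝔠 x).open_source.mem_nhds hx))
    refine (ContDiffOn.contDiffAt ?_ (ht.mem_nhds
        ((𝔠 x).map_source hx))).contMDiffAt
    exact ((contDiffOn_comp_chart_symm hf.1 x).fderiv_of_isOpen ht (by simp)).clm_apply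
      (contDiffOn_chartField hV x)
  · by_contra h
    exact hx (lieD_eq_zero_of_notMem_tsupport V h)

theorem exists_isTest_one_nhds {K U : Set M} (hK : IsCompact K) (hU : IsOpen U) (hKU : K ⊆ U) :
    ∃ χ : M → ℝ, ContMDiff (𝓡 d) 𝓘(ℝ) ∞ χ ∧ IsTest d ↟χ ∧ (∀ x, χ x ∈ Set.Icc 0 1) ∧
      (∀ᶠ x in 𝓝ˢ K, χ x = 1) ∧ tsupport ↟χ ⊆ U := by
  have : LocallyCompactSpace M := ChartedSpace.locallyCompactSpace 𝔼 M
  obtain ⟨L, hL, hKL, hLU⟩ := exists_compact_between hK hU hKU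
  obtain ⟨χ, h1, h0, hI⟩ := exists_contMDiffMap_one_nhds_of_subset_interior (𝓡 d) (n := ⊤)
    hK.isClosed hKL
  have hs : Function.support ↟χ ⊆ L := fun x hx => by by_contra h; exact hx (by simp [h0 x h])
  refine ⟨χ, χ.contMDiff, ⟨contMDiff_comp_contDiff Complex.ofRealCLM.contDiff χ.contMDiff,
    HasCompactSupport.of_support_subset_isCompact hL hs⟩, hI, h1,
    (closure_minimal hs hL.isClosed).trans hLU⟩

/-- A smooth partition of unity subordinate to finitely many chart domains covering the support; it
reduces global questions to one chart. -/
theorem IsTest.exists_sum_chart (hf : IsTest d f) :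
    ∃ (s : Finset M) (φ : M → M → ℝ), (∀ i ∈ s, ContMDiff (𝓡 d) 𝓘(ℝ) ∞ (φ i)) ∧
      (∀ i ∈ s, IsTest d (fun x => (φ i x : ℂ) * f x)) ∧
      (∀ i ∈ s, tsupport (fun x => (φ i x : ℂ) * f x) ⊆ (𝔠 i).source) ∧
      (∀ x, ∑ i ∈ s, (φ i x : ℂ) * f x = f x) := by
  classical
  obtain ⟨t, ht⟩ := hf.2.isCompact.elim_finite_subcover
    (fun i : M => (𝔠 i).source) (fun i => (𝔠 i).open_source)
    (fun x _ => Set.mem_iUnion.2 ⟨x, mem_chart_source _ x⟩)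
  obtain ⟨p, hp⟩ := SmoothPartitionOfUnity.exists_isSubordinate (𝓡 d) (isClosed_tsupport f)
    (fun i : t => (𝔠 (i : M)).source) (fun i => (𝔠 (i : M)).open_source)
    (fun x hx => by simpa using ht hx)
  let φ : M → M → ℝ := fun i => if h : i ∈ t then p ⟨i, h⟩ else 0
  have hφ : ∀ i : t, φ i = p i := fun i => by simp [φ]
  refine ⟨t, φ, fun i hi => ?_, fun i hi => ?_, fun i hi => ?_, fun x => ?_⟩
  · rw [hφ ⟨i, hi⟩]; exact (p ⟨i, hi⟩).contMDiff
  · rw [hφ ⟨i, hi⟩]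
    exact hf.mul_left (contMDiff_comp_contDiff Complex.ofRealCLM.contDiff (p ⟨i, hi⟩).contMDiff)
  · rw [hφ ⟨i, hi⟩]
    refine (closure_mono fun x hx => ?_).trans (hp ⟨i, hi⟩)
    intro h
    exact hx (by simp [show p ⟨i, hi⟩ x = 0 from h])
  · by_cases hx : x ∈ tsupport f
    · have h1 := p.sum_eq_one hx
      rw [finsum_eq_sum_of_fintype] at h1
      rw [← Finset.sum_mul, ← Finset.sum_attach]
      have : (∑ i ∈ t.attach, (φ i x : ℂ)) = 1 := by
        rw [← Complex.ofReal_one, ← h1]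
        push_cast
        exact Finset.sum_congr rfl fun i _ => by rw [hφ i]
      rw [this, one_mul]
    · simp [image_eq_zero_of_notMem_tsupport hx]

theorem ae_eq_zero_of_forall_isTest {μ : Measure M} {h : M → ℂ} (hh : Integrable h μ)
    (h0 : ∀ φ, IsTest d φ → ∫ x, conj (φ x) * h x ∂μ = 0) : h =ᵐ[μ] 0 := by
  refine ae_eq_zero_of_integral_contMDiff_smul_eq_zero (𝓡 d) hh.locallyIntegrable fun g hg hc => ?_
  have := h0 ↟g ⟨contMDiff_comp_contDiff Complex.ofRealCLM.contDiff hg,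
    hc.comp_left (g := ((↑) : ℝ → ℂ)) rfl⟩
  simpa using this

end TestFunctions

omit hm

theorem contDiff_of_contDiffOn_of_eq_zero {G : Type*} [NormedAddCommGroup G] [NormedSpace ℝ G]
    {F : 𝔼 → G} {T K : Set 𝔼} (hT : IsOpen T) (hK : IsClosed K) (hKT : K ⊆ T)
    (h0 : ∀ y, y ∉ K → F y = 0) (hF : ContDiffOn ℝ ∞ F T) : ContDiff ℝ ∞ F := by
  refine contDiff_iff_contDiffAt.2 fun y => ?_
  by_cases hy : y ∈ K
  · exact hF.contDiffAt (hT.mem_nhds (hKT hy))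
  · have : F =ᶠ[𝓝 y] fun _ => 0 := by
      filter_upwards [hK.isOpen_compl.mem_nhds hy] with z hz using h0 z hz
    exact contDiffAt_const.congr_of_eventuallyEq this

theorem contDiffOn_euclDiv {V : 𝔼 → 𝔼} {T : Set 𝔼} (hT : IsOpen T)
    (hV : ContDiffOn ℝ ∞ V T) : ContDiffOn ℝ ∞ (euclDiv V) T := by
  unfold euclDiv
  refine ContDiffOn.sum fun j _ => ?_
  exact (EuclideanSpace.proj (𝕜 := ℝ) j).contDiff.comp_contDiffOn
    ((hV.fderiv_of_isOpen hT (by simp)).clm_apply contDiffOn_const)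

theorem tsupport_subset_of_eq_zero {X' : Type*} [TopologicalSpace X'] {G : Type*} [Zero G]
    {F : X' → G} {K : Set X'} (hK : IsClosed K) (h0 : ∀ y, y ∉ K → F y = 0) : tsupport F ⊆ K :=
  closure_minimal (fun y hy => by by_contra h; exact hy (h0 y h)) hK

theorem fderiv_eq_zero_of_notMem {G : Type*} [NormedAddCommGroup G] [NormedSpace ℝ G]
    {F : 𝔼 → G} {K : Set 𝔼} (hK : IsClosed K)
    (h0 : ∀ y, y ∉ K → F y = 0) {y : 𝔼} (hy : y ∉ K) : fderiv ℝ F y = 0 := by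
  have : F =ᶠ[𝓝 y] fun _ => 0 := by
    filter_upwards [hK.isOpen_compl.mem_nhds hy] with z hz using h0 z hz
  rw [this.fderiv_eq]; simp

/-- The image in the chart of a compact subset of its domain. -/
theorem exists_compact_chart_image {K : Set M} {x₀ : M} (hK : IsCompact K)
    (hKS : K ⊆ (𝔠 x₀).source) : ∃ L : Set 𝔼, IsCompact L ∧
      L ⊆ (𝔠 x₀).target ∧ (∀ y ∈ (𝔠 x₀).target, y ∉ L → (𝔠 x₀).symm y ∉ K) := by
  refine ⟨𝔠 x₀ '' K, hK.image_of_continuousOn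
    ((𝔠 x₀).continuousOn.mono hKS), ?_, fun y hy hyL hyK => hyL ?_⟩
  · rintro _ ⟨x, hx, rfl⟩
    exact (𝔠 x₀).map_source (hKS hx)
  · exact ⟨_, hyK, (𝔠 x₀).right_inv hy⟩

variable [IsProbabilityMeasure μ]

/-! ### Formal adjoints and the weak Leibniz rule in a chart. -/

open scoped Classical in
/-- A function on `M`, multiplied by the density, in the chart at `x₀`. -/
def chartPush (x₀ : M) (m : 𝔼 → ℝ) (f : M → ℂ) (y : 𝔼) : ℂ :=
  if y ∈ (𝔠 x₀).target then m y • f ((𝔠 x₀).symm y) else 0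

theorem chartPush_of_mem {y : 𝔼} (hy : y ∈ (𝔠 x₀).target) (f : M → ℂ) :
    chartPush x₀ m f y = m y • f ((𝔠 x₀).symm y) := if_pos hy

theorem chartPush_eq_zero {K : Set M} (hf : ∀ x, x ∉ K → f x = 0) {L : Set 𝔼}
    (hL : ∀ y ∈ (𝔠 x₀).target, y ∉ L → (𝔠 x₀).symm y ∉ K) {y : 𝔼}
    (hy : y ∉ L) : chartPush x₀ m f y = 0 := by
  unfold chartPush
  split_ifs with h
  · rw [hf _ (hL y h hy), smul_zero]
  · rfl

include hm

theorem IsChartDensity.integral_eq_chartPush (hf : AEStronglyMeasurable f μ)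
    (hf0 : ∀ x, x ∉ (𝔠 x₀).source → f x = 0) : ∫ x, f x ∂μ = ∫ y, chartPush x₀ m f y := by
  rw [hm.integral_eq hf hf0, ← setIntegral_eq_integral_of_forall_compl_eq_zero
    (s := (𝔠 x₀).target) (f := chartPush x₀ m f) fun y hy => if_neg hy]
  exact setIntegral_congr_fun (𝔠 x₀).open_target.measurableSet
    fun y hy => (chartPush_of_mem hy f).symm

omit hm in
/-- The coordinate expression of the formal adjoint of a vector field. -/
def chartAdjoint (V : VField d M) (x₀ : M) (m : 𝔼 → ℝ) (φ : M → ℂ) : M → ℂ :=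
  chartLift x₀ fun y => -((m y : ℂ)⁻¹ * (fderiv ℝ (chartPush x₀ m φ) y (chartField V x₀ y) +
    (euclDiv (chartField V x₀) y : ℂ) * chartPush x₀ m φ y))

theorem contDiffOn_chartPush {φ : M → ℂ} (hφ : Smooth φ) :
    ContDiffOn ℝ ∞ (chartPush x₀ m φ) (𝔠 x₀).target :=
  (hm.smooth.smul (contDiffOn_comp_chart_symm hφ x₀)).congr fun _ hy => chartPush_of_mem hy φ

/-- With `W` the coordinate field and `m` the density, the adjoint is `-m⁻¹ (W(mφ) + (div W) mφ)`.
The required identity is the divergence theorem applied to `conj (mφ) η`, which is compactly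
supported in the chart target. -/
theorem IsChartDensity.isFormalAdjoint (hV : IsSmoothField V) {φ : M → ℂ} (hφ : IsTest d φ)
    (hφs : tsupport φ ⊆ (𝔠 x₀).source) :
    IsFormalAdjoint μ V φ (chartAdjoint V x₀ m φ) ∧
      tsupport (chartAdjoint V x₀ m φ) ⊆ (𝔠 x₀).source := by
  obtain ⟨L, hLc, hLT, hL⟩ := exists_compact_chart_image hφ.2.isCompact hφs
  have hTo := (𝔠 x₀).open_target
  set T := (𝔠 x₀).target with hT
  set ξ := chartPush x₀ m φ with hξ
  set W := chartField V x₀ with hW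
  have hφ0 : ∀ x, x ∉ tsupport φ → φ x = 0 := fun x hx => image_eq_zero_of_notMem_tsupport hx
  have hξ0 : ∀ y, y ∉ L → ξ y = 0 := fun y hy => chartPush_eq_zero hφ0 hL hy
  have hξs : ContDiff ℝ ∞ ξ := contDiff_of_contDiffOn_of_eq_zero hTo hLc.isClosed hLT hξ0
    (contDiffOn_chartPush hm hφ.1)
  have hWs : ContDiffOn ℝ ∞ W T := contDiffOn_chartField hV x₀
  have hDs : ContDiffOn ℝ ∞ (euclDiv W) T := contDiffOn_euclDiv hTo hWs
  set B : 𝔼 → ℂ := fun y => fderiv ℝ ξ y (W y) + (euclDiv W y : ℂ) * ξ y with hB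
  have hB0 : ∀ y, y ∉ L → B y = 0 := fun y hy => by
    simp [hB, fderiv_eq_zero_of_notMem hLc.isClosed hξ0 hy, hξ0 y hy]
  have hBs : ContDiffOn ℝ ∞ B T := by
    refine ContDiffOn.add ?_ ?_
    · exact ((hξs.fderiv_right (m := ∞) (by simp)).contDiffOn).clm_apply hWs
    · exact (Complex.ofRealCLM.contDiff.comp_contDiffOn hDs).mul hξs.contDiffOn
  have hmC : ContDiffOn ℝ ∞ (fun y => (m y : ℂ)⁻¹) T := by
    have := (hm.smooth.inv fun y hy => (hm.pos y hy).ne')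
    refine (Complex.ofRealCLM.contDiff.comp_contDiffOn this).congr fun y _ => ?_
    simp
  have hFs : ContDiffOn ℝ ∞ (fun y => -((m y : ℂ)⁻¹ * B y)) T := (hmC.mul hBs).neg
  have hF0 : ∀ y, y ∉ L → -((m y : ℂ)⁻¹ * B y) = 0 := fun y hy => by simp [hB0 y hy]
  refine ⟨⟨isTest_chartLift hLc hLT hF0 hFs, fun η hη => ?_⟩,
    (tsupport_chartLift_subset hLc hLT hF0).trans (symm_image_subset_source hLT)⟩
  have hψt : IsTest d (chartAdjoint V x₀ m φ) := isTest_chartLift hLc hLT hF0 hFs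
  have i1 : ∫ x, conj (chartAdjoint V x₀ m φ x) * η x ∂μ =
      ∫ y, chartPush x₀ m (fun x => conj (chartAdjoint V x₀ m φ x) * η x) y :=
    hm.integral_eq_chartPush (hψt.star.mul hη).continuous.aestronglyMeasurable
      fun x hx => by simp [chartAdjoint, chartLift_of_notMem hx]
  have i2 : ∫ x, conj (φ x) * lieD V η x ∂μ =
      ∫ y, chartPush x₀ m (fun x => conj (φ x) * lieD V η x) y :=
    hm.integral_eq_chartPush (hφ.star.mul (hη.lieD hV)).continuous.aestronglyMeasurable
      fun x hx => by rw [hφ0 x fun h => hx (hφs h)]; simp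
  rw [i1, i2]
  set η' : 𝔼 → ℂ := η ∘ (𝔠 x₀).symm with hη'
  have hη's : ContDiffOn ℝ ∞ η' T := contDiffOn_comp_chart_symm hη.1 x₀
  set a : 𝔼 → ℂ := fun y => conj (ξ y) * η' y with ha
  have ha0 : ∀ y, y ∉ L → a y = 0 := fun y hy => by simp [ha, hξ0 y hy]
  have hξc : ContDiff ℝ ∞ (fun y => conj (ξ y)) := Complex.conjCLE.contDiff.comp hξs
  have has : ContDiff ℝ ∞ a := contDiff_of_contDiffOn_of_eq_zero hTo hLc.isClosed hLT ha0
    (hξc.contDiffOn.mul hη's)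
  have key := integral_fderiv_add_euclDiv hTo (has.of_le (by simp))
    (HasCompactSupport.of_support_subset_isCompact hLc fun y hy => by
      by_contra h; exact hy (ha0 y h))
    ((tsupport_subset_of_eq_zero hLc.isClosed ha0).trans hLT) (hWs.of_le (by simp))
  have hpt : ∀ y, chartPush x₀ m (fun x => conj (φ x) * lieD V η x) y =
      fderiv ℝ a y (W y) + (euclDiv W y : ℂ) * a y +
        chartPush x₀ m (fun x => conj (chartAdjoint V x₀ m φ x) * η x) y := fun y => by
    by_cases hy : y ∈ L
    · have hyT := hLT hy
      have hd : DifferentiableAt ℝ η' y :=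
        (hη's.differentiableOn (by simp)).differentiableAt (hTo.mem_nhds hyT)
      have hdξ : HasFDerivAt (fun y => conj (ξ y))
          ((Complex.conjCLE : ℂ →L[ℝ] ℂ).comp (fderiv ℝ ξ y)) y :=
        (Complex.conjCLE : ℂ →L[ℝ] ℂ).hasFDerivAt.comp y
          (hξs.differentiable (by simp) y).hasFDerivAt
      have hda : fderiv ℝ a y (W y) = conj (ξ y) * fderiv ℝ η' y (W y) +
          conj (fderiv ℝ ξ y (W y)) * η' y := by
        have hda' : HasFDerivAt a _ y := hdξ.mul hd.hasFDerivAt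
        rw [hda'.fderiv]
        simp [mul_comm]
      have hl : lieD V η ((𝔠 x₀).symm y) = fderiv ℝ η' y (W y) := by
        rw [lieD_chart' ((𝔠 x₀).map_target hyT) hη.1, (𝔠 x₀).right_inv hyT]
      have hmy : (m y : ℂ) ≠ 0 := by exact_mod_cast (hm.pos y hyT).ne'
      have hξy : ξ y = m y * φ ((𝔠 x₀).symm y) := by rw [hξ, chartPush_of_mem hyT]; simp
      rw [chartPush_of_mem hyT, chartPush_of_mem hyT, chartAdjoint, chartLift_symm hyT, hl, hda]
      simp only [← hξ, ← hW, Complex.real_smul, map_neg, map_mul, map_add, map_inv₀,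
        Complex.conj_ofReal, ha, hη', Function.comp]
      rw [hξy]
      simp only [map_mul, Complex.conj_ofReal]
      field_simp
      ring
    · have h1 : chartPush x₀ m (fun x => conj (φ x) * lieD V η x) y = 0 :=
        chartPush_eq_zero (fun x hx => by rw [hφ0 x hx]; simp) hL hy
      have h2 : chartPush x₀ m (fun x => conj (chartAdjoint V x₀ m φ x) * η x) y = 0 := by
        unfold chartPush
        split_ifs with h
        · simp only [chartAdjoint, chartLift_symm h, ← hξ, ← hW]
          have := hF0 y hy
          simp only [hB] at this
          rw [this]; simp
        · rfl
      rw [h1, h2, fderiv_eq_zero_of_notMem hLc.isClosed ha0 hy, ha0 y hy]; simp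
  have hI1 : Integrable (fun y => fderiv ℝ a y (W y) + (euclDiv W y : ℂ) * a y) := by
    refine integrable_of_continuousOn_tsupport hLc hLT ?_ (fun y hy => by
      rw [fderiv_eq_zero_of_notMem hLc.isClosed ha0 hy, ha0 y hy]; simp)
    exact ((has.continuous_fderiv (by simp)).continuousOn.clm_apply hWs.continuousOn).add
      ((Complex.continuous_ofReal.comp_continuousOn hDs.continuousOn).mul has.continuous.continuousOn)
  have hI2 : Integrable (chartPush x₀ m (fun x => conj (chartAdjoint V x₀ m φ x) * η x)) := by
    have hc : ContDiffOn ℝ ∞ (chartPush x₀ m (fun x => conj (chartAdjoint V x₀ m φ x) * η x)) T :=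
      contDiffOn_chartPush hm (hψt.star.mul hη).1
    refine integrable_of_continuousOn_tsupport hLc hLT hc.continuousOn fun y hy => ?_
    unfold chartPush
    split_ifs with h
    · simp only [chartAdjoint, chartLift_symm h, ← hξ, ← hW]
      have := hF0 y hy
      simp only [hB] at this
      rw [this]; simp
    · rfl
  simp only [hpt]
  rw [integral_add hI1 hI2, key, zero_add]

theorem IsChartDensity.map_chart :
    Measure.map (𝔠 x₀) (μ.restrict (𝔠 x₀).source) = chartMeasure x₀ m := by
  have h1 : AEMeasurable (𝔠 x₀) (μ.restrict (𝔠 x₀).source) :=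
    (𝔠 x₀).continuousOn.aemeasurable (𝔠 x₀).open_source.measurableSet
  rw [← hm.map_chart_symm] at h1 ⊢
  rw [AEMeasurable.map_map_of_aemeasurable h1 (aemeasurable_chart_symm x₀ m)]
  have : (𝔠 x₀) ∘ (𝔠 x₀).symm =ᵐ[chartMeasure x₀ m] id := by
    refine (withDensity_absolutelyContinuous _ _).ae_le ?_
    filter_upwards [ae_restrict_mem (𝔠 x₀).open_target.measurableSet] with y hy
    exact (𝔠 x₀).right_inv hy
  rw [Measure.map_congr this, Measure.map_id]

theorem IsChartDensity.aestronglyMeasurable_chartLift {F : 𝔼 → ℂ}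
    (hF : AEStronglyMeasurable F volume) : AEStronglyMeasurable (chartLift x₀ F) μ := by
  have h1 : AEMeasurable (𝔠 x₀) (μ.restrict (𝔠 x₀).source) :=
    (𝔠 x₀).continuousOn.aemeasurable (𝔠 x₀).open_source.measurableSet
  have hac : chartMeasure x₀ m ≪ volume :=
    (withDensity_absolutelyContinuous _ _).trans Measure.restrict_le_self.absolutelyContinuous
  have h2 : AEStronglyMeasurable (F ∘ 𝔠 x₀) (μ.restrict (𝔠 x₀).source) :=
    AEStronglyMeasurable.comp_aemeasurable (by rw [hm.map_chart]; exact hF.mono_ac hac) h1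
  have e : chartLift x₀ F = (𝔠 x₀).source.indicator (F ∘ 𝔠 x₀) := by
    funext x
    by_cases hx : x ∈ (𝔠 x₀).source
    · rw [chartLift_of_mem hx, Set.indicator_of_mem hx]; rfl
    · rw [chartLift_of_notMem hx, Set.indicator_of_notMem hx]
  rw [e]
  exact (aestronglyMeasurable_indicator_iff (𝔠 x₀).open_source.measurableSet).2 h2

theorem IsChartDensity.exists_eLpNorm_chartLift_le {K : Set 𝔼}
    (hK : IsCompact K) (hKT : K ⊆ (𝔠 x₀).target) (p : ℝ≥0∞) :
    ∃ c : ℝ≥0∞, c ≠ ⊤ ∧ ∀ F : 𝔼 → ℂ, AEStronglyMeasurable F volume → (∀ y, y ∉ K → F y = 0) →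
      eLpNorm (chartLift x₀ F) p μ ≤ c * eLpNorm F p volume := by
  obtain ⟨c, hc, hc1, -⟩ := hm.exists_le hK hKT
  refine ⟨c ^ (1 / p).toReal, ENNReal.rpow_ne_top_of_nonneg ENNReal.toReal_nonneg hc,
    fun F hF hF0 => ?_⟩
  have h1 := hm.aestronglyMeasurable_chartLift hF
  calc eLpNorm (chartLift x₀ F) p μ
      = eLpNorm (chartLift x₀ F) p (μ.restrict (𝔠 x₀).source) :=
        (eLpNorm_restrict_eq_of_support_subset fun x hx => by
          by_contra h; exact hx (chartLift_of_notMem h F)).symm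
    _ = eLpNorm (chartLift x₀ F ∘ (𝔠 x₀).symm) p (chartMeasure x₀ m) := by
        rw [← hm.map_chart_symm, eLpNorm_map_measure (by rw [hm.map_chart_symm]; exact h1.restrict)
          (aemeasurable_chart_symm x₀ m)]
    _ = eLpNorm F p (chartMeasure x₀ m) := by
        refine eLpNorm_congr_ae ((withDensity_absolutelyContinuous _ _).ae_le ?_)
        filter_upwards [ae_restrict_mem (𝔠 x₀).open_target.measurableSet] with y hy
        exact chartLift_symm hy F
    _ = eLpNorm F p ((chartMeasure x₀ m).restrict K) :=
        (eLpNorm_restrict_eq_of_support_subset fun y hy => by by_contra h; exact hy (hF0 y h)).symm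
    _ ≤ eLpNorm F p (c • volume) := eLpNorm_mono_measure _ hc1
    _ ≤ _ := eLpNorm_smul_measure_le _ _ _ _

theorem IsChartDensity.memLp_chartPush_one {K : Set M} {L : Set 𝔼}
    (hLc : IsCompact L) (hLT : L ⊆ (𝔠 x₀).target)
    (hL : ∀ y ∈ (𝔠 x₀).target, y ∉ L → (𝔠 x₀).symm y ∉ K) (hf0 : ∀ x, x ∉ K → f x = 0) (hf : MemLp f p μ) :
    MemLp (chartPush x₀ (fun _ : 𝔼 => 1) f) p volume := by
  obtain ⟨c, hc, -, hc2⟩ := hm.exists_le hLc hLT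
  have h1 : MemLp (f ∘ (𝔠 x₀).symm) p (chartMeasure x₀ m) := by
    refine MemLp.comp_of_map ?_ (aemeasurable_chart_symm x₀ m)
    rw [hm.map_chart_symm]
    exact hf.restrict _
  have h2 : MemLp (f ∘ (𝔠 x₀).symm) p (volume.restrict L) := h1.of_measure_le_smul hc hc2
  have h3 := (memLp_indicator_iff_restrict hLc.measurableSet).2 h2
  refine h3.ae_eq (ae_of_all _ fun y => ?_)
  by_cases hy : y ∈ L
  · rw [Set.indicator_of_mem hy, chartPush_of_mem (hLT hy), one_smul]; rfl
  · rw [Set.indicator_of_notMem hy, chartPush_eq_zero hf0 hL hy]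

omit hm

theorem chartLift_chartPush_one (hf : ∀ x, x ∉ (𝔠 x₀).source → f x = 0) :
    chartLift x₀ (chartPush x₀ (fun _ : 𝔼 => 1) f) = f := by
  funext x
  by_cases hx : x ∈ (𝔠 x₀).source
  · rw [chartLift_of_mem hx, chartPush_of_mem ((𝔠 x₀).map_source hx),
      (𝔠 x₀).left_inv hx, one_smul]
  · rw [chartLift_of_notMem hx, hf x hx]

theorem mollify_eq_zero {η : 𝔼 → ℝ} {r : ℝ} (hη : ∀ z, η z ≠ 0 → ‖z‖ ≤ r) {g : 𝔼 → ℂ} {L : Set 𝔼}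
    (hg : ∀ y, y ∉ L → g y = 0) {x : 𝔼} (hx : x ∉ Metric.cthickening r L) : mollify η g x = 0 := by
  unfold mollify
  rw [← integral_zero 𝔼 ℂ]
  congr 1
  funext y
  by_cases hy : y ∈ L
  · have : η (x - y) = 0 := by
      by_contra h
      exact hx (Metric.mem_cthickening_of_dist_le x y r L hy (by simpa [dist_eq_norm] using hη _ h))
    rw [this, zero_smul]
  · rw [hg y hy, smul_zero]

include hm

/-- The coordinate form of the weak Leibniz rule. -/
theorem IsChartDensity.isEuclWeakDeriv (hV : IsSmoothField V) (hχt : IsTest d ↟χ) {L : Set 𝔼}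
    (hLc : IsCompact L) (hLT : L ⊆ (𝔠 x₀).target)
    (hL : ∀ y ∈ (𝔠 x₀).target, y ∉ L → (𝔠 x₀).symm y ∉ tsupport ↟χ) {W : 𝔼 → 𝔼}
    (hW : ∀ y ∈ L, W =ᶠ[𝓝 y] chartField V x₀) {f G : M → ℂ} (hf : Integrable f μ)
    (hG : Integrable G μ)
    (hw : ∀ φ ψ, IsTest d φ → IsFormalAdjoint μ V φ ψ →
      ∫ x, conj (φ x) * G x ∂μ = ∫ x, conj (ψ x) * f x ∂μ) :
    IsEuclWeakDeriv W (chartPush x₀ (fun _ : 𝔼 => 1) (fun x => (χ x : ℂ) * f x))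
      (chartPush x₀ (fun _ : 𝔼 => 1)
        (fun x => (χ x : ℂ) * G x + lieD V ↟χ x * f x)) := by
  intro ζ hζ hζc
  have hTo := (𝔠 x₀).open_target
  set T := (𝔠 x₀).target with hT
  set e := 𝔠 x₀ with he
  set χ' : 𝔼 → ℂ := ↟χ ∘ e.symm with hχ'
  have hχ's : ContDiffOn ℝ ∞ χ' T := contDiffOn_comp_chart_symm hχt.1 x₀
  have hχ0 : ∀ x, x ∉ tsupport ↟χ → (χ x : ℂ) = 0 :=
    fun x hx => image_eq_zero_of_notMem_tsupport (f := fun x => (χ x : ℂ)) hx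
  have hlχ0 : ∀ x, x ∉ tsupport ↟χ → lieD V ↟χ x = 0 :=
    fun x hx => lieD_eq_zero_of_notMem_tsupport V hx
  -- The Euclidean test function `ζ` is tested on the manifold through `χ ζ / m`; the division by
  -- `m` cancels the density of `μ`.
  open scoped Classical in
  set F : 𝔼 → ℂ := fun y => if y ∈ L then χ' y * ((ζ y : ℂ) * (m y : ℂ)⁻¹) else 0 with hF
  have hχ'0 : ∀ y ∈ T, y ∉ L → χ' y = 0 := fun y hy hyL => hχ0 _ (hL y hy hyL)
  have hFT : ∀ y ∈ T, F y = χ' y * ((ζ y : ℂ) * (m y : ℂ)⁻¹) := fun y hy => by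
    simp only [hF]
    split_ifs with h
    · rfl
    · rw [hχ'0 y hy h, zero_mul]
  have hF0 : ∀ y, y ∉ L → F y = 0 := fun y hy => if_neg hy
  have hζC : ContDiff ℝ ∞ (fun y => (ζ y : ℂ)) := Complex.ofRealCLM.contDiff.comp hζ
  have hmC : ContDiffOn ℝ ∞ (fun y => (m y : ℂ)⁻¹) T := by
    have := (hm.smooth.inv fun y hy => (hm.pos y hy).ne')
    refine (Complex.ofRealCLM.contDiff.comp_contDiffOn this).congr fun y _ => ?_
    simp
  have hFs : ContDiffOn ℝ ∞ F T := (hχ's.mul (hζC.contDiffOn.mul hmC)).congr hFT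
  have hφ : IsTest d (chartLift x₀ F) := isTest_chartLift hLc hLT hF0 hFs
  have hφs : tsupport (chartLift x₀ F) ⊆ e.source :=
    (tsupport_chartLift_subset hLc hLT hF0).trans (symm_image_subset_source hLT)
  have hadj := hm.isFormalAdjoint hV hφ hφs
  have key := hw _ _ hφ hadj.1
  set φ := chartLift x₀ F with hφdef
  set ψ := chartAdjoint V x₀ m φ with hψdef
  have hφb : AEStronglyMeasurable (fun x => conj (φ x) * G x) μ :=
    hφ.star.continuous.aestronglyMeasurable.mul hG.1
  have hψb : AEStronglyMeasurable (fun x => conj (ψ x) * f x) μ :=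
    hadj.1.1.star.continuous.aestronglyMeasurable.mul hf.1
  rw [hm.integral_eq_chartPush hφb fun x hx => by simp [hφdef, chartLift_of_notMem hx],
    hm.integral_eq_chartPush hψb fun x hx => by
      simp [hψdef, chartAdjoint, chartLift_of_notMem hx]] at key
  -- the three building blocks
  have g1 : MemLp (chartPush x₀ (fun _ : 𝔼 => 1) (fun x => (χ x : ℂ) * f x)) 1 volume :=
    hm.memLp_chartPush_one hLc hLT hL (fun x hx => by simp only [hχ0 x hx, zero_mul])
      (memLp_one_iff_integrable.2 (hf.bdd_mul hχt.continuous.aestronglyMeasurable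
        (ae_of_all _ hχt.exists_bound.choose_spec)))
  have hlt := hχt.lieD hV
  have g2 : MemLp (chartPush x₀ (fun _ : 𝔼 => 1)
      (fun x => lieD V ↟χ x * f x)) 1 volume :=
    hm.memLp_chartPush_one hLc hLT hL (fun x hx => by simp only [hlχ0 x hx, zero_mul])
      (memLp_one_iff_integrable.2 (hf.bdd_mul hlt.continuous.aestronglyMeasurable
        (ae_of_all _ hlt.exists_bound.choose_spec)))
  have g3 : MemLp (chartPush x₀ (fun _ : 𝔼 => 1) (fun x => (χ x : ℂ) * G x)) 1 volume :=
    hm.memLp_chartPush_one hLc hLT hL (fun x hx => by simp only [hχ0 x hx, zero_mul])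
      (memLp_one_iff_integrable.2 (hG.bdd_mul hχt.continuous.aestronglyMeasurable
        (ae_of_all _ hχt.exists_bound.choose_spec)))
  rw [memLp_one_iff_integrable] at g1 g2 g3
  set u1 := chartPush x₀ (fun _ : 𝔼 => 1) (fun x => (χ x : ℂ) * f x) with hu1
  set u2 := chartPush x₀ (fun _ : 𝔼 => 1) (fun x => lieD V ↟χ x * f x) with hu2
  set u3 := chartPush x₀ (fun _ : 𝔼 => 1) (fun x => (χ x : ℂ) * G x) with hu3
  have hsum : chartPush x₀ (fun _ : 𝔼 => 1)
      (fun x => (χ x : ℂ) * G x + lieD V ↟χ x * f x) = u3 + u2 := by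
    funext y
    simp only [hu3, hu2, chartPush, Pi.add_apply]
    split_ifs <;> simp
  have eL : chartPush x₀ m (fun x => conj (φ x) * G x) = fun y => ζ y • u3 y := by
    funext y
    by_cases hy : y ∈ T
    · have hmy : (m y : ℂ) ≠ 0 := by exact_mod_cast (hm.pos y hy).ne'
      rw [hu3, chartPush_of_mem hy, chartPush_of_mem hy, hφdef, chartLift_symm hy, hFT y hy]
      simp only [hχ', Function.comp, map_mul, Complex.conj_ofReal, map_inv₀, Complex.real_smul]
      field_simp
      simp only [Complex.ofReal_one, mul_one]
      ring
    · simp only [hu3]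
      unfold chartPush
      rw [if_neg hy, if_neg hy, smul_zero]
  have hξ : chartPush x₀ m φ =ᶠ[𝓟 T] fun y => χ' y * (ζ y : ℂ) := by
    intro y hy
    have hmy : (m y : ℂ) ≠ 0 := by exact_mod_cast (hm.pos y hy).ne'
    show chartPush x₀ m φ y = _
    rw [chartPush_of_mem hy, hφdef, chartLift_symm hy, hFT y hy, Complex.real_smul]
    field_simp
  have eR : chartPush x₀ m (fun x => conj (ψ x) * f x) = fun y =>
      -(ζ y • u2 y + (fderiv ℝ ζ y (W y) + euclDiv W y * ζ y) • u1 y) := by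
    funext y
    by_cases hyL : y ∈ L
    · have hy := hLT hyL
      have hmy : (m y : ℂ) ≠ 0 := by exact_mod_cast (hm.pos y hy).ne'
      have hξy : chartPush x₀ m φ =ᶠ[𝓝 y] fun y => χ' y * (ζ y : ℂ) := by
        filter_upwards [hTo.mem_nhds hy] with z hz using hξ hz
      have hdχ : DifferentiableAt ℝ χ' y :=
        (hχ's.differentiableOn (by simp)).differentiableAt (hTo.mem_nhds hy)
      have hdζ : HasFDerivAt (fun y => (ζ y : ℂ)) (Complex.ofRealCLM.comp (fderiv ℝ ζ y)) y :=
        Complex.ofRealCLM.hasFDerivAt.comp y (hζ.differentiable (by simp) y).hasFDerivAt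
      have hder : fderiv ℝ (chartPush x₀ m φ) y (chartField V x₀ y) =
          χ' y * ((fderiv ℝ ζ y (chartField V x₀ y) : ℝ) : ℂ) +
            fderiv ℝ χ' y (chartField V x₀ y) * (ζ y : ℂ) := by
        rw [hξy.fderiv_eq]
        have := hdχ.hasFDerivAt.mul hdζ
        rw [show fderiv ℝ (fun y => χ' y * (ζ y : ℂ)) y = _ from this.fderiv]
        simp [mul_comm]
      have hl : lieD V ↟χ (e.symm y) = fderiv ℝ χ' y (chartField V x₀ y) := by
        rw [lieD_chart' (e.map_target hy) hχt.1, e.right_inv hy]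
      have hlc : conj (fderiv ℝ χ' y (chartField V x₀ y)) = fderiv ℝ χ' y (chartField V x₀ y) := by
        rw [← hl, ← lieD_conj V hχt.1]
        simp
      have hWy : W y = chartField V x₀ y := (hW y hyL).eq_of_nhds
      have hDy : euclDiv W y = euclDiv (chartField V x₀) y := by
        unfold euclDiv; rw [(hW y hyL).fderiv_eq]
      rw [hWy, hDy, chartPush_of_mem hy, hu1, hu2, chartPush_of_mem hy, chartPush_of_mem hy, hψdef,
        chartAdjoint, chartLift_symm hy, hder, hξy.eq_of_nhds, hl]
      simp only [map_neg, map_mul, map_add, map_inv₀, Complex.conj_ofReal, Complex.real_smul, hlc]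
      have : conj (χ' y) = χ' y := by simp [hχ']
      rw [this]
      have hχe : ((χ (e.symm y) : ℝ) : ℂ) = χ' y := rfl
      rw [hχe]
      push_cast
      field_simp
      ring
    · have h1 : u1 y = 0 := chartPush_eq_zero (fun x hx => by simp only [hχ0 x hx, zero_mul]) hL hyL
      have h2 : u2 y = 0 := chartPush_eq_zero (fun x hx => by simp only [hlχ0 x hx, zero_mul]) hL hyL
      rw [h1, h2]
      simp only [smul_zero, add_zero, neg_zero]
      unfold chartPush
      split_ifs with h
      · have hz : fderiv ℝ (chartPush x₀ m φ) y = 0 := by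
          refine fderiv_eq_zero_of_notMem hLc.isClosed (fun z hz => ?_) hyL
          unfold chartPush
          split_ifs with h'
          · rw [hφdef, chartLift_symm h', hF0 z hz, smul_zero]
          · rfl
        have hz' : chartPush x₀ m φ y = 0 := by
          rw [chartPush_of_mem h, hφdef, chartLift_symm h, hF0 y hyL, smul_zero]
        simp only [hψdef, chartAdjoint, chartLift_symm h, hz, hz']
        simp
      · rfl
  rw [eL, eR, integral_neg] at key
  have I1 : Integrable (fun y => ζ y • u2 y) := integrable_smul_of_continuous hζ.continuous hζc g2
  have I3 : Integrable (fun y => ζ y • u3 y) := integrable_smul_of_continuous hζ.continuous hζc g3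
  have hstep : ∫ y, (ζ y • u2 y + (fderiv ℝ ζ y (W y) + euclDiv W y * ζ y) • u1 y) =
      (∫ y, ζ y • u2 y) + ∫ y, (fderiv ℝ ζ y (W y) + euclDiv W y * ζ y) • u1 y := by
    by_cases hI : Integrable (fun y => (fderiv ℝ ζ y (W y) + euclDiv W y * ζ y) • u1 y)
    · exact integral_add I1 hI
    · exfalso
      apply hI
      have hsm : ContDiffOn ℝ ∞ (chartField V x₀) T := contDiffOn_chartField hV x₀
      have hc : ContinuousOn (fun y => fderiv ℝ ζ y (chartField V x₀ y) +
          euclDiv (chartField V x₀) y * ζ y) L :=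
        (((hζ.continuous_fderiv (by simp)).continuousOn.clm_apply hsm.continuousOn).add
          ((contDiffOn_euclDiv hTo hsm).continuousOn.mul hζ.continuous.continuousOn)).mono hLT
      obtain ⟨c, hcb⟩ := hLc.exists_bound_of_continuousOn hc
      have hI2 : IntegrableOn (fun y => (fderiv ℝ ζ y (chartField V x₀ y) +
          euclDiv (chartField V x₀) y * ζ y) • u1 y) L :=
        (g1.integrableOn (s := L)).bdd_smul c (hc.aestronglyMeasurable hLc.measurableSet)
          ((ae_restrict_mem hLc.measurableSet).mono hcb)
      rw [← integrableOn_iff_integrable_of_support_subset (s := L) (fun y hy => by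
        by_contra h
        exact hy (by
          have h1 : u1 y = 0 :=
            chartPush_eq_zero (fun x hx => by simp only [hχ0 x hx, zero_mul]) hL h
          simp [h1]))]
      refine hI2.congr_fun (fun y hy => ?_) hLc.measurableSet
      have hWy : W y = chartField V x₀ y := (hW y hy).eq_of_nhds
      have hDy : euclDiv W y = euclDiv (chartField V x₀) y := by
        unfold euclDiv; rw [(hW y hy).fderiv_eq]
      simp only [hWy, hDy]
  rw [hstep] at key
  rw [hsum]
  simp only [Pi.add_apply, smul_add]
  rw [integral_add I3 I1, key]
  ring

/-! ### Friedrichs mollification on the manifold. -/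

omit hm in
/-- The kernel on `M` of `f ↦ η * (χ f)`, the convolution being taken in the chart at `x₀`. -/
def chartKernel (x₀ : M) (m : 𝔼 → ℝ) (η : 𝔼 → ℝ) (χ : M → ℝ) (x z : M) : ℝ :=
  open Classical in
  if x ∈ (𝔠 x₀).source ∧ z ∈ (𝔠 x₀).source then
    η (𝔠 x₀ x - 𝔠 x₀ z) * (χ z * (m (𝔠 x₀ z))⁻¹) else 0

theorem IsChartDensity.chartKernel_nonneg {η : 𝔼 → ℝ}
    (hη : ∀ z, 0 ≤ η z) (hχ : ∀ z, 0 ≤ χ z) (x z : M) : 0 ≤ chartKernel x₀ m η χ x z := by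
  unfold chartKernel
  split_ifs with h
  · exact mul_nonneg (hη _) (mul_nonneg (hχ _)
      (inv_nonneg.2 (hm.pos _ ((𝔠 x₀).map_source h.2)).le))
  · exact le_rfl

theorem IsChartDensity.isTest_chartKernel {η : 𝔼 → ℝ} (hη : ContDiff ℝ ∞ η) (hχt : IsTest d ↟χ)
    (hχs : tsupport ↟χ ⊆ (𝔠 x₀).source) (x : M) :
    IsTest d (fun z => (chartKernel x₀ m η χ x z : ℂ)) := by
  by_cases hx : x ∈ (𝔠 x₀).source
  swap
  · simp only [chartKernel, hx, false_and, if_false, Complex.ofReal_zero]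
    exact IsTest.zero
  obtain ⟨L, hLc, hLT, hL⟩ := exists_compact_chart_image hχt.2 hχs
  set T := (𝔠 x₀).target with hT
  set F : 𝔼 → ℂ := fun y => (η (𝔠 x₀ x - y) : ℂ) * chartPush x₀ (fun y => (m y)⁻¹) ↟χ y with hF
  have hχ0 : ∀ z, z ∉ tsupport ↟χ → (χ z : ℂ) = 0 := fun z hz =>
    image_eq_zero_of_notMem_tsupport (f := fun x => (χ x : ℂ)) hz
  have hF0 : ∀ y, y ∉ L → F y = 0 := fun y hy => by
    simp only [hF]
    rw [chartPush_eq_zero hχ0 hL hy, mul_zero]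
  have hFs : ContDiffOn ℝ ∞ F T := by
    have h1 : ContDiff ℝ ∞ (fun y => (η (𝔠 x₀ x - y) : ℂ)) :=
      Complex.ofRealCLM.contDiff.comp (hη.comp (contDiff_const.sub contDiff_id))
    have h2 : ContDiffOn ℝ ∞ (fun y => (m y)⁻¹) T := hm.smooth.inv fun y hy => (hm.pos y hy).ne'
    have h3 := contDiffOn_comp_chart_symm hχt.1 x₀
    refine h1.contDiffOn.mul ((h2.smul h3).congr fun y hy => ?_)
    rw [chartPush_of_mem hy]; rfl
  have e : (fun z => (chartKernel x₀ m η χ x z : ℂ)) = chartLift x₀ F := by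
    funext z
    by_cases hz : z ∈ (𝔠 x₀).source
    · rw [chartLift_of_mem hz]
      simp only [hF]
      rw [chartPush_of_mem ((𝔠 x₀).map_source hz), (𝔠 x₀).left_inv hz]
      simp only [chartKernel, hx, hz, and_self, if_true, Complex.real_smul]
      push_cast
      ring
    · rw [chartLift_of_notMem hz]
      simp [chartKernel, hz]
  rw [e]
  exact isTest_chartLift hLc hLT hF0 hFs

theorem IsChartDensity.integral_chartKernel {η : 𝔼 → ℝ} (hη : ContDiff ℝ ∞ η) (hχt : IsTest d ↟χ)
    (hχs : tsupport ↟χ ⊆ (𝔠 x₀).source) (hf : Integrable f μ) :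
    (fun x => ∫ z, chartKernel x₀ m η χ x z • f z ∂μ) = chartLift x₀ (mollify η
      (chartPush x₀ (fun _ : 𝔼 => 1) (fun x => (χ x : ℂ) * f x))) := by
  funext x
  by_cases hx : x ∈ (𝔠 x₀).source
  · have ht := hm.isTest_chartKernel hη hχt hχs x
    have haesm : AEStronglyMeasurable (fun z => chartKernel x₀ m η χ x z • f z) μ := by
      simp only [Complex.real_smul]
      exact ht.continuous.aestronglyMeasurable.mul hf.1
    rw [hm.integral_eq_chartPush haesm fun z hz => by simp [chartKernel, hz], chartLift_of_mem hx]
    unfold mollify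
    congr 1
    funext y
    unfold chartPush
    split_ifs with hy
    · have hmy := (hm.pos y hy).ne'
      have hmy' : (m y : ℂ) ≠ 0 := by exact_mod_cast hmy
      have hs := (𝔠 x₀).map_target hy
      simp only [chartKernel, hx, hs, and_self, if_true, Complex.real_smul, one_smul,
        (𝔠 x₀).right_inv hy]
      push_cast
      field_simp
    · simp
  · rw [chartLift_of_notMem hx]
    simp [chartKernel, hx]

omit hm

/-- The kernels do not depend on `f`, so one mollification acts on all entries of a matrix
simultaneously; being nonnegative when `χ` is, they preserve positive semidefiniteness. The limit
gradient is the one predicted by the Leibniz rule for `χ f`. -/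
theorem exists_friedrichs (hμ : IsSmoothMeasure d μ) {X : Fin k → VField d M}
    (hX : ∀ i, IsSmoothField (X i)) (hχt : IsTest d ↟χ) (hχs : tsupport ↟χ ⊆ (𝔠 x₀).source) :
    ∃ κ : ℕ → M → M → ℝ, ((∀ z, 0 ≤ χ z) → ∀ j x z, 0 ≤ κ j x z) ∧
      (∀ j x, IsTest d (fun z => (κ j x z : ℂ))) ∧
      ∀ f G, IsWeakGrad μ X f G → (∀ j, IsTest d (fun x => ∫ z, κ j x z • f z ∂μ)) ∧
        ∀ p : ℝ≥0∞, 1 ≤ p → p ≠ ⊤ → MemLp f p μ → (∀ i, MemLp (G i) p μ) →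
          Tendsto (fun j => eLpNorm ((fun x => ∫ z, κ j x z • f z ∂μ) -
            fun x => (χ x : ℂ) * f x) p μ) atTop (𝓝 0) ∧
          ∀ i, Tendsto (fun j => eLpNorm (lieD (X i) (fun x => ∫ z, κ j x z • f z ∂μ) -
            fun x => (χ x : ℂ) * G i x + lieD (X i) ↟χ x * f x) p μ)
            atTop (𝓝 0) := by
  obtain ⟨m, hm⟩ := hμ.exists_isChartDensity x₀
  obtain ⟨L, hLc, hLT, hL⟩ := exists_compact_chart_image hχt.2 hχs
  have hTo := (𝔠 x₀).open_target
  obtain ⟨δ, hδ, hδT⟩ := hLc.exists_cthickening_subset_open hTo hLT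
  -- From index `N` on, the mollifiers have radius at most `δ`, so the mollified functions stay
  -- supported in `L'`, inside the chart target.
  obtain ⟨N, hN⟩ := exists_nat_one_div_lt hδ
  set L' := Metric.cthickening δ L with hL'
  have hL'c : IsCompact L' := hLc.cthickening
  have hLL' : L ⊆ L' := Metric.self_subset_cthickening L
  obtain ⟨χ₁, hχ₁, hχ₁t, -, hχ₁1, hχ₁s⟩ := exists_isTest_one_nhds (d := d) (M := 𝔼) hL'c hTo hδT
  obtain ⟨η, hη⟩ := exists_isMollifier d
  have hηsupp : ∀ j z, η (j + N) z ≠ 0 → ‖z‖ ≤ δ := fun j z hz => by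
    refine (hη.support _ _ hz).trans (le_trans ?_ hN.le)
    apply one_div_le_one_div_of_le (by positivity)
    push_cast
    linarith [(Nat.cast_nonneg j : (0 : ℝ) ≤ j)]
  set S := tsupport ↟χ with hS
  have hχ0 : ∀ z, z ∉ S → (χ z : ℂ) = 0 := fun z hz =>
    image_eq_zero_of_notMem_tsupport (f := fun x => (χ x : ℂ)) hz
  have hlχ0 : ∀ i z, z ∉ S → lieD (X i) ↟χ z = 0 := fun i z hz =>
    lieD_eq_zero_of_notMem_tsupport (X i) hz
  refine ⟨fun j => chartKernel x₀ m (η (j + N)) χ, fun hχ j x z =>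
    hm.chartKernel_nonneg (hη.nonneg _) hχ x z, fun j x =>
    hm.isTest_chartKernel (hη.smooth _) hχt hχs x, fun f G hfG => ?_⟩
  have hf := hfG.1
  simp only [hm.integral_chartKernel (hη.smooth _) hχt hχs hf]
  set g := chartPush x₀ (fun _ : 𝔼 => 1) (fun x => (χ x : ℂ) * f x) with hg
  have hχb := hχt.continuous.aestronglyMeasurable (μ := μ)
  have hgp : ∀ p, MemLp f p μ → MemLp g p volume := fun p hfp =>
    hm.memLp_chartPush_one hLc hLT hL (fun x hx => by simp only [hχ0 x hx, zero_mul])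
      (hfp.of_le_mul (c := hχt.exists_bound.choose) (hχb.mul hfp.1) (ae_of_all _ fun x => by
        rw [norm_mul]
        exact mul_le_mul_of_nonneg_right (hχt.exists_bound.choose_spec x) (norm_nonneg _)))
  have hgi : Integrable g := memLp_one_iff_integrable.1 (hgp 1 (memLp_one_iff_integrable.2 hf))
  have hg0 : ∀ y, y ∉ L → g y = 0 := fun y hy =>
    chartPush_eq_zero (fun x hx => by simp only [hχ0 x hx, zero_mul]) hL hy
  have hmol0 : ∀ j y, y ∉ L' → mollify (η (j + N)) g y = 0 := fun j y hy =>
    mollify_eq_zero (hηsupp j) hg0 hy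
  have hmols : ∀ j, ContDiff ℝ ∞ (mollify (η (j + N)) g) := fun j =>
    contDiff_mollify (hη.smooth _) (hη.hasCompactSupport _) hgi
  refine ⟨fun j => isTest_chartLift hL'c hδT (hmol0 j) (hmols j).contDiffOn,
    fun p hp1 hpt hfp hGp => ?_⟩
  have : Fact (1 ≤ p) := ⟨hp1⟩
  obtain ⟨c, hc, hcle⟩ := hm.exists_eLpNorm_chartLift_le hL'c hδT p
  have hconv : ∀ F : ℕ → 𝔼 → ℂ, Tendsto (fun j => eLpNorm (F j) p volume) atTop (𝓝 0) →
      Tendsto (fun j => c * eLpNorm (F j) p volume) atTop (𝓝 0) := fun F hF => by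
    simpa using ENNReal.Tendsto.const_mul hF (Or.inr hc)
  constructor
  · have h1 := (hη.tendsto_mollify hpt hgi (hgp p hfp)).comp (tendsto_add_atTop_nat N)
    refine tendsto_of_tendsto_of_tendsto_of_le_of_le tendsto_const_nhds (hconv _ h1)
      (fun j => zero_le) fun j => ?_
    have e1 : (fun x => (χ x : ℂ) * f x) = chartLift x₀ g :=
      (chartLift_chartPush_one fun x hx => by simp only [hχ0 x fun h => hx (hχs h), zero_mul]).symm
    have e2 : chartLift x₀ (mollify (η (j + N)) g) - (fun x => (χ x : ℂ) * f x) =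
        chartLift x₀ (mollify (η (j + N)) g - g) := by
      rw [e1]
      funext x
      simp only [Pi.sub_apply, chartLift]
      split_ifs <;> simp
    simp only [e2]
    refine hcle _ ((hmols j).continuous.aestronglyMeasurable.sub hgi.1) fun y hy => ?_
    rw [Pi.sub_apply, hmol0 j y hy, hg0 y fun h => hy (hLL' h), sub_zero]
  · intro i
    -- The commutator estimate needs a globally smooth field of compact support; `W` is one, and it
    -- agrees with the coordinate field near `L'`, where everything takes place.
    set W : 𝔼 → 𝔼 := fun y => χ₁ y • chartField (X i) x₀ y with hW
    have hχ₁0 : ∀ y, y ∉ tsupport ↟χ₁ → χ₁ y = 0 := fun y hy => by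
      exact_mod_cast image_eq_zero_of_notMem_tsupport (f := fun x => (χ₁ x : ℂ)) hy
    have hW0 : ∀ y, y ∉ tsupport ↟χ₁ → W y = 0 := fun y hy => by
      simp only [hW, hχ₁0 y hy, zero_smul]
    have hWs : ContDiff ℝ ∞ W :=
      contDiff_of_contDiffOn_of_eq_zero hTo (isClosed_tsupport _) hχ₁s hW0
        ((contMDiff_iff_contDiff.1 hχ₁).contDiffOn.smul (contDiffOn_chartField (hX i) x₀))
    have hWc : HasCompactSupport W :=
      HasCompactSupport.of_support_subset_isCompact hχ₁t.2 fun y hy => by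
        by_contra h; exact hy (hW0 y h)
    have hWeq : ∀ y ∈ L', W =ᶠ[𝓝 y] chartField (X i) x₀ := fun y hy => by
      filter_upwards [hχ₁1.filter_mono (nhds_le_nhdsSet hy)] with z hz
      simp only [hW, hz, one_smul]
    set g' := chartPush x₀ (fun _ : 𝔼 => 1)
      (fun x => (χ x : ℂ) * G i x + lieD (X i) ↟χ x * f x) with hg'
    have hw : IsEuclWeakDeriv W g g' := hm.isEuclWeakDeriv (hX i) hχt hLc hLT hL
      (fun y hy => hWeq y (hLL' hy)) hf (hfG.2 i).1 (hfG.2 i).2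
    have hlt := hχt.lieD (hX i)
    have hfull : ∀ q, MemLp f q μ → MemLp (G i) q μ → MemLp (fun x =>
        (χ x : ℂ) * G i x + lieD (X i) ↟χ x * f x) q μ := fun q hfq hGq => by
      refine MemLp.add (f := fun x => (χ x : ℂ) * G i x)
        (g := fun x => lieD (X i) ↟χ x * f x) ?_ ?_
      · exact hGq.of_le_mul (c := hχt.exists_bound.choose) (hχb.mul hGq.1) (ae_of_all _ fun x => by
          rw [norm_mul]
          exact mul_le_mul_of_nonneg_right (hχt.exists_bound.choose_spec x) (norm_nonneg _))
      · exact hfq.of_le_mul (c := hlt.exists_bound.choose)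
          (hlt.continuous.aestronglyMeasurable.mul hfq.1) (ae_of_all _ fun x => by
          rw [norm_mul]
          exact mul_le_mul_of_nonneg_right (hlt.exists_bound.choose_spec x) (norm_nonneg _))
    have hfull0 : ∀ x, x ∉ S →
        (χ x : ℂ) * G i x + lieD (X i) ↟χ x * f x = 0 := fun x hx => by
      simp only [hχ0 x hx, hlχ0 i x hx, zero_mul, add_zero]
    have hg'p : ∀ q, MemLp f q μ → MemLp (G i) q μ → MemLp g' q volume := fun q hfq hGq =>
      hm.memLp_chartPush_one hLc hLT hL hfull0 (hfull q hfq hGq)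
    have hg'i : Integrable g' := memLp_one_iff_integrable.1 (hg'p 1
      (memLp_one_iff_integrable.2 hf) (memLp_one_iff_integrable.2 (hfG.2 i).1))
    have hg'0 : ∀ y, y ∉ L → g' y = 0 := fun y hy => chartPush_eq_zero hfull0 hL hy
    have h1 := (hη.tendsto_fderiv_mollify hpt hWs hWc hgi (hgp p hfp) hg'i
      (hg'p p hfp (hGp i)) hw).comp (tendsto_add_atTop_nat N)
    refine tendsto_of_tendsto_of_tendsto_of_le_of_le tendsto_const_nhds (hconv _ h1)
      (fun j => zero_le) fun j => ?_
    have hd0 : ∀ y, y ∉ L' → fderiv ℝ (mollify (η (j + N)) g) y = 0 := fun y hy =>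
      fderiv_eq_zero_of_notMem hL'c.isClosed (hmol0 j) hy
    have e1 : (fun x => (χ x : ℂ) * G i x + lieD (X i) ↟χ x * f x) =
        chartLift x₀ g' :=
      (chartLift_chartPush_one fun x hx => hfull0 x fun h => hx (hχs h)).symm
    have e2 : lieD (X i) (chartLift x₀ (mollify (η (j + N)) g)) - chartLift x₀ g' =
        chartLift x₀ (fun y => fderiv ℝ (mollify (η (j + N)) g) y (W y) - g' y) := by
      funext x
      by_cases hx : x ∈ (𝔠 x₀).source
      · rw [Pi.sub_apply, lieD_chartLift hx (hmols j).contDiffOn, chartLift_of_mem hx,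
          chartLift_of_mem hx]
        by_cases hy : 𝔠 x₀ x ∈ L'
        · rw [(hWeq _ hy).eq_of_nhds]
        · rw [hd0 _ hy]; simp
      · rw [Pi.sub_apply, chartLift_of_notMem hx, chartLift_of_notMem hx,
          lieD_eq_zero_of_notMem_tsupport (X i) fun h => hx (symm_image_subset_source hδT
            (tsupport_chartLift_subset hL'c hδT (hmol0 j) h)), sub_zero]
    rw [e1]
    simp only [e2]
    refine hcle _ (AEStronglyMeasurable.sub ?_ hg'i.1) fun y hy => ?_
    · exact (((hmols j).continuous_fderiv (by simp)).clm_apply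
        hWs.continuous).aestronglyMeasurable
    · rw [hd0 y hy, hg'0 y fun h => hy (hLL' h)]; simp

end Charts

/-! ### Formal adjoints and weak gradients on the whole manifold. -/

variable [SigmaCompactSpace M] [MeasurableSpace M] [BorelSpace M] {μ : Measure M}
  [IsProbabilityMeasure μ] {X : Fin k → VField d M} {P : Lp ℂ ∞ μ →ₗ[ℂ] Lp ℂ ∞ μ} {C : ℝ} (hμ : IsSmoothMeasure d μ)
  (hX : ∀ i, IsSmoothField (X i)) (hL : IsConservative μ X) (hP : IsMarkovMap μ P) (hC0 : 0 ≤ C)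
  (hC : GradientEstimate μ X P C) (hPL : Commutes μ X P)

theorem IsTest.integrable_conj_mul {φ f : M → ℂ} (hφ : IsTest d φ) (hf : Integrable f μ) :
    Integrable (fun x => conj (φ x) * f x) μ :=
  hf.bdd_mul hφ.star.continuous.aestronglyMeasurable
    (ae_of_all _ hφ.star.exists_bound.choose_spec)

/-- Integrals against a test function pass to the limit in `L¹`. -/
theorem IsTest.tendsto_integral {φ : M → ℂ} (hφ : IsTest d φ)
    {f : ι → M → ℂ} {g : M → ℂ} (hf : ∀ j, Integrable (f j) μ) (hg : Integrable g μ)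
    (h : Tendsto (fun j => eLpNorm (f j - g) 1 μ) l (𝓝 0)) :
    Tendsto (fun j => ∫ x, conj (φ x) * f j x ∂μ) l (𝓝 (∫ x, conj (φ x) * g x ∂μ)) := by
  obtain ⟨c, hc⟩ := hφ.star.exists_bound
  have hc0 : 0 ≤ max c 0 := le_max_right _ _
  refine tendsto_integral_of_L1' _ (hφ.integrable_conj_mul hg).1
    (Eventually.of_forall fun j => hφ.integrable_conj_mul (hf j)) ?_
  have h2 : Tendsto (fun j => ENNReal.ofReal (max c 0) * eLpNorm (f j - g) 1 μ) l (𝓝 0) := by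
    simpa using ENNReal.Tendsto.const_mul h (Or.inr ENNReal.ofReal_ne_top)
  refine tendsto_of_tendsto_of_tendsto_of_le_of_le tendsto_const_nhds h2 (fun j => zero_le)
    fun j => ?_
  refine eLpNorm_le_mul_eLpNorm_of_ae_le_mul (ae_of_all _ fun x => ?_) 1
  rw [Pi.sub_apply, Pi.sub_apply, ← mul_sub, norm_mul]
  exact mul_le_mul_of_nonneg_right ((hc x).trans (le_max_left _ _)) (norm_nonneg _)

namespace IsFormalAdjoint
variable {φ ψ φ' ψ' : M → ℂ}

theorem ae_unique (h : IsFormalAdjoint μ V φ ψ) (h' : IsFormalAdjoint μ V φ ψ') : ψ =ᵐ[μ] ψ' := by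
  have : ψ - ψ' =ᵐ[μ] 0 := by
    refine ae_eq_zero_of_forall_isTest (d := d) (h.1.sub h'.1).integrable fun η hη => ?_
    have h1 := congrArg conj ((h.2 η hη).trans (h'.2 η hη).symm)
    rw [← integral_conj, ← integral_conj] at h1
    simp only [map_mul, Complex.conj_conj] at h1
    have e : ∀ x, conj (η x) * (ψ - ψ') x = ψ x * conj (η x) - ψ' x * conj (η x) := fun x => by
      simp only [Pi.sub_apply]; ring
    simp only [e]
    rw [integral_sub (h.1.mul hη.star).integrable (h'.1.mul hη.star).integrable, h1, sub_self]
  filter_upwards [this] with x hx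
  simpa [sub_eq_zero] using hx

theorem finset_sum (hV : IsSmoothField V) {s : Finset ι} {φ ψ : ι → M → ℂ}
    (hφ : ∀ i ∈ s, IsTest d (φ i)) (h : ∀ i ∈ s, IsFormalAdjoint μ V (φ i) (ψ i)) :
    IsFormalAdjoint μ V (fun x => ∑ i ∈ s, φ i x) (fun x => ∑ i ∈ s, ψ i x) := by
  refine ⟨IsTest.sum fun i hi => (h i hi).1, fun η hη => ?_⟩
  simp only [map_sum, Finset.sum_mul]
  rw [integral_finsetSum _ fun i hi => (h i hi).1.integrable_conj_mul hη.integrable,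
    integral_finsetSum _ fun i hi => (hφ i hi).integrable_conj_mul (hη.lieD hV).integrable]
  exact Finset.sum_congr rfl fun i hi => (h i hi).2 η hη

/-- Integration by parts against a smooth function that need not have compact support. -/
theorem integral_smooth (hφ : IsTest d φ) (h : IsFormalAdjoint μ V φ ψ) {g : M → ℂ}
    (hg : Smooth g) : ∫ x, conj (ψ x) * g x ∂μ = ∫ x, conj (φ x) * lieD V g x ∂μ := by
  have hK : IsCompact (tsupport φ ∪ tsupport ψ) := hφ.2.union h.1.2
  obtain ⟨χ, -, hχt, -, hχ1, -⟩ := exists_isTest_one_nhds (d := d) hK isOpen_univ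
    (Set.subset_univ _)
  have h1 := h.2 _ (hχt.mul_left hg)
  have hnear : ∀ x ∈ tsupport φ ∪ tsupport ψ, (fun x => g x * (χ x : ℂ)) =ᶠ[𝓝 x] g :=
    fun x hx => by
      filter_upwards [hχ1.filter_mono (nhds_le_nhdsSet hx)] with z hz
      simp [hz]
  convert h1 using 1
  · congr 1
    funext x
    by_cases hx : x ∈ tsupport ψ
    · rw [(hnear x (Or.inr hx)).eq_of_nhds]
    · simp [image_eq_zero_of_notMem_tsupport hx]
  · congr 1
    funext x
    by_cases hx : x ∈ tsupport φ
    · rw [lieD_congr V (hnear x (Or.inl hx))]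
    · simp [image_eq_zero_of_notMem_tsupport hx]

end IsFormalAdjoint

include hμ

theorem exists_isFormalAdjoint (hV : IsSmoothField V)
    {φ : M → ℂ} (hφ : IsTest d φ) : ∃ (s : Finset M) (φ' ψ' : M → M → ℂ),
      (∀ i ∈ s, IsTest d (φ' i) ∧ IsFormalAdjoint μ V (φ' i) (ψ' i) ∧
        tsupport (φ' i) ⊆ (𝔠 i).source ∧ tsupport (ψ' i) ⊆ (𝔠 i).source) ∧
      (∀ x, ∑ i ∈ s, φ' i x = φ x) ∧ IsFormalAdjoint μ V φ (fun x => ∑ i ∈ s, ψ' i x) := by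
  obtain ⟨s, θ, -, h1, h2, h3⟩ := hφ.exists_sum_chart
  choose m hm using fun x₀ : M => hμ.exists_isChartDensity x₀
  have key := fun i hi => (hm i).isFormalAdjoint hV (h1 i hi) (h2 i hi)
  refine ⟨s, fun i x => (θ i x : ℂ) * φ x, fun i => chartAdjoint V i (m i) fun x => (θ i x : ℂ) * φ x,
    fun i hi => ⟨h1 i hi, (key i hi).1, h2 i hi, (key i hi).2⟩, h3, ?_⟩
  have := IsFormalAdjoint.finset_sum hV h1 fun i hi => (key i hi).1
  simpa only [h3] using this

namespace IsWeakGrad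
variable {f g : M → ℂ} {G H : Fin k → M → ℂ}

include hX

/-- A partition of unity splits the test function into pieces living in one chart, and uniqueness of
the formal adjoint splits its adjoint accordingly. -/
theorem of_chart (hf : Integrable f μ) (hG : ∀ i, Integrable (G i) μ)
    (h : ∀ i x₀ φ ψ, IsTest d φ → IsFormalAdjoint μ (X i) φ ψ →
      tsupport φ ⊆ (𝔠 x₀).source → tsupport ψ ⊆ (𝔠 x₀).source →
      ∫ x, conj (φ x) * G i x ∂μ = ∫ x, conj (ψ x) * f x ∂μ) : IsWeakGrad μ X f G := by
  refine ⟨hf, fun i => ⟨hG i, fun φ ψ hφ hψ => ?_⟩⟩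
  obtain ⟨s, φ', ψ', h1, h2, h3⟩ := exists_isFormalAdjoint hμ (hX i) hφ
  have hae := hψ.ae_unique h3
  have e1 : ∀ x, conj (φ x) * G i x = ∑ j ∈ s, conj (φ' j x) * G i x := fun x => by
    rw [← h2 x, map_sum, Finset.sum_mul]
  have e2 : (fun x => conj (ψ x) * f x) =ᵐ[μ] fun x => ∑ j ∈ s, conj (ψ' j x) * f x := by
    filter_upwards [hae] with x hx
    rw [hx, map_sum, Finset.sum_mul]
  rw [integral_congr_ae e2]
  simp only [e1]
  rw [integral_finsetSum _ fun j hj => (h1 j hj).1.integrable_conj_mul (hG i),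
    integral_finsetSum _ fun j hj => (h1 j hj).2.1.1.integrable_conj_mul hf]
  exact Finset.sum_congr rfl fun j hj =>
    h i j _ _ (h1 j hj).1 (h1 j hj).2.1 (h1 j hj).2.2.1 (h1 j hj).2.2.2

theorem ae_unique
    (h : IsWeakGrad μ X f G) (h' : IsWeakGrad μ X f H) (i : Fin k) : G i =ᵐ[μ] H i := by
  have : G i - H i =ᵐ[μ] 0 := by
    refine ae_eq_zero_of_forall_isTest (d := d) ((h.2 i).1.sub (h'.2 i).1) fun φ hφ => ?_
    obtain ⟨s, φ', ψ', -, -, h3⟩ := exists_isFormalAdjoint hμ (hX i) hφ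
    have e : ∀ x, conj (φ x) * (G i - H i) x = conj (φ x) * G i x - conj (φ x) * H i x := fun x => by
      simp only [Pi.sub_apply]; ring
    simp only [e]
    rw [integral_sub (hφ.integrable_conj_mul (h.2 i).1) (hφ.integrable_conj_mul (h'.2 i).1),
      (h.2 i).2 _ _ hφ h3, (h'.2 i).2 _ _ hφ h3, sub_self]
  filter_upwards [this] with x hx
  simpa [sub_eq_zero] using hx

omit hμ hX

theorem congr (h : IsWeakGrad μ X f G) (hf : f =ᵐ[μ] g) (hG : ∀ i, G i =ᵐ[μ] H i) :
    IsWeakGrad μ X g H := by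
  refine ⟨h.1.congr hf, fun i => ⟨(h.2 i).1.congr (hG i), fun φ ψ hφ hψ => ?_⟩⟩
  have e1 : (fun x => conj (φ x) * H i x) =ᵐ[μ] fun x => conj (φ x) * G i x := by
    filter_upwards [hG i] with x hx; rw [hx]
  have e2 : (fun x => conj (ψ x) * g x) =ᵐ[μ] fun x => conj (ψ x) * f x := by
    filter_upwards [hf] with x hx; rw [hx]
  rw [integral_congr_ae e1, integral_congr_ae e2]
  exact (h.2 i).2 φ ψ hφ hψ

theorem add (h : IsWeakGrad μ X f G) (h' : IsWeakGrad μ X g H) :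
    IsWeakGrad μ X (fun x => f x + g x) (fun i x => G i x + H i x) := by
  refine ⟨h.1.add h'.1, fun i => ⟨(h.2 i).1.add (h'.2 i).1, fun φ ψ hφ hψ => ?_⟩⟩
  simp only [mul_add]
  rw [integral_add (hφ.integrable_conj_mul (h.2 i).1) (hφ.integrable_conj_mul (h'.2 i).1),
    integral_add (hψ.1.integrable_conj_mul h.1) (hψ.1.integrable_conj_mul h'.1),
    (h.2 i).2 _ _ hφ hψ, (h'.2 i).2 _ _ hφ hψ]

theorem const_mul (c : ℂ) (h : IsWeakGrad μ X f G) :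
    IsWeakGrad μ X (fun x => c * f x) (fun i x => c * G i x) := by
  refine ⟨h.1.const_mul c, fun i => ⟨(h.2 i).1.const_mul c, fun φ ψ hφ hψ => ?_⟩⟩
  simp only [mul_left_comm _ c]
  rw [integral_const_mul, integral_const_mul, (h.2 i).2 _ _ hφ hψ]

theorem of_smooth (hg : Smooth g) (hgi : Integrable g μ)
    (hgG : ∀ i, Integrable (lieD (X i) g) μ) : IsWeakGrad μ X g (fun i => lieD (X i) g) :=
  ⟨hgi, fun i => ⟨hgG i, fun _ _ hφ hψ => (hψ.integral_smooth hφ hg).symm⟩⟩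

theorem const (c : ℂ) : IsWeakGrad μ X (fun _ => c) (fun _ _ => 0) := by
  have e : ∀ i, lieD (X i) (fun _ : M => c) = fun _ => 0 := fun i => by
    funext x; exact lieD_const _ c x
  have := of_smooth (μ := μ) (X := X) (g := fun _ => c) contMDiff_const (integrable_const c)
    fun i => by rw [e]; exact integrable_const 0
  simpa only [e] using this

theorem of_tendsto [l.NeBot] {F : ι → M → ℂ} {K : ι → Fin k → M → ℂ}
    (h : ∀ j, IsWeakGrad μ X (F j) (K j)) (hf : Integrable f μ) (hG : ∀ i, Integrable (G i) μ)
    (hF : Tendsto (fun j => eLpNorm (F j - f) 1 μ) l (𝓝 0))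
    (hK : ∀ i, Tendsto (fun j => eLpNorm (K j i - G i) 1 μ) l (𝓝 0)) : IsWeakGrad μ X f G := by
  refine ⟨hf, fun i => ⟨hG i, fun φ ψ hφ hψ => ?_⟩⟩
  have h1 := hφ.tendsto_integral (fun j => ((h j).2 i).1) (hG i) (hK i)
  have h2 := hψ.1.tendsto_integral (fun j => (h j).1) hf hF
  refine tendsto_nhds_unique h1 (h2.congr fun j => (((h j).2 i).2 _ _ hφ hψ).symm)

end IsWeakGrad

omit hμ

include hX

theorem IsTest.isWeakGrad
    (hf : IsTest d f) : IsWeakGrad μ X f (fun i => SubLaplacian.lieD (X i) f) :=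
  IsWeakGrad.of_smooth hf.1 hf.integrable fun i => (hf.lieD (hX i)).integrable

theorem IsClosedGrad.isWeakGrad
    {G : Fin k → M → ℂ} (h : IsClosedGrad μ X f G) : IsWeakGrad μ X f G := by
  obtain ⟨hf, hG, u, hu, h1, h2⟩ := h
  have le : ∀ g : ℕ → M → ℂ, (∀ j, AEStronglyMeasurable (g j) μ) →
      Tendsto (fun j => eLpNorm (g j) 2 μ) atTop (𝓝 0) →
      Tendsto (fun j => eLpNorm (g j) 1 μ) atTop (𝓝 0) := fun g hg h =>
    tendsto_of_tendsto_of_tendsto_of_le_of_le tendsto_const_nhds h (fun j => zero_le)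
      fun j => eLpNorm_le_eLpNorm_of_exponent_le (by norm_num) (hg j)
  exact IsWeakGrad.of_tendsto (fun j => (hu j).isWeakGrad hX) (hf.integrable (by norm_num))
    (fun i => (hG i).integrable (by norm_num))
    (le _ (fun j => (hu j).continuous.aestronglyMeasurable.sub hf.1) h1)
    fun i => le _ (fun j => ((hu j).lieD (hX i)).continuous.aestronglyMeasurable.sub (hG i).1) (h2 i)

/-! ### Convergence in `L^p`. -/

section Convergence
variable {α : Type*} [MeasurableSpace α] {μ : Measure α}

omit hX

theorem tendsto_eLpNorm_zero_of_dominated (hp0 : p ≠ 0) (hp : p ≠ ⊤) {F : ℕ → α → ℂ} {b : α → ℂ}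
    (hF : ∀ j, AEStronglyMeasurable (F j) μ) (hb : MemLp b p μ)
    (hle : ∀ j, ∀ᵐ x ∂μ, ‖F j x‖ ≤ ‖b x‖) (hlim : ∀ᵐ x ∂μ, Tendsto (fun j => F j x) atTop (𝓝 0)) :
    Tendsto (fun j => eLpNorm (F j) p μ) atTop (𝓝 0) := by
  have hpp := ENNReal.toReal_pos hp0 hp
  have h1 : Tendsto (fun j => ∫⁻ x, ‖F j x‖ₑ ^ p.toReal ∂μ) atTop (𝓝 (∫⁻ _, 0 ∂μ)) := by
    refine tendsto_lintegral_of_dominated_convergence' (fun x => ‖b x‖ₑ ^ p.toReal)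
      (fun j => (hF j).enorm.pow_const _) (fun j => ?_)
      (lintegral_rpow_enorm_lt_top_of_eLpNorm_lt_top hp0 hp hb.2).ne ?_
    · filter_upwards [hle j] with x hx
      exact ENNReal.rpow_le_rpow (enorm_le_iff_norm_le.2 hx) hpp.le
    · filter_upwards [hlim] with x hx
      have := (ENNReal.continuous_rpow_const (y := p.toReal)).continuousAt.tendsto.comp hx.enorm
      simpa [Function.comp_def, ENNReal.zero_rpow_of_pos hpp] using this
  rw [lintegral_zero] at h1
  have h2 := (ENNReal.continuous_rpow_const (y := 1 / p.toReal)).continuousAt.tendsto.comp h1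
  rw [ENNReal.zero_rpow_of_pos (by positivity)] at h2
  refine h2.congr fun j => ?_
  rw [eLpNorm_eq_lintegral_rpow_enorm_toReal hp0 hp]
  rfl

/-- Products of a boundedly a.e. convergent sequence with an `L^p`-convergent one. -/
theorem tendsto_eLpNorm_mul_sub (hp1 : 1 ≤ p) (hp : p ≠ ⊤) {a g : ℕ → α → ℂ} {a' g' : α → ℂ} {c : ℝ}
    (ha : ∀ j, AEStronglyMeasurable (a j) μ) (ha' : AEStronglyMeasurable a' μ)
    (hac : ∀ j, ∀ᵐ x ∂μ, ‖a j x‖ ≤ c) (hlim : ∀ᵐ x ∂μ, Tendsto (fun j => a j x) atTop (𝓝 (a' x)))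
    (hg : ∀ j, AEStronglyMeasurable (g j) μ) (hg' : MemLp g' p μ)
    (h : Tendsto (fun j => eLpNorm (g j - g') p μ) atTop (𝓝 0)) :
    Tendsto (fun j => eLpNorm ((fun x => a j x * g j x) - fun x => a' x * g' x) p μ)
      atTop (𝓝 0) := by
  have hac' : ∀ᵐ x ∂μ, ‖a' x‖ ≤ c := by
    filter_upwards [hlim, ae_all_iff.2 hac] with x hx hx2
    exact le_of_tendsto hx.norm (Eventually.of_forall hx2)
  have h1 : Tendsto (fun j => ENNReal.ofReal c * eLpNorm (g j - g') p μ) atTop (𝓝 0) := by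
    simpa using ENNReal.Tendsto.const_mul h (Or.inr ENNReal.ofReal_ne_top)
  have h2 : Tendsto (fun j => eLpNorm (fun x => (a j x - a' x) * g' x) p μ) atTop (𝓝 0) := by
    refine tendsto_eLpNorm_zero_of_dominated (by positivity) hp
      (fun j => ((ha j).sub ha').mul hg'.1) (hg'.const_mul ((2 * c : ℝ) : ℂ)) (fun j => ?_) ?_
    · filter_upwards [hac j, hac'] with x hx hx'
      have hc0 : 0 ≤ c := (norm_nonneg _).trans hx
      rw [norm_mul, norm_mul, Complex.norm_real, Real.norm_of_nonneg (by positivity)]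
      refine mul_le_mul_of_nonneg_right ((norm_sub_le _ _).trans (by linarith)) (norm_nonneg _)
    · filter_upwards [hlim] with x hx
      simpa using (hx.sub_const (a' x)).mul_const (g' x)
  have h12 := h1.add h2
  rw [add_zero] at h12
  refine tendsto_of_tendsto_of_tendsto_of_le_of_le tendsto_const_nhds h12 (fun j => zero_le)
    fun j => ?_
  have e : ((fun x => a j x * g j x) - fun x => a' x * g' x) =
      (fun x => a j x * (g j - g') x) + fun x => (a j x - a' x) * g' x := by
    funext x; simp only [Pi.sub_apply, Pi.add_apply]; ring
  rw [e]
  refine (eLpNorm_add_le ((ha j).mul ((hg j).sub hg'.1)) (((ha j).sub ha').mul hg'.1) hp1).trans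
    (add_le_add_left ?_ _)
  refine eLpNorm_le_mul_eLpNorm_of_ae_le_mul ?_ p
  filter_upwards [hac j] with x hx
  exact (norm_mul _ _).trans_le (mul_le_mul_of_nonneg_right hx (norm_nonneg _))

theorem exists_subseq_ae_tendsto [Finite ι] (hp : p ≠ 0) {F : ι → ℕ → α → ℂ} {f : ι → α → ℂ}
    (hF : ∀ i j, AEStronglyMeasurable (F i j) μ) (hf : ∀ i, AEStronglyMeasurable (f i) μ)
    (h : ∀ i, Tendsto (fun j => eLpNorm (F i j - f i) p μ) atTop (𝓝 0)) :
    ∃ ns : ℕ → ℕ, StrictMono ns ∧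
      ∀ᵐ x ∂μ, ∀ i, Tendsto (fun j => F i (ns j) x) atTop (𝓝 (f i x)) := by
  have := Fintype.ofFinite ι
  have hm : TendstoInMeasure μ (fun j x => fun i => F i j x) atTop (fun x i => f i x) := by
    intro ε hε
    have hi : ∀ i, Tendsto (fun j => μ {x | ε ≤ edist (F i j x) (f i x)}) atTop (𝓝 0) := fun i =>
      tendstoInMeasure_of_tendsto_eLpNorm hp (hF i) (hf i) (h i) ε hε
    have hs := tendsto_finsetSum Finset.univ fun i _ => hi i
    simp only [Finset.sum_const_zero] at hs
    by_cases hε2 : ε = ⊤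
    · refine tendsto_of_tendsto_of_tendsto_of_le_of_le tendsto_const_nhds hs (fun j => zero_le)
        fun j => ?_
      have : {x | ε ≤ edist (fun i => F i j x) (fun i => f i x)} = ∅ := by
        ext x
        simp [hε2, edist_ne_top]
      rw [this, measure_empty]
      exact zero_le
    refine tendsto_of_tendsto_of_tendsto_of_le_of_le tendsto_const_nhds hs (fun j => zero_le)
      fun j => ?_
    refine (measure_mono fun x hx => ?_).trans (measure_biUnion_finset_le Finset.univ _)
    simp only [Finset.mem_univ, Set.iUnion_true, Set.mem_iUnion, Set.mem_ofPred_eq] at hx ⊢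
    by_contra hc
    push Not at hc
    rw [edist_pi_def] at hx
    exact absurd hx (not_le.2 ((Finset.sup_lt_iff (pos_of_gt (lt_of_lt_of_le hε le_rfl))).2
      fun i _ => hc i))
  obtain ⟨ns, h1, h2⟩ := hm.exists_seq_tendsto_ae
  refine ⟨ns, h1, ?_⟩
  filter_upwards [h2] with x hx
  exact tendsto_pi_nhds.1 hx

end Convergence

omit hX

include hX in
theorem IsTest.isClosedGrad (hf : IsTest d f) :
    IsClosedGrad μ X f (fun i => SubLaplacian.lieD (X i) f) :=
  ⟨hf.memLp 2, fun i => (hf.lieD (hX i)).memLp 2, fun _ => f, fun _ => hf, by simp, by simp⟩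

/-! ### The graph of the closed gradient as a Hilbert space. -/

/-- The space `L² × (L²)^k`, the first factor being the component `none`. -/
abbrev GraphSpace (k : ℕ) (μ : Measure M) := PiLp 2 (fun _ : Option (Fin k) => Lp ℂ 2 μ)

variable (μ X) in
/-- The graph of `∇` on test functions. -/
def testGraph : Submodule ℂ (GraphSpace k μ) where
  carrier := {x | ∃ u, IsTest d u ∧ x none =ᵐ[μ] u ∧ ∀ i, x (some i) =ᵐ[μ] lieD (X i) u}
  add_mem' := by
    rintro x y ⟨u, hu, hx, hx'⟩ ⟨v, hv, hy, hy'⟩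
    refine ⟨u + v, hu.add hv, ?_, fun i => ?_⟩
    · exact (Lp.coeFn_add _ _).trans (hx.add hy)
    · refine (Lp.coeFn_add _ _).trans (((hx' i).add (hy' i)).trans (ae_of_all _ fun z => ?_))
      exact (lieD_add (X i) hu.1 hv.1 z).symm
  zero_mem' := by
    refine ⟨0, IsTest.zero, Lp.coeFn_zero _ _ _, fun i => (Lp.coeFn_zero _ _ _).trans
      (ae_of_all _ fun z => ?_)⟩
    exact (lieD_const (X i) 0 z).symm
  smul_mem' := by
    rintro c x ⟨u, hu, hx, hx'⟩
    refine ⟨fun z => c * u z, hu.const_mul c, ?_, fun i => ?_⟩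
    · exact (Lp.coeFn_smul _ _).trans (hx.const_smul c)
    · refine (Lp.coeFn_smul _ _).trans (((hx' i).const_smul c).trans (ae_of_all _ fun z => ?_))
      exact (lieD_const_mul (X i) c hu.1 z).symm

variable (μ X) in
/-- The graph of the closed gradient. -/
def gradGraph : Submodule ℂ (GraphSpace k μ) := (testGraph μ X).topologicalClosure

theorem isClosed_gradGraph : IsClosed (gradGraph μ X : Set (GraphSpace k μ)) :=
  Submodule.isClosed_topologicalClosure _

theorem tendsto_graphSpace {x : ι → GraphSpace k μ} {y : GraphSpace k μ} :
    Tendsto x l (𝓝 y) ↔ ∀ i, Tendsto (fun j => eLpNorm (x j i - y i : M → ℂ) 2 μ) l (𝓝 0) := by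
  have h : Tendsto x l (𝓝 y) ↔ ∀ i, Tendsto (fun j => x j i) l (𝓝 (y i)) := by
    rw [(PiLp.homeomorph 2 _).isInducing.tendsto_nhds_iff, tendsto_pi_nhds]
    rfl
  rw [h]
  exact forall_congr' fun i => Lp.tendsto_Lp_iff_tendsto_eLpNorm' _ _

theorem isClosedGrad_of_mem {x : GraphSpace k μ} (hx : x ∈ gradGraph μ X) :
    IsClosedGrad μ X (x none) (fun i => x (some i)) := by
  obtain ⟨w, hw, hlim⟩ := mem_closure_iff_seq_limit.1 hx
  choose u hu h1 h2 using hw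
  rw [tendsto_graphSpace] at hlim
  refine ⟨Lp.memLp _, fun i => Lp.memLp _, u, hu, ?_, fun i => ?_⟩
  · refine (hlim none).congr fun j => eLpNorm_congr_ae ?_
    exact (h1 j).sub (ae_eq_refl _)
  · refine (hlim (some i)).congr fun j => eLpNorm_congr_ae ?_
    exact (h2 j i).sub (ae_eq_refl _)

namespace IsClosedGrad
variable {f g : M → ℂ} {G H : Fin k → M → ℂ}

theorem congr (h : IsClosedGrad μ X f G) (hf : f =ᵐ[μ] g) (hG : ∀ i, G i =ᵐ[μ] H i) :
    IsClosedGrad μ X g H := by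
  obtain ⟨h1, h2, u, hu, h3, h4⟩ := h
  refine ⟨h1.ae_eq hf, fun i => (h2 i).ae_eq (hG i), u, hu, ?_, fun i => ?_⟩
  · exact h3.congr fun j => eLpNorm_congr_ae ((ae_eq_refl _).sub hf)
  · exact (h4 i).congr fun j => eLpNorm_congr_ae ((ae_eq_refl _).sub (hG i))

/-- The element of the graph space with the given components. -/
def toGraph (h : IsClosedGrad μ X f G) : GraphSpace k μ :=
  WithLp.toLp 2 fun o => match o with
    | none => h.1.toLp f
    | some i => (h.2.1 i).toLp (G i)

theorem toGraph_none (h : IsClosedGrad μ X f G) : h.toGraph none =ᵐ[μ] f := MemLp.coeFn_toLp h.1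

theorem toGraph_some (h : IsClosedGrad μ X f G) (i : Fin k) : h.toGraph (some i) =ᵐ[μ] G i :=
  MemLp.coeFn_toLp (h.2.1 i)

include hX

theorem toGraph_mem (h : IsClosedGrad μ X f G) : h.toGraph ∈ gradGraph μ X := by
  obtain ⟨h1, h2, u, hu, h3, h4⟩ := id h
  have hw : ∀ j, (IsTest.isClosedGrad (μ := μ) hX (hu j)).toGraph ∈ testGraph μ X := fun j =>
    ⟨u j, hu j, toGraph_none _, toGraph_some _⟩
  refine mem_closure_iff_seq_limit.2 ⟨_, hw, ?_⟩
  rw [tendsto_graphSpace]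
  rintro (_ | i)
  · exact h3.congr fun j => eLpNorm_congr_ae
      ((toGraph_none _).sub (toGraph_none _)).symm
  · exact (h4 i).congr fun j => eLpNorm_congr_ae
      ((toGraph_some _ i).sub (toGraph_some _ i)).symm

theorem add (h : IsClosedGrad μ X f G) (h' : IsClosedGrad μ X g H) :
    IsClosedGrad μ X (fun x => f x + g x) (fun i x => G i x + H i x) :=
  (isClosedGrad_of_mem (X := X) (add_mem (h.toGraph_mem hX) (h'.toGraph_mem hX))).congr
    ((Lp.coeFn_add _ _).trans (h.toGraph_none.add h'.toGraph_none))
    fun i => (Lp.coeFn_add _ _).trans ((h.toGraph_some i).add (h'.toGraph_some i))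

theorem const_mul (c : ℂ) (h : IsClosedGrad μ X f G) :
    IsClosedGrad μ X (fun x => c * f x) (fun i x => c * G i x) :=
  (isClosedGrad_of_mem (X := X) (Submodule.smul_mem _ c (h.toGraph_mem hX))).congr
    ((Lp.coeFn_smul _ _).trans (h.toGraph_none.const_smul c))
    fun i => (Lp.coeFn_smul _ _).trans ((h.toGraph_some i).const_smul c)

omit hX in
theorem zero : IsClosedGrad μ X (fun _ => 0) (fun _ _ => 0) :=
  (isClosedGrad_of_mem (zero_mem (gradGraph μ X))).congr (Lp.coeFn_zero _ _ _)
    fun _ => Lp.coeFn_zero _ _ _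

theorem finset_sum (s : Finset ι) {f : ι → M → ℂ}
    {G : ι → Fin k → M → ℂ} (h : ∀ j ∈ s, IsClosedGrad μ X (f j) (G j)) :
    IsClosedGrad μ X (fun x => ∑ j ∈ s, f j x) (fun i x => ∑ j ∈ s, G j i x) := by
  classical
  induction s using Finset.induction_on with
  | empty => simpa using zero
  | insert a s ha ih =>
    simp only [Finset.sum_insert ha]
    exact (h a (Finset.mem_insert_self _ _)).add hX
      (ih fun j hj => h j (Finset.mem_insert_of_mem hj))

theorem of_tendsto [l.NeBot] {F : ι → M → ℂ} {K : ι → Fin k → M → ℂ}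
    (h : ∀ j, IsClosedGrad μ X (F j) (K j)) (hf : MemLp f 2 μ) (hG : ∀ i, MemLp (G i) 2 μ)
    (hF : Tendsto (fun j => eLpNorm (F j - f) 2 μ) l (𝓝 0))
    (hK : ∀ i, Tendsto (fun j => eLpNorm (K j i - G i) 2 μ) l (𝓝 0)) : IsClosedGrad μ X f G := by
  let y : GraphSpace k μ := WithLp.toLp 2 fun o => match o with
    | none => hf.toLp f
    | some i => (hG i).toLp (G i)
  have y1 : y none =ᵐ[μ] f := MemLp.coeFn_toLp hf
  have y2 : ∀ i, y (some i) =ᵐ[μ] G i := fun i => MemLp.coeFn_toLp (hG i)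
  have : Tendsto (fun j => (h j).toGraph) l (𝓝 y) := by
    rw [tendsto_graphSpace]
    rintro (_ | i)
    · exact hF.congr fun j => eLpNorm_congr_ae
        ((toGraph_none _).sub y1).symm
    · exact (hK i).congr fun j => eLpNorm_congr_ae
        ((toGraph_some _ i).sub (y2 i)).symm
  exact (isClosedGrad_of_mem (isClosed_gradGraph.mem_of_tendsto this
    (Eventually.of_forall fun j => (h j).toGraph_mem hX))).congr y1 y2

omit hX

end IsClosedGrad

/-! ### Cutoffs, and the passage from weak to closed gradients. -/

theorem lieD_comp (V : VField d M) (hf : Smooth f) {Φ : ℂ → ℂ}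
    (hΦ : ContDiff ℝ ∞ Φ) (x : M) : lieD V (fun x => Φ (f x)) x = fderiv ℝ Φ (f x) (lieD V f x) := by
  have hx := mem_chart_source 𝔼 x
  have h1 := differentiableAt_comp_chart_symm hf hx
  have h2 : DifferentiableAt ℝ Φ ((f ∘ (𝔠 x).symm) (𝔠 x x)) := hΦ.differentiable (by simp) _
  have h3 : (fun x => Φ (f x)) =ᶠ[𝓝 x] (Φ ∘ (f ∘ (𝔠 x).symm)) ∘ 𝔠 x :=
    eventuallyEq_chart_comp (fun x => Φ (f x)) hx
  rw [lieD_chart hx (h2.comp _ h1) h3, fderiv_comp _ h2 h1, lieD_chart' hx hf]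
  simp [(𝔠 x).left_inv hx]

include hμ hX

include hL in
/-- Smooth compactly supported cutoffs, available since the semigroup is conservative. -/
theorem IsConservative.exists_cutoff : ∃ χ : ℕ → M → ℝ, (∀ j, IsTest d (↟(χ j))) ∧
      (∀ j x, |χ j x| ≤ 1) ∧ Tendsto (fun j => eLpNorm (fun x => (χ j x : ℂ) - 1) 2 μ) atTop (𝓝 0) ∧
      (∀ i, Tendsto (fun j => eLpNorm (lieD (X i) (↟(χ j))) 2 μ) atTop (𝓝 0)) ∧
      ∀ᵐ x ∂μ, Tendsto (fun j => (χ j x : ℂ)) atTop (𝓝 1) := by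
  obtain ⟨-, G, hG, -⟩ := hL
  have hG0 : ∀ i, G i =ᵐ[μ] fun _ => 0 := (hG.isWeakGrad hX).ae_unique hμ hX (IsWeakGrad.const 1)
  obtain ⟨h1, h2, u, hu, h3, h4⟩ := hG.congr (ae_eq_refl _) hG0
  -- Applied to the real parts of test functions approximating `1`, this `Ψ` makes them bounded:
  -- `|Ψ| ≤ 1` and `|Ψ'| ≤ 2`. Since `Ψ 1 = 1` the convergence survives, and since `Ψ 0 = 0` so does
  -- the compact support.
  set Ψ : ℝ → ℝ := fun t => 2 * t / (1 + t ^ 2) with hΨ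
  have hpos : ∀ t : ℝ, 0 < 1 + t ^ 2 := fun t => by positivity
  have hΨs : ContDiff ℝ ∞ Ψ :=
    (contDiff_const.mul contDiff_id).div (contDiff_const.add (contDiff_id.pow 2))
      fun t => (hpos t).ne'
  have hΨd : ∀ t, HasDerivAt Ψ (2 * (1 - t ^ 2) / (1 + t ^ 2) ^ 2) t := fun t => by
    have := ((hasDerivAt_id t).const_mul 2).div (((hasDerivAt_id t).pow 2).const_add 1) (hpos t).ne'
    convert! this using 1
    simp
    ring
  have hΨ'b : ∀ t : ℝ, |2 * (1 - t ^ 2) / (1 + t ^ 2) ^ 2| ≤ 2 := fun t => by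
    rw [abs_div, abs_of_pos (pow_pos (hpos t) 2), div_le_iff₀ (pow_pos (hpos t) 2), abs_le]
    constructor <;> nlinarith [sq_nonneg t, sq_nonneg (t ^ 2)]
  have hΨb : ∀ t, |Ψ t| ≤ 1 := fun t => by
    simp only [hΨ]
    rw [abs_div, abs_of_pos (hpos t), div_le_one (hpos t), abs_le]
    constructor <;> nlinarith [sq_nonneg (t - 1), sq_nonneg (t + 1)]
  have hΨ1 : ∀ t, |Ψ t - 1| ≤ 2 * |t - 1| := fun t => by
    have : Ψ t - 1 = -((t - 1) / (1 + t ^ 2)) * (t - 1) := by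
      simp only [hΨ]; field_simp [(hpos t).ne']; ring
    rw [this, abs_mul, abs_neg, abs_div, abs_of_pos (hpos t)]
    refine mul_le_mul_of_nonneg_right ?_ (abs_nonneg _)
    rw [div_le_iff₀ (hpos t), abs_le]
    constructor <;> nlinarith [sq_nonneg (t - 1), sq_nonneg (t + 1)]
  set Φ : ℂ → ℂ := fun z => ((Ψ z.re : ℝ) : ℂ) with hΦ
  have hΦs : ContDiff ℝ ∞ Φ := Complex.ofRealCLM.contDiff.comp (hΨs.comp Complex.reCLM.contDiff)
  have hΦd : ∀ z w, fderiv ℝ Φ z w = ((2 * (1 - z.re ^ 2) / (1 + z.re ^ 2) ^ 2 * w.re : ℝ) : ℂ) := by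
    intro z w
    have h1 := (hΨd z.re).hasFDerivAt.comp z Complex.reCLM.hasFDerivAt
    have h2 := Complex.ofRealCLM.hasFDerivAt.comp z h1
    rw [show fderiv ℝ Φ z = _ from h2.fderiv]
    simp [mul_comm]
  have hle : Tendsto (fun j => ENNReal.ofReal 2 * eLpNorm (u j - fun _ => 1) 2 μ) atTop (𝓝 0) := by
    simpa using ENNReal.Tendsto.const_mul (a := ENNReal.ofReal 2) h3 (Or.inr ENNReal.ofReal_ne_top)
  have hle' : ∀ i, Tendsto (fun j => ENNReal.ofReal 2 * eLpNorm (lieD (X i) (u j)) 2 μ)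
      atTop (𝓝 0) := fun i => by
    have h4' : Tendsto (fun j => eLpNorm (lieD (X i) (u j)) 2 μ) atTop (𝓝 0) :=
      (h4 i).congr fun j => by congr 1; funext x; simp
    simpa using ENNReal.Tendsto.const_mul (a := ENNReal.ofReal 2) h4' (Or.inr ENNReal.ofReal_ne_top)
  have hχt : ∀ j, IsTest d (fun x => ((Ψ (u j x).re : ℝ) : ℂ)) := fun j =>
    ⟨contMDiff_comp_contDiff hΦs (hu j).1, (hu j).2.comp_left (g := Φ) (by simp [hΦ, hΨ])⟩
  have hc1 : Tendsto (fun j => eLpNorm (fun x => ((Ψ (u j x).re : ℝ) : ℂ) - 1) 2 μ) atTop (𝓝 0) := by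
    refine tendsto_of_tendsto_of_tendsto_of_le_of_le tendsto_const_nhds hle (fun j => zero_le)
      fun j => eLpNorm_le_mul_eLpNorm_of_ae_le_mul (ae_of_all _ fun x => ?_) 2
    have e : ((Ψ (u j x).re : ℝ) : ℂ) - 1 = ((Ψ (u j x).re - 1 : ℝ) : ℂ) := by push_cast; ring
    rw [e, Complex.norm_real, Real.norm_eq_abs]
    refine (hΨ1 _).trans (mul_le_mul_of_nonneg_left ?_ zero_le_two)
    simpa using Complex.abs_re_le_norm (u j x - 1)
  obtain ⟨ns, hns, hae⟩ := exists_subseq_ae_tendsto (ι := Unit) (p := 2) (μ := μ) (by norm_num)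
    (F := fun _ j x => ((Ψ (u j x).re : ℝ) : ℂ)) (f := fun _ _ => 1)
    (fun _ j => (hχt j).continuous.aestronglyMeasurable) (fun _ => aestronglyMeasurable_const)
    fun _ => hc1
  refine ⟨fun j x => Ψ (u (ns j) x).re, fun j => hχt _, fun j x => hΨb _,
    hc1.comp hns.tendsto_atTop, fun i => ?_, hae.mono fun x hx => hx ()⟩
  refine tendsto_of_tendsto_of_tendsto_of_le_of_le tendsto_const_nhds
    ((hle' i).comp hns.tendsto_atTop) (fun j => zero_le)
    fun j => eLpNorm_le_mul_eLpNorm_of_ae_le_mul (ae_of_all _ fun x => ?_) 2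
  rw [show lieD (X i) (fun x => ((Ψ (u (ns j) x).re : ℝ) : ℂ)) x = _ from
    lieD_comp (X i) (hu (ns j)).1 hΦs x, hΦd, Complex.norm_real, Real.norm_eq_abs, abs_mul]
  exact mul_le_mul (hΨ'b _) (Complex.abs_re_le_norm _) (abs_nonneg _) zero_le_two

/-- In each chart of a partition of unity the Friedrichs mollifications are test functions
converging in the graph norm; the finitely many pieces are then added up. -/
theorem IsWeakGrad.isClosedGrad_test_mul {G : Fin k → M → ℂ} (h : IsWeakGrad μ X f G)
    (hf : MemLp f 2 μ) (hG : ∀ i, MemLp (G i) 2 μ) (hχ : IsTest d ↟χ) :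
    IsClosedGrad μ X (fun x => (χ x : ℂ) * f x)
      (fun i x => (χ x : ℂ) * G i x + lieD (X i) ↟χ x * f x) := by
  have hmul : ∀ (q : M → ℂ), IsTest d q → ∀ g : M → ℂ, MemLp g 2 μ →
      MemLp (fun x => q x * g x) 2 μ := fun q hq g hg =>
    hg.of_le_mul (c := hq.exists_bound.choose) (hq.continuous.aestronglyMeasurable.mul hg.1)
      (ae_of_all _ fun x => by
        rw [norm_mul]
        exact mul_le_mul_of_nonneg_right (hq.exists_bound.choose_spec x) (norm_nonneg _))
  obtain ⟨s, θ, -, h1, h2, h3⟩ := hχ.exists_sum_chart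
  have key : ∀ a ∈ s, IsClosedGrad μ X (fun x => ((θ a x : ℂ) * χ x) * f x)
      (fun i x => ((θ a x : ℂ) * χ x) * G i x +
        lieD (X i) (fun x => (θ a x : ℂ) * χ x) x * f x) := by
    intro a ha
    have e : (fun x => (θ a x : ℂ) * χ x) = fun x => ((θ a x * χ x : ℝ) : ℂ) := by
      funext x; push_cast; ring
    have h1a := h1 a ha
    have h2a := h2 a ha
    have ep : ∀ x, (θ a x : ℂ) * χ x = ((θ a x * χ x : ℝ) : ℂ) := fun x => by push_cast; ring
    simp only [ep] at h1a h2a ⊢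
    obtain ⟨κ, -, -, hκ⟩ := exists_friedrichs hμ hX h1a h2a
    obtain ⟨ht, hlim⟩ := hκ f G h
    obtain ⟨hl1, hl2⟩ := hlim 2 (by norm_num) (by norm_num) hf hG
    exact ⟨hmul _ h1a _ hf, fun i => (hmul _ h1a _ (hG i)).add (hmul _ (h1a.lieD (hX i)) _ hf),
      _, ht, hl1, hl2⟩
  refine (IsClosedGrad.finset_sum hX s key).congr (ae_of_all _ fun x => ?_)
    fun i => ae_of_all _ fun x => ?_
  · simp only [← Finset.sum_mul, h3]
  · have hl := lieD_sum (X i) s (fun a ha => (h1 a ha).1) x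
    have e : (fun x => ∑ a ∈ s, (θ a x : ℂ) * χ x) = fun x => (χ x : ℂ) := funext h3
    rw [e] at hl
    simp only [Finset.sum_add_distrib, ← Finset.sum_mul, h3, hl]

include hL in
/-- A bounded function with square integrable weak gradient lies in the domain of the closed
gradient. -/
theorem IsWeakGrad.isClosedGrad {G : Fin k → M → ℂ} (h : IsWeakGrad μ X f G)
    {c : ℝ} (hc : ∀ᵐ x ∂μ, ‖f x‖ ≤ c) (hG : ∀ i, MemLp (G i) 2 μ) : IsClosedGrad μ X f G := by
  have hf : MemLp f 2 μ := MemLp.of_bound h.1.1 c hc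
  obtain ⟨χ, h1, h2, h3, h4, h5⟩ := hL.exists_cutoff hμ hX
  have hχm : ∀ j, AEStronglyMeasurable (↟(χ j)) μ := fun j => (h1 j).continuous.aestronglyMeasurable
  have hχb : ∀ j, ∀ᵐ x ∂μ, ‖(χ j x : ℂ)‖ ≤ 1 := fun j => ae_of_all _ fun x => by
    rw [Complex.norm_real]; exact h2 j x
  have hlim : ∀ g : M → ℂ, MemLp g 2 μ →
      Tendsto (fun j => eLpNorm ((fun x => (χ j x : ℂ) * g x) - g) 2 μ) atTop (𝓝 0) := fun g hg => by
    have := tendsto_eLpNorm_mul_sub (p := 2) (by norm_num) (by norm_num) hχm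
      aestronglyMeasurable_const hχb h5 (g := fun _ => g) (fun _ => hg.1) hg (by simp)
    simpa only [one_mul] using this
  refine IsClosedGrad.of_tendsto hX (fun j => h.isClosedGrad_test_mul hμ hX hf hG (h1 j)) hf hG
    (hlim f hf) fun i => ?_
  have h6 : Tendsto (fun j => ENNReal.ofReal c * eLpNorm (lieD (X i) (↟(χ j))) 2 μ)
      atTop (𝓝 0) := by
    simpa using ENNReal.Tendsto.const_mul (h4 i) (Or.inr ENNReal.ofReal_ne_top)
  have h7 := (hlim _ (hG i)).add h6
  rw [add_zero] at h7
  refine tendsto_of_tendsto_of_tendsto_of_le_of_le tendsto_const_nhds h7 (fun j => zero_le)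
    fun j => ?_
  have hlm := ((h1 j).lieD (hX i)).continuous.aestronglyMeasurable (μ := μ)
  have e : (fun x => (χ j x : ℂ) * G i x + lieD (X i) (↟(χ j)) x * f x) - G i =
      ((fun x => (χ j x : ℂ) * G i x) - G i) + fun x => lieD (X i) (↟(χ j)) x * f x := by
    funext x; simp only [Pi.sub_apply, Pi.add_apply]; ring
  simp only [e]
  refine (eLpNorm_add_le (((hχm j).mul (hG i).1).sub (hG i).1) (hlm.mul hf.1) (by norm_num)).trans
    (add_le_add_right ?_ _)
  refine eLpNorm_le_mul_eLpNorm_of_ae_le_mul ?_ 2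
  filter_upwards [hc] with x hx
  refine (norm_mul _ _).trans_le ?_
  rw [mul_comm]
  exact mul_le_mul_of_nonneg_right hx (norm_nonneg _)

/-! ### Markov maps on bounded functions. -/

section Markov
variable {f g h h' s s' : M → ℂ}

omit hμ hX

theorem exists_bound_of_memLp_top (hf : MemLp f ∞ μ) : ∃ c : ℝ, 0 ≤ c ∧ ∀ᵐ x ∂μ, ‖f x‖ ≤ c := by
  refine ⟨(eLpNorm f ∞ μ).toReal, ENNReal.toReal_nonneg, ?_⟩
  rw [eLpNorm_exponent_top]
  filter_upwards [ae_le_eLpNormEssSup (f := f) (μ := μ)] with x hx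
  have h : eLpNormEssSup f μ ≠ ⊤ := by simpa [eLpNorm_exponent_top] using hf.2.ne
  simpa using ENNReal.toReal_mono h hx

theorem memLp_of_memLp_top (hf : MemLp f ∞ μ) (p : ℝ≥0∞) : MemLp f p μ := hf.mono_exponent le_top

theorem memLp_top_mul (hf : MemLp f ∞ μ) (hg : MemLp g ∞ μ) : MemLp (fun x => f x * g x) ∞ μ :=
  hg.mul (hpqr := ⟨by simp⟩) hf

theorem memLp_conj (hf : MemLp f p μ) : MemLp (fun x => conj (f x)) p μ :=
  Complex.conjCLE.toContinuousLinearMap.comp_memLp' hf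

theorem integrable_conj_mul_of_memLp_top (hf : MemLp f ∞ μ) (hg : Integrable g μ) :
    Integrable (fun x => conj (f x) * g x) μ := by
  obtain ⟨c, -, hc⟩ := exists_bound_of_memLp_top hf
  exact hg.bdd_mul (memLp_conj hf).1 (hc.mono fun x hx => by simpa using hx)

open Classical in
/-- `P f` for an essentially bounded function `f`. -/
def markovApply (P : Lp ℂ ∞ μ →ₗ[ℂ] Lp ℂ ∞ μ) (f : M → ℂ) : M → ℂ :=
  if h : MemLp f ∞ μ then P (h.toLp f) else 0

theorem markovApply_def (h : MemLp f ∞ μ) : markovApply P f = P (h.toLp f) := dif_pos h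

theorem markovApply_coe (F : Lp ℂ ∞ μ) : markovApply P F = P F := by
  rw [markovApply_def (Lp.memLp F), Lp.toLp_coeFn]

theorem memLp_markovApply : MemLp (markovApply P f) ∞ μ := by
  unfold markovApply
  split_ifs
  · exact Lp.memLp _
  · exact MemLp.zero

theorem markovApply_add (hf : MemLp f ∞ μ) (hg : MemLp g ∞ μ) :
    markovApply P (fun x => f x + g x) =ᵐ[μ] fun x => markovApply P f x + markovApply P g x := by
  rw [show (fun x => f x + g x) = f + g from rfl, markovApply_def (hf.add hg), markovApply_def hf,
    markovApply_def hg, MemLp.toLp_add, map_add]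
  exact Lp.coeFn_add _ _

theorem markovApply_const_mul (hf : MemLp f ∞ μ) (c : ℂ) :
    markovApply P (fun x => c * f x) =ᵐ[μ] fun x => c * markovApply P f x := by
  rw [show (fun x => c * f x) = c • f from rfl, markovApply_def (hf.const_smul c),
    markovApply_def hf, MemLp.toLp_const_smul, map_smul]
  exact Lp.coeFn_smul _ _

theorem markovApply_sub (hf : MemLp f ∞ μ) (hg : MemLp g ∞ μ) :
    markovApply P (fun x => f x - g x) =ᵐ[μ] fun x => markovApply P f x - markovApply P g x := by
  rw [show (fun x => f x - g x) = f - g from rfl, markovApply_def (hf.sub hg), markovApply_def hf,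
    markovApply_def hg, MemLp.toLp_sub, map_sub]
  exact Lp.coeFn_sub _ _

theorem markovApply_finset_sum (s : Finset ι) {f : ι → M → ℂ} (hf : ∀ i ∈ s, MemLp (f i) ∞ μ) :
    markovApply P (fun x => ∑ i ∈ s, f i x) =ᵐ[μ] fun x => ∑ i ∈ s, markovApply P (f i) x := by
  classical
  induction s using Finset.induction_on with
  | empty =>
    have := markovApply_const_mul (P := P) (μ := μ) (f := 0) MemLp.zero 0
    simpa using this
  | insert a s ha ih =>
    simp only [Finset.sum_insert ha]
    have h := fun i hi => hf i (Finset.mem_insert_of_mem hi)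
    filter_upwards [markovApply_add (P := P) (hf a (Finset.mem_insert_self _ _))
      (memLp_finsetSum s h), ih h] with x h1 h2
    rw [h1, h2]

namespace IsMarkovMap

include hP

theorem apply_const (c : ℂ) : markovApply P (fun _ => c) =ᵐ[μ] fun _ => c := by
  have h1 : MemLp (fun _ : M => (1 : ℂ)) ∞ μ := memLp_const 1
  have h2 := hP.unital _ h1.coeFn_toLp
  rw [← markovApply_def] at h2
  have h3 := markovApply_const_mul (P := P) h1 c
  simp only [mul_one] at h3
  filter_upwards [h2, h3] with x hx hx'
  rw [hx', hx, mul_one]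

theorem apply_nonneg (hf : MemLp f ∞ μ) (h : ∀ᵐ x ∂μ, 0 ≤ f x) :
    ∀ᵐ x ∂μ, 0 ≤ markovApply P f x := by
  rw [markovApply_def hf]
  refine hP.positive _ ?_
  filter_upwards [h, hf.coeFn_toLp] with x hx hx'
  rwa [hx']

theorem integral_apply (hf : MemLp f ∞ μ) : ∫ x, markovApply P f x ∂μ = ∫ x, f x ∂μ := by
  rw [markovApply_def hf, hP.preserves]
  exact integral_congr_ae hf.coeFn_toLp

theorem apply_im (hf : MemLp f ∞ μ) (h : ∀ᵐ x ∂μ, (f x).im = 0) :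
    ∀ᵐ x ∂μ, (markovApply P f x).im = 0 := by
  obtain ⟨c, -, hc⟩ := exists_bound_of_memLp_top hf
  have h1 : MemLp (fun x => f x + c) ∞ μ := hf.add (memLp_const (c : ℂ))
  have h2 := hP.apply_nonneg h1 (by
    filter_upwards [h, hc] with x hx hx'
    rw [Complex.nonneg_iff]
    have := (abs_le.1 ((Complex.abs_re_le_norm (f x)).trans hx')).1
    simp [hx]
    linarith)
  filter_upwards [h2, markovApply_add (P := P) hf (memLp_const (c : ℂ)), hP.apply_const c]
    with x h3 h4 h5
  rw [h4, h5, Complex.nonneg_iff] at h3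
  simpa using h3.2.symm

theorem apply_conj (hf : MemLp f ∞ μ) :
    markovApply P (fun x => conj (f x)) =ᵐ[μ] fun x => conj (markovApply P f x) := by
  have h1 : MemLp (fun x => (((f x).re : ℝ) : ℂ)) ∞ μ :=
    (Complex.ofRealCLM.comp Complex.reCLM).comp_memLp' hf
  have h2 : MemLp (fun x => (((f x).im : ℝ) : ℂ)) ∞ μ :=
    (Complex.ofRealCLM.comp Complex.imCLM).comp_memLp' hf
  have e1 : f = fun x => (((f x).re : ℝ) : ℂ) + Complex.I * (((f x).im : ℝ) : ℂ) := by
    funext x; rw [mul_comm]; exact (Complex.re_add_im _).symm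
  have e2 : (fun x => conj (f x)) =
      fun x => (((f x).re : ℝ) : ℂ) - Complex.I * (((f x).im : ℝ) : ℂ) := by
    funext x; apply Complex.ext <;> simp
  have h3 := markovApply_add (P := P) h1 (h2.const_mul Complex.I)
  have h4 := markovApply_sub (P := P) h1 (h2.const_mul Complex.I)
  rw [← e1] at h3
  rw [e2]
  filter_upwards [h3, h4, markovApply_const_mul (P := P) h2 Complex.I,
    hP.apply_im h1 (by simp), hP.apply_im h2 (by simp)] with x h5 h6 h7 h8 h9
  rw [h6, h5, h7]
  apply Complex.ext <;> simp [h8, h9]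

/-- The Kadison–Schwarz inequality. -/
theorem norm_sq_apply_le (hf : MemLp f ∞ μ) :
    ∀ᵐ x ∂μ, ‖markovApply P f x‖ ^ 2 ≤ (markovApply P (fun x => ((‖f x‖ ^ 2 : ℝ) : ℂ)) x).re := by
  have e : ∀ x, ((‖f x‖ ^ 2 : ℝ) : ℂ) = conj (f x) * f x := fun x => by
    rw [Complex.conj_mul']; push_cast; rfl
  have hs : MemLp (fun x => ((‖f x‖ ^ 2 : ℝ) : ℂ)) ∞ μ := by
    simp only [e]; exact memLp_top_mul (memLp_conj hf) hf
  -- Positivity of `P` applied to `|f - z|²`. Countably many `z` from a dense sequence share one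
  -- null set, and continuity in `z` then allows `z = P f x`.
  have key : ∀ z : ℂ, ∀ᵐ x ∂μ, 0 ≤ (markovApply P (fun x => ((‖f x‖ ^ 2 : ℝ) : ℂ)) x).re -
      2 * (conj z * markovApply P f x).re + ‖z‖ ^ 2 := by
    intro z
    have h1 : MemLp (fun x => ((‖f x - z‖ ^ 2 : ℝ) : ℂ)) ∞ μ := by
      have e' : ∀ x, ((‖f x - z‖ ^ 2 : ℝ) : ℂ) = conj (f x - z) * (f x - z) := fun x => by
        rw [Complex.conj_mul']; push_cast; rfl
      simp only [e']
      exact memLp_top_mul (memLp_conj (hf.sub (memLp_const z))) (hf.sub (memLp_const z))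
    have h2 := hP.apply_nonneg h1 (ae_of_all _ fun x => by exact_mod_cast sq_nonneg ‖f x - z‖)
    have e2 : (fun x => ((‖f x - z‖ ^ 2 : ℝ) : ℂ)) = fun x => ((‖f x‖ ^ 2 : ℝ) : ℂ) +
        ((-conj z * f x + -z * conj (f x)) + ((‖z‖ ^ 2 : ℝ) : ℂ)) := by
      funext x
      have h1 : ((‖f x - z‖ ^ 2 : ℝ) : ℂ) = conj (f x - z) * (f x - z) := by
        rw [Complex.conj_mul']; push_cast; rfl
      have h2 : ((‖z‖ ^ 2 : ℝ) : ℂ) = conj z * z := by rw [Complex.conj_mul']; push_cast; rfl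
      rw [h1, h2, e, map_sub]; ring
    have m1 := hf.const_mul (-conj z)
    have m2 := (memLp_conj hf).const_mul (-z)
    have m3 : MemLp (fun _ : M => ((‖z‖ ^ 2 : ℝ) : ℂ)) ∞ μ := memLp_const _
    rw [e2] at h2
    filter_upwards [h2, markovApply_add (P := P) hs ((m1.add m2).add m3),
      markovApply_add (P := P) (m1.add m2) m3, markovApply_add (P := P) m1 m2,
      markovApply_const_mul (P := P) hf (-conj z), markovApply_const_mul (P := P) (memLp_conj hf) (-z),
      hP.apply_conj hf, hP.apply_const ((‖z‖ ^ 2 : ℝ) : ℂ)] with x h3 h4 h5 h6 h7 h8 h9 h10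
    have h11 := (Complex.nonneg_iff.1 h3).1
    erw [h4, h5, h6, h7, h8, h9, h10] at h11
    simp only [Complex.add_re, Complex.mul_re, Complex.neg_re, Complex.neg_im, Complex.conj_re,
      Complex.conj_im, Complex.ofReal_re] at h11 ⊢
    linarith
  have hall := ae_all_iff.2 fun j => key (TopologicalSpace.denseSeq ℂ j)
  filter_upwards [hall] with x hx
  have hcl : IsClosed {z : ℂ | 0 ≤ (markovApply P (fun x => ((‖f x‖ ^ 2 : ℝ) : ℂ)) x).re -
      2 * (conj z * markovApply P f x).re + ‖z‖ ^ 2} := by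
    refine isClosed_le continuous_const ?_
    have : Continuous fun z : ℂ => (conj z * markovApply P f x).re :=
      Complex.continuous_re.comp (Complex.continuous_conj.mul continuous_const)
    fun_prop
  have hmem := hcl.closure_subset_iff.2 (Set.range_subset_iff.2 hx)
    (TopologicalSpace.denseRange_denseSeq ℂ (markovApply P f x))
  simp only [Set.mem_ofPred_eq, Complex.conj_mul'] at hmem
  norm_cast at hmem
  linarith

theorem norm_apply_le (hf : MemLp f ∞ μ) {c : ℝ} (hc : 0 ≤ c)
    (h : ∀ᵐ x ∂μ, ‖f x‖ ≤ c) : ∀ᵐ x ∂μ, ‖markovApply P f x‖ ≤ c := by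
  have e : ∀ x, ((‖f x‖ ^ 2 : ℝ) : ℂ) = conj (f x) * f x := fun x => by
    rw [Complex.conj_mul']; push_cast; rfl
  have hs : MemLp (fun x => ((‖f x‖ ^ 2 : ℝ) : ℂ)) ∞ μ := by
    simp only [e]; exact memLp_top_mul (memLp_conj hf) hf
  have hcm : MemLp (fun _ : M => ((c ^ 2 : ℝ) : ℂ)) ∞ μ := memLp_const _
  have h1 := hP.apply_nonneg (hcm.sub hs) (by
    filter_upwards [h] with x hx
    have := pow_le_pow_left₀ (norm_nonneg _) hx 2
    simp only [Pi.sub_apply]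
    rw [← Complex.ofReal_sub]
    exact_mod_cast sub_nonneg.2 this)
  filter_upwards [h1, markovApply_sub (P := P) hcm hs, hP.apply_const ((c ^ 2 : ℝ) : ℂ),
    hP.norm_sq_apply_le hf] with x h2 h3 h4 h5
  have h6 := (Complex.nonneg_iff.1 h2).1
  erw [h3, h4] at h6
  simp only [Complex.sub_re, Complex.ofReal_re] at h6
  exact le_of_sq_le_sq (h5.trans (by linarith)) hc

end IsMarkovMap

/-! ### The extension to `L²` -/

/-- The inclusion of `L^∞` into `L²`. -/
def inclTop (μ : Measure M) [IsProbabilityMeasure μ] : Lp ℂ ∞ μ →ₗ[ℂ] Lp ℂ 2 μ where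
  toFun F := (memLp_of_memLp_top (Lp.memLp F) 2).toLp F
  map_add' F G := by
    rw [← MemLp.toLp_add]
    exact MemLp.toLp_congr _ _ (Lp.coeFn_add _ _)
  map_smul' c F := by
    rw [RingHom.id_apply, ← MemLp.toLp_const_smul]
    exact MemLp.toLp_congr _ _ (Lp.coeFn_smul _ _)

theorem coeFn_inclTop (F : Lp ℂ ∞ μ) : inclTop μ F =ᵐ[μ] F :=
  (memLp_of_memLp_top (Lp.memLp F) 2).coeFn_toLp

/-- The truncation `f 1_{|f| ≤ N}`. -/
def truncate (f : M → ℂ) (N : ℕ) (x : M) : ℂ := open Classical in if ‖f x‖ ≤ N then f x else 0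

theorem norm_truncate_le (f : M → ℂ) (N : ℕ) (x : M) : ‖truncate f N x‖ ≤ N := by
  unfold truncate
  split_ifs with h
  · exact h
  · simp

theorem tendsto_truncate (f : M → ℂ) (x : M) :
    Tendsto (fun N => truncate f N x) atTop (𝓝 (f x)) := by
  refine tendsto_const_nhds.congr' ?_
  filter_upwards [eventually_ge_atTop ⌈‖f x‖⌉₊] with N hN
  unfold truncate
  rw [if_pos ((Nat.le_ceil _).trans (by exact_mod_cast hN))]

theorem aestronglyMeasurable_truncate (hf : AEStronglyMeasurable f μ) (N : ℕ) :
    AEStronglyMeasurable (truncate f N) μ := by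
  refine AEStronglyMeasurable.congr (f := truncate (hf.mk f) N) ?_ ?_
  · refine (StronglyMeasurable.ite ?_ hf.stronglyMeasurable_mk
      stronglyMeasurable_const).aestronglyMeasurable
    exact measurableSet_le hf.stronglyMeasurable_mk.norm.measurable measurable_const
  · filter_upwards [hf.ae_eq_mk] with x hx
    simp only [truncate, hx]

theorem memLp_top_truncate (hf : AEStronglyMeasurable f μ) (N : ℕ) : MemLp (truncate f N) ∞ μ :=
  memLp_top_of_bound (aestronglyMeasurable_truncate hf N) N (ae_of_all _ (norm_truncate_le f N))

theorem tendsto_eLpNorm_truncate_sub (hp0 : p ≠ 0) (hp : p ≠ ⊤) (hf : MemLp f p μ) :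
    Tendsto (fun N => eLpNorm (truncate f N - f) p μ) atTop (𝓝 0) := by
  refine tendsto_eLpNorm_zero_of_dominated hp0 hp
    (fun N => (aestronglyMeasurable_truncate hf.1 N).sub hf.1) hf
    (fun N => ae_of_all _ fun x => ?_) (ae_of_all _ fun x => ?_)
  · simp only [Pi.sub_apply, truncate]
    split_ifs <;> simp
  · simpa using (tendsto_truncate f x).sub_const (f x)

theorem denseRange_inclTop : DenseRange (inclTop μ) := by
  intro f
  refine mem_closure_of_tendsto (f := fun N => inclTop μ
    ((memLp_top_truncate (Lp.memLp f).1 N).toLp _)) (b := atTop) ?_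
    (Eventually.of_forall fun N => Set.mem_range_self _)
  rw [Lp.tendsto_Lp_iff_tendsto_eLpNorm']
  refine (tendsto_eLpNorm_truncate_sub (by norm_num) (by norm_num) (Lp.memLp f)).congr fun N =>
    eLpNorm_congr_ae ?_
  exact (((coeFn_inclTop _).trans (MemLp.coeFn_toLp _)).sub (ae_eq_refl _)).symm

theorem norm_sq_Lp (f : Lp ℂ 2 μ) : ‖f‖ ^ 2 = ∫ x, ‖f x‖ ^ 2 ∂μ := by
  have h := @inner_self_eq_norm_sq ℂ _ _ _ _ f
  rw [← h, L2.inner_def]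
  have : ∀ x, inner ℂ (f x) (f x) = ((‖f x‖ ^ 2 : ℝ) : ℂ) := fun x => by
    rw [inner_self_eq_norm_sq_to_K]; push_cast; rfl
  simp only [this]
  rw [integral_complex_ofReal]; rfl

include hP

/-- The Kadison–Schwarz inequality, integrated with the invariance of `μ`, makes `P` an `L²`
contraction. -/
theorem IsMarkovMap.norm_inclTop_le (F : Lp ℂ ∞ μ) : ‖inclTop μ (P F)‖ ≤ 1 * ‖inclTop μ F‖ := by
  rw [one_mul]
  refine le_of_sq_le_sq ?_ (norm_nonneg _)
  rw [norm_sq_Lp, norm_sq_Lp]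
  have hF := Lp.memLp F
  have e : ∀ x, ((‖F x‖ ^ 2 : ℝ) : ℂ) = conj (F x) * F x := fun x => by
    rw [Complex.conj_mul']; push_cast; rfl
  have hs : MemLp (fun x => ((‖F x‖ ^ 2 : ℝ) : ℂ)) ∞ μ := by
    simp only [e]; exact memLp_top_mul (memLp_conj hF) hF
  have h1 : ∫ x, ‖(inclTop μ (P F)) x‖ ^ 2 ∂μ = ∫ x, ‖P F x‖ ^ 2 ∂μ :=
    integral_congr_ae ((coeFn_inclTop (P F)).mono fun x hx => by simp only [hx])
  have h2 : ∫ x, ‖(inclTop μ F) x‖ ^ 2 ∂μ = ∫ x, ‖F x‖ ^ 2 ∂μ :=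
    integral_congr_ae ((coeFn_inclTop F).mono fun x hx => by simp only [hx])
  rw [h1, h2]
  have h3 := hP.norm_sq_apply_le hF
  rw [markovApply_coe] at h3
  have hi : Integrable (markovApply P (fun x => ((‖F x‖ ^ 2 : ℝ) : ℂ))) μ :=
    memLp_markovApply.integrable le_top
  calc ∫ x, ‖P F x‖ ^ 2 ∂μ ≤ ∫ x, (markovApply P (fun x => ((‖F x‖ ^ 2 : ℝ) : ℂ)) x).re ∂μ :=
        integral_mono_of_nonneg (ae_of_all _ fun x => sq_nonneg _) hi.re h3
    _ = (∫ x, markovApply P (fun x => ((‖F x‖ ^ 2 : ℝ) : ℂ)) x ∂μ).re := integral_re hi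
    _ = ∫ x, ‖F x‖ ^ 2 ∂μ := by rw [hP.integral_apply hs, integral_complex_ofReal]; rfl

omit hP in
/-- The continuous extension of `P` to `L²`. -/
def markovExt (P : Lp ℂ ∞ μ →ₗ[ℂ] Lp ℂ ∞ μ) : Lp ℂ 2 μ →L[ℂ] Lp ℂ 2 μ :=
  ((inclTop μ).comp P).extendOfNorm (inclTop μ)

theorem IsMarkovMap.markovExt_inclTop (F : Lp ℂ ∞ μ) :
    markovExt P (inclTop μ F) = inclTop μ (P F) :=
  LinearMap.extendOfNorm_eq denseRange_inclTop ⟨1, hP.norm_inclTop_le⟩ F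

theorem IsMarkovMap.isExtension (f : Lp ℂ 2 μ) : IsExtension μ P f (markovExt P f) := by
  obtain ⟨w, hw, hlim⟩ := mem_closure_iff_seq_limit.1 (denseRange_inclTop (μ := μ) f)
  choose F hF using hw
  refine ⟨Lp.memLp _, Lp.memLp _, F, ?_, ?_⟩
  · rw [Lp.tendsto_Lp_iff_tendsto_eLpNorm'] at hlim
    refine hlim.congr fun m => eLpNorm_congr_ae ?_
    rw [← hF m]
    exact (coeFn_inclTop _).sub (ae_eq_refl _)
  · have h := ((markovExt P).continuous.tendsto f).comp hlim
    rw [Lp.tendsto_Lp_iff_tendsto_eLpNorm'] at h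
    refine h.congr fun m => eLpNorm_congr_ae ?_
    rw [Function.comp, ← hF m, hP.markovExt_inclTop]
    exact (coeFn_inclTop _).sub (ae_eq_refl _)

omit hP

theorem tendsto_integral_conj_mul {φ : M → ℂ} (hφ : MemLp φ ∞ μ)
    {f : ι → M → ℂ} {g : M → ℂ} (hf : ∀ j, Integrable (f j) μ) (hg : Integrable g μ)
    (hlim : Tendsto (fun j => eLpNorm (f j - g) 1 μ) l (𝓝 0)) :
    Tendsto (fun j => ∫ x, conj (φ x) * f j x ∂μ) l (𝓝 (∫ x, conj (φ x) * g x ∂μ)) := by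
  obtain ⟨c, hc0, hc⟩ := exists_bound_of_memLp_top hφ
  refine tendsto_integral_of_L1' _ (integrable_conj_mul_of_memLp_top hφ hg).1
    (Eventually.of_forall fun j => integrable_conj_mul_of_memLp_top hφ (hf j)) ?_
  have h2 : Tendsto (fun j => ENNReal.ofReal c * eLpNorm (f j - g) 1 μ) l (𝓝 0) := by
    simpa using ENNReal.Tendsto.const_mul (a := ENNReal.ofReal c) hlim
      (Or.inr ENNReal.ofReal_ne_top)
  refine tendsto_of_tendsto_of_tendsto_of_le_of_le tendsto_const_nhds h2 (fun j => zero_le)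
    fun j => ?_
  refine eLpNorm_le_mul_eLpNorm_of_ae_le_mul ?_ 1
  filter_upwards [hc] with x hx
  rw [Pi.sub_apply, Pi.sub_apply, ← mul_sub, norm_mul, RCLike.norm_conj]
  exact mul_le_mul_of_nonneg_right hx (norm_nonneg _)

/-! ### The adjoint of a Markov map on `L¹`. -/

/-- `s = P^† h` for scalar functions. -/
def IsAdj (μ : Measure M) (P : Lp ℂ ∞ μ →ₗ[ℂ] Lp ℂ ∞ μ) (h s : M → ℂ) : Prop :=
  Integrable s μ ∧ ∀ F : Lp ℂ ∞ μ, ∫ x, conj (F x) * s x ∂μ = ∫ x, conj (P F x) * h x ∂μ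

namespace IsAdj

theorem integral_eq (hs : IsAdj μ P h s) {φ : M → ℂ} (hφ : MemLp φ ∞ μ) :
    ∫ x, conj (φ x) * s x ∂μ = ∫ x, conj (markovApply P φ x) * h x ∂μ := by
  rw [markovApply_def hφ, ← hs.2]
  exact integral_congr_ae (hφ.coeFn_toLp.mono fun x hx => by simp only [hx])

theorem mk' (hs : Integrable s μ) (H : ∀ φ, MemLp φ ∞ μ →
    ∫ x, conj (φ x) * s x ∂μ = ∫ x, conj (markovApply P φ x) * h x ∂μ) : IsAdj μ P h s :=
  ⟨hs, fun F => by rw [H F (Lp.memLp F), markovApply_coe]⟩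

theorem congr (hs : IsAdj μ P h s) (e : h =ᵐ[μ] h') (e' : s =ᵐ[μ] s') : IsAdj μ P h' s' := by
  refine ⟨hs.1.congr e', fun F => ?_⟩
  have h1 := hs.2 F
  rw [integral_congr_ae (e'.mono fun x hx => by simp only [hx] :
      (fun x => conj (F x) * s x) =ᵐ[μ] fun x => conj (F x) * s' x),
    integral_congr_ae (e.mono fun x hx => by simp only [hx] :
      (fun x => conj (P F x) * h x) =ᵐ[μ] fun x => conj (P F x) * h' x)] at h1
  exact h1

theorem add (hh : Integrable h μ) (hh' : Integrable h' μ) (hs : IsAdj μ P h s)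
    (hs' : IsAdj μ P h' s') : IsAdj μ P (fun x => h x + h' x) (fun x => s x + s' x) := by
  refine ⟨hs.1.add hs'.1, fun F => ?_⟩
  simp only [mul_add]
  rw [integral_add (integrable_conj_mul_of_memLp_top (Lp.memLp _) hs.1)
    (integrable_conj_mul_of_memLp_top (Lp.memLp _) hs'.1),
    integral_add (integrable_conj_mul_of_memLp_top (Lp.memLp _) hh)
    (integrable_conj_mul_of_memLp_top (Lp.memLp _) hh'), hs.2, hs'.2]

theorem const_mul (c : ℂ) (hs : IsAdj μ P h s) :
    IsAdj μ P (fun x => c * h x) (fun x => c * s x) := by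
  refine ⟨hs.1.const_mul c, fun F => ?_⟩
  simp only [mul_left_comm _ c]
  rw [integral_const_mul, integral_const_mul, hs.2]

theorem sub (hh : Integrable h μ) (hh' : Integrable h' μ) (hs : IsAdj μ P h s)
    (hs' : IsAdj μ P h' s') : IsAdj μ P (fun x => h x - h' x) (fun x => s x - s' x) := by
  have := hs.add hh (hh'.const_mul (-1)) (hs'.const_mul (-1))
  simpa only [neg_mul, one_mul, ← sub_eq_add_neg] using this

theorem finset_sum (t : Finset ι) {h s : ι → M → ℂ}
    (hh : ∀ i ∈ t, Integrable (h i) μ) (hs : ∀ i ∈ t, IsAdj μ P (h i) (s i)) :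
    IsAdj μ P (fun x => ∑ i ∈ t, h i x) (fun x => ∑ i ∈ t, s i x) := by
  refine ⟨integrable_finsetSum _ fun i hi => (hs i hi).1, fun F => ?_⟩
  simp only [Finset.mul_sum]
  rw [integral_finsetSum _ fun i hi => integrable_conj_mul_of_memLp_top (Lp.memLp _) (hs i hi).1,
    integral_finsetSum _ fun i hi => integrable_conj_mul_of_memLp_top (Lp.memLp _) (hh i hi)]
  exact Finset.sum_congr rfl fun i hi => (hs i hi).2 F

include hP

theorem one (c : ℂ) : IsAdj μ P (fun _ => c) (fun _ => c) := by
  refine mk' (integrable_const c) fun φ hφ => ?_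
  rw [integral_mul_const, integral_mul_const, integral_conj, integral_conj, hP.integral_apply hφ]

/-- Duality with the `L^∞` contraction, tested against the phase `s / |s|`; where `s = 0` the
convention `0⁻¹ = 0` makes this phase zero. -/
theorem integral_norm_le (hh : Integrable h μ) (hs : IsAdj μ P h s) :
    ∫ x, ‖s x‖ ∂μ ≤ ∫ x, ‖h x‖ ∂μ := by
  set φ : M → ℂ := fun x => s x * ((‖s x‖⁻¹ : ℝ) : ℂ) with hφ
  have hφ1 : ∀ x, ‖φ x‖ ≤ 1 := fun x => by
    simp only [hφ, norm_mul, Complex.norm_real, norm_inv, norm_norm]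
    exact mul_inv_le_one
  have hφm : MemLp φ ∞ μ := by
    refine memLp_top_of_bound (hs.1.1.mul ?_) 1 (ae_of_all _ hφ1)
    exact (Complex.measurable_ofReal.comp_aemeasurable
      (hs.1.1.norm.aemeasurable.inv)).aestronglyMeasurable
  have h1 := hs.integral_eq hφm
  have e : ∀ x, conj (φ x) * s x = ((‖s x‖ : ℝ) : ℂ) := fun x => by
    simp only [hφ, map_mul, Complex.conj_ofReal]
    rw [mul_right_comm, Complex.conj_mul']
    by_cases h0 : ‖s x‖ = 0
    · simp [h0]
    · push_cast
      have : (‖s x‖ : ℂ) ≠ 0 := by exact_mod_cast h0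
      field_simp
  simp only [e] at h1
  rw [integral_complex_ofReal] at h1
  have h2 : ‖((∫ x, ‖s x‖ ∂μ : ℝ) : ℂ)‖ = ∫ x, ‖s x‖ ∂μ := by
    rw [Complex.norm_real, Real.norm_of_nonneg (integral_nonneg fun x => norm_nonneg _)]
  rw [← h2, h1]
  refine (norm_integral_le_integral_norm _).trans (integral_mono_of_nonneg
    (ae_of_all _ fun x => norm_nonneg _) hh.norm ?_)
  filter_upwards [hP.norm_apply_le hφm zero_le_one (ae_of_all _ hφ1)] with x hx
  rw [norm_mul, RCLike.norm_conj]
  exact mul_le_of_le_one_left (norm_nonneg _) hx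

theorem eLpNorm_le (hh : Integrable h μ) (hs : IsAdj μ P h s) : eLpNorm s 1 μ ≤ eLpNorm h 1 μ := by
  rw [eLpNorm_one_eq_lintegral_enorm, eLpNorm_one_eq_lintegral_enorm,
    ← ofReal_integral_norm_eq_lintegral_enorm hs.1, ← ofReal_integral_norm_eq_lintegral_enorm hh]
  exact ENNReal.ofReal_le_ofReal (hs.integral_norm_le hP hh)

theorem ae_unique (hh : Integrable h μ) (hs : IsAdj μ P h s)
    (hs' : IsAdj μ P h s') : s =ᵐ[μ] s' := by
  have h1 := (hs.sub hh hh hs').integral_norm_le hP (hh.sub hh)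
  have h0 : ∫ x, ‖(h - h) x‖ ∂μ = 0 := by simp
  have h2 := (integral_eq_zero_iff_of_nonneg (fun x => norm_nonneg _) (hs.1.sub hs'.1).norm).1
    (le_antisymm (h1.trans_eq h0) (integral_nonneg fun x => norm_nonneg _))
  filter_upwards [h2] with x hx
  simpa [sub_eq_zero] using hx

theorem tendsto {hj sj : ι → M → ℂ}
    (hhj : ∀ j, Integrable (hj j) μ) (hh : Integrable h μ) (hsj : ∀ j, IsAdj μ P (hj j) (sj j))
    (hs : IsAdj μ P h s) (hlim : Tendsto (fun j => eLpNorm (hj j - h) 1 μ) l (𝓝 0)) :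
    Tendsto (fun j => eLpNorm (sj j - s) 1 μ) l (𝓝 0) :=
  tendsto_of_tendsto_of_tendsto_of_le_of_le tendsto_const_nhds hlim (fun _ => zero_le)
    fun j => ((hsj j).sub (hhj j) hh hs).eLpNorm_le hP ((hhj j).sub hh)

theorem of_L2 (f : Lp ℂ 2 μ) : IsAdj μ P f (ContinuousLinearMap.adjoint (markovExt P) f) := by
  refine ⟨(Lp.memLp _).integrable (by norm_num), fun F => ?_⟩
  have h1 := ContinuousLinearMap.adjoint_inner_right (markovExt P) (inclTop μ F) f
  rw [hP.markovExt_inclTop, L2.inner_def, L2.inner_def] at h1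
  simp only [RCLike.inner_apply'] at h1
  convert h1 using 1
  · refine integral_congr_ae ((coeFn_inclTop F).mono fun x hx => ?_)
    simp only [hx]
  · refine integral_congr_ae ((coeFn_inclTop (P F)).mono fun x hx => ?_)
    simp only [hx]

/-- For square integrable functions the Hilbert space adjoint of the `L²` extension works. The
images of the truncations of `h` are Cauchy in `L¹` by the contraction property, and their limit is
the adjoint image. -/
theorem exists_adj (hh : Integrable h μ) : ∃ s, IsAdj μ P h s := by
  have hh1 : MemLp h 1 μ := memLp_one_iff_integrable.2 hh
  have ht : ∀ N, MemLp (truncate h N) 2 μ := fun N => memLp_of_memLp_top (memLp_top_truncate hh.1 N) 2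
  have hti : ∀ N, Integrable (truncate h N) μ := fun N => (ht N).integrable (by norm_num)
  have hlim := tendsto_eLpNorm_truncate_sub (p := 1) (by norm_num) (by norm_num) hh1
  have hadj : ∀ N, ∃ s, IsAdj μ P (truncate h N) s := fun N =>
    ⟨_, (of_L2 hP ((ht N).toLp _)).congr (MemLp.coeFn_toLp _) (ae_eq_refl _)⟩
  choose s hs using hadj
  have hs1 : ∀ N, MemLp (s N) 1 μ := fun N => memLp_one_iff_integrable.2 (hs N).1
  have ht1 : ∀ N, MemLp (truncate h N) 1 μ := fun N => memLp_one_iff_integrable.2 (hti N)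
  have hc : CauchySeq (fun N => (ht1 N).toLp _) :=
    ((Lp.tendsto_Lp_iff_tendsto_eLpNorm'' _ ht1 _ hh1).2 hlim).cauchySeq
  have hc2 : CauchySeq (fun N => (hs1 N).toLp _) := by
    rw [Metric.cauchySeq_iff] at hc ⊢
    intro ε hε
    obtain ⟨N, hN⟩ := hc ε hε
    refine ⟨N, fun m hm n hn => lt_of_le_of_lt ?_ (hN m hm n hn)⟩
    rw [dist_edist, dist_edist, Lp.edist_toLp_toLp, Lp.edist_toLp_toLp]
    exact ENNReal.toReal_mono ((ht1 m).sub (ht1 n)).2.ne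
      (((hs m).sub (hti m) (hti n) (hs n)).eLpNorm_le hP ((hti m).sub (hti n)))
  obtain ⟨S, hS⟩ := cauchySeq_tendsto_of_complete hc2
  have hS' : Tendsto (fun N => eLpNorm (s N - (S : M → ℂ)) 1 μ) atTop (𝓝 0) := by
    rw [Lp.tendsto_Lp_iff_tendsto_eLpNorm'] at hS
    exact hS.congr fun N => eLpNorm_congr_ae ((MemLp.coeFn_toLp _).sub (ae_eq_refl _))
  have hSi : Integrable S μ := memLp_one_iff_integrable.1 (Lp.memLp S)
  refine ⟨S, hSi, fun F => ?_⟩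
  have h1 := tendsto_integral_conj_mul (Lp.memLp F) (fun N => (hs N).1) hSi hS'
  have h2 := tendsto_integral_conj_mul (Lp.memLp (P F)) hti hh hlim
  exact tendsto_nhds_unique h1 (h2.congr fun N => ((hs N).2 F).symm)

theorem nonneg (hs : IsAdj μ P h s) (h0 : ∀ᵐ x ∂μ, 0 ≤ h x) : ∀ᵐ x ∂μ, 0 ≤ s x := by
  have key : ∀ A, MeasurableSet A → 0 ≤ ∫ x in A, s x ∂μ := by
    intro A hA
    have hm : MemLp (A.indicator fun _ => (1 : ℂ)) ∞ μ := (memLp_const 1).indicator hA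
    have h1 := hs.integral_eq hm
    have e : ∀ x, conj (A.indicator (fun _ => (1 : ℂ)) x) * s x = A.indicator s x := fun x => by
      by_cases hx : x ∈ A <;> simp [hx]
    simp only [e] at h1
    rw [← integral_indicator hA, h1]
    refine integral_nonneg_of_ae ?_
    filter_upwards [h0, hP.apply_nonneg hm (ae_of_all _ fun x => by
      by_cases hx : x ∈ A <;> simp [hx])] with x hx hx'
    have : conj (markovApply P (A.indicator fun _ => (1 : ℂ)) x) =
        markovApply P (A.indicator fun _ => (1 : ℂ)) x :=
      Complex.conj_eq_iff_im.2 (Complex.nonneg_iff.1 hx').2.symm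
    rw [this]
    exact mul_nonneg hx' hx
  have hre : ∀ A, ∫ x in A, (s x).re ∂μ = (∫ x in A, s x ∂μ).re := fun A =>
    integral_re hs.1.integrableOn
  have him : ∀ A, ∫ x in A, (s x).im ∂μ = (∫ x in A, s x ∂μ).im := fun A =>
    integral_im hs.1.integrableOn
  have h1 : 0 ≤ᵐ[μ] fun x => (s x).re :=
    ae_nonneg_of_forall_setIntegral_nonneg hs.1.re fun A hA _ => by
      show 0 ≤ ∫ x in A, (s x).re ∂μ
      rw [hre]; exact (Complex.nonneg_iff.1 (key A hA)).1
  have h2 : 0 ≤ᵐ[μ] fun x => (s x).im :=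
    ae_nonneg_of_forall_setIntegral_nonneg hs.1.im fun A hA _ => by
      show 0 ≤ ∫ x in A, (s x).im ∂μ
      rw [him]; exact (Complex.nonneg_iff.1 (key A hA)).2.le
  have h3 : 0 ≤ᵐ[μ] fun x => -(s x).im :=
    ae_nonneg_of_forall_setIntegral_nonneg hs.1.im.neg fun A hA _ => by
      show 0 ≤ ∫ x in A, -(s x).im ∂μ
      rw [integral_neg, him]; exact (neg_eq_zero.2 (Complex.nonneg_iff.1 (key A hA)).2.symm).ge
  filter_upwards [h1, h2, h3] with x h4 h5 h6
  exact Complex.nonneg_iff.2 ⟨h4, le_antisymm h5 (neg_nonneg.1 h6)⟩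

end IsAdj

/-! ### Matrix-valued adjoint images and positivity. -/

include hP

omit hP in
theorem isAdjointImage_iff {ρ σ : M → 𝕄} :
    IsAdjointImage μ P ρ σ ↔ ∀ a b, IsAdj μ P (fun x => ρ x a b) (fun x => σ x a b) := Iff.rfl

theorem IsAdjointImage.exists_of_integrable {ρ : M → 𝕄}
    (hρ : ∀ a b, Integrable (fun x => ρ x a b) μ) : ∃ σ : M → 𝕄, IsAdjointImage μ P ρ σ := by
  choose s hs using fun a b => IsAdj.exists_adj hP (hρ a b)
  exact ⟨fun x => Matrix.of fun a b => s a b x, fun a b => hs a b⟩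

omit hP

-- Over `ℂ` a quadratic form with real values comes from a Hermitian matrix, so symmetry need not be
-- assumed.
open Matrix in
theorem posSemidef_of_forall_nonneg {A : 𝕄}
    (h : ∀ v : Fin n → ℂ, 0 ≤ star v ⬝ᵥ (A *ᵥ v)) : A.PosSemidef := by
  rw [← Matrix.isPositive_toEuclideanLin_iff, LinearMap.isPositive_iff_complex]
  intro v
  have e : inner ℂ (A.toEuclideanLin v) v = star (star v.ofLp ⬝ᵥ (A *ᵥ v.ofLp)) := by
    rw [EuclideanSpace.inner_eq_star_dotProduct, Matrix.star_dotProduct]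
    simp [Matrix.ofLp_toLpLin, Matrix.toLin'_apply, dotProduct_comm]
  have h1 := Complex.nonneg_iff.1 (star_nonneg_iff.2 (h v.ofLp))
  rw [← e] at h1
  refine ⟨?_, h1.1⟩
  apply Complex.ext
  · simp
  · simpa using h1.2

-- A dense sequence of vectors and continuity of the form exchange "for every vector, almost
-- everywhere" with "almost everywhere, for every vector".
open Matrix in
theorem ae_posSemidef_of_forall {σ : M → 𝕄}
    (h : ∀ v : Fin n → ℂ, ∀ᵐ x ∂μ, 0 ≤ star v ⬝ᵥ (σ x *ᵥ v)) : ∀ᵐ x ∂μ, (σ x).PosSemidef := by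
  have hall := ae_all_iff.2 fun j => h (TopologicalSpace.denseSeq (Fin n → ℂ) j)
  filter_upwards [hall] with x hx
  have hcl : IsClosed {v : Fin n → ℂ | 0 ≤ star v ⬝ᵥ (σ x *ᵥ v)} := by
    refine isClosed_le continuous_const ?_
    exact Continuous.dotProduct continuous_star (Continuous.matrix_mulVec continuous_const continuous_id)
  have hall : ∀ v, 0 ≤ star v ⬝ᵥ (σ x *ᵥ v) := fun v =>
    hcl.closure_subset_iff.2 (Set.range_subset_iff.2 hx) (TopologicalSpace.denseRange_denseSeq _ v)
  exact posSemidef_of_forall_nonneg hall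

open Matrix in
theorem IsAdjointImage.dotProduct_mulVec {ρ σ : M → 𝕄}
    (hρ : ∀ a b, Integrable (fun x => ρ x a b) μ) (h : IsAdjointImage μ P ρ σ) (v w : Fin n → ℂ) :
    IsAdj μ P (fun x => v ⬝ᵥ (ρ x *ᵥ w)) (fun x => v ⬝ᵥ (σ x *ᵥ w)) := by
  simp only [Matrix.mulVec, dotProduct]
  refine IsAdj.finset_sum _ (fun a _ => (integrable_finsetSum _ fun b _ =>
    (hρ a b).mul_const (w b)).const_mul (v a)) fun a _ => IsAdj.const_mul _ ?_
  refine IsAdj.finset_sum _ (fun b _ => (hρ a b).mul_const (w b)) fun b _ => ?_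
  simpa only [mul_comm] using (isAdjointImage_iff.1 h a b).const_mul (w b)

include hP

theorem IsAdjointImage.posSemidef {ρ σ : M → 𝕄} (hρ : ∀ a b, Integrable (fun x => ρ x a b) μ)
    (h : IsAdjointImage μ P ρ σ) (hpos : ∀ᵐ x ∂μ, (ρ x).PosSemidef) : ∀ᵐ x ∂μ, (σ x).PosSemidef :=
  ae_posSemidef_of_forall fun v => (h.dotProduct_mulVec hρ (star v) v).nonneg hP
    (hpos.mono fun _ hx => hx.dotProduct_mulVec_nonneg v)

omit hP in
theorem IsAdjointImage.sub {ρ σ ρ' σ' : M → 𝕄}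
    (hρ : ∀ a b, Integrable (fun x => ρ x a b) μ) (hρ' : ∀ a b, Integrable (fun x => ρ' x a b) μ)
    (h : IsAdjointImage μ P ρ σ) (h' : IsAdjointImage μ P ρ' σ') :
    IsAdjointImage μ P (fun x => ρ x - ρ' x) (fun x => σ x - σ' x) := fun a b =>
  (isAdjointImage_iff.1 h a b).sub (hρ a b) (hρ' a b) (isAdjointImage_iff.1 h' a b)

theorem IsAdjointImage.const (A : 𝕄) :
    IsAdjointImage μ P (fun _ => A) (fun _ => A) := fun a b => IsAdj.one hP (A a b)

/-- `P^†` preserves matrix-valued densities. -/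
theorem IsMatrixDensity.adjointImage {ρ σ : M → 𝕄} (hρ : IsMatrixDensity μ ρ)
    (h : IsAdjointImage μ P ρ σ) : IsMatrixDensity μ σ := by
  refine ⟨h.posSemidef hP hρ.integrable hρ.posSemidef, fun a b => (h a b).1, ?_⟩
  have h1 : IsAdj μ P (fun x => (ρ x).trace) (fun x => (σ x).trace) :=
    IsAdj.finset_sum _ (fun a _ => hρ.integrable a a) fun a _ => isAdjointImage_iff.1 h a a
  have h2 := h1.integral_eq (memLp_const (1 : ℂ))
  rw [integral_congr_ae ((hP.apply_const 1).mono fun x hx => by simp only [hx] :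
    (fun x => conj (markovApply P (fun _ => (1 : ℂ)) x) * (ρ x).trace) =ᵐ[μ]
      fun x => conj (1 : ℂ) * (ρ x).trace)] at h2
  simpa [hρ.trace_one] using h2

theorem IsUniformlyPositive.adjointImage
    {ρ σ : M → 𝕄} (hρi : ∀ a b, Integrable (fun x => ρ x a b) μ)
    (hρ : IsUniformlyPositive μ ρ) (h : IsAdjointImage μ P ρ σ) : IsUniformlyPositive μ σ := by
  obtain ⟨δ, hδ, hpos⟩ := hρ
  set A : 𝕄 := (δ : ℂ) • 1
  have h1 : IsAdjointImage μ P (fun x => ρ x - A) (fun x => σ x - A) :=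
    h.sub hρi (fun a b => integrable_const (A a b)) (IsAdjointImage.const hP A)
  exact ⟨δ, hδ, h1.posSemidef hP (fun a b => (hρi a b).sub (integrable_const (A a b))) hpos⟩

end Markov

omit hμ hX

/-! ### The sub-Laplacian and its resolvent on the graph. -/

theorem inner_graphSpace (x y : GraphSpace k μ) :
    inner ℂ x y = inner ℂ (x none) (y none) + ∑ i, inner ℂ (x (some i)) (y (some i)) := by
  rw [PiLp.inner_apply, Fintype.sum_option]

theorem norm_sq_graphSpace (x : GraphSpace k μ) :
    ‖x‖ ^ 2 = ‖x none‖ ^ 2 + ∑ i, ‖x (some i)‖ ^ 2 := by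
  rw [PiLp.norm_sq_eq_of_L2, Fintype.sum_option]

theorem inner_Lp_eq (f g : Lp ℂ 2 μ) : inner ℂ f g = ∫ x, conj (f x) * g x ∂μ := by
  rw [L2.inner_def]
  simp only [RCLike.inner_apply']

include hμ hX in
/-- The graph of the closed gradient determines the gradient. -/
theorem gradGraph_ext {x y : GraphSpace k μ} (hx : x ∈ gradGraph μ X) (hy : y ∈ gradGraph μ X)
    (h : x none = y none) : x = y := by
  have h1 := (isClosedGrad_of_mem hx).isWeakGrad hX
  have h2 := (isClosedGrad_of_mem hy).isWeakGrad hX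
  rw [h] at h1
  ext1 o
  rcases o with _ | i
  · exact h
  · exact Lp.ext (h1.ae_unique hμ hX h2 i)

/-- The vector `(h, 0)` of the graph space. -/
def graphEmbed (k : ℕ) (h : Lp ℂ 2 μ) : GraphSpace k μ :=
  WithLp.toLp 2 fun o => match o with
    | none => h
    | some _ => 0

theorem inner_graphEmbed (x : GraphSpace k μ) (h : Lp ℂ 2 μ) :
    inner ℂ x (graphEmbed k h) = inner ℂ (x none) h := by
  rw [inner_graphSpace]
  simp [graphEmbed]

/-- `x` is in the domain of the sub-Laplacian, with image `u`, tested on the closed gradient. -/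
def IsLaplaceGraph (μ : Measure M) [IsProbabilityMeasure μ] (X : Fin k → VField d M)
    (x : GraphSpace k μ) (u : Lp ℂ 2 μ) : Prop :=
  ∀ y ∈ gradGraph μ X, ∑ i, inner ℂ (y (some i)) (x (some i)) = -inner ℂ (y none) u

include hX

theorem IsLaplaceGraph.isSubLaplacian {x : GraphSpace k μ} {u : Lp ℂ 2 μ} (hx : x ∈ gradGraph μ X)
    (h : IsLaplaceGraph μ X x u) : IsSubLaplacian μ X (x none) u := by
  refine ⟨Lp.memLp u, _, isClosedGrad_of_mem hx, fun φ hφ => ?_⟩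
  have h1 := h _ ((hφ.isClosedGrad (μ := μ) hX).toGraph_mem hX)
  simp only [inner_Lp_eq] at h1
  convert h1 using 1
  · refine Finset.sum_congr rfl fun i _ => integral_congr_ae ?_
    filter_upwards [(hφ.isClosedGrad (μ := μ) hX).toGraph_some i] with x hx
    rw [hx]
  · congr 1
    refine integral_congr_ae ?_
    filter_upwards [(hφ.isClosedGrad (μ := μ) hX).toGraph_none] with x hx
    rw [hx]

theorem IsSubLaplacian.exists_graph {f u : M → ℂ} (h : IsSubLaplacian μ X f u) :
    ∃ x ∈ gradGraph μ X, x none =ᵐ[μ] f ∧ IsLaplaceGraph μ X x (h.1.toLp u) := by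
  obtain ⟨hu, G, hG, hlap⟩ := id h
  refine ⟨_, hG.toGraph_mem hX, hG.toGraph_none, fun y hy => ?_⟩
  have hcl : IsClosed {y : GraphSpace k μ | ∑ i, inner ℂ (y (some i)) (hG.toGraph (some i)) =
      -inner ℂ (y none) (hu.toLp u)} := by
    refine isClosed_eq (continuous_finsetSum _ fun i _ => ?_) ?_
    · exact (PiLp.continuous_apply 2 _ (some i)).inner continuous_const
    · exact ((PiLp.continuous_apply 2 _ none).inner continuous_const).neg
  refine hcl.closure_subset_iff.2 ?_ hy
  rintro w ⟨φ, hφ, h1, h2⟩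
  simp only [Set.mem_ofPred_eq, inner_Lp_eq]
  convert hlap φ hφ using 1
  · refine Finset.sum_congr rfl fun i _ => integral_congr_ae ?_
    filter_upwards [h2 i, hG.toGraph_some i] with x hx hx'
    rw [hx, hx']
  · congr 1
    refine integral_congr_ae ?_
    filter_upwards [h1, hu.coeFn_toLp] with x hx hx'
    rw [hx, hx']

noncomputable instance : CompleteSpace (gradGraph μ X) := isClosed_gradGraph.completeSpace_coe

omit hX

/-- `(1 - L)⁻¹ h` together with its gradient. -/
def graphResolvent (X : Fin k → VField d M) (h : Lp ℂ 2 μ) : GraphSpace k μ :=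
  (gradGraph μ X).starProjection (graphEmbed k h)

theorem graphResolvent_mem (h : Lp ℂ 2 μ) : graphResolvent X h ∈ gradGraph μ X :=
  Submodule.starProjection_apply_mem _ _

/-- The weak form of `(1 - L) x = h` says that `x` has the same inner products with the graph as
`(h, 0)`, so the resolvent is the orthogonal projection of `(h, 0)`. -/
theorem inner_graphResolvent {y : GraphSpace k μ} (hy : y ∈ gradGraph μ X) (h : Lp ℂ 2 μ) :
    inner ℂ y (graphResolvent X h) = inner ℂ (y none) h := by
  have h1 := Submodule.starProjection_inner_eq_zero (K := gradGraph μ X) (graphEmbed k h) y hy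
  have h2 : inner ℂ y (graphEmbed k h - graphResolvent X h) = 0 := by
    rw [← inner_conj_symm]
    exact (congrArg _ h1).trans (map_zero _)
  rw [inner_sub_right, sub_eq_zero, inner_graphEmbed] at h2
  exact h2.symm

theorem eq_graphResolvent {x : GraphSpace k μ} (hx : x ∈ gradGraph μ X) {h : Lp ℂ 2 μ}
    (H : ∀ y ∈ gradGraph μ X, inner ℂ y x = inner ℂ (y none) h) : x = graphResolvent X h := by
  have hm := sub_mem hx (graphResolvent_mem (X := X) h)
  have h1 : inner ℂ (x - graphResolvent X h) (x - graphResolvent X h) = (0 : ℂ) := by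
    rw [inner_sub_right, H _ hm, inner_graphResolvent hm, sub_self]
  exact sub_eq_zero.1 (inner_self_eq_zero.1 h1)

include hX hP

-- If `x = (1 - L)⁻¹ h`, then `L x = x - h`. Commutation gives `L P x = P x - P h`, so `P x` solves
-- the resolvent equation with datum `P h`, whose solution is unique.
include hPL in
theorem graphResolvent_commute (h : Lp ℂ 2 μ) :
    (graphResolvent X (markovExt P h)) none = markovExt P (graphResolvent X h none) := by
  have hm := graphResolvent_mem (X := X) h
  have h1 : IsLaplaceGraph μ X (graphResolvent X h) (graphResolvent X h none - h) := by
    intro y hy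
    have := inner_graphResolvent hy h
    rw [inner_graphSpace] at this
    rw [inner_sub_right, ← this]
    ring
  have h2 := hPL _ _ _ _ (h1.isSubLaplacian hX hm) (hP.isExtension _) (hP.isExtension _)
  obtain ⟨x, hx, hx0, hx1⟩ := h2.exists_graph hX
  have hx0' : x none = markovExt P (graphResolvent X h none) := Lp.ext hx0
  rw [← hx0']
  refine congrArg (fun z : GraphSpace k μ => z none) (eq_graphResolvent hx fun y hy => ?_).symm
  rw [inner_graphSpace, hx1 y hy, Lp.toLp_coeFn, map_sub, hx0', inner_sub_right]
  ring

/-! ### `P` as a bounded operator on the graph of `∇` -/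

include hC

-- Since `P Γ(f, f) ≥ 0`, enlarging the constant preserves the estimate; this makes nonnegative
-- constants available everywhere.
omit hX in
theorem GradientEstimate.max_zero :
    GradientEstimate μ X P (max C 0) := by
  intro f hf F S hF hS
  obtain ⟨G, hG, hle⟩ := hC f hf F S hF hS
  refine ⟨G, hG, ?_⟩
  have h0 : ∀ᵐ x ∂μ, 0 ≤ S x := by
    filter_upwards [hS] with x hx
    rw [hx]
    have : 0 ≤ carre X f x := Finset.sum_nonneg fun i _ => sq_nonneg _
    exact_mod_cast this
  filter_upwards [hle, hP.positive S h0] with x h1 h2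
  exact h1.trans (mul_le_mul_of_nonneg_right (le_max_left _ _) (Complex.nonneg_iff.1 h2).1)

omit hP hC in
theorem IsTest.memLp_carre (hf : IsTest d f) : MemLp (↟(carre X f)) ∞ μ := by
  have e : (↟(carre X f)) =
      fun x => ∑ i, conj (SubLaplacian.lieD (X i) f x) * SubLaplacian.lieD (X i) f x := by
    funext x
    simp only [carre, Complex.conj_mul']
    push_cast
    rfl
  rw [e]
  exact memLp_finsetSum _ fun i _ => memLp_top_mul (memLp_conj ((hf.lieD (hX i)).memLp _))
    ((hf.lieD (hX i)).memLp _)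

include hμ hL hC0

/-- `P Γ(f, f)` is bounded, hence so is the weak gradient of `P f`, and a bounded function with such
a gradient lies in the closed domain. The energy bound follows by integration, as `P` preserves `μ`.
-/
theorem GradientEstimate.exists_closedGrad (hf : IsTest d f) :
    ∃ G, IsClosedGrad μ X (markovApply P f) G ∧ (∀ᵐ x ∂μ, ∑ i, ‖G i x‖ ^ 2 ≤
      C * (markovApply P (↟(carre X f)) x).re) ∧
      ∑ i, ∫ x, ‖G i x‖ ^ 2 ∂μ ≤ C * ∑ i, ∫ x, ‖lieD (X i) f x‖ ^ 2 ∂μ := by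
  have hfm := hf.memLp (μ := μ) ∞
  have hcm := hf.memLp_carre (μ := μ) hX
  obtain ⟨G, hG, hle⟩ := hC f hf (hfm.toLp f) (hcm.toLp _) hfm.coeFn_toLp hcm.coeFn_toLp
  rw [← markovApply_def] at hG hle
  obtain ⟨c, hc0, hc⟩ := exists_bound_of_memLp_top
    (memLp_markovApply (P := P) (f := fun x => (carre X f x : ℂ)))
  have hGb : ∀ i, ∀ᵐ x ∂μ, ‖G i x‖ ≤ Real.sqrt (C * c) := fun i => by
    filter_upwards [hle, hc] with x h1 h2
    refine Real.le_sqrt_of_sq_le (le_trans (le_trans ?_ h1) (mul_le_mul_of_nonneg_left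
      ((Complex.re_le_norm _).trans h2) hC0))
    exact Finset.single_le_sum (f := fun i => ‖G i x‖ ^ 2) (fun i _ => sq_nonneg _)
      (Finset.mem_univ i)
  have hGm : ∀ i, MemLp (G i) ∞ μ := fun i => memLp_top_of_bound (hG.2 i).1.1 _ (hGb i)
  obtain ⟨c', -, hc'⟩ := exists_bound_of_memLp_top (memLp_markovApply (P := P) (f := f) (μ := μ))
  refine ⟨G, hG.isClosedGrad hμ hX hL hc' fun i => memLp_of_memLp_top (hGm i) 2, hle, ?_⟩
  have hci : Integrable (markovApply P (↟(carre X f))) μ := memLp_markovApply.integrable le_top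
  have hsq : ∀ g : M → ℂ, MemLp g ∞ μ → Integrable (fun x => ‖g x‖ ^ 2) μ := fun g hg =>
    (memLp_of_memLp_top hg 2).integrable_norm_pow (by norm_num)
  rw [← integral_finsetSum _ fun i _ => hsq _ (hGm i)]
  calc ∫ x, ∑ i, ‖G i x‖ ^ 2 ∂μ
      ≤ ∫ x, C * (markovApply P (↟(carre X f)) x).re ∂μ :=
        integral_mono_of_nonneg (ae_of_all _ fun x => Finset.sum_nonneg fun i _ => sq_nonneg _)
          (hci.re.const_mul C) hle
    _ = C * (∫ x, markovApply P (↟(carre X f)) x ∂μ).re := by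
        rw [integral_const_mul]; congr 1; exact integral_re hci
    _ = C * ∑ i, ∫ x, ‖lieD (X i) f x‖ ^ 2 ∂μ := by
        rw [hP.integral_apply hcm, integral_complex_ofReal, Complex.ofReal_re]
        congr 1
        exact integral_finsetSum _ fun i _ => hsq _ ((hf.lieD (hX i)).memLp _)

theorem exists_graphMap_test (x : testGraph μ X) :
    ∃ y : gradGraph μ X, y.1 none = markovExt P (x.1 none) ∧ ‖y‖ ≤ max 1 C * ‖x‖ := by
  obtain ⟨x, u, hu, h1, h2⟩ := x
  obtain ⟨G, hG, -, hle⟩ := hC.exists_closedGrad hμ hX hL hP hC0 hu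
  have hum := hu.memLp (μ := μ) ∞
  have e : markovExt P (x none) = hG.toGraph none := by
    have e1 : x none = inclTop μ (hum.toLp u) :=
      Lp.ext (h1.trans ((coeFn_inclTop _).trans hum.coeFn_toLp).symm)
    rw [e1, hP.markovExt_inclTop]
    refine Lp.ext ((coeFn_inclTop _).trans ?_)
    rw [← markovApply_def hum]
    exact hG.toGraph_none.symm
  refine ⟨⟨hG.toGraph, hG.toGraph_mem hX⟩, e.symm, ?_⟩
  have hm : (1 : ℝ) ≤ max 1 C := le_max_left _ _
  refine le_of_sq_le_sq ?_ (mul_nonneg (by positivity) (norm_nonneg _))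
  have key : ‖hG.toGraph‖ ^ 2 ≤ max 1 C * ‖x‖ ^ 2 := by
    rw [norm_sq_graphSpace, norm_sq_graphSpace, mul_add]
    refine add_le_add ?_ ?_
    · rw [← e]
      have : ‖markovExt P (x none)‖ ≤ 1 * ‖x none‖ :=
        LinearMap.norm_extendOfNorm_apply_le denseRange_inclTop 1 hP.norm_inclTop_le _
      rw [one_mul] at this
      calc ‖markovExt P (x none)‖ ^ 2 ≤ ‖x none‖ ^ 2 := pow_le_pow_left₀ (norm_nonneg _) this 2
        _ ≤ max 1 C * ‖x none‖ ^ 2 := le_mul_of_one_le_left (sq_nonneg _) hm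
    · have e1 : ∑ i, ‖hG.toGraph (some i)‖ ^ 2 = ∑ i, ∫ x, ‖G i x‖ ^ 2 ∂μ := by
        refine Finset.sum_congr rfl fun i _ => ?_
        rw [norm_sq_Lp]
        exact integral_congr_ae ((hG.toGraph_some i).mono fun z hz => by simp only [hz])
      have e2 : ∑ i, ‖x (some i)‖ ^ 2 = ∑ i, ∫ x, ‖lieD (X i) u x‖ ^ 2 ∂μ := by
        refine Finset.sum_congr rfl fun i _ => ?_
        rw [norm_sq_Lp]
        exact integral_congr_ae ((h2 i).mono fun z hz => by simp only [hz])
      rw [e1, e2]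
      exact hle.trans (mul_le_mul_of_nonneg_right (le_max_right _ _)
        (Finset.sum_nonneg fun i _ => integral_nonneg fun z => sq_nonneg _))
  show ‖hG.toGraph‖ ^ 2 ≤ (max 1 C * ‖x‖) ^ 2
  rw [mul_pow]
  exact key.trans (mul_le_mul_of_nonneg_right (le_self_pow₀ hm (by norm_num)) (sq_nonneg _))

theorem exists_graphMap :
    ∃ B : gradGraph μ X →L[ℂ] gradGraph μ X, ∀ x, (B x).1 none = markovExt P (x.1 none) := by
  choose T hT1 hT2 using exists_graphMap_test hμ hX hL hP hC0 hC
  -- An element of the graph is determined by its first component, where the map is the linear map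
  -- `P`; this yields linearity of the chosen lifts.
  have hext : ∀ y z : gradGraph μ X, y.1 none = z.1 none → y = z := fun y z h =>
    Subtype.ext (gradGraph_ext hμ hX y.2 z.2 h)
  let T' : testGraph μ X →ₗ[ℂ] gradGraph μ X :=
    { toFun := T
      map_add' := fun x y => hext _ _ (by
        show (T (x + y)).1 none = (T x).1 none + (T y).1 none
        rw [hT1, hT1, hT1, ← map_add]; rfl)
      map_smul' := fun c x => hext _ _ (by
        show (T (c • x)).1 none = c • (T x).1 none
        rw [hT1, hT1, ← map_smul]; rfl) }
  let e : testGraph μ X →ₗ[ℂ] gradGraph μ X := Submodule.inclusion (Submodule.le_topologicalClosure _)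
  have hd : DenseRange e := by
    rintro ⟨x, hx⟩
    obtain ⟨w, hw, hlim⟩ := mem_closure_iff_seq_limit.1 hx
    refine mem_closure_of_tendsto (f := fun j => e ⟨w j, hw j⟩) (b := atTop) ?_
      (Eventually.of_forall fun j => Set.mem_range_self _)
    exact tendsto_subtype_rng.2 hlim
  have hn : ∀ x, ‖T' x‖ ≤ max 1 C * ‖e x‖ := hT2
  refine ⟨T'.extendOfNorm e, fun x => ?_⟩
  have hcl : IsClosed {x : gradGraph μ X |
      (T'.extendOfNorm e x).1 none = markovExt P (x.1 none)} := by
    have h1 : Continuous fun x : gradGraph μ X => x.1 none :=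
      (PiLp.continuous_apply 2 _ none).comp continuous_subtype_val
    exact isClosed_eq (h1.comp (T'.extendOfNorm e).continuous) ((markovExt P).continuous.comp h1)
  refine hcl.closure_subset_iff.2 ?_ (hd x)
  rintro _ ⟨w, rfl⟩
  show (T'.extendOfNorm e (e w)).1 none = _
  rw [LinearMap.extendOfNorm_eq hd ⟨_, hn⟩]
  exact hT1 w

include hPL in
/-- `P^†` maps the domain of the closed gradient into itself, and
`⟨∇ P^† x, ∇ y⟩ = ⟨∇ x, ∇ P y⟩`. -/
theorem exists_adjoint_graph {x : GraphSpace k μ}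
    (hx : x ∈ gradGraph μ X) : ∃ z ∈ gradGraph μ X,
      z none = ContinuousLinearMap.adjoint (markovExt P) (x none) ∧
      ∀ y ∈ gradGraph μ X, ∃ w ∈ gradGraph μ X, w none = markovExt P (y none) ∧
        ∑ i, inner ℂ (y (some i)) (z (some i)) = ∑ i, inner ℂ (w (some i)) (x (some i)) := by
  obtain ⟨B, hB⟩ := exists_graphMap hμ hX hL hP hC0 hC
  set z := ContinuousLinearMap.adjoint B ⟨x, hx⟩ with hz
  have hadj : ∀ y : gradGraph μ X, inner ℂ y.1 z.1 = inner ℂ (B y).1 x := fun y => by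
    have := ContinuousLinearMap.adjoint_inner_right B y ⟨x, hx⟩
    exact this
  -- Pairing in the graph with `(1 - L)⁻¹ g` extracts the `L²` inner product of `g` with the first
  -- component. Because `B` sends this vector to `(1 - L)⁻¹ P g`, the first component of the graph
  -- adjoint is the `L²` adjoint.
  have h0 : z.1 none = ContinuousLinearMap.adjoint (markovExt P) (x none) := by
    refine ext_inner_left ℂ fun g => ?_
    have h1 := hadj ⟨_, graphResolvent_mem (X := X) g⟩
    have h2 : (B ⟨_, graphResolvent_mem (X := X) g⟩).1 = graphResolvent X (markovExt P g) :=
      gradGraph_ext hμ hX (B _).2 (graphResolvent_mem _)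
        ((hB _).trans (graphResolvent_commute hX hP hPL g).symm)
    rw [h2, ← inner_conj_symm, inner_graphResolvent z.2, ← inner_conj_symm (graphResolvent _ _),
      inner_graphResolvent hx, inner_conj_symm, inner_conj_symm] at h1
    rw [h1, ContinuousLinearMap.adjoint_inner_right]
  refine ⟨z.1, z.2, h0, fun y hy => ⟨(B ⟨y, hy⟩).1, (B _).2, hB _, ?_⟩⟩
  have h1 := hadj ⟨y, hy⟩
  -- The first components contribute equally to both graph inner products and cancel, leaving the
  -- gradient parts.
  rw [inner_graphSpace, inner_graphSpace, h0, hB, ContinuousLinearMap.adjoint_inner_right] at h1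
  exact add_left_cancel h1

/-! ### Gradient and sub-Laplacian of adjoint images. -/

section AdjointGradient
variable {r s u v f : M → ℂ} {F G : Fin k → M → ℂ}

omit hL hP hC0 hC

omit hμ hX in
theorem sum_integral_toGraph (hF : IsClosedGrad μ X f F) (hG : IsClosedGrad μ X r G) :
    ∑ i, inner ℂ (hF.toGraph (some i)) (hG.toGraph (some i)) =
      ∑ i, ∫ x, conj (F i x) * G i x ∂μ := by
  refine Finset.sum_congr rfl fun i _ => ?_
  rw [inner_Lp_eq]
  refine integral_congr_ae ?_
  filter_upwards [hF.toGraph_some i, hG.toGraph_some i] with x h1 h2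
  rw [h1, h2]

theorem IsSubLaplacian.sum_integral_eq (h : IsSubLaplacian μ X r u) (hG : IsClosedGrad μ X r G)
    (hF : IsClosedGrad μ X f F) :
    ∑ i, ∫ x, conj (F i x) * G i x ∂μ = -∫ x, conj (f x) * u x ∂μ := by
  obtain ⟨x, hx, hx0, hx1⟩ := h.exists_graph hX
  have e : x = hG.toGraph := gradGraph_ext hμ hX hx (hG.toGraph_mem hX)
    (Lp.ext (hx0.trans hG.toGraph_none.symm))
  have h1 := hx1 _ (hF.toGraph_mem hX)
  rw [e, sum_integral_toGraph, inner_Lp_eq] at h1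
  rw [h1]
  congr 1
  refine integral_congr_ae ?_
  filter_upwards [hF.toGraph_none, h.1.coeFn_toLp] with z h2 h3
  rw [h2, h3]

omit hμ hX

theorem IsSubLaplacian.congr (h : IsSubLaplacian μ X f u) (e : f =ᵐ[μ] r) (e' : u =ᵐ[μ] v) :
    IsSubLaplacian μ X r v := by
  obtain ⟨h1, G, hG, h2⟩ := h
  refine ⟨h1.ae_eq e', G, hG.congr e fun i => ae_eq_refl _, fun φ hφ => ?_⟩
  rw [h2 φ hφ]
  congr 1
  exact integral_congr_ae (e'.mono fun x hx => by simp only [hx])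

include hP

theorem IsAdj.toLp (hr : MemLp r 2 μ) (hs : IsAdj μ P r s) :
    s =ᵐ[μ] ContinuousLinearMap.adjoint (markovExt P) (hr.toLp r) := by
  have h1 := (IsAdj.of_L2 hP (hr.toLp r)).congr hr.coeFn_toLp (ae_eq_refl _)
  exact hs.ae_unique hP (hr.integrable (by norm_num)) h1

include hμ hX hL hC hPL

/-- `P^†` preserves the domain of the closed gradient. -/
theorem IsAdj.exists_closedGrad (hs : IsAdj μ P r s)
    (hr : IsClosedGrad μ X r G) : ∃ H, IsClosedGrad μ X s H ∧ ∀ φ, IsTest d φ → ∀ K,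
      IsClosedGrad μ X (markovApply P φ) K →
      ∑ i, ∫ x, conj (lieD (X i) φ x) * H i x ∂μ = ∑ i, ∫ x, conj (K i x) * G i x ∂μ := by
  obtain ⟨z, hz, hz0, hz1⟩ := exists_adjoint_graph hμ hX hL hP (le_max_right C 0)
    (hC.max_zero hP) hPL (hr.toGraph_mem hX)
  have e0 : z none =ᵐ[μ] s := by
    rw [hz0]
    refine Filter.EventuallyEq.trans ?_ (hs.toLp hP hr.1).symm
    rw [show hr.toGraph none = hr.1.toLp r from rfl]
  have hH := (isClosedGrad_of_mem hz).congr e0 fun i => ae_eq_refl _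
  refine ⟨_, hH, fun φ hφ K hK => ?_⟩
  have hφ' := hφ.isClosedGrad (μ := μ) hX
  obtain ⟨w, hw, hw0, hw1⟩ := hz1 _ (hφ'.toGraph_mem hX)
  have hφm := hφ.memLp (μ := μ) ∞
  have e1 : w = hK.toGraph := by
    refine gradGraph_ext hμ hX hw (hK.toGraph_mem hX) (Lp.ext ?_)
    refine Filter.EventuallyEq.trans ?_ hK.toGraph_none.symm
    have e2 : hφ'.toGraph none = inclTop μ (hφm.toLp φ) :=
      Lp.ext (hφ'.toGraph_none.trans ((coeFn_inclTop _).trans hφm.coeFn_toLp).symm)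
    rw [hw0, e2, hP.markovExt_inclTop, markovApply_def hφm]
    exact coeFn_inclTop _
  rw [e1, sum_integral_toGraph] at hw1
  rw [← hw1]
  refine Finset.sum_congr rfl fun i _ => ?_
  rw [inner_Lp_eq]
  refine integral_congr_ae ?_
  filter_upwards [hφ'.toGraph_some i] with x h1
  rw [h1]

/-- `P^†` preserves the domain of `L` and commutes with `L`. -/
theorem IsSubLaplacian.adj (h : IsSubLaplacian μ X r u)
    (hs : IsAdj μ P r s) (hv : IsAdj μ P u v) : IsSubLaplacian μ X s v := by
  obtain ⟨x, hx, hx0, hx1⟩ := h.exists_graph hX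
  obtain ⟨z, hz, hz0, hz1⟩ := exists_adjoint_graph hμ hX hL hP (le_max_right C 0)
    (hC.max_zero hP) hPL hx
  have hr : MemLp r 2 μ := (Lp.memLp (x none)).ae_eq hx0
  have e0 : z none =ᵐ[μ] s := by
    have e : x none = hr.toLp r := Lp.ext (hx0.trans hr.coeFn_toLp.symm)
    rw [hz0, e]
    exact (hs.toLp hP hr).symm
  have hl : IsLaplaceGraph μ X z (ContinuousLinearMap.adjoint (markovExt P) (h.1.toLp u)) := by
    intro y hy
    obtain ⟨w, hw, hw0, hw1⟩ := hz1 y hy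
    rw [hw1, hx1 w hw, hw0, ContinuousLinearMap.adjoint_inner_right]
  exact (hl.isSubLaplacian hX hz).congr e0 (hv.toLp hP h.1).symm

end AdjointGradient

omit hμ hX hL hP hC0 hC

/-! ### Scalar kernels and the logarithmic mean. -/

/-- `∫_0^∞ ds / ((a + s)(b + s))`. -/
def resKernel (a b : ℝ) : ℝ≥0∞ := ∫⁻ s in Set.Ioi (0 : ℝ), ENNReal.ofReal ((a + s)⁻¹ * (b + s)⁻¹)

/-- The inverse of the logarithmic mean of `a` and `b`. -/
def logKernel (a b : ℝ) : ℝ := ∫ w in Set.Ioc (0 : ℝ) 1, (w * a + (1 - w) * b)⁻¹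

section ScalarKernels
variable {a b : ℝ}

theorem convexComb_pos (ha : 0 < a) (hb : 0 < b) {w : ℝ} (hw : w ∈ Set.Icc (0 : ℝ) 1) :
    0 < w * a + (1 - w) * b := by
  have h1 : min a b ≤ w * a + (1 - w) * b := by
    nlinarith [min_le_left a b, min_le_right a b, hw.1, hw.2,
      mul_le_mul_of_nonneg_left (min_le_left a b) hw.1,
      mul_le_mul_of_nonneg_left (min_le_right a b) (sub_nonneg.2 hw.2)]
  exact (lt_min ha hb).trans_le h1

theorem continuousOn_convexComb_inv (ha : 0 < a) (hb : 0 < b) :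
    ContinuousOn (fun w : ℝ => (w * a + (1 - w) * b)⁻¹) (Set.Icc 0 1) :=
  ContinuousOn.inv₀ (by fun_prop) fun _ hw => (convexComb_pos ha hb hw).ne'

theorem integrableOn_convexComb_inv (ha : 0 < a) (hb : 0 < b) :
    IntegrableOn (fun w : ℝ => (w * a + (1 - w) * b)⁻¹) (Set.Ioc 0 1) :=
  ((continuousOn_convexComb_inv ha hb).integrableOn_Icc).mono_set Set.Ioc_subset_Icc_self

theorem logKernel_pos (ha : 0 < a) (hb : 0 < b) : 0 < logKernel a b := by
  have hm : 0 < max a b := lt_max_of_lt_left ha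
  have h1 : ∫ w in Set.Ioc (0 : ℝ) 1, (max a b)⁻¹ ≤ logKernel a b := by
    refine setIntegral_mono_on (by simp) (integrableOn_convexComb_inv ha hb) measurableSet_Ioc
      fun w hw => ?_
    have hw' := Set.Ioc_subset_Icc_self hw
    refine inv_anti₀ (convexComb_pos ha hb hw') ?_
    nlinarith [mul_le_mul_of_nonneg_left (le_max_left a b) hw'.1,
      mul_le_mul_of_nonneg_left (le_max_right a b) (sub_nonneg.2 hw'.2)]
  refine lt_of_lt_of_le ?_ h1
  simp
  exact Or.inl ha

theorem lintegral_Ioi_inv_sq {c : ℝ} (hc : 0 < c) :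
    ∫⁻ s in Set.Ioi (0 : ℝ), ENNReal.ofReal (((c + s) ^ 2)⁻¹) = ENNReal.ofReal c⁻¹ := by
  have hd : ∀ s ∈ Set.Ioi (0 : ℝ), HasDerivAt (fun s => -(c + s)⁻¹) (((c + s) ^ 2)⁻¹) s := by
    intro s hs
    have hs' : (0 : ℝ) < s := hs
    have := ((hasDerivAt_id s).const_add c).inv (by positivity : c + s ≠ 0)
    convert! this.neg using 1
    simp [neg_div]
  have hcont : ContinuousWithinAt (fun s => -(c + s)⁻¹) (Set.Ici (0 : ℝ)) 0 := by
    refine ContinuousAt.continuousWithinAt ?_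
    have : c + 0 ≠ 0 := by simpa using hc.ne'
    fun_prop (disch := assumption)
  have hlim : Tendsto (fun s : ℝ => -(c + s)⁻¹) atTop (𝓝 0) := by
    have := (tendsto_inv_atTop_zero.comp (tendsto_atTop_add_const_left atTop c tendsto_id)).neg
    simpa using this
  have hnn : ∀ s ∈ Set.Ioi (0 : ℝ), 0 ≤ ((c + s) ^ 2)⁻¹ := fun s _ => by positivity
  have h1 := integral_Ioi_of_hasDerivAt_of_nonneg hcont hd hnn hlim
  have h2 := integrableOn_Ioi_deriv_of_nonneg hcont hd hnn hlim
  rw [← ofReal_integral_eq_lintegral_ofReal h2 ((ae_restrict_iff' measurableSet_Ioi).2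
    (ae_of_all _ hnn)), h1]
  simp

theorem lintegral_convexComb_inv_sq (ha : 0 < a) (hb : 0 < b) :
    ∫⁻ w in Set.Ioc (0 : ℝ) 1, ENNReal.ofReal (((w * a + (1 - w) * b) ^ 2)⁻¹) =
      ENNReal.ofReal (a⁻¹ * b⁻¹) := by
  -- This antiderivative vanishes at `0` and involves no division by `a - b`, so the case `a = b`
  -- needs no separate treatment.
  have hd : ∀ w ∈ Set.uIcc (0 : ℝ) 1, HasDerivAt (fun w => w / (b * (w * a + (1 - w) * b)))
      (((w * a + (1 - w) * b) ^ 2)⁻¹) w := by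
    intro w hw
    rw [Set.uIcc_of_le zero_le_one] at hw
    have hp := convexComb_pos ha hb hw
    have h1 : HasDerivAt (fun w : ℝ => b * (w * a + (1 - w) * b)) (b * (1 * a + (0 - 1) * b)) w :=
      (((hasDerivAt_id w).mul_const a).add (((hasDerivAt_const w (1 : ℝ)).sub
        (hasDerivAt_id w)).mul_const b)).const_mul b
    convert! (hasDerivAt_id w).div h1 (by positivity) using 1
    simp only [id]
    field_simp
    ring
  have hc : ContinuousOn (fun w : ℝ => ((w * a + (1 - w) * b) ^ 2)⁻¹) (Set.Icc 0 1) :=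
    ContinuousOn.inv₀ (by fun_prop) fun _ hw => pow_ne_zero 2 (convexComb_pos ha hb hw).ne'
  have h1 := intervalIntegral.integral_eq_sub_of_hasDerivAt hd
    (by rw [← Set.uIcc_of_le (zero_le_one (α := ℝ))] at hc; exact hc.intervalIntegrable)
  rw [intervalIntegral.integral_of_le zero_le_one] at h1
  rw [← ofReal_integral_eq_lintegral_ofReal
    ((hc.integrableOn_Icc).mono_set Set.Ioc_subset_Icc_self)
    (ae_of_all _ fun w => by positivity), h1]
  congr 1
  field_simp
  ring

/-- Write `1 / ((a + s)(b + s))` as `∫_0^1 dw / (w a + (1 - w) b + s)²`, exchange the integrals, and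
integrate in `s` first. -/
theorem resKernel_eq_logKernel (ha : 0 < a) (hb : 0 < b) :
    resKernel a b = ENNReal.ofReal (logKernel a b) := by
  have e1 : resKernel a b = ∫⁻ s in Set.Ioi (0 : ℝ), ∫⁻ w in Set.Ioc (0 : ℝ) 1,
      ENNReal.ofReal (((w * a + (1 - w) * b + s) ^ 2)⁻¹) := by
    refine setLIntegral_congr_fun measurableSet_Ioi fun s hs => ?_
    have hs' : (0 : ℝ) < s := hs
    rw [← lintegral_convexComb_inv_sq (by positivity : 0 < a + s) (by positivity : 0 < b + s)]
    refine lintegral_congr fun w => ?_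
    congr 3
    ring
  rw [e1, lintegral_lintegral_swap]
  · have e2 : ∀ w ∈ Set.Ioc (0 : ℝ) 1, ∫⁻ s in Set.Ioi (0 : ℝ),
        ENNReal.ofReal (((w * a + (1 - w) * b + s) ^ 2)⁻¹) =
          ENNReal.ofReal ((w * a + (1 - w) * b)⁻¹) := fun w hw =>
      lintegral_Ioi_inv_sq (convexComb_pos ha hb (Set.Ioc_subset_Icc_self hw))
    rw [setLIntegral_congr_fun measurableSet_Ioc e2, logKernel,
      ofReal_integral_eq_lintegral_ofReal (integrableOn_convexComb_inv ha hb)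
      ((ae_restrict_iff' measurableSet_Ioc).2 (ae_of_all _ fun w hw =>
        (inv_pos.2 (convexComb_pos ha hb (Set.Ioc_subset_Icc_self hw))).le))]
  · refine Measurable.aemeasurable ?_
    unfold Function.uncurry
    fun_prop

theorem resKernel_mono {a' b' : ℝ} (ha : 0 ≤ a) (hb : 0 ≤ b) (haa : a ≤ a') (hbb : b ≤ b') :
    resKernel a' b' ≤ resKernel a b := by
  refine setLIntegral_mono' measurableSet_Ioi fun s hs => ENNReal.ofReal_le_ofReal ?_
  have hs' : (0 : ℝ) < s := hs
  have h1 : 0 ≤ (b' + s)⁻¹ := inv_nonneg.2 (by linarith)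
  gcongr

theorem le_resKernel (ha : 0 ≤ a) (hb : 0 ≤ b) {m : ℝ} (hm : 0 < m) (ham : a ≤ m) (hbm : b ≤ m) :
    ENNReal.ofReal m⁻¹ ≤ resKernel a b := by
  refine le_trans (le_of_eq ?_) (resKernel_mono ha hb ham hbm)
  rw [← lintegral_Ioi_inv_sq hm, resKernel]
  simp only [sq, mul_inv]

/-- The behaviour of `resKernel` under the Yosida approximation `a ↦ R a / (a + R)`. -/
theorem resKernel_yosida_le (ha : 0 ≤ a) (hb : 0 ≤ b) {R : ℝ} (hR : 0 < R) :
    ENNReal.ofReal ((R ^ 2 / ((a + R) * (b + R))) ^ 2) *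
      resKernel (R * a / (a + R)) (R * b / (b + R)) ≤ resKernel a b := by
  -- This substitution satisfies `R a / (a + R) + s = (R + s)(a + f s) / (a + R)`, which turns the
  -- kernel at the Yosida images into the kernel at `a` and `b`. Its image lies in `(0, ∞)`, and the
  -- surplus factor `R² / ((a + R)(b + R))` is at most one, so both effects go in the right
  -- direction.
  set f : ℝ → ℝ := fun s => s * R / (R + s) with hf
  have hfd : ∀ s ∈ Set.Ioi (0 : ℝ), HasDerivWithinAt f (R ^ 2 / (R + s) ^ 2) (Set.Ioi 0) s := by
    intro s hs
    have hs' : (0 : ℝ) < s := hs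
    have := ((hasDerivAt_id s).mul_const R).div ((hasDerivAt_id s).const_add R)
      (by simp only [id]; positivity)
    refine HasDerivAt.hasDerivWithinAt ?_
    convert! this using 1
    simp only [id]
    congr 1
    ring
  have hinj : Set.InjOn f (Set.Ioi 0) := by
    intro s hs t ht hst
    have hs' : (0 : ℝ) < s := hs
    have ht' : (0 : ℝ) < t := ht
    simp only [hf] at hst
    rw [div_eq_div_iff (by positivity) (by positivity)] at hst
    have : R ^ 2 * (s - t) = 0 := by linear_combination hst
    rcases mul_eq_zero.1 this with h | h
    · exact absurd h (by positivity)
    · linarith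
  have hsub : f '' Set.Ioi 0 ⊆ Set.Ioi 0 := by
    rintro _ ⟨s, hs, rfl⟩
    have hs' : (0 : ℝ) < s := hs
    exact show 0 < s * R / (R + s) by positivity
  have h1 : ∫⁻ s in Set.Ioi (0 : ℝ), ENNReal.ofReal |R ^ 2 / (R + s) ^ 2| *
      ENNReal.ofReal ((a + f s)⁻¹ * (b + f s)⁻¹) ≤ resKernel a b := by
    have h0 := lintegral_image_eq_lintegral_abs_deriv_mul measurableSet_Ioi hfd hinj
      fun t => ENNReal.ofReal ((a + t)⁻¹ * (b + t)⁻¹)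
    rw [← h0]
    exact lintegral_mono_set hsub
  refine le_trans ?_ h1
  unfold resKernel
  rw [← lintegral_const_mul' _ _ ENNReal.ofReal_ne_top]
  refine setLIntegral_mono' measurableSet_Ioi fun s hs => ?_
  have hs' : (0 : ℝ) < s := hs
  rw [← ENNReal.ofReal_mul (by positivity), ← ENNReal.ofReal_mul (by positivity)]
  refine ENNReal.ofReal_le_ofReal ?_
  rw [abs_of_pos (by positivity)]
  have hfs : 0 < f s := show 0 < s * R / (R + s) by positivity
  have ea : R * a / (a + R) + s = (R + s) * (a + f s) / (a + R) := by
    simp only [hf]; field_simp; ring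
  have eb : R * b / (b + R) + s = (R + s) * (b + f s) / (b + R) := by
    simp only [hf]; field_simp; ring
  have hle : R ^ 2 / ((a + R) * (b + R)) ≤ 1 := by
    rw [div_le_one (by positivity)]; nlinarith [mul_nonneg ha hb]
  have e : (R ^ 2 / ((a + R) * (b + R))) ^ 2 *
      ((R * a / (a + R) + s)⁻¹ * (R * b / (b + R) + s)⁻¹) =
      (R ^ 2 / ((a + R) * (b + R))) * (R ^ 2 / (R + s) ^ 2 * ((a + f s)⁻¹ * (b + f s)⁻¹)) := by
    rw [ea, eb]
    field_simp
  rw [e]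
  exact mul_le_of_le_one_left (by positivity) hle

end ScalarKernels

/-! ### Matrices in an eigenbasis. -/

open Matrix

/-- The matrix with eigenvalues `a` and eigenvectors the columns of `U`. -/
def diagConj (U : 𝕄) (a : Fin n → ℝ) : 𝕄 := U * diagonal (fun i => (a i : ℂ)) * Uᴴ

/-- The matrix `G` in the basis of the columns of `U`. -/
def rot (U G : 𝕄) : 𝕄 := Uᴴ * G * U

/-- The square of the Hilbert–Schmidt norm. -/
def hsNormSq (G : 𝕄) : ℝ := ∑ j, ∑ k, ‖G j k‖ ^ 2

variable {U A G H : Matrix (Fin n) (Fin n) ℂ} {a b : Fin n → ℝ} {w δ m R ε : ℝ}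

variable (hU : U ∈ Matrix.unitaryGroup (Fin n) ℂ) (hb : ∀ i, 0 < b i)

include hU

theorem unitary_mul : Uᴴ * U = 1 := (mem_unitaryGroup_iff').1 hU

theorem unitary_mul' : U * Uᴴ = 1 := (mem_unitaryGroup_iff).1 hU

omit hU in
theorem exists_diagConj {A : 𝕄} (hA : A.IsHermitian) :
    ∃ U ∈ 𝕌, ∃ a : Fin n → ℝ, A = diagConj U a ∧ ∀ f : ℝ → ℝ, cfc f A = diagConj U (f ∘ a) := by
  refine ⟨hA.eigenvectorUnitary, SetLike.coe_mem _, hA.eigenvalues, ?_, fun f => ?_⟩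
  · conv_lhs => rw [hA.spectral_theorem, Unitary.conjStarAlgAut_apply]
    rfl
  · rw [Matrix.IsHermitian.cfc_eq hA, Matrix.IsHermitian.cfc, Unitary.conjStarAlgAut_apply]
    rfl

theorem diagConj_mul :
    diagConj U a * diagConj U b = diagConj U (fun i => a i * b i) := by
  unfold diagConj
  calc U * diagonal (fun i => (a i : ℂ)) * Uᴴ * (U * diagonal (fun i => (b i : ℂ)) * Uᴴ)
      = U * diagonal (fun i => (a i : ℂ)) * (Uᴴ * U) * diagonal (fun i => (b i : ℂ)) * Uᴴ := by
        simp only [Matrix.mul_assoc]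
    _ = _ := by
        rw [unitary_mul hU, Matrix.mul_one, Matrix.mul_assoc U, diagonal_mul_diagonal]
        push_cast
        rfl

theorem diagConj_const (c : ℝ) : diagConj U (fun _ => c) = (c : ℂ) • 1 := by
  unfold diagConj
  rw [← smul_one_eq_diagonal, Matrix.mul_smul, Matrix.mul_one, Matrix.smul_mul, unitary_mul' hU]

omit hU

theorem diagConj_add : diagConj U a + diagConj U b = diagConj U (fun i => a i + b i) := by
  unfold diagConj
  rw [← Matrix.add_mul, ← Matrix.mul_add, diagonal_add]
  push_cast
  rfl

theorem diagConj_smul (c : ℝ) : (c : ℂ) • diagConj U a = diagConj U (fun i => c * a i) := by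
  unfold diagConj
  rw [← Matrix.smul_mul, ← Matrix.mul_smul, ← diagonal_smul]
  congr 3
  funext i
  simp

include hU

theorem diagConj_add_const (c : ℝ) :
    diagConj U a + (c : ℂ) • 1 = diagConj U (fun i => a i + c) := by
  rw [← diagConj_const hU, diagConj_add]

theorem diagConj_inv (ha : ∀ i, a i ≠ 0) : (diagConj U a)⁻¹ = diagConj U (fun i => (a i)⁻¹) := by
  refine Matrix.inv_eq_right_inv ?_
  rw [diagConj_mul hU, show (fun i => a i * (a i)⁻¹) = fun _ => (1 : ℝ) from
    funext fun i => mul_inv_cancel₀ (ha i), diagConj_const hU]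
  simp

theorem diagConj_resolvent (ha : ∀ i, 0 ≤ a i) {s : ℝ} (hs : 0 < s) :
    (diagConj U a + (s : ℂ) • 1)⁻¹ = diagConj U (fun i => (a i + s)⁻¹) := by
  rw [diagConj_add_const hU, diagConj_inv hU fun i => by have := ha i; positivity]

omit hU in
theorem diagConj_conjTranspose : (diagConj U a)ᴴ = diagConj U a := by
  unfold diagConj
  rw [conjTranspose_mul, conjTranspose_mul, conjTranspose_conjTranspose, diagonal_conjTranspose,
    Matrix.mul_assoc]
  congr 3
  funext i
  simp

theorem mul_rot_mul (G : 𝕄) : U * rot U G * Uᴴ = G := by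
  unfold rot
  calc U * (Uᴴ * G * U) * Uᴴ = (U * Uᴴ) * G * (U * Uᴴ) := by simp only [Matrix.mul_assoc]
    _ = G := by rw [unitary_mul' hU, Matrix.one_mul, Matrix.mul_one]

theorem rot_mul (G H : 𝕄) : rot U (G * H) = rot U G * rot U H := by
  unfold rot
  calc Uᴴ * (G * H) * U = Uᴴ * G * 1 * H * U := by simp only [Matrix.mul_assoc, Matrix.one_mul]
    _ = _ := by rw [← unitary_mul' hU]; simp only [Matrix.mul_assoc]

omit hU

theorem rot_add (G H : 𝕄) : rot U (G + H) = rot U G + rot U H := by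
  unfold rot; rw [Matrix.mul_add, Matrix.add_mul]

theorem rot_smul (c : ℂ) (G : 𝕄) : rot U (c • G) = c • rot U G := by
  unfold rot; rw [Matrix.mul_smul, Matrix.smul_mul]

theorem rot_conjTranspose (G : 𝕄) : rot U Gᴴ = (rot U G)ᴴ := by
  unfold rot
  rw [conjTranspose_mul, conjTranspose_mul, conjTranspose_conjTranspose, Matrix.mul_assoc]

include hU

theorem rot_diagConj :
    rot U (diagConj U a) = diagonal (fun i => (a i : ℂ)) := by
  unfold rot diagConj
  calc Uᴴ * (U * diagonal (fun i => (a i : ℂ)) * Uᴴ) * U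
      = (Uᴴ * U) * diagonal (fun i => (a i : ℂ)) * (Uᴴ * U) := by simp only [Matrix.mul_assoc]
    _ = _ := by rw [unitary_mul hU, Matrix.one_mul, Matrix.mul_one]

omit hU in
theorem rot_apply (G : 𝕄) (j k : Fin n) : rot U G j k = ∑ q, ∑ p, conj (U p j) * G p q * U q k := by
  simp only [rot, Matrix.mul_apply, conjTranspose_apply, Finset.sum_mul]
  rfl

theorem trace_rot (G : 𝕄) : (rot U G).trace = G.trace := by
  unfold rot
  rw [trace_mul_comm, ← Matrix.mul_assoc, unitary_mul' hU, Matrix.one_mul]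

theorem trace_diagConj_mul (V G : 𝕄) :
    (Vᴴ * diagConj U a * G * diagConj U b).trace =
      ∑ j, ∑ k, ((a j * b k : ℝ) : ℂ) * (conj (rot U V j k) * rot U G j k) := by
  rw [← trace_rot hU, rot_mul hU, rot_mul hU, rot_mul hU, rot_conjTranspose, rot_diagConj hU,
    rot_diagConj hU]
  simp only [trace, diag, mul_diagonal]
  have h : ∀ k, ((rot U V)ᴴ * diagonal (fun i => (a i : ℂ)) * rot U G) k k =
      ∑ j, conj (rot U V j k) * (a j : ℂ) * rot U G j k := fun k => by
    rw [Matrix.mul_apply]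
    refine Finset.sum_congr rfl fun j _ => ?_
    rw [mul_diagonal, conjTranspose_apply, RCLike.star_def]
  simp only [h, Finset.sum_mul]
  rw [Finset.sum_comm]
  refine Finset.sum_congr rfl fun j _ => Finset.sum_congr rfl fun k _ => ?_
  push_cast
  ring

theorem trace_conjTranspose_mul_eq_rot (V G : 𝕄) :
    (Vᴴ * G).trace = ∑ j, ∑ k, conj (rot U V j k) * rot U G j k := by
  have := trace_diagConj_mul (a := fun _ => 1) (b := fun _ => 1) hU V G
  rw [diagConj_const hU] at this
  simpa using this

omit hU

theorem trace_conjTranspose_mul (V G : 𝕄) : (Vᴴ * G).trace = ∑ j, ∑ k, conj (V j k) * G j k := by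
  have := trace_conjTranspose_mul_eq_rot (U := 1) (one_mem _) V G
  simpa [rot] using this

theorem conj_mul_self_eq (z : ℂ) : conj z * z = ((‖z‖ ^ 2 : ℝ) : ℂ) := by
  rw [Complex.conj_mul']; push_cast; rfl

include hU

theorem trace_diagConj_self (G : 𝕄) :
    (Gᴴ * diagConj U a * G * diagConj U b).trace.re = ∑ j, ∑ k, a j * b k * ‖rot U G j k‖ ^ 2 := by
  rw [trace_diagConj_mul hU]
  simp only [conj_mul_self_eq, ← Complex.ofReal_mul, ← Complex.ofReal_sum, Complex.ofReal_re]

theorem hsNormSq_rot (G : 𝕄) : hsNormSq (rot U G) = hsNormSq G := by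
  have h1 := trace_conjTranspose_mul_eq_rot hU G G
  rw [trace_conjTranspose_mul] at h1
  simp only [conj_mul_self_eq, ← Complex.ofReal_sum] at h1
  exact (Complex.ofReal_injective h1).symm

omit hU

theorem norm_sq_le_hsNormSq (G : 𝕄) (j k : Fin n) : ‖G j k‖ ^ 2 ≤ hsNormSq G :=
  (Finset.single_le_sum (f := fun k => ‖G j k‖ ^ 2) (fun _ _ => sq_nonneg _)
    (Finset.mem_univ k)).trans (Finset.single_le_sum (f := fun j => ∑ k, ‖G j k‖ ^ 2)
    (fun _ _ => Finset.sum_nonneg fun _ _ => sq_nonneg _) (Finset.mem_univ j))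

theorem hsNormSq_nonneg (G : 𝕄) : 0 ≤ hsNormSq G :=
  Finset.sum_nonneg fun _ _ => Finset.sum_nonneg fun _ _ => sq_nonneg _

include hU

theorem PosSemidef_diagConj_iff :
    (diagConj U a).PosSemidef ↔ ∀ i, 0 ≤ a i := by
  constructor
  · intro h i
    have h1 := h.conjTranspose_mul_mul_same U
    have h2 : Uᴴ * diagConj U a * U = diagonal (fun i => (a i : ℂ)) := rot_diagConj hU
    rw [h2, posSemidef_diagonal_iff] at h1
    exact_mod_cast h1 i
  · intro h
    exact (PosSemidef.diagonal (d := fun i => (a i : ℂ)) fun i =>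
      show (0 : ℂ) ≤ (a i : ℂ) by exact_mod_cast h i).mul_mul_conjTranspose_same U

theorem PosSemidef_diagConj_sub_iff {δ : ℝ} :
    (diagConj U a - (δ : ℂ) • 1).PosSemidef ↔ ∀ i, δ ≤ a i := by
  have : diagConj U a - (δ : ℂ) • 1 = diagConj U (fun i => a i + -δ) := by
    rw [← diagConj_add_const hU]; push_cast; rw [neg_smul, sub_eq_add_neg]
  rw [this, PosSemidef_diagConj_iff hU]
  exact forall_congr' fun i => by rw [← sub_eq_add_neg, sub_nonneg]

theorem trace_diagConj : (diagConj U a).trace = ((∑ i, a i : ℝ) : ℂ) := by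
  rw [← trace_rot hU, rot_diagConj hU, trace_diagonal]
  push_cast
  rfl

/-! ### The density of the Fisher information -/

omit hU in
/-- The density of the Fisher information at a point. -/
def fisherDensity (A G : 𝕄) : ℝ≥0∞ :=
  ∫⁻ s in Set.Ioi (0 : ℝ), ENNReal.ofReal
    ((Gᴴ * (A + (s : ℂ) • 1)⁻¹ * G * (A + (s : ℂ) • 1)⁻¹).trace.re)

/-- In an eigenbasis of `A` the resolvents are diagonal, so the integral over `s` falls on the
scalar kernel of each pair of eigenvalues. Zero eigenvalues are allowed, which is why the kernel
takes values in `[0, ∞]`. -/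
theorem fisherDensity_diagConj (ha : ∀ i, 0 ≤ a i) (G : 𝕄) :
    fisherDensity (diagConj U a) G =
      ∑ j, ∑ k, resKernel (a j) (a k) * ENNReal.ofReal (‖rot U G j k‖ ^ 2) := by
  unfold fisherDensity resKernel
  simp only [← lintegral_mul_const' _ _ ENNReal.ofReal_ne_top]
  rw [setLIntegral_congr_fun (g := fun s => ∑ j, ∑ k, ENNReal.ofReal ((a j + s)⁻¹ * (a k + s)⁻¹) *
    ENNReal.ofReal (‖rot U G j k‖ ^ 2)) measurableSet_Ioi]
  · rw [lintegral_finsetSum _ fun j _ => Finset.measurable_fun_sum _ fun k _ => by fun_prop]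
    refine Finset.sum_congr rfl fun j _ => ?_
    rw [lintegral_finsetSum _ fun k _ => by fun_prop]
  · intro s hs
    have hs' : (0 : ℝ) < s := hs
    have hp : ∀ i, 0 ≤ (a i + s)⁻¹ := fun i => by have := ha i; positivity
    simp only
    rw [diagConj_resolvent hU ha hs', trace_diagConj_self hU,
      ENNReal.ofReal_sum_of_nonneg fun j _ => Finset.sum_nonneg fun k _ =>
        mul_nonneg (mul_nonneg (hp j) (hp k)) (sq_nonneg _)]
    refine Finset.sum_congr rfl fun j _ => ?_
    rw [ENNReal.ofReal_sum_of_nonneg fun k _ => mul_nonneg (mul_nonneg (hp j) (hp k)) (sq_nonneg _)]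
    exact Finset.sum_congr rfl fun k _ => ENNReal.ofReal_mul (mul_nonneg (hp j) (hp k))

theorem fisherDensity_diagConj_of_pos (ha : ∀ i, 0 < a i)
    (G : 𝕄) : fisherDensity (diagConj U a) G =
      ENNReal.ofReal (∑ j, ∑ k, logKernel (a j) (a k) * ‖rot U G j k‖ ^ 2) := by
  have hp : ∀ j k, 0 ≤ logKernel (a j) (a k) * ‖rot U G j k‖ ^ 2 := fun j k =>
    mul_nonneg (logKernel_pos (ha j) (ha k)).le (sq_nonneg _)
  rw [fisherDensity_diagConj hU fun i => (ha i).le,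
    ENNReal.ofReal_sum_of_nonneg fun j _ => Finset.sum_nonneg fun k _ => hp j k]
  refine Finset.sum_congr rfl fun j _ => ?_
  rw [ENNReal.ofReal_sum_of_nonneg fun k _ => hp j k]
  refine Finset.sum_congr rfl fun k _ => ?_
  rw [resKernel_eq_logKernel (ha j) (ha k), ENNReal.ofReal_mul (logKernel_pos (ha j) (ha k)).le]

/-! ### The Sylvester operator `X ↦ w B X + (1 - w) X B` -/

omit hU

/-- The matrix of `X ↦ w B X + (1 - w) X B`. -/
def sylvMatrix (w : ℝ) (B : 𝕄) : Matrix (Fin n × Fin n) (Fin n × Fin n) ℂ :=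
  Matrix.of fun p q => (w : ℂ) * B p.1 q.1 * (if p.2 = q.2 then 1 else 0) +
    (1 - w : ℂ) * (if p.1 = q.1 then 1 else 0) * B q.2 p.2

/-- The solution `X` of `w B X + (1 - w) X B = H`. -/
def sylv (w : ℝ) (B H : 𝕄) : 𝕄 :=
  Matrix.of fun i j => ((sylvMatrix w B)⁻¹ *ᵥ fun p => H p.1 p.2) (i, j)

theorem sylvMatrix_mulVec (w : ℝ) (B Y : 𝕄) (i j : Fin n) :
    (sylvMatrix w B *ᵥ fun p => Y p.1 p.2) (i, j) =
      ((w : ℂ) • (B * Y) + (1 - w : ℂ) • (Y * B)) i j := by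
  simp only [mulVec, dotProduct, sylvMatrix, of_apply, add_mul, Finset.sum_add_distrib,
    Fintype.sum_prod_type, Matrix.add_apply, Matrix.smul_apply, smul_eq_mul, Matrix.mul_apply,
    Finset.mul_sum]
  congr 1
  · refine Finset.sum_congr rfl fun l _ => ?_
    simp [mul_assoc]
  · rw [Finset.sum_comm]
    refine Finset.sum_congr rfl fun l _ => ?_
    simp [mul_assoc, mul_comm]
    ring

include hU

theorem rot_sylvester (Y : 𝕄) (j k : Fin n) :
    rot U ((w : ℂ) • (diagConj U b * Y) + (1 - w : ℂ) • (Y * diagConj U b)) j k =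
      ((w * b j + (1 - w) * b k : ℝ) : ℂ) * rot U Y j k := by
  rw [rot_add, rot_smul, rot_smul, rot_mul hU, rot_mul hU, rot_diagConj hU]
  simp only [Matrix.add_apply, Matrix.smul_apply, smul_eq_mul, diagonal_mul, mul_diagonal]
  push_cast
  ring

theorem eq_of_rot_eq {G H : 𝕄} (h : rot U G = rot U H) : G = H := by
  rw [← mul_rot_mul hU G, h, mul_rot_mul hU]

-- In an eigenbasis of `B` the Sylvester operator multiplies the entry `(j, k)` by `w b j + (1 - w)
-- b k > 0`. It is thus injective, its determinant is nonzero, and the solution is explicit.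
include hb in
theorem rot_sylv (hw : w ∈ Set.Icc (0 : ℝ) 1)
    (H : 𝕄) (j k : Fin n) : rot U (sylv w (diagConj U b) H) j k =
      (((w * b j + (1 - w) * b k)⁻¹ : ℝ) : ℂ) * rot U H j k := by
  have hc : ∀ j k, ((w * b j + (1 - w) * b k : ℝ) : ℂ) ≠ 0 := fun j k => by
    exact_mod_cast (convexComb_pos (hb j) (hb k) hw).ne'
  have hdet : (sylvMatrix w (diagConj U b)).det ≠ 0 := by
    intro h0
    obtain ⟨v, hv, hv0⟩ := Matrix.exists_mulVec_eq_zero_iff.2 h0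
    refine hv ?_
    set Y : 𝕄 := Matrix.of fun i j => v (i, j)
    have h1 : (w : ℂ) • (diagConj U b * Y) + (1 - w : ℂ) • (Y * diagConj U b) = 0 := by
      ext i j
      rw [← sylvMatrix_mulVec]
      exact congrFun hv0 (i, j)
    have h2 : rot U Y = rot U 0 := by
      ext j k
      have h3 := rot_sylvester (w := w) (b := b) hU Y j k
      rw [h1] at h3
      have h4 : rot U (0 : 𝕄) j k = 0 := by simp [rot]
      rw [h4] at h3 ⊢
      exact (mul_eq_zero.1 h3.symm).resolve_left (hc j k)
    have h3 := eq_of_rot_eq hU h2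
    funext p
    exact congrFun (congrFun h3 p.1) p.2
  have h1 : (w : ℂ) • (diagConj U b * sylv w (diagConj U b) H) +
      (1 - w : ℂ) • (sylv w (diagConj U b) H * diagConj U b) = H := by
    ext i j
    rw [← sylvMatrix_mulVec]
    have : (fun p : Fin n × Fin n => sylv w (diagConj U b) H p.1 p.2) =
        (sylvMatrix w (diagConj U b))⁻¹ *ᵥ fun p => H p.1 p.2 := rfl
    rw [this, mulVec_mulVec, Matrix.mul_nonsing_inv _ (isUnit_iff_ne_zero.2 hdet), one_mulVec]
  have h2 := rot_sylvester (w := w) (b := b) hU (sylv w (diagConj U b) H) j k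
  rw [h1] at h2
  rw [h2, ← mul_assoc, Complex.ofReal_inv, inv_mul_cancel₀ (hc j k), one_mul]

omit hU in
/-- The quadratic form `tr(A (w v v* + (1 - w) v* v))`. -/
def sylvCost (w : ℝ) (A v : 𝕄) : ℝ := w * (vᴴ * A * v).trace.re + (1 - w) * (v * A * vᴴ).trace.re

theorem sylvCost_diagConj (v : 𝕄) :
    sylvCost w (diagConj U a) v = ∑ j, ∑ k, (w * a j + (1 - w) * a k) * ‖rot U v j k‖ ^ 2 := by
  have h1 := trace_diagConj_self (a := a) (b := fun _ => 1) hU v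
  have h2 := trace_diagConj_self (a := fun _ => 1) (b := a) hU v
  rw [diagConj_const hU] at h1 h2
  simp only [Complex.ofReal_one, one_smul, Matrix.mul_one] at h1 h2
  have h3 : (v * diagConj U a * vᴴ).trace = (vᴴ * v * diagConj U a).trace := by
    rw [trace_mul_comm, Matrix.mul_assoc]
  unfold sylvCost
  rw [h3, h1, h2, Finset.mul_sum, Finset.mul_sum, ← Finset.sum_add_distrib]
  refine Finset.sum_congr rfl fun j _ => ?_
  rw [Finset.mul_sum, Finset.mul_sum, ← Finset.sum_add_distrib]
  exact Finset.sum_congr rfl fun k _ => by ring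

/-! ### Measurability of matrix operations. -/

section Measurability
variable {ι α : Type*} [Fintype ι] [MeasurableSpace α]

omit hU

theorem measurable_mul_apply {A B : α → Matrix ι ι ℂ} (hA : ∀ i j, Measurable fun x => A x i j)
    (hB : ∀ i j, Measurable fun x => B x i j) (i j : ι) : Measurable fun x => (A x * B x) i j := by
  simp only [Matrix.mul_apply]
  exact Finset.measurable_fun_sum _ fun l _ => (hA i l).mul (hB l j)

theorem measurable_trace {A : α → Matrix ι ι ℂ} (hA : ∀ i j, Measurable fun x => A x i j) :
    Measurable fun x => (A x).trace := by
  simp only [trace, diag]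
  exact Finset.measurable_fun_sum _ fun l _ => hA l l

theorem measurable_conjTranspose_apply {A : α → Matrix ι ι ℂ}
    (hA : ∀ i j, Measurable fun x => A x i j) (i j : ι) : Measurable fun x => (A x)ᴴ i j := by
  simp only [conjTranspose_apply, RCLike.star_def]
  exact Complex.continuous_conj.measurable.comp (hA j i)

theorem measurable_det [DecidableEq ι] {A : α → Matrix ι ι ℂ}
    (hA : ∀ i j, Measurable fun x => A x i j) : Measurable fun x => (A x).det := by
  simp only [Matrix.det_apply']
  exact Finset.measurable_fun_sum _ fun p _ =>
    measurable_const.mul (Finset.measurable_fun_prod _ fun i _ => hA _ _)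

theorem measurable_inv_apply [DecidableEq ι] {A : α → Matrix ι ι ℂ}
    (hA : ∀ i j, Measurable fun x => A x i j) (i j : ι) : Measurable fun x => (A x)⁻¹ i j := by
  simp only [Matrix.inv_def, Matrix.smul_apply, smul_eq_mul, Ring.inverse_eq_inv']
  refine (measurable_det hA).inv.mul ?_
  simp only [Matrix.adjugate_apply]
  refine measurable_det fun p q => ?_
  simp only [Matrix.updateRow_apply]
  split_ifs
  · exact measurable_const
  · exact hA p q

end Measurability

omit hU

/-! ### Averaging over the Sylvester parameter. -/

/-- The entrywise integral of a matrix-valued function. -/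
def matInt (ν : Measure ℝ) (f : ℝ → 𝕄) :
    𝕄 := Matrix.of fun i j => ∫ w, f w i j ∂ν

theorem rot_matInt {ν : Measure ℝ} {f : ℝ → 𝕄} (hf : ∀ i j, Integrable (fun w => f w i j) ν)
    (j l : Fin n) : rot U (matInt ν f) j l = ∫ w, rot U (f w) j l ∂ν := by
  simp only [rot_apply, matInt, of_apply]
  rw [integral_finsetSum _ fun q _ => integrable_finsetSum _ fun p _ =>
    ((hf p q).const_mul _).mul_const _]
  refine Finset.sum_congr rfl fun q _ => ?_
  rw [integral_finsetSum _ fun p _ => ((hf p q).const_mul _).mul_const _]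
  refine Finset.sum_congr rfl fun p _ => ?_
  rw [integral_mul_const, integral_const_mul]

theorem trace_mul_matInt {ν : Measure ℝ} {f : ℝ → 𝕄} (hf : ∀ i j, Integrable (fun w => f w i j) ν)
    (A : 𝕄) : (A * matInt ν f).trace = ∫ w, (A * f w).trace ∂ν := by
  simp only [trace, diag, Matrix.mul_apply, matInt, of_apply]
  refine (Eq.trans (integral_finsetSum _ fun i _ => integrable_finsetSum _ fun p _ =>
    (hf p i).const_mul (A i p)) ?_).symm
  refine Finset.sum_congr rfl fun q _ => ?_
  refine (integral_finsetSum _ fun p _ => (hf p q).const_mul (A q p)).trans ?_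
  exact Finset.sum_congr rfl fun p _ => integral_const_mul _ _

/-- The weighted Cauchy–Schwarz inequality `|∫ g|² ≤ (∫ c⁻¹)(∫ c |g|²)`. With `c w = w a + (1 - w)
b` on `(0, 1]` the factor `(∫ c⁻¹)⁻¹` is the logarithmic mean, and this is the source of the linear
majorants of the dual form. -/
theorem sq_integral_norm_le {ν : Measure ℝ} {g : ℝ → ℂ} {c : ℝ → ℝ}
    (hc : ∀ᵐ w ∂ν, 0 < c w) (hg : Integrable g ν) (hci : Integrable (fun w => (c w)⁻¹) ν)
    (hgc : Integrable (fun w => c w * ‖g w‖ ^ 2) ν) (hκ : 0 < ∫ w, (c w)⁻¹ ∂ν) :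
    (∫ w, (c w)⁻¹ ∂ν)⁻¹ * ‖∫ w, g w ∂ν‖ ^ 2 ≤ ∫ w, c w * ‖g w‖ ^ 2 ∂ν := by
  set κ := ∫ w, (c w)⁻¹ ∂ν
  set Q := ∫ w, c w * ‖g w‖ ^ 2 ∂ν
  set I := ‖∫ w, g w ∂ν‖
  have hQ : 0 ≤ Q := integral_nonneg_of_ae (hc.mono fun w hw => by positivity)
  have hI0 : 0 ≤ I := norm_nonneg _
  rcases hI0.eq_or_lt with h0 | hI
  · rw [← h0]; simpa using hQ
  -- Young's inequality for `‖g w‖`, with weights chosen so that the second term integrates to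
  -- exactly `I / 2`.
  have h1 : I ≤ ∫ w, ((κ / I / 2) * (c w * ‖g w‖ ^ 2) + (I / κ / 2) * (c w)⁻¹) ∂ν := by
    refine (norm_integral_le_integral_norm g).trans (integral_mono_ae hg.norm
      ((hgc.const_mul _).add (hci.const_mul _)) (hc.mono fun w hw => ?_))
    simp only
    have h2 : (κ / I / 2) * (c w * ‖g w‖ ^ 2) + (I / κ / 2) * (c w)⁻¹ - ‖g w‖ =
        (κ * c w * ‖g w‖ - I) ^ 2 / (2 * κ * I * c w) := by
      field_simp
      ring
    have h3 : 0 ≤ (κ * c w * ‖g w‖ - I) ^ 2 / (2 * κ * I * c w) := by positivity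
    linarith
  rw [integral_add (hgc.const_mul _) (hci.const_mul _), integral_const_mul,
    integral_const_mul] at h1
  change I ≤ κ / I / 2 * Q + I / κ / 2 * κ at h1
  have h4 : I / κ / 2 * κ = I / 2 := by field_simp
  have h5 : κ / I / 2 * Q = κ * Q / I / 2 := by ring
  rw [h4, h5] at h1
  have h6 : I ≤ κ * Q / I := by linarith
  rw [le_div_iff₀ hI] at h6
  rw [inv_mul_le_iff₀ hκ]
  nlinarith

/-- Lebesgue measure on `(0, 1]`. -/
def unitMeasure : Measure ℝ := volume.restrict (Set.Ioc 0 1)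

theorem integrable_unitMeasure {E : Type*} [NormedAddCommGroup E] {f : ℝ → E}
    (hf : ContinuousOn f (Set.Icc 0 1)) : Integrable f unitMeasure :=
  ((hf.integrableOn_compact (μ := volume) isCompact_Icc).mono_set Set.Ioc_subset_Icc_self :)

theorem ae_unitMeasure : ∀ᵐ w ∂unitMeasure, w ∈ Set.Icc (0 : ℝ) 1 :=
  (ae_restrict_mem measurableSet_Ioc).mono fun _ h => Set.Ioc_subset_Icc_self h

instance : IsProbabilityMeasure unitMeasure := ⟨by simp [unitMeasure]⟩

include hU hb in
theorem continuousOn_sylv (H : 𝕄) (i j : Fin n) :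
    ContinuousOn (fun w => sylv w (diagConj U b) H i j) (Set.Icc 0 1) := by
  have : Set.EqOn (fun w => sylv w (diagConj U b) H i j) (fun w => ∑ q, ∑ p, U i p *
      ((((w * b p + (1 - w) * b q)⁻¹ : ℝ) : ℂ) * rot U H p q) * conj (U j q)) (Set.Icc 0 1) := by
    intro w hw
    simp only
    conv_lhs => rw [← mul_rot_mul hU (sylv w (diagConj U b) H)]
    simp only [Matrix.mul_apply, conjTranspose_apply, Finset.sum_mul, rot_sylv hU hb hw,
      RCLike.star_def]
  refine ContinuousOn.congr ?_ this
  refine continuousOn_finsetSum _ fun q _ => continuousOn_finsetSum _ fun p _ => ?_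
  refine (continuousOn_const.mul (ContinuousOn.mul ?_ continuousOn_const)).mul continuousOn_const
  exact Complex.continuous_ofReal.comp_continuousOn (continuousOn_convexComb_inv (hb p) (hb q))

/-- The derivative of the matrix logarithm at `B` in the direction `H`. -/
def logDeriv (B H : 𝕄) : 𝕄 := matInt unitMeasure fun w => sylv w B H

/-- The matrix whose pairing with `A` is the mean cost of the solutions of the Sylvester
equations. -/
def dualN (B H : 𝕄) : 𝕄 :=
  matInt unitMeasure fun w => (w : ℂ) • (sylv w B H * (sylv w B H)ᴴ) +
    (1 - w : ℂ) • ((sylv w B H)ᴴ * sylv w B H)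

include hU hb

theorem continuousOn_dualN (H : 𝕄) (i j : Fin n) :
    ContinuousOn (fun w : ℝ => ((w : ℂ) • (sylv w (diagConj U b) H * (sylv w (diagConj U b) H)ᴴ) +
    (1 - w : ℂ) • ((sylv w (diagConj U b) H)ᴴ * sylv w (diagConj U b) H)) i j) (Set.Icc 0 1) := by
  have h := continuousOn_sylv hU hb H
  have h' : ∀ i j, ContinuousOn (fun w => conj (sylv w (diagConj U b) H i j)) (Set.Icc 0 1) :=
    fun i j => Complex.continuous_conj.comp_continuousOn (h i j)
  simp only [Matrix.add_apply, Matrix.smul_apply, Matrix.mul_apply, smul_eq_mul,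
    conjTranspose_apply, RCLike.star_def]
  refine ContinuousOn.add (ContinuousOn.mul (by fun_prop) ?_) (ContinuousOn.mul (by fun_prop) ?_)
  · exact continuousOn_finsetSum _ fun l _ => (h _ _).mul (h' _ _)
  · exact continuousOn_finsetSum _ fun l _ => (h' _ _).mul (h _ _)

theorem rot_logDeriv (H : 𝕄) (j l : Fin n) :
    rot U (logDeriv (diagConj U b) H) j l = (logKernel (b j) (b l) : ℂ) * rot U H j l := by
  unfold logDeriv
  rw [rot_matInt fun i j => integrable_unitMeasure (continuousOn_sylv hU hb H i j),
    integral_congr_ae (ae_unitMeasure.mono fun w hw => rot_sylv hU hb hw H j l),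
    integral_mul_const, integral_complex_ofReal]
  rfl

theorem trace_mul_dualN
    (A H : 𝕄) : (A * dualN (diagConj U b) H).trace.re =
      ∫ w, sylvCost w A (sylv w (diagConj U b) H) ∂unitMeasure := by
  have hi : ∀ i j, Integrable (fun w : ℝ => ((w : ℂ) • (sylv w (diagConj U b) H *
      (sylv w (diagConj U b) H)ᴴ) + (1 - w : ℂ) • ((sylv w (diagConj U b) H)ᴴ *
      sylv w (diagConj U b) H)) i j) unitMeasure :=
    fun i j => integrable_unitMeasure (continuousOn_dualN hU hb H i j)
  unfold dualN
  rw [trace_mul_matInt hi]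
  refine (integral_re (𝕜 := ℂ) ?_).symm.trans ?_
  rotate_left
  · refine integral_congr_ae (Eventually.of_forall fun w => ?_)
    simp only [sylvCost]
    rw [Matrix.mul_add, trace_add, Matrix.mul_smul, Matrix.mul_smul, trace_smul, trace_smul,
      ← Matrix.mul_assoc, ← Matrix.mul_assoc, trace_mul_comm (A * _) _, ← Matrix.mul_assoc,
      trace_mul_comm (A * _) (sylv w (diagConj U b) H), ← Matrix.mul_assoc]
    have h1 : (1 - w : ℂ) = ((1 - w : ℝ) : ℂ) := by push_cast; rfl
    rw [h1]
    simp [smul_eq_mul]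
  · simp only [trace, diag, Matrix.mul_apply]
    exact integrable_finsetSum _ fun i _ => integrable_finsetSum _ fun j _ => (hi _ _).const_mul _

omit hU hb

/-! ### Bounds for the logarithmic derivative and the dual matrix. -/

theorem convexComb_le {a b m w : ℝ} (ha : a ≤ m) (hb : b ≤ m) (hw : w ∈ Set.Icc (0 : ℝ) 1) :
    w * a + (1 - w) * b ≤ m := by
  nlinarith [mul_le_mul_of_nonneg_left ha hw.1, mul_le_mul_of_nonneg_left hb (sub_nonneg.2 hw.2)]

theorem le_convexComb {a b m w : ℝ} (ha : m ≤ a) (hb : m ≤ b) (hw : w ∈ Set.Icc (0 : ℝ) 1) :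
    m ≤ w * a + (1 - w) * b := by
  nlinarith [mul_le_mul_of_nonneg_left ha hw.1, mul_le_mul_of_nonneg_left hb (sub_nonneg.2 hw.2)]

theorem logKernel_le {a b δ : ℝ} (hδ : 0 < δ) (ha : δ ≤ a) (hb : δ ≤ b) : logKernel a b ≤ δ⁻¹ := by
  have h1 : logKernel a b ≤ ∫ w in Set.Ioc (0 : ℝ) 1, δ⁻¹ := by
    refine setIntegral_mono_on (integrableOn_convexComb_inv (hδ.trans_le ha) (hδ.trans_le hb))
      (by simp) measurableSet_Ioc fun w hw => inv_anti₀ hδ ?_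
    exact le_convexComb ha hb (Set.Ioc_subset_Icc_self hw)
  simpa using h1

theorem le_logKernel {a b m : ℝ} (ha : 0 < a) (hb : 0 < b) (ham : a ≤ m) (hbm : b ≤ m) :
    m⁻¹ ≤ logKernel a b := by
  have h1 : ∫ w in Set.Ioc (0 : ℝ) 1, m⁻¹ ≤ logKernel a b := by
    refine setIntegral_mono_on (by simp) (integrableOn_convexComb_inv ha hb)
      measurableSet_Ioc fun w hw => inv_anti₀ (convexComb_pos ha hb (Set.Ioc_subset_Icc_self hw)) ?_
    exact convexComb_le ham hbm (Set.Ioc_subset_Icc_self hw)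
  simpa using h1

theorem hsNormSq_add_le (G H : 𝕄) : hsNormSq (G + H) ≤ 2 * hsNormSq G + 2 * hsNormSq H := by
  unfold hsNormSq
  simp only [Finset.mul_sum, ← Finset.sum_add_distrib]
  refine Finset.sum_le_sum fun i _ => Finset.sum_le_sum fun j _ => ?_
  rw [Matrix.add_apply]
  have := pow_le_pow_left₀ (norm_nonneg _) (norm_add_le (G i j) (H i j)) 2
  nlinarith [sq_nonneg (‖G i j‖ - ‖H i j‖)]

include hU

theorem hsNormSq_le_of_rot {G H : 𝕄}
    {c : ℝ} {r : Fin n → Fin n → ℝ} (hr : ∀ j l, 0 ≤ r j l ∧ r j l ≤ c)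
    (h : ∀ j l, rot U G j l = (r j l : ℂ) * rot U H j l) : hsNormSq G ≤ c ^ 2 * hsNormSq H := by
  rw [← hsNormSq_rot hU G, ← hsNormSq_rot hU H]
  unfold hsNormSq
  simp only [Finset.mul_sum]
  refine Finset.sum_le_sum fun i _ => Finset.sum_le_sum fun j _ => ?_
  rw [h, norm_mul, Complex.norm_real, mul_pow, Real.norm_of_nonneg (hr i j).1]
  exact mul_le_mul_of_nonneg_right (pow_le_pow_left₀ (hr i j).1 (hr i j).2 2) (sq_nonneg _)

theorem hsNormSq_sylv_le (hδ : 0 < δ) (hb : ∀ i, δ ≤ b i) (hw : w ∈ Set.Icc (0 : ℝ) 1) (H : 𝕄) :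
    hsNormSq (sylv w (diagConj U b) H) ≤ δ⁻¹ ^ 2 * hsNormSq H := by
  have hb' : ∀ i, 0 < b i := fun i => hδ.trans_le (hb i)
  exact hsNormSq_le_of_rot hU (r := fun j l => (w * b j + (1 - w) * b l)⁻¹)
    (fun j l => ⟨(inv_pos.2 (convexComb_pos (hb' j) (hb' l) hw)).le,
      inv_anti₀ hδ (le_convexComb (hb j) (hb l) hw)⟩) fun j l => rot_sylv hU hb' hw H j l

theorem hsNormSq_logDeriv_le (hδ : 0 < δ) (hb : ∀ i, δ ≤ b i) (H : 𝕄) :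
    hsNormSq (logDeriv (diagConj U b) H) ≤ δ⁻¹ ^ 2 * hsNormSq H := by
  have hb' : ∀ i, 0 < b i := fun i => hδ.trans_le (hb i)
  exact hsNormSq_le_of_rot hU (r := fun j l => logKernel (b j) (b l))
    (fun j l => ⟨(logKernel_pos (hb' j) (hb' l)).le, logKernel_le hδ (hb j) (hb l)⟩)
    fun j l => rot_logDeriv hU hb' H j l

omit hU

theorem norm_mul_conjTranspose_apply_le (v : 𝕄) (i j : Fin n) : ‖(v * vᴴ) i j‖ ≤ hsNormSq v := by
  rw [Matrix.mul_apply]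
  refine (norm_sum_le _ _).trans ?_
  have h1 : ∀ i, ∑ l, ‖v i l‖ ^ 2 ≤ hsNormSq v := fun i =>
    Finset.single_le_sum (f := fun j => ∑ k, ‖v j k‖ ^ 2)
      (fun _ _ => Finset.sum_nonneg fun _ _ => sq_nonneg _) (Finset.mem_univ i)
  have h2 : ∑ l, ‖v i l * vᴴ l j‖ ≤ ∑ l, (‖v i l‖ ^ 2 / 2 + ‖v j l‖ ^ 2 / 2) := by
    refine Finset.sum_le_sum fun l _ => ?_
    rw [norm_mul, conjTranspose_apply, norm_star]
    nlinarith [sq_nonneg (‖v i l‖ - ‖v j l‖)]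
  refine h2.trans ?_
  rw [Finset.sum_add_distrib, ← Finset.sum_div, ← Finset.sum_div]
  linarith [h1 i, h1 j]

theorem hsNormSq_conjTranspose (v : 𝕄) : hsNormSq vᴴ = hsNormSq v := by
  unfold hsNormSq
  rw [Finset.sum_comm]
  simp

include hU

theorem norm_dualN_apply_le (hδ : 0 < δ) (hb : ∀ i, δ ≤ b i) (H : 𝕄) (i j : Fin n) :
    ‖dualN (diagConj U b) H i j‖ ≤ δ⁻¹ ^ 2 * hsNormSq H := by
  have hint : ‖dualN (diagConj U b) H i j‖ ≤ ∫ _w, δ⁻¹ ^ 2 * hsNormSq H ∂unitMeasure := by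
    refine norm_integral_le_of_norm_le (integrable_const _) (ae_unitMeasure.mono fun w hw => ?_)
    set v := sylv w (diagConj U b) H
    have h1 := norm_mul_conjTranspose_apply_le v i j
    have h2 := norm_mul_conjTranspose_apply_le vᴴ i j
    rw [conjTranspose_conjTranspose, hsNormSq_conjTranspose] at h2
    have h3 := hsNormSq_sylv_le hU hδ hb hw H
    simp only
    rw [Matrix.add_apply, Matrix.smul_apply, Matrix.smul_apply, smul_eq_mul, smul_eq_mul]
    refine (norm_add_le _ _).trans ?_
    have h4 : ‖(1 - w : ℂ)‖ = 1 - w := by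
      rw [show (1 - w : ℂ) = ((1 - w : ℝ) : ℂ) by push_cast; rfl, Complex.norm_real,
        Real.norm_of_nonneg (sub_nonneg.2 hw.2)]
    rw [norm_mul, norm_mul, h4, Complex.norm_real, Real.norm_of_nonneg hw.1]
    exact convexComb_le (h1.trans h3) (h2.trans h3) hw
  simpa using hint

include hb in
theorem continuousOn_rot_sylv (W H : 𝕄) (i j : Fin n) :
    ContinuousOn (fun w => rot W (sylv w (diagConj U b) H) i j) (Set.Icc 0 1) := by
  simp only [rot_apply]
  exact continuousOn_finsetSum _ fun q _ => continuousOn_finsetSum _ fun p _ =>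
    (continuousOn_const.mul (continuousOn_sylv hU hb H p q)).mul continuousOn_const

omit hU

/-! ### Linear majorants of the dual quadratic form. -/

/-- `N` bounds the quadratic form in `V` that is dual to the Fisher information density. -/
def Dominates (V : Fin k → 𝕄) (N : 𝕄) : Prop :=
  ∀ W ∈ 𝕌, ∀ (a : Fin n → ℝ) (l : Fin n → Fin n → ℝ), (∀ i, 0 < a i) →
    (∀ p q, 0 ≤ l p q) → (∀ p q, l p q * logKernel (a p) (a q) ≤ 1) →
    ∑ i, ∑ p, ∑ q, l p q * ‖rot W (V i) p q‖ ^ 2 ≤ (diagConj W a * N).trace.re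

theorem le_inv_logKernel {l a b : ℝ} (ha : 0 < a) (hb : 0 < b) (h : l * logKernel a b ≤ 1) :
    l ≤ (logKernel a b)⁻¹ := by
  rw [← one_div]
  exact (le_div_iff₀ (logKernel_pos ha hb)).2 h

-- In any basis the entries of the logarithmic derivative are averages over `w` of those of the
-- Sylvester solutions. Cauchy–Schwarz with weight `w a p + (1 - w) a q` bounds the logarithmic mean
-- form by the average of `sylvCost`, and this average is the trace of `A` times `dualN`, hence
-- linear in `A`. The weight belongs to `A` and the solutions to `B`, so a single `N` serves every
-- `A`.
include hU hb in
theorem dominates_logDeriv (H : Fin k → 𝕄) :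
    Dominates (fun i => logDeriv (diagConj U b) (H i)) (∑ i, dualN (diagConj U b) (H i)) := by
  intro W hW a l ha _ hl
  rw [Matrix.mul_sum, trace_sum, Complex.re_sum]
  refine Finset.sum_le_sum fun i _ => ?_
  rw [trace_mul_dualN hU hb]
  simp only [sylvCost_diagConj hW]
  have hcont : ∀ p q, ContinuousOn (fun w => rot W (sylv w (diagConj U b) (H i)) p q)
      (Set.Icc 0 1) := fun p q => continuousOn_rot_sylv hU hb W (H i) p q
  have hcont2 : ∀ p q, ContinuousOn (fun w : ℝ => (w * a p + (1 - w) * a q) *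
      ‖rot W (sylv w (diagConj U b) (H i)) p q‖ ^ 2) (Set.Icc 0 1) := fun p q =>
    ContinuousOn.mul (by fun_prop) ((hcont p q).norm.pow 2)
  have hint := fun p q => integrable_unitMeasure (hcont2 p q)
  rw [integral_finsetSum _ fun p _ => integrable_finsetSum _ fun q _ => hint p q]
  refine Finset.sum_le_sum fun p _ => ?_
  rw [integral_finsetSum _ fun q _ => hint p q]
  refine Finset.sum_le_sum fun q _ => ?_
  unfold logDeriv
  rw [rot_matInt fun i' j => integrable_unitMeasure (continuousOn_sylv hU hb (H i) i' j)]
  refine (mul_le_mul_of_nonneg_right (le_inv_logKernel (ha p) (ha q) (hl p q))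
    (sq_nonneg _)).trans ?_
  exact sq_integral_norm_le (ae_unitMeasure.mono fun w hw => convexComb_pos (ha p) (ha q) hw)
    (integrable_unitMeasure (hcont p q))
    (integrable_unitMeasure (continuousOn_convexComb_inv (ha p) (ha q))) (hint p q)
    (logKernel_pos (ha p) (ha q))

theorem sum_le_of_le {l : Fin n → Fin n → ℝ} (hl : ∀ p q, l p q ≤ δ) (G : 𝕄) :
    ∑ p, ∑ q, l p q * ‖rot U G p q‖ ^ 2 ≤ δ * hsNormSq (rot U G) := by
  unfold hsNormSq
  simp only [Finset.mul_sum]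
  exact Finset.sum_le_sum fun p _ => Finset.sum_le_sum fun q _ =>
    mul_le_mul_of_nonneg_right (hl p q) (sq_nonneg _)

/-- The logarithmic mean of two eigenvalues of `A` is at most the trace of `A`. This crude majorant
is used only for small errors. -/
theorem dominates_hsNormSq (E : Fin k → 𝕄) : Dominates E (((∑ i, hsNormSq (E i) : ℝ) : ℂ) • 1) := by
  intro W hW a l ha _ hl
  rw [Matrix.mul_smul, Matrix.mul_one, trace_smul, trace_diagConj hW, smul_eq_mul,
    ← Complex.ofReal_mul, Complex.ofReal_re, mul_comm, Finset.mul_sum]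
  refine Finset.sum_le_sum fun i _ => ?_
  rw [← hsNormSq_rot hW]
  refine sum_le_of_le (fun p q => ?_) _
  refine (le_inv_logKernel (ha p) (ha q) (hl p q)).trans ?_
  have hle : ∀ p, a p ≤ ∑ i, a i := fun p =>
    Finset.single_le_sum (fun i _ => (ha i).le) (Finset.mem_univ p)
  exact inv_le_of_inv_le₀ ((ha p).trans_le (hle p)) (le_logKernel (ha p) (ha q) (hle p) (hle q))

/-- From `|x + y|² ≤ (1 + ε)|x|² + (1 + ε⁻¹)|y|²`. A main term nearly keeps its constant, while an
approximation error may be multiplied by a large one. -/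
theorem Dominates.add {V V' : Fin k → 𝕄} {N N' : 𝕄}
    (h : Dominates V N) (h' : Dominates V' N') {ε : ℝ} (hε : 0 < ε) :
    Dominates (V + V') (((1 + ε : ℝ) : ℂ) • N + ((1 + ε⁻¹ : ℝ) : ℂ) • N') := by
  intro W hW a l ha _ hl
  have h0 : ∀ p q, 0 ≤ (logKernel (a p) (a q))⁻¹ := fun p q =>
    (inv_pos.2 (logKernel_pos (ha p) (ha q))).le
  have hs : ∀ p q, (logKernel (a p) (a q))⁻¹ * logKernel (a p) (a q) ≤ 1 := fun p q =>
    (inv_mul_cancel₀ (logKernel_pos (ha p) (ha q)).ne').le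
  have h1 := mul_le_mul_of_nonneg_left (h W hW a _ ha h0 hs) (by positivity : 0 ≤ 1 + ε)
  have h2 := mul_le_mul_of_nonneg_left (h' W hW a _ ha h0 hs) (by positivity : 0 ≤ 1 + ε⁻¹)
  rw [Matrix.mul_add, trace_add, Matrix.mul_smul, Matrix.mul_smul, trace_smul, trace_smul,
    smul_eq_mul, smul_eq_mul, Complex.add_re, Complex.re_ofReal_mul, Complex.re_ofReal_mul]
  refine le_trans ?_ (add_le_add h1 h2)
  simp only [Finset.mul_sum, ← Finset.sum_add_distrib]
  refine Finset.sum_le_sum fun i _ => Finset.sum_le_sum fun p _ => Finset.sum_le_sum fun q _ => ?_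
  refine (mul_le_mul_of_nonneg_right (le_inv_logKernel (ha p) (ha q) (hl p q))
    (sq_nonneg _)).trans ?_
  rw [Pi.add_apply, rot_add, Matrix.add_apply]
  set x := rot W (V i) p q
  set y := rot W (V' i) p q
  have hxy := norm_add_le x y
  have h3 : ‖x + y‖ ^ 2 ≤ (1 + ε) * ‖x‖ ^ 2 + (1 + ε⁻¹) * ‖y‖ ^ 2 := by
    have h4 : (1 + ε) * ‖x‖ ^ 2 + (1 + ε⁻¹) * ‖y‖ ^ 2 - (‖x‖ + ‖y‖) ^ 2 =
        (ε * ‖x‖ - ‖y‖) ^ 2 / ε := by field_simp; ring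
    have h5 : 0 ≤ (ε * ‖x‖ - ‖y‖) ^ 2 / ε := by positivity
    nlinarith [pow_le_pow_left₀ (norm_nonneg _) hxy 2]
  calc _ ≤ (logKernel (a p) (a q))⁻¹ * ((1 + ε) * ‖x‖ ^ 2 + (1 + ε⁻¹) * ‖y‖ ^ 2) :=
        mul_le_mul_of_nonneg_left h3 (h0 p q)
    _ = _ := by ring

/-- Young's inequality for each entry in an eigenbasis of `A`, pairing the kernel with its inverse;
the weights `l` of `Dominates` are taken to be the inverse kernel itself. -/
theorem Dominates.two_re_trace_le {V : Fin k → 𝕄} {N : 𝕄} (h : Dominates V N) (hU : U ∈ 𝕌)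
    (ha : ∀ i, 0 < a i) (G : Fin k → 𝕄) {t : ℝ} (ht : 0 < t) :
    2 * ∑ i, ((V i)ᴴ * G i).trace.re ≤
      t * (∑ i, ∑ p, ∑ q, logKernel (a p) (a q) * ‖rot U (G i) p q‖ ^ 2) +
        t⁻¹ * (diagConj U a * N).trace.re := by
  have h0 : ∀ p q, 0 ≤ (logKernel (a p) (a q))⁻¹ := fun p q =>
    (inv_pos.2 (logKernel_pos (ha p) (ha q))).le
  have hs : ∀ p q, (logKernel (a p) (a q))⁻¹ * logKernel (a p) (a q) ≤ 1 := fun p q =>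
    (inv_mul_cancel₀ (logKernel_pos (ha p) (ha q)).ne').le
  refine le_trans ?_ (add_le_add_right (mul_le_mul_of_nonneg_left (h U hU a _ ha h0 hs)
    (inv_pos.2 ht).le) _)
  simp only [trace_conjTranspose_mul_eq_rot hU, Complex.re_sum, Finset.mul_sum,
    ← Finset.sum_add_distrib]
  refine Finset.sum_le_sum fun i _ => Finset.sum_le_sum fun p _ => Finset.sum_le_sum fun q _ => ?_
  set x := rot U (V i) p q
  set y := rot U (G i) p q
  have hκ := logKernel_pos (ha p) (ha q)
  set κ := logKernel (a p) (a q)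
  have h1 : (conj x * y).re ≤ ‖x‖ * ‖y‖ :=
    (Complex.re_le_norm _).trans (by rw [norm_mul, RCLike.norm_conj])
  have h2 : t * (κ * ‖y‖ ^ 2) + t⁻¹ * (κ⁻¹ * ‖x‖ ^ 2) - 2 * (‖x‖ * ‖y‖) =
      (t * κ * ‖y‖ - ‖x‖) ^ 2 / (t * κ) := by field_simp; ring
  have h3 : 0 ≤ (t * κ * ‖y‖ - ‖x‖) ^ 2 / (t * κ) := by positivity
  linarith

include hU hb

/-- At `A = B` the majorant is attained: it equals the Fisher density, so nothing is lost in the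
duality argument. -/
theorem trace_mul_dualN_self
    (H : 𝕄) : (diagConj U b * dualN (diagConj U b) H).trace.re =
      ∑ p, ∑ q, logKernel (b p) (b q) * ‖rot U H p q‖ ^ 2 := by
  rw [trace_mul_dualN hU hb, integral_congr_ae (g := fun w => ∑ p, ∑ q,
    (w * b p + (1 - w) * b q)⁻¹ * ‖rot U H p q‖ ^ 2)]
  · have hint := fun p q => (integrable_unitMeasure
      (continuousOn_convexComb_inv (hb p) (hb q))).mul_const (‖rot U H p q‖ ^ 2)
    rw [integral_finsetSum _ fun p _ => integrable_finsetSum _ fun q _ => hint p q]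
    refine Finset.sum_congr rfl fun p _ => ?_
    rw [integral_finsetSum _ fun q _ => hint p q]
    exact Finset.sum_congr rfl fun q _ => integral_mul_const _ _
  · refine ae_unitMeasure.mono fun w hw => ?_
    simp only
    rw [sylvCost_diagConj hU]
    refine Finset.sum_congr rfl fun p _ => Finset.sum_congr rfl fun q _ => ?_
    have := convexComb_pos (hb p) (hb q) hw
    rw [rot_sylv hU hb hw, norm_mul, Complex.norm_real, mul_pow,
      Real.norm_of_nonneg (inv_pos.2 this).le]
    field_simp

theorem re_trace_dualN_nonneg (H : 𝕄) : 0 ≤ (dualN (diagConj U b) H).trace.re := by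
  have h := trace_mul_dualN hU hb 1 H
  rw [Matrix.one_mul] at h
  rw [h]
  refine integral_nonneg_of_ae (ae_unitMeasure.mono fun w hw => ?_)
  have h1 := sylvCost_diagConj (w := w) (a := fun _ => 1) hU (sylv w (diagConj U b) H)
  rw [diagConj_const hU] at h1
  simp only [Complex.ofReal_one, one_smul] at h1
  simp only [Pi.zero_apply]
  rw [h1]
  refine Finset.sum_nonneg fun p _ => Finset.sum_nonneg fun q _ => ?_
  rw [show w * 1 + (1 - w) * 1 = (1 : ℝ) by ring, one_mul]
  positivity

theorem re_trace_logDeriv_mul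
    (H : 𝕄) : ((logDeriv (diagConj U b) H)ᴴ * H).trace.re =
      ∑ p, ∑ q, logKernel (b p) (b q) * ‖rot U H p q‖ ^ 2 := by
  rw [trace_conjTranspose_mul_eq_rot hU, Complex.re_sum]
  refine Finset.sum_congr rfl fun p _ => ?_
  rw [Complex.re_sum]
  refine Finset.sum_congr rfl fun q _ => ?_
  rw [rot_logDeriv hU hb, map_mul, Complex.conj_ofReal, mul_assoc, conj_mul_self_eq,
    ← Complex.ofReal_mul, Complex.ofReal_re]

/-! ### The logarithm as an integral of resolvents. -/

section ScalarLog
variable {a b : ℝ}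

omit hU hb

theorem integrableOn_inv_mul_inv (ha : 0 < a) (hb : 0 < b) :
    IntegrableOn (fun s : ℝ => (a + s)⁻¹ * (b + s)⁻¹) (Set.Ioi 0) := by
  refine ⟨(Measurable.aestronglyMeasurable (by fun_prop)), ?_⟩
  rw [hasFiniteIntegral_iff_ofReal]
  · change resKernel a b < ⊤
    rw [resKernel_eq_logKernel ha hb]
    exact ENNReal.ofReal_lt_top
  · refine (ae_restrict_mem measurableSet_Ioi).mono fun s hs => ?_
    have hs' : (0 : ℝ) < s := hs
    simp only [Pi.zero_apply]
    positivity

theorem integral_inv_mul_inv (ha : 0 < a) (hb : 0 < b) :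
    ∫ s in Set.Ioi (0 : ℝ), (a + s)⁻¹ * (b + s)⁻¹ = logKernel a b := by
  rw [integral_eq_lintegral_of_nonneg_ae]
  · change (resKernel a b).toReal = _
    rw [resKernel_eq_logKernel ha hb, ENNReal.toReal_ofReal (logKernel_pos ha hb).le]
  · refine (ae_restrict_mem measurableSet_Ioi).mono fun s hs => ?_
    have hs' : (0 : ℝ) < s := hs
    simp only [Pi.zero_apply]
    positivity
  · exact Measurable.aestronglyMeasurable (by fun_prop)

theorem inv_sub_inv_eq (ha : 0 < a) {s : ℝ} (hs : 0 < s) :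
    (1 + s)⁻¹ - (a + s)⁻¹ = (a - 1) * ((1 + s)⁻¹ * (a + s)⁻¹) := by
  have h1 : 1 + s ≠ 0 := by positivity
  have h2 : a + s ≠ 0 := by positivity
  field_simp
  ring

theorem integrableOn_inv_sub_inv (ha : 0 < a) :
    IntegrableOn (fun s : ℝ => (1 + s)⁻¹ - (a + s)⁻¹) (Set.Ioi 0) :=
  IntegrableOn.congr_fun ((integrableOn_inv_mul_inv one_pos ha).const_mul (a - 1))
    (fun _ hs => (inv_sub_inv_eq ha hs).symm) measurableSet_Ioi

theorem integral_inv_sub_inv (ha : 0 < a) :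
    ∫ s in Set.Ioi (0 : ℝ), ((1 + s)⁻¹ - (a + s)⁻¹) = Real.log a := by
  have h := integral_Ioi_of_hasDerivAt_of_tendsto (a := (0 : ℝ)) (m := 0)
    (f := fun s => Real.log (1 + s) - Real.log (a + s)) (f' := fun s => (1 + s)⁻¹ - (a + s)⁻¹)
    ?_ ?_ (integrableOn_inv_sub_inv ha) ?_
  · rw [h]; simp
  · refine ContinuousAt.continuousWithinAt ?_
    have h1 : (1 : ℝ) + 0 ≠ 0 := by norm_num
    have h2 : a + 0 ≠ 0 := by simpa using ha.ne'
    exact ((continuousAt_const.add continuousAt_id).log h1).sub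
      ((continuousAt_const.add continuousAt_id).log h2)
  · intro s hs
    have hs' : (0 : ℝ) < s := hs
    have h1 := ((hasDerivAt_id s).const_add 1).log (by positivity : 1 + s ≠ 0)
    have h2 := ((hasDerivAt_id s).const_add a).log (by positivity : a + s ≠ 0)
    convert! h1.sub h2 using 1
    simp
  · have h1 : Tendsto (fun s : ℝ => 1 + (1 - a) * (a + s)⁻¹) atTop (𝓝 (1 + (1 - a) * 0)) :=
      tendsto_const_nhds.add (tendsto_const_nhds.mul
        (tendsto_inv_atTop_zero.comp (tendsto_atTop_add_const_left _ a tendsto_id)))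
    rw [mul_zero, add_zero] at h1
    have h2 := (Real.continuousAt_log one_ne_zero).tendsto.comp h1
    rw [Real.log_one] at h2
    refine h2.congr' ((eventually_gt_atTop 0).mono fun s hs => ?_)
    have h3 : a + s ≠ 0 := by positivity
    have h4 : 1 + s ≠ 0 := by positivity
    simp only [Function.comp]
    rw [← Real.log_div h4 h3]
    congr 1
    field_simp
    ring

/-- `resKernel` at shifted arguments increases to its value. -/
theorem tendsto_resKernel (ha : 0 ≤ a) (hb : 0 ≤ b) {ε : ℕ → ℝ} (hε : ∀ m, 0 < ε m)
    (hanti : Antitone ε) (hlim : Tendsto ε atTop (𝓝 0)) :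
    Tendsto (fun m => resKernel (a + ε m) (b + ε m)) atTop (𝓝 (resKernel a b)) := by
  refine lintegral_tendsto_of_tendsto_of_monotone (fun m => by fun_prop) ?_ ?_
  · refine (ae_restrict_mem measurableSet_Ioi).mono fun s hs => ?_
    have hs' : (0 : ℝ) < s := hs
    intro m m' hm
    have h1 := hanti hm
    have h2 := hε m'
    refine ENNReal.ofReal_le_ofReal (mul_le_mul (inv_anti₀ (by positivity) (by linarith))
      (inv_anti₀ (by positivity) (by linarith)) ?_ ?_)
    · have := hε m; positivity
    · positivity
  · refine (ae_restrict_mem measurableSet_Ioi).mono fun s hs => ?_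
    have hs' : (0 : ℝ) < s := hs
    refine ENNReal.tendsto_ofReal ?_
    have h1 : Tendsto (fun m => a + ε m + s) atTop (𝓝 (a + 0 + s)) :=
      (tendsto_const_nhds.add hlim).add tendsto_const_nhds
    have h2 : Tendsto (fun m => b + ε m + s) atTop (𝓝 (b + 0 + s)) :=
      (tendsto_const_nhds.add hlim).add tendsto_const_nhds
    rw [add_zero] at h1 h2
    exact (h1.inv₀ (by positivity)).mul (h2.inv₀ (by positivity))

end ScalarLog

omit hU hb

theorem exists_diagConj_of_posSemidef (hA : A.PosSemidef) :
    ∃ U ∈ 𝕌, ∃ a : Fin n → ℝ, A = diagConj U a ∧ (∀ i, 0 ≤ a i) ∧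
      ∀ f : ℝ → ℝ, cfc f A = diagConj U (f ∘ a) := by
  obtain ⟨U, hU, a, rfl, hf⟩ := exists_diagConj hA.1
  exact ⟨U, hU, a, rfl, (PosSemidef_diagConj_iff hU).1 hA, hf⟩

/-! ### Estimates for matrices bounded below. -/

section Positive
variable (hA : (A - (δ : ℂ) • 1).PosSemidef) (hδ : 0 < δ)

include hA in
theorem exists_diagConj_of_sub :
    ∃ U ∈ 𝕌, ∃ a : Fin n → ℝ, A = diagConj U a ∧ (∀ i, δ ≤ a i) ∧
      ∀ f : ℝ → ℝ, cfc f A = diagConj U (f ∘ a) := by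
  have h1 : A.IsHermitian := by
    have h2 : ((δ : ℂ) • (1 : 𝕄)).IsHermitian := by
      rw [IsHermitian, conjTranspose_smul, conjTranspose_one, RCLike.star_def, Complex.conj_ofReal]
    simpa using hA.1.add h2
  obtain ⟨U, hU, a, rfl, hf⟩ := exists_diagConj h1
  exact ⟨U, hU, a, rfl, (PosSemidef_diagConj_sub_iff hU).1 hA, hf⟩

include hU

theorem PosSemidef_sub_diagConj_iff :
    ((m : ℂ) • 1 - diagConj U a).PosSemidef ↔ ∀ i, a i ≤ m := by
  have h1 : (m : ℂ) • 1 - diagConj U a =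
      diagConj U (fun i => -1 * a i + m) := by
    rw [← diagConj_add_const hU, ← diagConj_smul]
    push_cast
    rw [neg_smul, one_smul]
    abel
  rw [h1, PosSemidef_diagConj_iff hU]
  exact forall_congr' fun i => by constructor <;> intro h <;> linarith

omit hU in
theorem diagConj_apply (i j : Fin n) :
    diagConj U a i j = ∑ p, U i p * (a p : ℂ) * conj (U j p) := by
  rw [diagConj, Matrix.mul_apply]
  simp only [mul_diagonal, conjTranspose_apply, RCLike.star_def]

theorem norm_diagConj_apply_le (i j : Fin n) : ‖diagConj U a i j‖ ≤ ∑ p, |a p| := by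
  rw [diagConj_apply]
  refine (norm_sum_le _ _).trans (Finset.sum_le_sum fun p _ => ?_)
  rw [norm_mul, norm_mul, RCLike.norm_conj, Complex.norm_real, Real.norm_eq_abs]
  have h1 := entry_norm_bound_of_unitary hU i p
  have h2 := entry_norm_bound_of_unitary hU j p
  calc ‖U i p‖ * |a p| * ‖U j p‖ ≤ 1 * |a p| * 1 := by gcongr
    _ = |a p| := by ring

omit hU in
theorem norm_apply_le_trace (hA : A.PosSemidef) (i j : Fin n) : ‖A i j‖ ≤ A.trace.re := by
  obtain ⟨U, hU, a, rfl, ha, -⟩ := exists_diagConj_of_posSemidef hA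
  rw [trace_diagConj hU, Complex.ofReal_re]
  refine (norm_diagConj_apply_le hU i j).trans (Finset.sum_le_sum fun p _ => ?_)
  rw [abs_of_nonneg (ha p)]

theorem apply_eq_sum_rot (i j : Fin n) : G i j = ∑ q, ∑ p, U i p * rot U G p q * conj (U j q) := by
  conv_lhs => rw [← mul_rot_mul hU G]
  simp only [Matrix.mul_apply, conjTranspose_apply, Finset.sum_mul, RCLike.star_def]

/-! ### Sandwiching by the resolvent -/

theorem rot_resolvent_mul (ha : ∀ i, 0 ≤ a i) {s : ℝ} (hs : 0 < s) (p q : Fin n) :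
    rot U ((diagConj U a + (s : ℂ) • 1)⁻¹ * G *
      (diagConj U a + (s : ℂ) • 1)⁻¹) p q =
      (((a p + s)⁻¹ * (a q + s)⁻¹ : ℝ) : ℂ) * rot U G p q := by
  rw [diagConj_resolvent hU ha hs, rot_mul hU, rot_mul hU, rot_diagConj hU, mul_diagonal,
    diagonal_mul]
  push_cast
  ring

omit hU

theorem norm_apply_le_of_hsNormSq {c : ℝ} (hc : 0 ≤ c) (h : hsNormSq G ≤ c ^ 2 * hsNormSq H)
    (i j : Fin n) : ‖G i j‖ ≤ c * √(hsNormSq H) := by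
  have h1 : ‖G i j‖ ≤ √(hsNormSq G) := Real.le_sqrt_of_sq_le (norm_sq_le_hsNormSq G i j)
  refine h1.trans ((Real.sqrt_le_sqrt h).trans ?_)
  rw [Real.sqrt_mul (sq_nonneg _), Real.sqrt_sq hc]

include hA

theorem norm_resolvent_mul_le (hδ : 0 ≤ δ) {s : ℝ} (hs : 0 < s) (i j : Fin n) :
    ‖((A + (s : ℂ) • 1)⁻¹ * G *
      (A + (s : ℂ) • 1)⁻¹) i j‖ ≤
      ((δ + s)⁻¹ * (δ + s)⁻¹) * √(hsNormSq G) := by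
  obtain ⟨U, hU, a, rfl, ha, -⟩ := exists_diagConj_of_sub hA
  refine norm_apply_le_of_hsNormSq (by positivity) (hsNormSq_le_of_rot hU (fun p q => ⟨?_, ?_⟩)
    fun p q => rot_resolvent_mul hU (fun i => hδ.trans (ha i)) hs p q) i j
  · have h1 := hδ.trans (ha p)
    have h2 := hδ.trans (ha q)
    positivity
  · have h1 := ha p
    have h2 := ha q
    refine mul_le_mul (inv_anti₀ (by positivity) (by linarith))
      (inv_anti₀ (by positivity) (by linarith)) ?_ (by positivity)
    have := hδ.trans h2
    positivity

theorem norm_resolvent_le (hδ : 0 ≤ δ) {s : ℝ} (hs : 0 < s) (i j : Fin n) :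
    ‖(A + (s : ℂ) • 1)⁻¹ i j‖ ≤ n * (δ + s)⁻¹ := by
  obtain ⟨U, hU, a, rfl, ha, -⟩ := exists_diagConj_of_sub hA
  rw [diagConj_resolvent hU (fun i => hδ.trans (ha i)) hs]
  refine (norm_diagConj_apply_le hU i j).trans ?_
  have : ∑ p, |(a p + s)⁻¹| ≤ ∑ _p : Fin n, (δ + s)⁻¹ := by
    refine Finset.sum_le_sum fun p _ => ?_
    have h1 := ha p
    rw [abs_of_pos (inv_pos.2 (by linarith))]
    exact inv_anti₀ (by positivity) (by linarith)
  simpa using this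

include hδ

/-- In an eigenbasis both sides multiply the entries by the same kernel, written once over `(0, 1]`
and once over `(0, ∞)`. The first form gives the majorants; the second is the derivative of the
resolvent formula for the logarithm. -/
theorem logDeriv_eq_matInt (G : 𝕄) :
    logDeriv A G = matInt (volume.restrict (Set.Ioi 0)) fun s =>
      (A + (s : ℂ) • 1)⁻¹ * G * (A + (s : ℂ) • 1)⁻¹ := by
  obtain ⟨U, hU, a, rfl, ha, -⟩ := exists_diagConj_of_sub hA
  have ha' : ∀ i, 0 < a i := fun i => hδ.trans_le (ha i)
  refine eq_of_rot_eq hU ?_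
  ext p q
  have hmem : ∀ᵐ s ∂(volume.restrict (Set.Ioi (0 : ℝ))), 0 < s := ae_restrict_mem measurableSet_Ioi
  rw [rot_logDeriv hU ha', rot_matInt]
  · rw [integral_congr_ae (hmem.mono fun s hs =>
      rot_resolvent_mul hU (fun i => (ha' i).le) hs p q), integral_mul_const,
      integral_complex_ofReal, integral_inv_mul_inv (ha' p) (ha' q)]
  · intro i j
    have : Integrable (fun s : ℝ => ∑ q, ∑ p, U i p * ((((a p + s)⁻¹ * (a q + s)⁻¹ : ℝ) : ℂ) *
        rot U G p q) * conj (U j q)) (volume.restrict (Set.Ioi 0)) :=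
      integrable_finsetSum _ fun q _ => integrable_finsetSum _ fun p _ =>
        ((((integrableOn_inv_mul_inv (ha' p) (ha' q)).ofReal).mul_const _).const_mul _).mul_const _
    refine this.congr (hmem.mono fun s hs => ?_)
    have e := apply_eq_sum_rot (G := (diagConj U a + (s : ℂ) • 1)⁻¹ *
      G * (diagConj U a + (s : ℂ) • 1)⁻¹) hU i j
    simp only [rot_resolvent_mul hU (fun i => (ha' i).le) hs] at e
    exact e.symm

omit hA hδ in
include hU in
theorem inv_sub_resolvent (ha : ∀ i, 0 ≤ a i) {s : ℝ}
    (hs : 0 < s) : (((1 + s)⁻¹ : ℝ) : ℂ) • 1 -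
      (diagConj U a + (s : ℂ) • 1)⁻¹ =
      diagConj U (fun i => (1 + s)⁻¹ - (a i + s)⁻¹) := by
  rw [diagConj_resolvent hU ha hs, ← diagConj_const hU, sub_eq_iff_eq_add, diagConj_add]
  simp

theorem cfc_log_eq_matInt :
    cfc Real.log A = matInt (volume.restrict (Set.Ioi 0)) fun s =>
      (((1 + s)⁻¹ : ℝ) : ℂ) • 1 -
        (A + (s : ℂ) • 1)⁻¹ := by
  obtain ⟨U, hU, a, rfl, ha, hf⟩ := exists_diagConj_of_sub hA
  have ha' : ∀ i, 0 < a i := fun i => hδ.trans_le (ha i)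
  have hmem : ∀ᵐ s ∂(volume.restrict (Set.Ioi (0 : ℝ))), 0 < s := ae_restrict_mem measurableSet_Ioi
  rw [hf]
  ext i j
  simp only [matInt, of_apply]
  rw [integral_congr_ae (g := fun s : ℝ => ∑ p, U i p * (((1 + s)⁻¹ - (a p + s)⁻¹ : ℝ) : ℂ) *
    conj (U j p)), integral_finsetSum, diagConj_apply]
  · refine Finset.sum_congr rfl fun p _ => ?_
    rw [integral_mul_const, integral_const_mul, integral_complex_ofReal,
      integral_inv_sub_inv (ha' p)]
    rfl
  · exact fun p _ => ((integrableOn_inv_sub_inv (ha' p)).ofReal.const_mul _).mul_const _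
  · refine hmem.mono fun s hs => ?_
    simp only
    rw [inv_sub_resolvent hU (fun i => (ha' i).le) hs, diagConj_apply]

theorem norm_inv_sub_resolvent_le
    (hm : ((m : ℂ) • 1 - A).PosSemidef) {s : ℝ} (hs : 0 < s)
    (i j : Fin n) : ‖((((1 + s)⁻¹ : ℝ) : ℂ) • 1 -
      (A + (s : ℂ) • 1)⁻¹) i j‖ ≤
      n * ((m + 1) * ((1 + s)⁻¹ * (δ + s)⁻¹)) := by
  obtain ⟨U, hU, a, rfl, ha, -⟩ := exists_diagConj_of_sub hA
  have ha' : ∀ i, 0 < a i := fun i => hδ.trans_le (ha i)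
  rw [inv_sub_resolvent hU (fun i => (ha' i).le) hs]
  refine (norm_diagConj_apply_le hU i j).trans ?_
  have hm' := (PosSemidef_sub_diagConj_iff hU).1 hm
  have : ∑ p, |(1 + s)⁻¹ - (a p + s)⁻¹| ≤
      ∑ _p : Fin n, ((m + 1) * ((1 + s)⁻¹ * (δ + s)⁻¹)) := by
    refine Finset.sum_le_sum fun p _ => ?_
    have h0 := ha' p
    rw [inv_sub_inv_eq (ha' p) hs, abs_mul,
      abs_of_nonneg (by positivity : 0 ≤ (1 + s)⁻¹ * (a p + s)⁻¹)]
    refine mul_le_mul ?_ (mul_le_mul_of_nonneg_left (inv_anti₀ (by positivity)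
      (by linarith [ha p])) (by positivity)) (by positivity) (by linarith [hm' p])
    rw [abs_le]
    constructor <;> linarith [hm' p]
  simpa using this

omit hA hδ

/-! ### Yosida approximation and the size of the Fisher density. -/

theorem diagConj_sub : diagConj U a - diagConj U b = diagConj U (fun i => a i - b i) := by
  rw [sub_eq_iff_eq_add, diagConj_add]
  simp

/-- The Yosida approximation `R A (A + R)⁻¹`, shifted by `ε`. -/
def yosida (R ε : ℝ) (A : 𝕄) : 𝕄 :=
  ((R + ε : ℝ) : ℂ) • 1 -
    ((R ^ 2 : ℝ) : ℂ) • (A + (R : ℂ) • 1)⁻¹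

/-- The derivative of the Yosida approximation at `A` in the direction `G`. -/
def yosidaGrad (R : ℝ) (A G : 𝕄) : 𝕄 :=
  ((R ^ 2 : ℝ) : ℂ) • ((A + (R : ℂ) • 1)⁻¹ * G * (A + (R : ℂ) • 1)⁻¹)

include hU in
theorem yosida_diagConj (ha : ∀ i, 0 ≤ a i) (hR : 0 < R) :
    yosida R ε (diagConj U a) = diagConj U (fun i => R * a i / (a i + R) + ε) := by
  unfold yosida
  rw [diagConj_resolvent hU ha hR, diagConj_smul, ← diagConj_const hU, diagConj_sub]
  congr 1
  funext i
  have : a i + R ≠ 0 := by have := ha i; positivity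
  field_simp
  ring

theorem yosida_sub_posSemidef (hA : A.PosSemidef) (hR : 0 < R) :
    (yosida R ε A - (ε : ℂ) • 1).PosSemidef := by
  obtain ⟨U, hU, a, rfl, ha, -⟩ := exists_diagConj_of_posSemidef hA
  rw [yosida_diagConj hU ha hR, PosSemidef_diagConj_sub_iff hU]
  intro i
  have := ha i
  have h : 0 ≤ R * a i / (a i + R) := by positivity
  linarith

theorem sub_yosida_posSemidef (hA : A.PosSemidef) (hR : 0 < R) :
    (((R + ε : ℝ) : ℂ) • 1 - yosida R ε A).PosSemidef := by
  obtain ⟨U, hU, a, rfl, ha, -⟩ := exists_diagConj_of_posSemidef hA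
  rw [yosida_diagConj hU ha hR, PosSemidef_sub_diagConj_iff hU]
  intro i
  have := ha i
  have h : R * a i / (a i + R) ≤ R := by rw [div_le_iff₀ (by positivity)]; nlinarith
  linarith

include hU in
theorem yosida_sub_diagConj (ha : ∀ i, 0 ≤ a i) (hR : 0 < R) :
    yosida R ε (diagConj U a) - diagConj U a =
      diagConj U (fun i => R * a i / (a i + R) + ε - a i) := by
  rw [yosida_diagConj hU ha hR, diagConj_sub]

theorem norm_yosida_sub_le (hA : A.PosSemidef) (hR : 0 < R) (hε : 0 ≤ ε) (i j : Fin n) :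
    ‖yosida R ε A i j - A i j‖ ≤ A.trace.re + n * ε := by
  obtain ⟨U, hU, a, rfl, ha, -⟩ := exists_diagConj_of_posSemidef hA
  rw [← Matrix.sub_apply, yosida_sub_diagConj hU ha hR, trace_diagConj hU, Complex.ofReal_re]
  refine (norm_diagConj_apply_le hU i j).trans ?_
  have : ∑ p, |R * a p / (a p + R) + ε - a p| ≤ ∑ p, (a p + ε) := by
    refine Finset.sum_le_sum fun p _ => ?_
    have h0 := ha p
    have h1 : 0 ≤ R * a p / (a p + R) := by positivity
    have h2 : R * a p / (a p + R) ≤ a p := by rw [div_le_iff₀ (by positivity)]; nlinarith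
    rw [abs_le]
    constructor <;> linarith
  refine this.trans_eq ?_
  rw [Finset.sum_add_distrib]
  simp

theorem tendsto_yosida (hA : A.PosSemidef) {R ε : ℕ → ℝ} (hR : ∀ m, 0 < R m)
    (hRt : Tendsto R atTop atTop) (hε : Tendsto ε atTop (𝓝 0)) (i j : Fin n) :
    Tendsto (fun m => yosida (R m) (ε m) A i j) atTop (𝓝 (A i j)) := by
  obtain ⟨U, hU, a, rfl, ha, -⟩ := exists_diagConj_of_posSemidef hA
  simp only [yosida_diagConj hU ha (hR _), diagConj_apply]
  refine tendsto_finsetSum _ fun p _ => (tendsto_const_nhds.mul ?_).mul tendsto_const_nhds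
  refine (Complex.continuous_ofReal.tendsto _).comp ?_
  have h1 : Tendsto (fun m => a p - a p ^ 2 * (a p + R m)⁻¹ + ε m) atTop
      (𝓝 (a p - a p ^ 2 * 0 + 0)) :=
    (tendsto_const_nhds.sub (tendsto_const_nhds.mul
      (tendsto_inv_atTop_zero.comp (tendsto_atTop_add_const_left _ _ hRt)))).add hε
  rw [mul_zero, sub_zero, add_zero] at h1
  refine h1.congr fun m => ?_
  have h0 := ha p
  have h2 := hR m
  field_simp
  ring

/-- In an eigenbasis the derivative multiplies the entry `(p, q)` by `R² / ((a p + R)(a q + R))`, so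
`resKernel_yosida_le` applies entry by entry. The shift by `ε` raises the eigenvalues and only
lowers the kernel. -/
theorem fisherDensity_yosida_le (hA : A.PosSemidef) (hR : 0 < R) (hε : 0 ≤ ε) :
    fisherDensity (yosida R ε A) (yosidaGrad R A G) ≤ fisherDensity A G := by
  obtain ⟨U, hU, a, rfl, ha, -⟩ := exists_diagConj_of_posSemidef hA
  have h0 : ∀ i, 0 ≤ R * a i / (a i + R) := fun i => by have := ha i; positivity
  rw [yosida_diagConj hU ha hR, fisherDensity_diagConj hU (fun i => add_nonneg (h0 i) hε),
    fisherDensity_diagConj hU ha]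
  refine Finset.sum_le_sum fun p _ => Finset.sum_le_sum fun q _ => ?_
  have hp := ha p
  have hq := ha q
  have e : ‖rot U (yosidaGrad R (diagConj U a) G) p q‖ ^ 2 =
      (R ^ 2 / ((a p + R) * (a q + R))) ^ 2 * ‖rot U G p q‖ ^ 2 := by
    unfold yosidaGrad
    rw [rot_smul, Matrix.smul_apply, rot_resolvent_mul hU ha hR, smul_eq_mul, norm_mul, norm_mul,
      Complex.norm_real, Complex.norm_real, Real.norm_of_nonneg (by positivity),
      Real.norm_of_nonneg (by positivity)]
    field_simp
  rw [e, ENNReal.ofReal_mul (by positivity), ← mul_assoc]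
  refine mul_le_mul_left ?_ _
  rw [mul_comm]
  refine le_trans (mul_le_mul_right ?_ _) (resKernel_yosida_le hp hq hR)
  exact resKernel_mono (h0 p) (h0 q) (by linarith) (by linarith)

theorem tendsto_fisherDensity_add (hA : A.PosSemidef) (G : 𝕄) {ε : ℕ → ℝ} (hε : ∀ m, 0 < ε m)
    (hanti : Antitone ε) (hlim : Tendsto ε atTop (𝓝 0)) :
    Tendsto (fun m => fisherDensity (A + (ε m : ℂ) • 1) G) atTop (𝓝 (fisherDensity A G)) := by
  obtain ⟨U, hU, a, rfl, ha, -⟩ := exists_diagConj_of_posSemidef hA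
  simp only [diagConj_add_const hU]
  rw [fisherDensity_diagConj hU ha]
  have e : (fun m => fisherDensity (diagConj U fun i => a i + ε m) G) = fun m =>
      ∑ p, ∑ q, resKernel (a p + ε m) (a q + ε m) * ENNReal.ofReal (‖rot U G p q‖ ^ 2) :=
    funext fun m => fisherDensity_diagConj hU (fun i => add_nonneg (ha i) (hε m).le) G
  rw [e]
  exact tendsto_finsetSum _ fun p _ => tendsto_finsetSum _ fun q _ =>
    ENNReal.Tendsto.mul_const (tendsto_resKernel (ha p) (ha q) hε hanti hlim)
      (Or.inr ENNReal.ofReal_ne_top)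

theorem trace_sub_posSemidef (hA : A.PosSemidef) : (((A.trace.re : ℝ) : ℂ) • 1 - A).PosSemidef := by
  obtain ⟨U, hU, a, rfl, ha, -⟩ := exists_diagConj_of_posSemidef hA
  rw [PosSemidef_sub_diagConj_iff hU, trace_diagConj hU, Complex.ofReal_re]
  exact fun i => Finset.single_le_sum (fun i _ => ha i) (Finset.mem_univ i)

/-- The kernel is at least `m⁻¹` when both eigenvalues are at most `m`. -/
theorem ofReal_hsNormSq_le (hA : A.PosSemidef) (hm : 0 < m) (hAm : ((m : ℂ) • 1 - A).PosSemidef) :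
    ENNReal.ofReal (hsNormSq G) ≤ ENNReal.ofReal m * fisherDensity A G := by
  obtain ⟨U, hU, a, rfl, ha, -⟩ := exists_diagConj_of_posSemidef hA
  have ham := (PosSemidef_sub_diagConj_iff hU).1 hAm
  rw [fisherDensity_diagConj hU ha, ← hsNormSq_rot hU, Finset.mul_sum]
  unfold hsNormSq
  rw [ENNReal.ofReal_sum_of_nonneg fun j _ => Finset.sum_nonneg fun k _ => sq_nonneg _]
  refine Finset.sum_le_sum fun p _ => ?_
  rw [ENNReal.ofReal_sum_of_nonneg fun k _ => sq_nonneg _, Finset.mul_sum]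
  refine Finset.sum_le_sum fun q _ => ?_
  rw [← mul_assoc]
  refine le_mul_of_one_le_left zero_le ?_
  have h := mul_le_mul_right (le_resKernel (ha p) (ha q) hm (ham p) (ham q)) (ENNReal.ofReal m)
  rwa [← ENNReal.ofReal_mul hm.le, mul_inv_cancel₀ hm.ne', ENNReal.ofReal_one] at h

/-- The density of the Fisher information at a positive definite matrix, as a real number. -/
def fisherReal (A G : 𝕄) : ℝ := ((logDeriv A G)ᴴ * G).trace.re

include hA hδ

theorem fisherReal_nonneg (G : 𝕄) : 0 ≤ fisherReal A G := by
  obtain ⟨U, hU, a, rfl, ha, -⟩ := exists_diagConj_of_sub hA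
  have ha' : ∀ i, 0 < a i := fun i => hδ.trans_le (ha i)
  rw [fisherReal, re_trace_logDeriv_mul hU ha']
  exact Finset.sum_nonneg fun p _ => Finset.sum_nonneg fun q _ =>
    mul_nonneg (logKernel_pos (ha' p) (ha' q)).le (sq_nonneg _)

theorem fisherDensity_eq_ofReal (G : 𝕄) : fisherDensity A G = ENNReal.ofReal (fisherReal A G) := by
  obtain ⟨U, hU, a, rfl, ha, -⟩ := exists_diagConj_of_sub hA
  have ha' : ∀ i, 0 < a i := fun i => hδ.trans_le (ha i)
  rw [fisherReal, re_trace_logDeriv_mul hU ha', fisherDensity_diagConj_of_pos hU ha']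

theorem re_trace_mul_dualN (G : 𝕄) : (A * dualN A G).trace.re = fisherReal A G := by
  obtain ⟨U, hU, a, rfl, ha, -⟩ := exists_diagConj_of_sub hA
  have ha' : ∀ i, 0 < a i := fun i => hδ.trans_le (ha i)
  rw [fisherReal, re_trace_logDeriv_mul hU ha', trace_mul_dualN_self hU ha']

theorem re_trace_dualN_nonneg' (G : 𝕄) : 0 ≤ (dualN A G).trace.re := by
  obtain ⟨U, hU, a, rfl, ha, -⟩ := exists_diagConj_of_sub hA
  exact re_trace_dualN_nonneg hU (fun i => hδ.trans_le (ha i)) G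

theorem hsNormSq_logDeriv_le' (G : 𝕄) : hsNormSq (logDeriv A G) ≤ δ⁻¹ ^ 2 * hsNormSq G := by
  obtain ⟨U, hU, a, rfl, ha, -⟩ := exists_diagConj_of_sub hA
  exact hsNormSq_logDeriv_le hU hδ ha G

theorem norm_dualN_apply_le' (G : 𝕄) (i j : Fin n) : ‖dualN A G i j‖ ≤ δ⁻¹ ^ 2 * hsNormSq G := by
  obtain ⟨U, hU, a, rfl, ha, -⟩ := exists_diagConj_of_sub hA
  exact norm_dualN_apply_le hU hδ ha G i j

theorem dominates_logDeriv' (G : Fin k → 𝕄) :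
    Dominates (fun i => logDeriv A (G i)) (∑ i, dualN A (G i)) := by
  obtain ⟨U, hU, a, rfl, ha, -⟩ := exists_diagConj_of_sub hA
  exact dominates_logDeriv hU (fun i => hδ.trans_le (ha i)) G

theorem Dominates.two_re_trace_le' {V : Fin k → 𝕄} {N : 𝕄} (h : Dominates V N) (G : Fin k → 𝕄)
    {t : ℝ} (ht : 0 < t) :
    2 * ∑ i, ((V i)ᴴ * G i).trace.re ≤ t * (∑ i, fisherReal A (G i)) + t⁻¹ * (A * N).trace.re := by
  obtain ⟨U, hU, a, rfl, ha, -⟩ := exists_diagConj_of_sub hA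
  have ha' : ∀ i, 0 < a i := fun i => hδ.trans_le (ha i)
  refine (h.two_re_trace_le hU ha' G ht).trans_eq ?_
  simp only [fisherReal, re_trace_logDeriv_mul hU ha']

end Positive

/-! ### Measurability of the Sylvester solutions and of the Fisher density. -/

section Measurability
variable {α : Type*} [MeasurableSpace α] {B H : α → Matrix (Fin n) (Fin n) ℂ}
  (hB : ∀ i j, Measurable fun x => B x i j) (hH : ∀ i j, Measurable fun x => H x i j)
include hB

theorem measurable_resolvent_apply (i j : Fin n) : Measurable fun p : α × ℝ =>
    (B p.1 + (p.2 : ℂ) • 1)⁻¹ i j := by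
  refine measurable_inv_apply (A := fun p : α × ℝ => B p.1 + (p.2 : ℂ) • 1) (fun i j => ?_) i j
  simp only [Matrix.add_apply, Matrix.smul_apply, smul_eq_mul]
  exact ((hB i j).comp measurable_fst).add
    ((Complex.measurable_ofReal.comp measurable_snd).mul_const _)

include hH

/-- The solution is given by the inverse of a matrix whose entries are explicit in `w` and `B`, and
inverses are measurable by Cramer's rule. No measurable choice of eigenvectors is required. -/
theorem measurable_sylv_apply (i j : Fin n) :
    Measurable fun p : α × ℝ => sylv p.2 (B p.1) (H p.1) i j := by
  simp only [sylv, of_apply, mulVec, dotProduct]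
  refine Finset.measurable_fun_sum _ fun l _ => Measurable.mul ?_ ((hH _ _).comp measurable_fst)
  refine measurable_inv_apply (A := fun p : α × ℝ => sylvMatrix p.2 (B p.1)) (fun i j => ?_) _ _
  simp only [sylvMatrix, of_apply]
  have h1 : ∀ i j, Measurable fun p : α × ℝ => B p.1 i j := fun i j => (hB i j).comp measurable_fst
  have h2 : Measurable fun p : α × ℝ => (p.2 : ℂ) := Complex.measurable_ofReal.comp measurable_snd
  exact ((h2.mul (h1 _ _)).mul_const _).add (((h2.const_sub _).mul_const _).mul (h1 _ _))

theorem measurable_logDeriv_apply (i j : Fin n) : Measurable fun x => logDeriv (B x) (H x) i j := by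
  have h : StronglyMeasurable (Function.uncurry fun x w => sylv w (B x) (H x) i j) :=
    (measurable_sylv_apply hB hH i j).stronglyMeasurable
  exact (h.integral_prod_right (ν := unitMeasure)).measurable

theorem measurable_dualN_apply (i j : Fin n) : Measurable fun x => dualN (B x) (H x) i j := by
  have h := fun i j => measurable_sylv_apply hB hH i j
  have h1 := measurable_mul_apply h (fun i j => measurable_conjTranspose_apply h i j) i j
  have h2 := measurable_mul_apply (fun i j => measurable_conjTranspose_apply h i j) h i j
  have h3 : Measurable fun p : α × ℝ => (p.2 : ℂ) := Complex.measurable_ofReal.comp measurable_snd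
  have h4 : StronglyMeasurable (Function.uncurry fun (x : α) (w : ℝ) =>
      ((w : ℂ) • (sylv w (B x) (H x) * (sylv w (B x) (H x))ᴴ) +
        (1 - w : ℂ) • ((sylv w (B x) (H x))ᴴ * sylv w (B x) (H x))) i j) := by
    simp only [Matrix.add_apply, Matrix.smul_apply, smul_eq_mul]
    exact ((h3.mul h1).add ((h3.const_sub _).mul h2)).stronglyMeasurable
  exact (h4.integral_prod_right (ν := unitMeasure)).measurable

theorem measurable_resolvent_mul_apply (i j : Fin n) : Measurable fun p : α × ℝ =>
    ((B p.1 + (p.2 : ℂ) • 1)⁻¹ * H p.1 * (B p.1 + (p.2 : ℂ) • 1)⁻¹) i j := by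
  have h := fun i j => measurable_resolvent_apply hB i j
  have h2 : ∀ i j, Measurable fun p : α × ℝ => H p.1 i j := fun i j => (hH i j).comp measurable_fst
  exact measurable_mul_apply (measurable_mul_apply h h2) h i j

theorem measurable_fisherIntegrand : Measurable fun p : α × ℝ => ENNReal.ofReal
    (((H p.1)ᴴ * (B p.1 + (p.2 : ℂ) • 1)⁻¹ * H p.1 * (B p.1 + (p.2 : ℂ) • 1)⁻¹).trace.re) := by
  have h := fun i j => measurable_resolvent_apply hB i j
  have h2 : ∀ i j, Measurable fun p : α × ℝ => H p.1 i j := fun i j => (hH i j).comp measurable_fst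
  have h3 := fun i j => measurable_conjTranspose_apply h2 i j
  exact (Complex.measurable_re.comp (measurable_trace (measurable_mul_apply (measurable_mul_apply
    (measurable_mul_apply h3 h) h2) h))).ennreal_ofReal

theorem measurable_fisherDensity : Measurable fun x => fisherDensity (B x) (H x) :=
  (measurable_fisherIntegrand hB hH).lintegral_prod_right'

end Measurability

/-! ### The chain rule for matrix resolvents. -/

theorem contDiff_det {E ι : Type*} [NormedAddCommGroup E] [NormedSpace ℝ E] [Fintype ι]
    [DecidableEq ι] {A : E → Matrix ι ι ℂ} (hA : ∀ i j, ContDiff ℝ ∞ fun v => A v i j) :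
    ContDiff ℝ ∞ fun v => (A v).det := by
  simp only [det_apply']
  exact ContDiff.sum fun p _ => contDiff_const.mul (contDiff_prod fun i _ => hA _ _)

theorem contMDiff_inv_apply {A : M → 𝕄} (hA : ∀ i j, Smooth fun x => A x i j)
    (hdet : ∀ x, (A x).det ≠ 0) (i j : Fin n) : Smooth fun x => (A x)⁻¹ i j := by
  have h1 : ContMDiff (𝓡 d) 𝓘(ℝ, Fin n → Fin n → ℂ) ∞ (fun x i j => A x i j) :=
    contMDiff_pi_space.2 fun i => contMDiff_pi_space.2 fun j => hA i j
  have h2 : ∀ i j, ContDiff ℝ ∞ fun v : Fin n → Fin n → ℂ => Matrix.of v i j := fun i j =>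
    (contDiff_apply ℝ ℂ j).comp (contDiff_apply ℝ (Fin n → ℂ) i)
  have h3 := contDiff_det h2
  have h4 : ContDiff ℝ ∞ fun v : Fin n → Fin n → ℂ => (Matrix.of v).adjugate i j := by
    simp only [adjugate_apply]
    refine contDiff_det fun p q => ?_
    simp only [updateRow_apply]
    split_ifs
    · exact contDiff_const
    · exact h2 p q
  intro x
  have h5 : ContDiffAt ℝ ∞ (fun v : Fin n → Fin n → ℂ => (Matrix.of v).det⁻¹ *
      (Matrix.of v).adjugate i j) (fun i j => A x i j) :=
    (h3.contDiffAt.inv (hdet x)).mul h4.contDiffAt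
  refine (h5.contMDiffAt.comp x (h1 x)).congr_of_eventuallyEq (Eventually.of_forall fun y => ?_)
  simp only [inv_def, Matrix.smul_apply, smul_eq_mul, Ring.inverse_eq_inv']
  rfl

theorem lieD_inv_apply (V : VField d M) {A : M → 𝕄}
    (hA : ∀ i j, Smooth fun x => A x i j) (hdet : ∀ x, (A x).det ≠ 0)
    (i j : Fin n) (x : M) : lieD V (fun x => (A x)⁻¹ i j) x =
      -((A x)⁻¹ * Matrix.of (fun p q => lieD V (fun x => A x p q) x) * (A x)⁻¹) i j := by
  have hR := fun i j => contMDiff_inv_apply hA hdet i j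
  set LA : 𝕄 := Matrix.of fun p q => lieD V (fun x => A x p q) x
  set LR : 𝕄 := Matrix.of fun p q => lieD V (fun x => (A x)⁻¹ p q) x with hLR
  have h1 : LR * A x + (A x)⁻¹ * LA = 0 := by
    ext p q
    have h2 : (fun x => ∑ c, (A x)⁻¹ p c * A x c q) =
        fun _ => (1 : 𝕄) p q := by
      funext y
      rw [← Matrix.mul_apply, nonsing_inv_mul _ (isUnit_iff_ne_zero.2 (hdet y))]
    have h3 := lieD_sum V Finset.univ (fun c _ => contMDiff_mul (hR p c) (hA c q)) x
    rw [h2, lieD_const] at h3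
    simp only [lieD_mul V (hR p _) (hA _ q), Finset.sum_add_distrib] at h3
    rw [Matrix.add_apply, Matrix.mul_apply, Matrix.mul_apply]
    exact h3.symm
  have h4 : LR = -((A x)⁻¹ * LA * (A x)⁻¹) := by
    have h5 : LR * A x * (A x)⁻¹ = -((A x)⁻¹ * LA) * (A x)⁻¹ := by
      rw [eq_neg_of_add_eq_zero_left h1]
    rwa [Matrix.mul_assoc, mul_nonsing_inv _ (isUnit_iff_ne_zero.2 (hdet x)), Matrix.mul_one,
      Matrix.neg_mul] at h5
  calc _ = LR i j := rfl
    _ = _ := by rw [h4]; rfl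

variable {ρ σ u : M → Matrix (Fin n) (Fin n) ℂ} {G H : Fin k → M → Matrix (Fin n) (Fin n) ℂ}

theorem det_add_smul_ne_zero {A : 𝕄} (hA : A.PosSemidef) {s : ℝ}
    (hs : 0 < s) : (A + (s : ℂ) • 1).det ≠ 0 := by
  obtain ⟨U, hU, a, rfl, ha, -⟩ := exists_diagConj_of_posSemidef hA
  rw [diagConj_add_const hU]
  intro h
  have h1 := diagConj_mul (a := fun i => a i + s) (b := fun i => (a i + s)⁻¹) hU
  rw [show (fun i => (a i + s) * (a i + s)⁻¹) = fun _ => (1 : ℝ) from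
    funext fun i => mul_inv_cancel₀ (by have := ha i; positivity), diagConj_const hU] at h1
  have h2 := congrArg det h1
  rw [det_mul, h] at h2
  simp at h2

theorem norm_resolvent_le' {A : 𝕄} (hA : A.PosSemidef) {s : ℝ} (hs : 0 < s)
    (i j : Fin n) : ‖(A + (s : ℂ) • 1)⁻¹ i j‖ ≤ n * s⁻¹ := by
  simpa using norm_resolvent_le (δ := 0) (by simpa using hA) le_rfl hs i j

theorem tendsto_resolvent {A : ℕ → 𝕄} {B : 𝕄}
    (h : ∀ i j, Tendsto (fun m => A m i j) atTop (𝓝 (B i j))) (hB : B.PosSemidef) {s : ℝ}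
    (hs : 0 < s) (i j : Fin n) :
    Tendsto (fun m => (A m + (s : ℂ) • 1)⁻¹ i j) atTop (𝓝 ((B + (s : ℂ) • 1)⁻¹ i j)) := by
  have h1 : Tendsto (fun m => A m + (s : ℂ) • 1) atTop
      (𝓝 (B + (s : ℂ) • 1)) :=
    (tendsto_pi_nhds.2 fun i => tendsto_pi_nhds.2 fun j => h i j).add tendsto_const_nhds
  have h2 : Tendsto (fun m => (A m + (s : ℂ) • 1)⁻¹) atTop
      (𝓝 ((B + (s : ℂ) • 1)⁻¹)) := by
    simp only [inv_def, Ring.inverse_eq_inv']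
    exact (((continuous_id.matrix_det.tendsto _).comp h1).inv₀ (det_add_smul_ne_zero hB hs)).smul
      ((continuous_id.matrix_adjugate.tendsto _).comp h1)
  exact (tendsto_pi_nhds.1 (tendsto_pi_nhds.1 h2 i) j)

theorem aestronglyMeasurable_of_measurable_apply {ν : Measure M} {A : M → 𝕄} (F : 𝕄 → ℂ)
    (hF : ∀ {B : M → 𝕄}, (∀ i j, Measurable fun x => B x i j) → Measurable fun x => F (B x))
    (hA : ∀ i j, AEStronglyMeasurable (fun x => A x i j) ν) :
    AEStronglyMeasurable (fun x => F (A x)) ν := by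
  refine ⟨fun x => F (Matrix.of fun i j => (hA i j).mk _ x),
    (hF fun i j => (hA i j).stronglyMeasurable_mk.measurable).stronglyMeasurable, ?_⟩
  filter_upwards [ae_all_iff.2 fun i => ae_all_iff.2 fun j => (hA i j).ae_eq_mk] with x hx
  congr 1
  ext i j
  exact hx i j

theorem aestronglyMeasurable_resolvent {ν : Measure M} {A : M → 𝕄}
    (hA : ∀ i j, AEStronglyMeasurable (fun x => A x i j) ν) (s : ℝ) (i j : Fin n) :
    AEStronglyMeasurable (fun x => (A x + (s : ℂ) • 1)⁻¹ i j) ν :=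
  aestronglyMeasurable_of_measurable_apply
    (fun A => (A + (s : ℂ) • 1)⁻¹ i j)
    (fun hB => by
      have := (measurable_resolvent_apply hB i j).comp (measurable_prodMk_right (y := s))
      simpa only [Function.comp_def] using this) hA

theorem mul_mul_apply_eq (A B C : 𝕄) (i j : Fin n) :
    (A * B * C) i j = ∑ q, ∑ p, A i p * C q j * B p q := by
  simp only [Matrix.mul_apply, Finset.sum_mul]
  exact Finset.sum_congr rfl fun q _ => Finset.sum_congr rfl fun p _ => by ring

include hμ hX

/-- The chain rule for the resolvent of a matrix-valued function. -/
theorem IsMatrixWeakGrad.resolvent {ρ : M → 𝕄} {G : Fin k → M → 𝕄} (hρ : ∀ᵐ x ∂μ, (ρ x).PosSemidef)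
    (h : IsMatrixWeakGrad μ X ρ G) {s : ℝ} (hs : 0 < s) :
    IsMatrixWeakGrad μ X (fun x => (ρ x + (s : ℂ) • 1)⁻¹)
      (fun i x => -((ρ x + (s : ℂ) • 1)⁻¹ * G i x * (ρ x + (s : ℂ) • 1)⁻¹)) := by
  intro a b
  have hρm := fun c e => (h c e).1.1
  have hRm := fun c e => aestronglyMeasurable_resolvent hρm s c e
  have hRb : ∀ c e, ∀ᵐ x ∂μ, ‖(ρ x + (s : ℂ) • 1)⁻¹ c e‖ ≤ n * s⁻¹ :=
    fun c e => hρ.mono fun x hx => norm_resolvent_le' hx hs c e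
  have hRGm : ∀ i c e, Integrable (fun x => (ρ x + (s : ℂ) • 1)⁻¹ a c *
      (ρ x + (s : ℂ) • 1)⁻¹ e b * G i x c e) μ := fun i c e => by
    refine (((h c e).2 i).1.bdd_mul (c := n * s⁻¹ * (n * s⁻¹)) ((hRm a c).mul (hRm e b)) ?_)
    filter_upwards [hRb a c, hRb e b] with x h1 h2
    exact (norm_mul_le _ _).trans (mul_le_mul h1 h2 (norm_nonneg _) (by positivity))
  refine IsWeakGrad.of_chart hμ hX
    ((integrable_const (n * s⁻¹ : ℝ)).mono' (hRm a b) (hRb a b)) (fun i => ?_) ?_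
  · simp only [Matrix.neg_apply, mul_mul_apply_eq]
    exact (integrable_finsetSum _ fun q _ => integrable_finsetSum _ fun p _ => hRGm i p q).neg
  intro i x₀ φ ψ hφ hψ hφs hψs
  obtain ⟨χ, -, hχt, hχ0, hχ1, hχs⟩ := exists_isTest_one_nhds (d := d) (hφ.2.union hψ.1.2)
    (𝔠 x₀).open_source (Set.union_subset hφs hψs)
  obtain ⟨κ, hκ0, hκt, hκ⟩ := exists_friedrichs hμ hX hχt hχs
  have hκ0 := hκ0 fun z => (hχ0 z).1
  set u : ℕ → Fin n → Fin n → M → ℂ := fun j c e x => ∫ z, κ j x z • ρ z c e ∂μ with hu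
  have hut : ∀ j c e, IsTest d (u j c e) := fun j c e => (hκ _ _ (h c e)).1 j
  have hconv := fun c e => (hκ _ _ (h c e)).2 1 le_rfl ENNReal.one_ne_top
    (memLp_one_iff_integrable.2 (h c e).1) fun i => memLp_one_iff_integrable.2 ((h c e).2 i).1
  set W : ℕ → M → 𝕄 := fun j x => Matrix.of fun c e => u j c e x with hW
  -- The mollifying kernel is nonnegative and common to all entries, so `W` stays positive
  -- semidefinite. Hence `W + s` is invertible with inverse bounded independently of `j` and `x`,
  -- and the smooth chain rule applies to it.
  have hWpos : ∀ j x, (W j x).PosSemidef := fun j x => by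
    refine posSemidef_of_forall_nonneg fun v => ?_
    have hi : ∀ c e, Integrable (fun z => (κ j x z : ℂ) * (star v c * (ρ z c e * v e))) μ :=
      fun c e => by
        simpa only [Complex.conj_ofReal] using
          (hκt j x).integrable_conj_mul (((h c e).1.mul_const (v e)).const_mul (star v c))
    have e : star v ⬝ᵥ (W j x *ᵥ v) = ∫ z, (κ j x z : ℂ) * (star v ⬝ᵥ (ρ z *ᵥ v)) ∂μ := by
      simp only [hW, hu, dotProduct, mulVec, of_apply, Finset.mul_sum]
      rw [integral_finsetSum _ fun c _ => integrable_finsetSum _ fun e _ => hi c e]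
      refine Finset.sum_congr rfl fun c _ => ?_
      rw [integral_finsetSum _ fun e _ => hi c e]
      refine Finset.sum_congr rfl fun e _ => ?_
      rw [← integral_mul_const, ← integral_const_mul]
      refine integral_congr_ae (ae_of_all _ fun z => ?_)
      simp only [Complex.real_smul]
      ring
    rw [e]
    refine integral_nonneg_of_ae (hρ.mono fun z hz => ?_)
    exact mul_nonneg (by exact_mod_cast hκ0 j x z) (hz.dotProduct_mulVec_nonneg v)
  set A : ℕ → M → 𝕄 := fun j x => W j x + (s : ℂ) • 1 with hA
  have hdet : ∀ j x, (A j x).det ≠ 0 := fun j x => det_add_smul_ne_zero (hWpos j x) hs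
  have hAs : ∀ j c e, Smooth fun x => A j x c e := fun j c e => (hut j c e).1.add contMDiff_const
  have hLA : ∀ j x c e, lieD (X i) (fun x => A j x c e) x = lieD (X i) (u j c e) x := by
    intro j x c e
    have := lieD_add (X i) (hut j c e).1 (contMDiff_const
      (c := ((s : ℂ) • (1 : 𝕄)) c e)) x
    rw [lieD_const, add_zero] at this
    exact this
  have hRs := fun j c e => contMDiff_inv_apply (hAs j) (hdet j) c e
  have hIBP : ∀ j, ∫ x, conj (ψ x) * (A j x)⁻¹ a b ∂μ =
      -∑ q, ∑ p, ∫ x, (conj (φ x) * ((A j x)⁻¹ a p * (A j x)⁻¹ q b)) *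
        lieD (X i) (u j p q) x ∂μ := by
    intro j
    have hint : ∀ p q, Integrable (fun x => (conj (φ x) * ((A j x)⁻¹ a p * (A j x)⁻¹ q b)) *
        lieD (X i) (u j p q) x) μ := fun p q => by
      simp only [mul_assoc]
      have hc := ((hRs j a p).continuous.mul ((hRs j q b).continuous.mul
        ((hut j p q).lieD (hX i)).1.continuous))
      have hcs : HasCompactSupport fun x => conj (φ x) * ((A j x)⁻¹ a p * ((A j x)⁻¹ q b *
          lieD (X i) (u j p q) x)) :=
        HasCompactSupport.mul_right (hφ.2.comp_left (g := conj) (map_zero _))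
      exact Continuous.integrable_of_hasCompactSupport
        ((Complex.continuous_conj.comp hφ.1.continuous).mul hc) hcs
    rw [hψ.integral_smooth hφ (hRs j a b)]
    simp only [lieD_inv_apply (X i) (hAs j) (hdet j) a b, mul_mul_apply_eq, hLA, of_apply,
      mul_neg, integral_neg, Finset.mul_sum, ← mul_assoc (conj (φ _)) (_ * _)]
    rw [integral_finsetSum _ fun q _ => integrable_finsetSum _ fun p _ => hint p q]
    congr 1
    refine Finset.sum_congr rfl fun q _ => ?_
    rw [integral_finsetSum _ fun p _ => hint p q]
  have hχρ : ∀ c e, AEStronglyMeasurable (fun x => (χ x : ℂ) * ρ x c e) μ := fun c e =>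
    hχt.1.continuous.aestronglyMeasurable.mul (hρm c e)
  -- Along a subsequence all mollified entries converge almost everywhere. The resolvents then
  -- converge boundedly while the gradients converge in `L¹`, which suffices for the products.
  obtain ⟨ns, hns, hae⟩ := exists_subseq_ae_tendsto (ι := Fin n × Fin n) one_ne_zero
    (F := fun ce j => u j ce.1 ce.2) (f := fun ce x => (χ x : ℂ) * ρ x ce.1 ce.2)
    (fun ce j => (hut j _ _).1.continuous.aestronglyMeasurable) (fun ce => hχρ _ _)
    (fun ce => (hconv ce.1 ce.2).1)
  set S : M → 𝕄 := fun x => ((χ x : ℂ) • ρ x + (s : ℂ) • 1)⁻¹ with hS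
  have hSlim : ∀ᵐ x ∂μ, ∀ c e, Tendsto (fun j => (A (ns j) x)⁻¹ c e) atTop (𝓝 (S x c e)) := by
    filter_upwards [hρ, hae] with x hx hx' c e
    refine tendsto_resolvent (B := (χ x : ℂ) • ρ x) (fun c e => hx' (c, e)) (hx.smul ?_) hs c e
    exact_mod_cast (hχ0 x).1
  have hSm := fun c e => aestronglyMeasurable_resolvent (A := fun x => (χ x : ℂ) • ρ x) hχρ s c e
  -- Near the supports of `φ` and `ψ` the localising function is `1`, so neither it nor its
  -- derivative is seen in the limit identity.
  have hχe : ∀ x, (x ∈ tsupport φ ∨ x ∈ tsupport ψ) → χ =ᶠ[𝓝 x] fun _ => 1 := fun x hx =>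
    (hχ1.filter_mono (nhds_le_nhdsSet (Set.mem_union _ _ _ |>.2 hx)) :)
  have hSe : ∀ x, (x ∈ tsupport φ ∨ x ∈ tsupport ψ) → S x =
      (ρ x + (s : ℂ) • 1)⁻¹ := fun x hx => by
    simp only [hS, (hχe x hx).self_of_nhds, Complex.ofReal_one, one_smul]
  obtain ⟨cφ, hcφ⟩ := hφ.2.exists_bound_of_continuous hφ.1.continuous
  have hcφ0 : 0 ≤ cφ := (norm_nonneg _).trans (hcφ x₀)
  have hl1 : Tendsto (fun j => ∫ x, conj (ψ x) * (A (ns j) x)⁻¹ a b ∂μ) atTop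
      (𝓝 (∫ x, conj (ψ x) * S x a b ∂μ)) := by
    refine tendsto_integral_of_dominated_convergence (fun x => ‖ψ x‖ * (n * s⁻¹))
      (fun j => (Complex.continuous_conj.comp hψ.1.1.continuous).aestronglyMeasurable.mul
        (hRs _ a b).continuous.aestronglyMeasurable) (hψ.1.integrable.norm.mul_const _)
      (fun j => ae_of_all _ fun x => ?_) (hSlim.mono fun x hx => tendsto_const_nhds.mul (hx a b))
    rw [norm_mul, RCLike.norm_conj]
    exact mul_le_mul_of_nonneg_left (norm_resolvent_le' (hWpos _ x) hs a b) (norm_nonneg _)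
  have hl2 : ∀ p q, Tendsto (fun j => ∫ x, (conj (φ x) * ((A (ns j) x)⁻¹ a p *
      (A (ns j) x)⁻¹ q b)) * lieD (X i) (u (ns j) p q) x ∂μ) atTop
      (𝓝 (∫ x, (conj (φ x) * (S x a p * S x q b)) *
        ((χ x : ℂ) * G i x p q + lieD (X i) ↟χ x * ρ x p q) ∂μ)) := by
    intro p q
    have hφm := (Complex.continuous_conj.comp hφ.1.continuous).aestronglyMeasurable (μ := μ)
    have hg' : Integrable (fun x => (χ x : ℂ) * G i x p q +
        lieD (X i) ↟χ x * ρ x p q) μ := by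
      obtain ⟨c1, hc1⟩ := hχt.2.exists_bound_of_continuous hχt.1.continuous
      obtain ⟨c2, hc2⟩ := (hχt.lieD (hX i)).2.exists_bound_of_continuous
        (hχt.lieD (hX i)).1.continuous
      exact (((h p q).2 i).1.bdd_mul hχt.1.continuous.aestronglyMeasurable (ae_of_all _ hc1)).add
        ((h p q).1.bdd_mul (hχt.lieD (hX i)).1.continuous.aestronglyMeasurable (ae_of_all _ hc2))
    have hcont : ∀ j, AEStronglyMeasurable (fun x => conj (φ x) * ((A j x)⁻¹ a p *
      (A j x)⁻¹ q b)) μ := fun j => hφm.mul ((hRs _ a p).continuous.aestronglyMeasurable.mul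
        (hRs _ q b).continuous.aestronglyMeasurable)
    have hbd : ∀ j x, ‖conj (φ x) * ((A j x)⁻¹ a p * (A j x)⁻¹ q b)‖ ≤
        cφ * (n * s⁻¹ * (n * s⁻¹)) := fun j x => by
      rw [norm_mul, norm_mul, RCLike.norm_conj]
      exact mul_le_mul (hcφ x) (mul_le_mul (norm_resolvent_le' (hWpos _ x) hs _ _)
        (norm_resolvent_le' (hWpos _ x) hs _ _) (norm_nonneg _) (by positivity)) (by positivity)
        hcφ0
    have hSb : AEStronglyMeasurable (fun x => conj (φ x) * (S x a p * S x q b)) μ :=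
      hφm.mul ((hSm a p).mul (hSm q b))
    have hL := tendsto_eLpNorm_mul_sub (μ := μ) (p := 1) le_rfl ENNReal.one_ne_top
      (fun j => hcont (ns j)) hSb (fun j => ae_of_all _ (hbd (ns j)))
      (hSlim.mono fun x hx => tendsto_const_nhds.mul ((hx a p).mul (hx q b)))
      (fun j => ((hut (ns j) p q).lieD (hX i)).1.continuous.aestronglyMeasurable)
      (memLp_one_iff_integrable.2 hg') (((hconv p q).2 i).comp hns.tendsto_atTop)
    exact tendsto_integral_of_L1' _ (hSb.mul hg'.1) (Eventually.of_forall fun j =>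
      ((hut (ns j) p q).lieD (hX i)).integrable.bdd_mul (hcont _) (ae_of_all _ (hbd (ns j)))) hL
  have hlim := tendsto_nhds_unique (hl1.congr fun j => hIBP (ns j))
    (tendsto_finsetSum _ fun q _ => tendsto_finsetSum _ fun p _ => hl2 p q).neg
  have e1 : ∀ x, conj (ψ x) * (ρ x + (s : ℂ) • 1)⁻¹ a b =
      conj (ψ x) * S x a b := fun x => by
    by_cases hx : x ∈ tsupport ψ
    · rw [hSe x (Or.inr hx)]
    · rw [image_eq_zero_of_notMem_tsupport hx, map_zero, zero_mul, zero_mul]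
  have e2 : ∀ p q x, (conj (φ x) * (S x a p * S x q b)) * ((χ x : ℂ) * G i x p q +
      lieD (X i) ↟χ x * ρ x p q) = conj (φ x) *
      ((ρ x + (s : ℂ) • 1)⁻¹ a p *
      (ρ x + (s : ℂ) • 1)⁻¹ q b * G i x p q) := fun p q x => by
    by_cases hx : x ∈ tsupport φ
    · have h0 : lieD (X i) ↟χ x = 0 := by
        rw [lieD_congr (X i) (g := fun _ => ((1 : ℝ) : ℂ))
          ((hχe x (Or.inl hx)).mono fun y hy => by simp only [hy]), lieD_const]
      rw [hSe x (Or.inl hx), h0, (hχe x (Or.inl hx)).self_of_nhds]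
      push_cast
      ring
    · rw [image_eq_zero_of_notMem_tsupport hx, map_zero, zero_mul, zero_mul, zero_mul]
  simp only [e2] at hlim
  simp only [e1, hlim, Matrix.neg_apply, mul_neg, integral_neg, mul_mul_apply_eq, Finset.mul_sum]
  congr 1
  have hint := fun p q => hφ.integrable_conj_mul (hRGm i p q)
  rw [integral_finsetSum _ fun q _ => integrable_finsetSum _ fun p _ => hint p q]
  refine Finset.sum_congr rfl fun q _ => ?_
  rw [integral_finsetSum _ fun p _ => hint p q]

theorem IsMatrixWeakGrad.yosida {ρ : M → 𝕄} {G : Fin k → M → 𝕄} (hρ : ∀ᵐ x ∂μ, (ρ x).PosSemidef)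
    (h : IsMatrixWeakGrad μ X ρ G) {R : ℝ} (hR : 0 < R) (ε : ℝ) :
    IsMatrixWeakGrad μ X (fun x => yosida R ε (ρ x)) (fun i x => yosidaGrad R (ρ x) (G i x)) := by
  intro a b
  have h1 := (IsWeakGrad.const (μ := μ) (X := X) (((R + ε : ℝ) : ℂ) •
    (1 : 𝕄) a b)).add
      ((h.resolvent hμ hX hρ hR a b).const_mul (-((R ^ 2 : ℝ) : ℂ)))
  refine h1.congr (ae_of_all _ fun x => ?_) fun i => ae_of_all _ fun x => ?_
  · simp only [SubLaplacian.yosida, Matrix.sub_apply, Matrix.smul_apply, smul_eq_mul]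
    ring
  · simp only [yosidaGrad, Matrix.smul_apply, smul_eq_mul, Matrix.neg_apply]
    ring

omit hμ hX

/-! ### The chain rule for the matrix logarithm. -/

theorem IsWeakGrad.integral {ν : Measure ℝ} [SFinite ν] {F : M → ℝ → ℂ} {K : Fin k → M → ℝ → ℂ}
    (hF : Integrable (Function.uncurry F) (μ.prod ν))
    (hK : ∀ i, Integrable (Function.uncurry (K i)) (μ.prod ν))
    (h : ∀ᵐ s ∂ν, IsWeakGrad μ X (fun x => F x s) (fun i x => K i x s)) :
    IsWeakGrad μ X (fun x => ∫ s, F x s ∂ν) (fun i x => ∫ s, K i x s ∂ν) := by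
  refine ⟨hF.integral_prod_left, fun i => ⟨(hK i).integral_prod_left, fun φ ψ hφ hψ => ?_⟩⟩
  have key : ∀ {η : M → ℂ} {F : M → ℝ → ℂ}, IsTest d η → Integrable (Function.uncurry F) (μ.prod ν) →
      ∫ x, conj (η x) * ∫ s, F x s ∂ν ∂μ = ∫ s, ∫ x, conj (η x) * F x s ∂μ ∂ν := by
    intro η F hη hF
    simp only [← integral_const_mul]
    obtain ⟨c, hc⟩ := hη.2.exists_bound_of_continuous hη.1.continuous
    refine integral_integral_swap (f := fun x s => conj (η x) * F x s) ?_
    refine hF.bdd_mul (f := fun p : M × ℝ => conj (η p.1)) (c := c) ?_ (ae_of_all _ fun p => ?_)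
    · exact (Complex.continuous_conj.comp hη.1.continuous).aestronglyMeasurable.comp_fst
    · rw [RCLike.norm_conj]; exact hc p.1
  rw [key hφ (hK i), key hψ.1 hF]
  exact integral_congr_ae (h.mono fun s hs => (hs.2 i).2 φ ψ hφ hψ)

theorem memLp_two_of_sq_le {g : M → ℝ} (hf : AEStronglyMeasurable f μ)
    (hg : Integrable g μ) (h : ∀ᵐ x ∂μ, ‖f x‖ ^ 2 ≤ g x) : MemLp f 2 μ := by
  rw [← memLp_norm_iff hf, memLp_two_iff_integrable_sq hf.norm]
  refine hg.mono' (hf.norm.pow 2) (h.mono fun x hx => ?_)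
  rwa [Real.norm_of_nonneg (sq_nonneg _)]

theorem integrable_hsNormSq {G : M → 𝕄}
    (hG : ∀ a b, MemLp (fun x => G x a b) 2 μ) : Integrable (fun x => hsNormSq (G x)) μ :=
  integrable_finsetSum _ fun a _ => integrable_finsetSum _ fun b _ =>
    (memLp_two_iff_integrable_sq (hG a b).1.norm).1 (hG a b).norm

theorem posSemidef_of_sub {A : 𝕄} (hδ : 0 ≤ δ)
    (hA : (A - (δ : ℂ) • 1).PosSemidef) : A.PosSemidef := by
  obtain ⟨U, hU, a, rfl, ha, -⟩ := exists_diagConj_of_sub hA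
  exact (PosSemidef_diagConj_iff hU).2 fun i => hδ.trans (ha i)

theorem measurable_hsNormSq {A : M → 𝕄}
    (hA : ∀ a b, Measurable fun x => A x a b) : Measurable fun x => hsNormSq (A x) :=
  Finset.measurable_fun_sum _ fun a _ => Finset.measurable_fun_sum _ fun b _ => (hA a b).norm.pow_const 2

theorem norm_setIntegral_Ioc_le {f : ℝ → ℂ} {g : ℝ → ℝ} (hg : IntegrableOn g (Set.Ioi 0))
    (h : ∀ s, 0 < s → ‖f s‖ ≤ g s) (N : ℝ) :
    ‖∫ s in Set.Ioc 0 N, f s‖ ≤ ∫ s in Set.Ioi (0 : ℝ), g s := by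
  have hIoi : ∀ᵐ s ∂volume.restrict (Set.Ioi (0 : ℝ)), ‖f s‖ ≤ g s :=
    (ae_restrict_mem measurableSet_Ioi).mono h
  refine (norm_integral_le_of_norm_le (hg.mono_set Set.Ioc_subset_Ioi_self)
    (ae_restrict_of_ae_restrict_of_subset Set.Ioc_subset_Ioi_self hIoi)).trans ?_
  exact setIntegral_mono_set hg (hIoi.mono fun s hs => (norm_nonneg _).trans hs)
    Set.Ioc_subset_Ioi_self.eventuallyLE

theorem tendsto_setIntegral_Ioc {f : ℝ → ℂ} {g : ℝ → ℝ} (hg : IntegrableOn g (Set.Ioi 0))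
    (hf : Measurable f) (h : ∀ s, 0 < s → ‖f s‖ ≤ g s) :
    Tendsto (fun N : ℕ => ∫ s in Set.Ioc 0 (N : ℝ), f s) atTop (𝓝 (∫ s in Set.Ioi (0 : ℝ), f s)) := by
  refine (intervalIntegral_tendsto_integral_Ioi (0 : ℝ) (hg.mono' hf.aestronglyMeasurable
    ((ae_restrict_mem measurableSet_Ioi).mono h)) tendsto_natCast_atTop_atTop).congr fun N => ?_
  rw [intervalIntegral.integral_of_le N.cast_nonneg]

include hμ hX hL

/-- Truncated integrals of a family of weakly differentiable functions, bounded by `w x * g s` with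
`w ∈ L²` and `g` integrable on `(0, ∞)`, approximate the full integral in the graph norm. -/
theorem IsClosedGrad.integral_Ioi {F : M → ℝ → ℂ} {K : Fin k → M → ℝ → ℂ} {w : M → ℝ} {g : ℝ → ℝ} {c : ℝ}
    (hFm : Measurable (Function.uncurry F)) (hKm : ∀ i, Measurable (Function.uncurry (K i)))
    (hw : MemLp w 2 μ) (hg : IntegrableOn g (Set.Ioi 0))
    (hc : ∀ᵐ x ∂μ, ∀ s, 0 < s → ‖F x s‖ ≤ c) (hF : ∀ᵐ x ∂μ, ∀ s, 0 < s → ‖F x s‖ ≤ w x * g s)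
    (hK : ∀ i, ∀ᵐ x ∂μ, ∀ s, 0 < s → ‖K i x s‖ ≤ w x * g s)
    (h : ∀ s, 0 < s → IsWeakGrad μ X (fun x => F x s) (fun i x => K i x s)) :
    IsClosedGrad μ X (fun x => ∫ s in Set.Ioi (0 : ℝ), F x s)
      (fun i x => ∫ s in Set.Ioi (0 : ℝ), K i x s) := by
  set I := ∫ s in Set.Ioi (0 : ℝ), g s
  have hsm : ∀ {H : M → ℝ → ℂ} (S : Set ℝ), Measurable (Function.uncurry H) →
      AEStronglyMeasurable (fun x => ∫ s in S, H x s) μ := fun S hH =>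
    hH.stronglyMeasurable.integral_prod_right.aestronglyMeasurable
  have hbd : ∀ {H : M → ℝ → ℂ}, (∀ᵐ x ∂μ, ∀ s, 0 < s → ‖H x s‖ ≤ w x * g s) → ∀ N : ℝ,
      ∀ᵐ x ∂μ, ‖∫ s in Set.Ioc 0 N, H x s‖ ≤ w x * I := fun hH N => hH.mono fun x hx => by
    rw [← integral_const_mul]
    exact norm_setIntegral_Ioc_le (hg.const_mul _) hx N
  have hbd' : ∀ {H : M → ℝ → ℂ}, (∀ᵐ x ∂μ, ∀ s, 0 < s → ‖H x s‖ ≤ w x * g s) →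
      ∀ᵐ x ∂μ, ‖∫ s in Set.Ioi (0 : ℝ), H x s‖ ≤ w x * I := fun hH => hH.mono fun x hx => by
    rw [← integral_const_mul]
    exact norm_integral_le_of_norm_le (hg.const_mul _)
      ((ae_restrict_mem measurableSet_Ioi).mono hx)
  have hwI : MemLp (fun x => w x * I) 2 μ := hw.mul_const I
  have hm : ∀ {f : M → ℂ}, AEStronglyMeasurable f μ → (∀ᵐ x ∂μ, ‖f x‖ ≤ w x * I) → MemLp f 2 μ :=
    fun hf hb => hwI.mono hf (hb.mono fun x hx => hx.trans (le_abs_self _))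
  have hlim : ∀ {H : M → ℝ → ℂ}, Measurable (Function.uncurry H) →
      (∀ᵐ x ∂μ, ∀ s, 0 < s → ‖H x s‖ ≤ w x * g s) →
      Tendsto (fun N : ℕ => eLpNorm ((fun x => ∫ s in Set.Ioc 0 (N : ℝ), H x s) -
        fun x => ∫ s in Set.Ioi (0 : ℝ), H x s) 2 μ) atTop (𝓝 0) := by
    intro H hHm hH
    refine tendsto_eLpNorm_zero_of_dominated (b := fun x => ((2 * (w x * I) : ℝ) : ℂ)) two_ne_zero
      ENNReal.ofNat_ne_top (fun N => (hsm _ hHm).sub (hsm _ hHm)) (hwI.const_mul 2).ofReal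
      (fun N => ?_) (hH.mono fun x hx => ?_)
    · filter_upwards [hbd hH N, hbd' hH] with x h1 h2
      rw [Complex.norm_real, Pi.sub_apply]
      refine (norm_sub_le _ _).trans (le_trans ?_ (le_abs_self _))
      linarith
    · have := (tendsto_setIntegral_Ioc (hg.const_mul (w x)) (hHm.of_uncurry_left (x := x)) hx).sub_const
        (∫ s in Set.Ioi (0 : ℝ), H x s)
      rwa [sub_self] at this
  refine IsClosedGrad.of_tendsto hX (l := atTop) (fun N : ℕ => ?_) (hm (hsm _ hFm) (hbd' hF))
    (fun i => hm (hsm _ (hKm i)) (hbd' (hK i))) (hlim hFm hF) fun i => hlim (hKm i) (hK i)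
  have hprod : ∀ {H : M → ℝ → ℂ}, Measurable (Function.uncurry H) →
      (∀ᵐ x ∂μ, ∀ s, 0 < s → ‖H x s‖ ≤ w x * g s) →
      Integrable (Function.uncurry H) (μ.prod (volume.restrict (Set.Ioc 0 (N : ℝ)))) := by
    intro H hHm hH
    refine ((hw.integrable one_le_two).mul_prod (hg.mono_set Set.Ioc_subset_Ioi_self)).mono'
      hHm.aestronglyMeasurable ?_
    filter_upwards [Measure.quasiMeasurePreserving_fst.tendsto_ae.eventually hH,
      Measure.quasiMeasurePreserving_snd.tendsto_ae.eventually
        (ae_restrict_mem measurableSet_Ioc)] with y h1 h2 using h1 y.2 h2.1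
  refine (IsWeakGrad.integral (hprod hFm hF) (fun i => hprod (hKm i) (hK i))
    ((ae_restrict_mem measurableSet_Ioc).mono fun s hs => h s hs.1)).isClosedGrad hμ hX hL
      (c := c * N) (hc.mono fun x hx => ?_) fun i => hm (hsm _ (hKm i)) (hbd (hK i) N)
  have := norm_setIntegral_le_of_norm_le_const (μ := volume) (s := Set.Ioc 0 (N : ℝ))
    measure_Ioc_lt_top fun s hs => hx s hs.1
  simpa using this

/-- The chain rule for resolvents is integrated in `∫_0^∞ ((1 + s)⁻¹ - (ρ + s)⁻¹) ds`. No upper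
bound on `ρ` is assumed: the integrand is dominated by an `L²` function built from the trace of `ρ`
and the size of its gradient, times a function of `s` integrable because of the lower bound `δ`. -/
theorem IsClosedGrad.matrix_log (hρm : ∀ a b, Measurable fun x => ρ x a b)
    (hGm : ∀ i a b, Measurable fun x => G i x a b) (hδ : 0 < δ)
    (hρ : ∀ᵐ x ∂μ, (ρ x - (δ : ℂ) • 1).PosSemidef)
    (h : ∀ a b, IsClosedGrad μ X (fun x => ρ x a b) (fun i x => G i x a b)) (a b : Fin n) :
    IsClosedGrad μ X (fun x => cfc Real.log (ρ x) a b) (fun i x => logDeriv (ρ x) (G i x) a b) := by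
  have hpos : ∀ᵐ x ∂μ, (ρ x).PosSemidef := hρ.mono fun _ => posSemidef_of_sub hδ.le
  have hG : ∀ i, MemLp (fun x => √(hsNormSq (G i x))) 2 μ := fun i => by
    rw [memLp_two_iff_integrable_sq
      (measurable_hsNormSq (hGm i)).sqrt.aestronglyMeasurable]
    simpa only [Real.sq_sqrt (hsNormSq_nonneg _)] using
      integrable_hsNormSq fun a b => (h a b).2.1 i
  have htr : MemLp (fun x => (ρ x).trace.re) 2 μ :=
    (memLp_finsetSum Finset.univ fun a _ => (h a a).1).re
  have hw : MemLp (fun x => n * ((ρ x).trace.re + 1) + ∑ i, √(hsNormSq (G i x))) 2 μ :=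
    ((htr.add (memLp_const 1)).const_mul n).add (memLp_finsetSum _ fun i _ => hG i)
  have hg : IntegrableOn (fun s : ℝ => (1 + s)⁻¹ * (δ + s)⁻¹ + (δ + s)⁻¹ * (δ + s)⁻¹) (Set.Ioi 0) :=
    (integrableOn_inv_mul_inv one_pos hδ).add (integrableOn_inv_mul_inv hδ hδ)
  have htr0 : ∀ᵐ x ∂μ, 0 ≤ n * ((ρ x).trace.re + 1) := hpos.mono fun x hx =>
    mul_nonneg n.cast_nonneg (add_nonneg (Complex.nonneg_iff.1 hx.trace_nonneg).1 zero_le_one)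
  have hs0 : ∀ x, 0 ≤ ∑ i, √(hsNormSq (G i x)) := fun x => Finset.sum_nonneg fun _ _ => Real.sqrt_nonneg _
  set R : M → ℝ → 𝕄 := fun x s => (ρ x + (s : ℂ) • 1)⁻¹ with hR
  have h1 := IsClosedGrad.integral_Ioi hμ hX hL (c := 1 + n * δ⁻¹)
    (F := fun x s => ((((1 + s)⁻¹ : ℝ) : ℂ) • 1 - R x s) a b)
    (K := fun i x s => (R x s * G i x * R x s) a b) ?_
    (fun i => measurable_resolvent_mul_apply hρm (hGm i) a b) hw hg ?_ ?_ ?_ fun s hs => ?_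
  · refine h1.congr (hρ.mono fun x hx => ?_) fun i => hρ.mono fun x hx => ?_
    · simp only
      rw [cfc_log_eq_matInt hx hδ]
      rfl
    · simp only
      rw [logDeriv_eq_matInt hx hδ]
      rfl
  · have h2 : Measurable fun y : M × ℝ => (((1 + y.2)⁻¹ : ℝ) : ℂ) :=
      Complex.measurable_ofReal.comp (measurable_snd.const_add 1).inv
    exact (h2.mul_const _).sub (measurable_resolvent_apply hρm a b)
  · filter_upwards [hρ] with x hx s hs
    rw [Matrix.sub_apply, Matrix.smul_apply, smul_eq_mul]
    refine (norm_sub_le _ _).trans (add_le_add ?_ ((norm_resolvent_le hx hδ.le hs a b).trans ?_))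
    · rw [norm_mul, Complex.norm_real, Real.norm_of_nonneg (by positivity)]
      refine mul_le_one₀ (inv_le_one_of_one_le₀ (by linarith)) (norm_nonneg _) ?_
      rw [Matrix.one_apply]; split_ifs <;> simp
    · gcongr; linarith
  · filter_upwards [hρ, hpos, htr0] with x hx hp h0 s hs
    refine (norm_inv_sub_resolvent_le hx hδ (trace_sub_posSemidef hp) hs a b).trans ?_
    rw [← mul_assoc]
    have := hs0 x
    gcongr <;> [linarith; exact le_add_of_nonneg_right (by positivity)]
  · intro i
    filter_upwards [hρ, htr0] with x hx h0 s hs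
    refine (norm_resolvent_mul_le hx hδ.le hs a b).trans ?_
    rw [mul_comm]
    have h2 := Finset.single_le_sum (f := fun i => √(hsNormSq (G i x)))
      (fun _ _ => Real.sqrt_nonneg _) (Finset.mem_univ i)
    have := hs0 x
    gcongr <;> [exact h2.trans (le_add_of_nonneg_left h0); exact le_add_of_nonneg_left (by positivity)]
  · have h2 := (IsWeakGrad.const (μ := μ) (X := X) ((((1 + s)⁻¹ : ℝ) : ℂ) •
      (1 : 𝕄) a b)).add ((IsMatrixWeakGrad.resolvent hμ hX hpos
        (fun a b => (h a b).isWeakGrad hX) hs a b).const_mul (-1))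
    refine h2.congr (ae_of_all _ fun x => ?_) fun i => ae_of_all _ fun x => ?_
    · simp only [hR, Matrix.sub_apply, Matrix.smul_apply, smul_eq_mul]
      ring
    · simp only [hR, Matrix.neg_apply]
      ring

omit hμ hX hL

/-! ### Matrix-valued functions bounded above and below. -/

/-- A matrix-valued function bounded from below and above with gradient in `L²`. -/
structure IsNice (μ : Measure M) (X : Fin k → VField d M) (δ m : ℝ)
    (ρ : M → 𝕄) (G : Fin k → M → 𝕄) : Prop where
  meas : ∀ a b, Measurable fun x => ρ x a b
  meas_grad : ∀ i a b, Measurable fun x => G i x a b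
  pos : 0 < δ
  le : ∀ᵐ x ∂μ, (ρ x - (δ : ℂ) • 1).PosSemidef
  ge : ∀ᵐ x ∂μ, ((m : ℂ) • 1 - ρ x).PosSemidef
  grad : ∀ a b, IsClosedGrad μ X (fun x => ρ x a b) (fun i x => G i x a b)

namespace IsNice

theorem posSemidef (h : IsNice μ X δ m ρ G) : ∀ᵐ x ∂μ, (ρ x).PosSemidef :=
  h.le.mono fun _ hx => posSemidef_of_sub h.pos.le hx

theorem memLp_logDeriv (h : IsNice μ X δ m ρ G) {H : M → 𝕄}
    (hHm : ∀ a b, Measurable fun x => H x a b) (hH : ∀ a b, MemLp (fun x => H x a b) 2 μ)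
    (a b : Fin n) : MemLp (fun x => logDeriv (ρ x) (H x) a b) 2 μ :=
  memLp_two_of_sq_le (measurable_logDeriv_apply h.meas hHm a b).aestronglyMeasurable
    ((integrable_hsNormSq hH).const_mul (δ⁻¹ ^ 2)) (h.le.mono fun _ hx =>
      (norm_sq_le_hsNormSq _ a b).trans (hsNormSq_logDeriv_le' hx h.pos _))

include hμ hX hL in
theorem log (h : IsNice μ X δ m ρ G) (a b : Fin n) :
    IsClosedGrad μ X (fun x => cfc Real.log (ρ x) a b) (fun i x => logDeriv (ρ x) (G i x) a b) :=
  IsClosedGrad.matrix_log hμ hX hL h.meas h.meas_grad h.pos h.le h.grad a b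

end IsNice

/-! ### The matrix form of the gradient estimate. -/

include hP in
theorem IsMarkovMap.re_apply_nonneg (hf : MemLp f ∞ μ)
    (h : ∀ᵐ x ∂μ, 0 ≤ (f x).re) : ∀ᵐ x ∂μ, 0 ≤ (markovApply P f x).re := by
  have h1 : MemLp (fun x => f x + conj (f x)) ∞ μ := hf.add (memLp_conj hf)
  have h2 := hP.apply_nonneg h1 (h.mono fun x hx => by
    rw [Complex.add_conj]; exact_mod_cast mul_nonneg zero_le_two hx)
  filter_upwards [h2, markovApply_add (P := P) hf (memLp_conj hf), hP.apply_conj hf]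
    with x hx1 hx2 hx3
  rw [hx2, hx3, Complex.add_conj] at hx1
  have : 0 ≤ 2 * (markovApply P f x).re := by exact_mod_cast hx1
  linarith

theorem re_trace_mul_eq (A N : 𝕄) : (A * N).trace = ∑ p, ∑ q, A p q * N q p := by
  simp only [trace, diag, Matrix.mul_apply]

/-- The entrywise action of `P` on matrix-valued functions. -/
def markovMat (P : Lp ℂ ∞ μ →ₗ[ℂ] Lp ℂ ∞ μ) (N : M → 𝕄)
    (x : M) : 𝕄 := Matrix.of fun a b => markovApply P (fun y => N y a b) x

theorem markovApply_trace {N : M → 𝕄} (hN : ∀ a b, MemLp (fun x => N x a b) ∞ μ) (A : 𝕄) :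
    markovApply P (fun x => (A * N x).trace) =ᵐ[μ] fun x => (A * markovMat P N x).trace := by
  simp only [re_trace_mul_eq]
  refine (markovApply_finset_sum _ fun p _ => memLp_finsetSum _ fun q _ =>
    (hN q p).const_mul (A p q)).trans ?_
  have h1 : ∀ p, markovApply P (fun x => ∑ q, A p q * N x q p) =ᵐ[μ]
      fun x => ∑ q, A p q * markovMat P N x q p := fun p => by
    refine (markovApply_finset_sum _ fun q _ => (hN q p).const_mul (A p q)).trans ?_
    filter_upwards [ae_all_iff.2 fun q => markovApply_const_mul (P := P) (hN q p) (A p q)] with x hx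
    exact Finset.sum_congr rfl fun q _ => hx q
  filter_upwards [ae_all_iff.2 h1] with x hx
  exact Finset.sum_congr rfl fun p _ => hx p

theorem memLp_trace_mul {N : M → 𝕄} (hN : ∀ a b, MemLp (fun x => N x a b) p μ) (A : 𝕄) :
    MemLp (fun x => (A * N x).trace) p μ := by
  simp only [re_trace_mul_eq]
  exact memLp_finsetSum _ fun p _ => memLp_finsetSum _ fun q _ => (hN q p).const_mul (A p q)

/-- The gradient matrix of a matrix of test functions. -/
def lieMat (V : VField d M) (f : Fin n → Fin n → M → ℂ) (x : M) :
    𝕄 := Matrix.of fun a b => lieD V (f a b) x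

-- For a constant `W`, each entry of the rotated gradient matrix is the gradient of one scalar test
-- function `g p q`. The left side of the hypothesis is therefore a nonnegative combination of
-- scalar carrés du champ; positivity of `P` transports the inequality, and the scalar gradient
-- estimate bounds each `Γ(P g p q)`.
include hμ hX hL hP hC0 hC in
theorem GradientEstimate.dominates_at {f : Fin n → Fin n → M → ℂ} (hf : ∀ a b, IsTest d (f a b))
    {K : Fin n → Fin n → Fin k → M → ℂ} (hK : ∀ a b, IsClosedGrad μ X (markovApply P (f a b)) (K a b))
    {N : M → 𝕄} (hN : ∀ a b, MemLp (fun x => N x a b) ∞ μ)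
    {W A : 𝕄} {l : Fin n → Fin n → ℝ} (hl : ∀ p q, 0 ≤ l p q)
    (hdom : ∀ᵐ x ∂μ, ∑ i, ∑ p, ∑ q, l p q * ‖rot W (lieMat (X i) f x) p q‖ ^ 2 ≤
      (A * N x).trace.re) :
    ∀ᵐ x ∂μ, ∑ i, ∑ p, ∑ q, l p q * ‖rot W (Matrix.of fun a b => K a b i x) p q‖ ^ 2 ≤
      C * (A * markovMat P N x).trace.re := by
  set g : Fin n → Fin n → M → ℂ := fun p q x => ∑ e, ∑ c, (conj (W c p) * W e q) * f c e x with hg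
  have hterm : ∀ p q e, ∀ c, IsTest d fun x => (conj (W c p) * W e q) * f c e x := fun p q e c =>
    (hf c e).const_mul _
  have hgt : ∀ p q, IsTest d (g p q) := fun p q =>
    IsTest.sum fun e _ => IsTest.sum fun c _ => hterm p q e c
  have hlie : ∀ p q i x, lieD (X i) (g p q) x = rot W (lieMat (X i) f x) p q := fun p q i x => by
    rw [hg, lieD_sum (X i) _ fun e _ => (IsTest.sum fun c _ => hterm p q e c).1, rot_apply]
    refine Finset.sum_congr rfl fun e _ => ?_
    rw [lieD_sum (X i) _ fun c _ => (hterm p q e c).1]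
    refine Finset.sum_congr rfl fun c _ => ?_
    rw [lieD_const_mul (X i) _ (hf c e).1, lieMat, of_apply]
    ring
  have hGK : ∀ p q, ∃ L, IsClosedGrad μ X (markovApply P (g p q)) L ∧
      ∀ i, L i =ᵐ[μ] fun x => rot W (Matrix.of fun a b => K a b i x) p q := fun p q => by
    have h1 := IsClosedGrad.finset_sum hX Finset.univ fun e _ =>
      IsClosedGrad.finset_sum hX Finset.univ fun c _ => (hK c e).const_mul hX (conj (W c p) * W e q)
    refine ⟨_, h1.congr ?_ fun i => ae_eq_refl _, fun i => ae_of_all _ fun x => ?_⟩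
    · refine Filter.EventuallyEq.symm ?_
      refine (markovApply_finset_sum _ fun e _ => (IsTest.sum fun c _ =>
        hterm p q e c).memLp ∞).trans ?_
      have h2 : ∀ e, markovApply P (fun x => ∑ c, (conj (W c p) * W e q) * f c e x) =ᵐ[μ]
          fun x => ∑ c, (conj (W c p) * W e q) * markovApply P (f c e) x := fun e => by
        refine (markovApply_finset_sum _ fun c _ => (hterm p q e c).memLp ∞).trans ?_
        filter_upwards [ae_all_iff.2 fun c => markovApply_const_mul (P := P) ((hf c e).memLp ∞)
          (conj (W c p) * W e q)] with x hx
        exact Finset.sum_congr rfl fun c _ => hx c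
      filter_upwards [ae_all_iff.2 h2] with x hx
      exact Finset.sum_congr rfl fun e _ => hx e
    · simp only [rot_apply, of_apply]
      exact Finset.sum_congr rfl fun e _ => Finset.sum_congr rfl fun c _ => by ring
  choose L hL1 hL2 using hGK
  choose L' hL1' hle _ using fun p q => hC.exists_closedGrad hμ hX hL hP hC0 (hgt p q)
  have hcm := fun p q => (hgt p q).memLp_carre (μ := μ) hX
  have hcl := fun p q => (hcm p q).const_mul (l p q : ℂ)
  have hsum : MemLp (fun x => ∑ p, ∑ q, (l p q : ℂ) * (carre X (g p q) x : ℂ)) ∞ μ :=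
    memLp_finsetSum _ fun p _ => memLp_finsetSum _ fun q _ => hcl p q
  have hpos := hP.re_apply_nonneg ((memLp_trace_mul hN A).sub hsum) (hdom.mono fun x hx => by
    rw [Pi.sub_apply, Complex.sub_re, sub_nonneg]
    refine le_trans (le_of_eq ?_) hx
    simp only [carre, hlie, ← Complex.ofReal_mul, ← Complex.ofReal_sum, Complex.ofReal_re,
      Finset.mul_sum]
    rw [eq_comm, Finset.sum_comm]
    refine (Finset.sum_congr rfl fun p _ => ?_)
    rw [Finset.sum_comm])
  have hPs : markovApply P (fun x => ∑ p, ∑ q, (l p q : ℂ) * (carre X (g p q) x : ℂ)) =ᵐ[μ]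
      fun x => ∑ p, ∑ q, (l p q : ℂ) * markovApply P (fun x => (carre X (g p q) x : ℂ)) x := by
    refine (markovApply_finset_sum _ fun p _ => memLp_finsetSum _ fun q _ => hcl p q).trans ?_
    have h2 : ∀ p, markovApply P (fun x => ∑ q, (l p q : ℂ) * (carre X (g p q) x : ℂ)) =ᵐ[μ]
        fun x => ∑ q, (l p q : ℂ) * markovApply P (fun x => (carre X (g p q) x : ℂ)) x := fun p => by
      refine (markovApply_finset_sum _ fun q _ => hcl p q).trans ?_
      filter_upwards [ae_all_iff.2 fun q => markovApply_const_mul (P := P) (hcm p q) (l p q : ℂ)]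
        with x hx
      exact Finset.sum_congr rfl fun q _ => hx q
    filter_upwards [ae_all_iff.2 h2] with x hx
    exact Finset.sum_congr rfl fun p _ => hx p
  have hLL := ae_all_iff.2 fun p => ae_all_iff.2 fun q => ae_all_iff.2 fun i =>
    ((((hL1' p q).isWeakGrad hX).ae_unique hμ hX ((hL1 p q).isWeakGrad hX) i).trans (hL2 p q i))
  filter_upwards [hpos, hPs, hLL, ae_all_iff.2 fun p => ae_all_iff.2 fun q => hle p q,
    markovApply_sub (P := P) (memLp_trace_mul hN A) hsum, markovApply_trace (P := P) hN A]
    with x h1 h2 h3 h4 h5 h6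
  have h7 : markovApply P ((fun x => (A * N x).trace) -
      fun x => ∑ p, ∑ q, (l p q : ℂ) * (carre X (g p q) x : ℂ)) x = (A * markovMat P N x).trace -
      ∑ p, ∑ q, (l p q : ℂ) * markovApply P (fun x => (carre X (g p q) x : ℂ)) x := by
    rw [← h6, ← h2]
    exact h5
  rw [h7, Complex.sub_re, sub_nonneg] at h1
  refine le_trans ?_ (mul_le_mul_of_nonneg_left h1 hC0)
  rw [Finset.sum_comm, Complex.re_sum, Finset.mul_sum]
  refine Finset.sum_le_sum fun p _ => ?_
  rw [Finset.sum_comm, Complex.re_sum, Finset.mul_sum]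
  refine Finset.sum_le_sum fun q _ => ?_
  rw [← Finset.mul_sum, Complex.re_ofReal_mul, mul_left_comm]
  refine mul_le_mul_of_nonneg_left ?_ (hl p q)
  simpa only [h3] using h4 p q

theorem continuous_rot_apply {Θ : Type*} [TopologicalSpace Θ] {W : Θ → 𝕄}
    (hW : ∀ a b, Continuous fun θ => W θ a b) (G : 𝕄) (p q : Fin n) :
    Continuous fun θ => rot (W θ) G p q := by
  simp only [rot_apply]
  exact continuous_finsetSum _ fun e _ => continuous_finsetSum _ fun c _ =>
    ((Complex.continuous_conj.comp (hW c p)).mul continuous_const).mul (hW e q)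

include hμ hX hL hP hC0 hC in
/-- The gradient estimate for matrix-valued functions in its dual form. -/
theorem GradientEstimate.dominates {f : Fin n → Fin n → M → ℂ} (hf : ∀ a b, IsTest d (f a b))
    {K : Fin n → Fin n → Fin k → M → ℂ} (hK : ∀ a b, IsClosedGrad μ X (markovApply P (f a b)) (K a b))
    {N : M → 𝕄} (hN : ∀ a b, MemLp (fun x => N x a b) ∞ μ)
    (hdom : ∀ᵐ x ∂μ, Dominates (fun i => lieMat (X i) f x) (N x)) :
    ∀ᵐ x ∂μ, Dominates (fun i => Matrix.of fun a b => K a b i x) ((C : ℂ) • markovMat P N x) := by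
  -- The pointwise bound has a null set for each parameter; a countable dense family removes this
  -- dependence. The weights `l` are independent parameters constrained by an inequality, so the
  -- final bound is continuous in the parameters without any continuity of the logarithmic mean.
  let Θ := {θ : (Fin n → Fin n → ℂ) × (Fin n → ℝ) × (Fin n → Fin n → ℝ) //
    Matrix.of θ.1 ∈ 𝕌 ∧ (∀ i, 0 < θ.2.1 i) ∧ (∀ p q, 0 ≤ θ.2.2 p q) ∧
      ∀ p q, θ.2.2 p q * logKernel (θ.2.1 p) (θ.2.1 q) ≤ 1}
  obtain ⟨S, hSc, hSd⟩ := TopologicalSpace.exists_countable_dense Θ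
  have h1 : ∀ᵐ x ∂μ, ∀ θ ∈ S, ∑ i, ∑ p, ∑ q, θ.1.2.2 p q *
      ‖rot (Matrix.of θ.1.1) (Matrix.of fun a b => K a b i x) p q‖ ^ 2 ≤
      C * (diagConj (Matrix.of θ.1.1) θ.1.2.1 * markovMat P N x).trace.re := by
    refine (ae_ball_iff hSc).2 fun θ _ => ?_
    exact hC.dominates_at hμ hX hL hP hC0 hf hK hN θ.2.2.2.1
      (hdom.mono fun x hx => hx _ θ.2.1 _ _ θ.2.2.1 θ.2.2.2.1 θ.2.2.2.2)
  filter_upwards [h1] with x hx W hW a l ha hl0 hl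
  have hcW : ∀ a b, Continuous fun θ : Θ => Matrix.of θ.1.1 a b := fun a b =>
    (continuous_apply_apply a b).comp (continuous_fst.comp continuous_subtype_val)
  have hca : ∀ p, Continuous fun θ : Θ => θ.1.2.1 p := fun p =>
    (continuous_apply p).comp (continuous_fst.comp (continuous_snd.comp continuous_subtype_val))
  have hcl : ∀ p q, Continuous fun θ : Θ => θ.1.2.2 p q := fun p q =>
    (continuous_apply_apply p q).comp
      (continuous_snd.comp (continuous_snd.comp continuous_subtype_val))
  have hclosed : IsClosed {θ : Θ | ∑ i, ∑ p, ∑ q, θ.1.2.2 p q *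
      ‖rot (Matrix.of θ.1.1) (Matrix.of fun a b => K a b i x) p q‖ ^ 2 ≤
      C * (diagConj (Matrix.of θ.1.1) θ.1.2.1 * markovMat P N x).trace.re} := by
    refine isClosed_le ?_ (continuous_const.mul (Complex.continuous_re.comp ?_))
    · exact continuous_finsetSum _ fun i _ => continuous_finsetSum _ fun p _ =>
        continuous_finsetSum _ fun q _ => (hcl p q).mul
          ((continuous_rot_apply hcW _ p q).norm.pow 2)
    · simp only [re_trace_mul_eq, diagConj_apply]
      exact continuous_finsetSum _ fun p _ => continuous_finsetSum _ fun q _ =>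
        (continuous_finsetSum _ fun r _ => ((hcW p r).mul (Complex.continuous_ofReal.comp
          (hca r))).mul (Complex.continuous_conj.comp (hcW q r))).mul continuous_const
  have h2 := hclosed.closure_subset_iff.2 hx (hSd ⟨(W, a, l), hW, ha, hl0, hl⟩)
  refine le_trans h2 (le_of_eq ?_)
  rw [Matrix.mul_smul, trace_smul, smul_eq_mul, Complex.re_ofReal_mul]
  rfl

/-! ### Integrals of traces and the pairing with the adjoint image. -/

theorem inner_toLp {f g : M → ℂ} (hf : MemLp f 2 μ) (hg : MemLp g 2 μ) :
    inner ℂ (hf.toLp f) (hg.toLp g) = ∫ x, conj (f x) * g x ∂μ := by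
  rw [inner_Lp_eq]
  refine integral_congr_ae ?_
  filter_upwards [hf.coeFn_toLp, hg.coeFn_toLp] with x h1 h2
  rw [h1, h2]

theorem tendsto_integral_conj_mul_two {g : ι → M → ℂ} {g' h : M → ℂ}
    (hg : ∀ j, MemLp (g j) 2 μ) (hg' : MemLp g' 2 μ) (hh : MemLp h 2 μ)
    (hlim : Tendsto (fun j => eLpNorm (g j - g') 2 μ) l (𝓝 0)) :
    Tendsto (fun j => ∫ x, conj (g j x) * h x ∂μ) l (𝓝 (∫ x, conj (g' x) * h x ∂μ)) := by
  have h1 := (Lp.tendsto_Lp_iff_tendsto_eLpNorm'' g hg g' hg').2 hlim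
  have h2 := h1.inner (𝕜 := ℂ) (tendsto_const_nhds (x := hh.toLp h))
  simpa only [inner_toLp] using h2

theorem tendsto_integral_norm_sq {g : ι → M → ℂ}
    (hg : ∀ j, MemLp (g j) 2 μ) (hlim : Tendsto (fun j => eLpNorm (g j) 2 μ) l (𝓝 0)) :
    Tendsto (fun j => ∫ x, ‖g j x‖ ^ 2 ∂μ) l (𝓝 0) := by
  have e : ∀ j, ∫ x, ‖g j x‖ ^ 2 ∂μ = (eLpNorm (g j) 2 μ).toReal ^ 2 := fun j => by
    rw [← Lp.norm_toLp _ (hg j), norm_sq_Lp]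
    exact integral_congr_ae ((hg j).coeFn_toLp.mono fun x hx => by simp only [hx])
  simp only [e]
  simpa using ((ENNReal.tendsto_toReal ENNReal.zero_ne_top).comp hlim).pow 2

theorem integrable_conj_mul_two {f g : M → ℂ} (hf : MemLp f 2 μ) (hg : MemLp g 2 μ) :
    Integrable (fun x => conj (f x) * g x) μ :=
  MemLp.integrable_mul (memLp_conj hf) hg

theorem integral_re_trace_mul {V W : Fin k → M → 𝕄}
    (h : ∀ i a b, Integrable (fun x => conj (V i x a b) * W i x a b) μ) :
    Integrable (fun x => ∑ i, ((V i x)ᴴ * W i x).trace.re) μ ∧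
    ∫ x, ∑ i, ((V i x)ᴴ * W i x).trace.re ∂μ =
      (∑ a, ∑ b, ∑ i, ∫ x, conj (V i x a b) * W i x a b ∂μ).re := by
  have e : ∀ x, ∑ i, ((V i x)ᴴ * W i x).trace.re =
      ∑ a, ∑ b, ∑ i, (conj (V i x a b) * W i x a b).re := fun x => by
    simp only [trace_conjTranspose_mul, Complex.re_sum]
    rw [Finset.sum_comm]
    exact Finset.sum_congr rfl fun a _ => Finset.sum_comm
  simp only [e, Complex.re_sum]
  have h' : ∀ i a b, Integrable (fun x => (conj (V i x a b) * W i x a b).re) μ :=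
    fun i a b => (h i a b).re
  refine ⟨integrable_finsetSum _ fun a _ => integrable_finsetSum _ fun b _ =>
    integrable_finsetSum _ fun i _ => h' i a b, ?_⟩
  rw [integral_finsetSum _ fun a _ => integrable_finsetSum _ fun b _ =>
    integrable_finsetSum _ fun i _ => h' i a b]
  refine Finset.sum_congr rfl fun a _ => ?_
  rw [integral_finsetSum _ fun b _ => integrable_finsetSum _ fun i _ => h' i a b]
  refine Finset.sum_congr rfl fun b _ => ?_
  rw [integral_finsetSum _ fun i _ => h' i a b]
  exact Finset.sum_congr rfl fun i _ => integral_re (h i a b)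

theorem integrable_trace_mul {N : M → 𝕄} (hρ : ∀ a b, Integrable (fun x => ρ x a b) μ)
    (hN : ∀ a b, MemLp (fun x => N x a b) ∞ μ) : Integrable (fun x => (ρ x * N x).trace) μ := by
  simp only [re_trace_mul_eq]
  refine integrable_finsetSum _ fun p _ => integrable_finsetSum _ fun q _ => ?_
  simpa [mul_comm] using integrable_conj_mul_of_memLp_top (memLp_conj (hN q p)) (hρ p q)

include hP in
theorem IsAdjointImage.integral_trace_mul (had : IsAdjointImage μ P ρ σ)
    (hρ : ∀ a b, Integrable (fun x => ρ x a b) μ) {N : M → 𝕄}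
    (hN : ∀ a b, MemLp (fun x => N x a b) ∞ μ) :
    ∫ x, (ρ x * markovMat P N x).trace ∂μ = ∫ x, (σ x * N x).trace ∂μ := by
  have h1 : ∀ {τ N' : M → 𝕄}, (∀ a b, Integrable (fun x => τ x a b) μ) →
      (∀ a b, MemLp (fun x => N' x a b) ∞ μ) → ∫ x, (τ x * N' x).trace ∂μ =
        ∑ p, ∑ q, ∫ x, τ x p q * N' x q p ∂μ := by
    intro τ N' hτ hN'
    have hi : ∀ p q, Integrable (fun x => τ x p q * N' x q p) μ := fun p q => by
      simpa [mul_comm] using integrable_conj_mul_of_memLp_top (memLp_conj (hN' q p)) (hτ p q)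
    simp only [re_trace_mul_eq]
    rw [integral_finsetSum _ fun p _ => integrable_finsetSum _ fun q _ => hi p q]
    exact Finset.sum_congr rfl fun p _ => integral_finsetSum _ fun q _ => hi p q
  rw [h1 (N' := markovMat P N) hρ fun a b => memLp_markovApply, h1 (fun a b => (had a b).1) hN]
  refine Finset.sum_congr rfl fun p _ => Finset.sum_congr rfl fun q _ => ?_
  have h2 := (isAdjointImage_iff.1 had p q).integral_eq (memLp_conj (hN q p))
  simp only [Complex.conj_conj, mul_comm _ (σ _ p q)] at h2
  rw [h2]
  refine integral_congr_ae ((hP.apply_conj (hN q p)).mono fun x hx => ?_)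
  simp only [hx, Complex.conj_conj, markovMat, of_apply, mul_comm]

theorem logDeriv_zero {A : 𝕄} (hδ : 0 < δ)
    (hA : (A - (δ : ℂ) • 1).PosSemidef) : logDeriv A 0 = 0 := by
  ext a b
  have h1 := (norm_sq_le_hsNormSq (logDeriv A 0) a b).trans (hsNormSq_logDeriv_le' hA hδ 0)
  have h2 : hsNormSq (0 : 𝕄) = 0 := by simp [hsNormSq]
  rw [h2, mul_zero] at h1
  simpa using le_antisymm h1 (sq_nonneg _)

theorem re_trace_le_of_sub {A : 𝕄} (hA : ((m : ℂ) • 1 - A).PosSemidef) : A.trace.re ≤ n * m := by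
  have h := (Complex.nonneg_iff.1 hA.trace_nonneg).1
  rw [trace_sub, trace_smul, trace_one, Complex.sub_re, smul_eq_mul, Complex.re_ofReal_mul] at h
  simp at h
  linarith

namespace IsNice

theorem memLp_apply (h : IsNice μ X δ m ρ G) (a b : Fin n) : MemLp (fun x => ρ x a b) ∞ μ := by
  refine memLp_top_of_bound (h.meas a b).aestronglyMeasurable (n * m) ?_
  filter_upwards [h.posSemidef, h.ge] with x h1 h2
  exact (norm_apply_le_trace h1 a b).trans (re_trace_le_of_sub h2)

theorem re_trace_le (h : IsNice μ X δ m ρ G) : ∀ᵐ x ∂μ, (ρ x).trace.re ≤ n * m :=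
  h.ge.mono fun _ hx => re_trace_le_of_sub hx

theorem integrable_fisherReal (h : IsNice μ X δ m ρ G) :
    Integrable (fun x => ∑ i, fisherReal (ρ x) (G i x)) μ ∧
    ∫ x, ∑ i, fisherReal (ρ x) (G i x) ∂μ = (∑ a, ∑ b, ∑ i, ∫ x,
      conj (logDeriv (ρ x) (G i x) a b) * G i x a b ∂μ).re :=
  integral_re_trace_mul (V := fun i x => logDeriv (ρ x) (G i x)) fun i a b =>
    integrable_conj_mul_two (h.memLp_logDeriv (h.meas_grad i) (fun a b => (h.grad a b).2.1 i) a b)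
      ((h.grad a b).2.1 i)

end IsNice

/-! ### The duality estimate and its limit. -/

/-- Cut-off of large matrices. -/
def cut (j : ℕ) (A : 𝕄) : 𝕄 := open Classical in if hsNormSq A ≤ j then A else 0

theorem hsNormSq_cut_le (j : ℕ) (A : 𝕄) : hsNormSq (cut j A) ≤ j := by
  unfold cut
  split_ifs with h
  · exact h
  · simp [hsNormSq]

theorem measurable_cut {A : M → 𝕄} (hA : ∀ a b, Measurable fun x => A x a b)
    (j : ℕ) (a b : Fin n) : Measurable fun x => cut j (A x) a b := by
  have e : (fun x => cut j (A x) a b) = fun x =>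
      open Classical in if hsNormSq (A x) ≤ j then A x a b else 0 := by
    funext x; unfold cut; split_ifs <;> rfl
  rw [e]
  exact Measurable.ite (measurableSet_le (measurable_hsNormSq hA) measurable_const) (hA a b)
    measurable_const

theorem memLp_hsNormSq {A : M → 𝕄} (hA : ∀ a b, MemLp (fun x => A x a b) ∞ μ) :
    MemLp (fun x => ((hsNormSq (A x) : ℝ) : ℂ)) ∞ μ := by
  unfold hsNormSq
  simp only [Complex.ofReal_sum, ← conj_mul_self_eq]
  exact memLp_finsetSum _ fun a _ => memLp_finsetSum _ fun b _ =>
    memLp_top_mul (memLp_conj (hA a b)) (hA a b)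

theorem memLp_top_of_hsNormSq_le {A : M → 𝕄} (hA : ∀ a b, Measurable fun x => A x a b) {c : ℝ}
    (h : ∀ᵐ x ∂μ, hsNormSq (A x) ≤ c) (a b : Fin n) : MemLp (fun x => A x a b) ∞ μ :=
  memLp_top_of_bound (hA a b).aestronglyMeasurable (√c)
    (h.mono fun x hx => Real.le_sqrt_of_sq_le ((norm_sq_le_hsNormSq (A x) a b).trans hx))

include hμ hX hL hP hC0 hC in
/-- The bound for the pairing of the gradients in terms of an approximation of the logarithm. -/
theorem IsNice.pairing_le
    (hρ : IsNice μ X δ m ρ G) (hσ : IsNice μ X δ m σ H) (had : IsAdjointImage μ P ρ σ)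
    (hrel : ∀ a b φ, IsTest d φ → ∀ K, IsClosedGrad μ X (markovApply P φ) K →
      ∑ i, ∫ x, conj (lieD (X i) φ x) * H i x a b ∂μ = ∑ i, ∫ x, conj (K i x) * G i x a b ∂μ)
    {t ε : ℝ} (ht : 0 < t) (hε : 0 < ε) {f : Fin n → Fin n → M → ℂ} (hf : ∀ a b, IsTest d (f a b))
    (j : ℕ) : 2 * (∑ a, ∑ b, ∑ i, ∫ x, conj (lieD (X i) (f a b) x) * H i x a b ∂μ).re ≤
      t * ∫ x, ∑ i, fisherReal (ρ x) (G i x) ∂μ +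
        t⁻¹ * (C * ((1 + ε) * ∫ x, ∑ i, fisherReal (σ x) (H i x) ∂μ + (1 + ε⁻¹) * (n * m *
          ∫ x, ∑ i, hsNormSq (lieMat (X i) f x - logDeriv (σ x) (cut j (H i x))) ∂μ))) := by
  -- `P` acts on bounded functions, so the majorant is built from the cut gradient, for which
  -- `dualN` is bounded. The difference between `∇f` and `T` is carried along as an error with the
  -- crude majorant.
  set T : Fin k → M → 𝕄 := fun i x => logDeriv (σ x) (cut j (H i x)) with hT
  set E : Fin k → M → 𝕄 := fun i x => lieMat (X i) f x - T i x with hE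
  set N : M → 𝕄 := fun x =>
    ((1 + ε : ℝ) : ℂ) • ∑ i, dualN (σ x) (cut j (H i x)) +
      ((1 + ε⁻¹ : ℝ) : ℂ) • (((∑ i, hsNormSq (E i x) : ℝ) : ℂ) • 1) with hN
  have hcm := fun i => measurable_cut (hσ.meas_grad i) j
  have hTtop : ∀ i a b, MemLp (fun x => T i x a b) ∞ μ := fun i a b =>
    memLp_top_of_hsNormSq_le (measurable_logDeriv_apply hσ.meas (hcm i)) (hσ.le.mono fun x hx =>
      (hsNormSq_logDeriv_le' hx hσ.pos _).trans (mul_le_mul_of_nonneg_left (hsNormSq_cut_le j _)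
        (sq_nonneg _))) a b
  have hEtop : ∀ i a b, MemLp (fun x => E i x a b) ∞ μ := fun i a b =>
    (((hf a b).lieD (hX i)).memLp ∞).sub (hTtop i a b)
  have hDtop : ∀ i a b, MemLp (fun x => dualN (σ x) (cut j (H i x)) a b) ∞ μ := fun i a b =>
    memLp_top_of_bound (measurable_dualN_apply hσ.meas (hcm i) a b).aestronglyMeasurable
      (δ⁻¹ ^ 2 * j) (hσ.le.mono fun x hx => (norm_dualN_apply_le' hx hσ.pos _ a b).trans
        (mul_le_mul_of_nonneg_left (hsNormSq_cut_le j _) (sq_nonneg _)))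
  have hNtop : ∀ a b, MemLp (fun x => N x a b) ∞ μ := fun a b => by
    simp only [hN, Matrix.add_apply, Matrix.smul_apply, smul_eq_mul, Matrix.sum_apply,
      Complex.ofReal_sum]
    exact ((memLp_finsetSum _ fun i _ => hDtop i a b).const_mul _).add
      (((memLp_finsetSum _ fun i _ => memLp_hsNormSq (hEtop i)).mul_const _).const_mul _)
  have hdom : ∀ᵐ x ∂μ, Dominates (fun i => lieMat (X i) f x) (N x) := hσ.le.mono fun x hx => by
    have h1 := (dominates_logDeriv' hx hσ.pos fun i => cut j (H i x)).add
      (dominates_hsNormSq fun i => E i x) hε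
    have e : (fun i => logDeriv (σ x) (cut j (H i x))) + (fun i => E i x) =
        fun i => lieMat (X i) f x := by
      funext i; simp [hE, hT]
    rwa [e] at h1
  choose K hK _ _ using fun a b => hC.exists_closedGrad hμ hX hL hP hC0 (hf a b)
  have hdomP := hC.dominates hμ hX hL hP hC0 hf hK hNtop hdom
  have hρi := fun a b => (hρ.memLp_apply a b).integrable le_top
  have hσi := fun a b => (hσ.memLp_apply a b).integrable le_top
  have hI := hρ.integrable_fisherReal.1
  have hIσ := hσ.integrable_fisherReal.1
  have hpair := integral_re_trace_mul (V := fun i x => Matrix.of fun a b => K a b i x) (W := G)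
    fun i a b => integrable_conj_mul_two ((hK a b).2.1 i) ((hρ.grad a b).2.1 i)
  simp only [of_apply] at hpair
  have htr := integrable_trace_mul (N := markovMat P N) hρi fun a b => memLp_markovApply
  have htr' : Integrable (fun x => (ρ x * markovMat P N x).trace.re) μ := htr.re
  -- The dual inequality at `A = ρ x`, with the gradient of `P f` and its majorant `C P N`.
  have hmain : 2 * ∫ x, ∑ i, ((Matrix.of fun a b => K a b i x)ᴴ * G i x).trace.re ∂μ ≤
      t * ∫ x, ∑ i, fisherReal (ρ x) (G i x) ∂μ +
        t⁻¹ * (C * ∫ x, (ρ x * markovMat P N x).trace.re ∂μ) := by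
    rw [← integral_const_mul, ← integral_const_mul, ← integral_const_mul, ← integral_const_mul,
      ← integral_add (hI.const_mul t) ((htr'.const_mul C).const_mul t⁻¹)]
    refine integral_mono_ae (hpair.1.const_mul 2)
      ((hI.const_mul t).add ((htr'.const_mul C).const_mul t⁻¹)) ?_
    filter_upwards [hdomP, hρ.le] with x h1 h2
    refine (h1.two_re_trace_le' h2 hρ.pos (fun i => G i x) ht).trans (le_of_eq ?_)
    simp only [Matrix.mul_smul, trace_smul, smul_eq_mul, Complex.re_ofReal_mul]
  -- Moving `P` to `ρ` replaces the pairing of `ρ` with `P N` by that of `σ` with `N`, and at `σ`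
  -- the main part of the majorant is the Fisher density of the cut gradient.
  have hσN : ∫ x, (ρ x * markovMat P N x).trace.re ∂μ ≤
      (1 + ε) * ∫ x, ∑ i, fisherReal (σ x) (H i x) ∂μ +
        (1 + ε⁻¹) * (n * m * ∫ x, ∑ i, hsNormSq (E i x) ∂μ) := by
    have hEi : Integrable (fun x => ∑ i, hsNormSq (E i x)) μ := integrable_finsetSum _ fun i _ =>
      integrable_hsNormSq fun a b => memLp_of_memLp_top (hEtop i a b) 2
    have e := had.integral_trace_mul hP hρi hNtop
    have e1 : ∫ x, (ρ x * markovMat P N x).trace.re ∂μ = ∫ x, (σ x * N x).trace.re ∂μ :=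
      (integral_re htr).trans ((congrArg Complex.re e).trans
        (integral_re (integrable_trace_mul hσi hNtop)).symm)
    rw [e1, ← integral_const_mul, ← integral_const_mul, ← integral_const_mul,
      ← integral_add (hIσ.const_mul _) ((hEi.const_mul _).const_mul _)]
    refine integral_mono_ae (integrable_trace_mul hσi hNtop).re
      ((hIσ.const_mul _).add ((hEi.const_mul _).const_mul _)) ?_
    filter_upwards [hσ.le, hσ.re_trace_le] with x h1 h2
    simp only [hN, Matrix.mul_add, Matrix.mul_smul, trace_add, trace_smul, smul_eq_mul,
      Complex.add_re, Complex.re_ofReal_mul, Matrix.mul_one, Matrix.mul_sum, trace_sum,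
      Complex.re_sum, re_trace_mul_dualN h1 hσ.pos]
    refine add_le_add (mul_le_mul_of_nonneg_left (Finset.sum_le_sum fun i _ => ?_)
      (by positivity)) (mul_le_mul_of_nonneg_left ?_ (by positivity))
    · unfold cut
      split_ifs
      · exact le_rfl
      · simpa [fisherReal] using fisherReal_nonneg h1 hσ.pos (H i x)
    · rw [mul_comm]
      exact mul_le_mul_of_nonneg_right h2 (Finset.sum_nonneg fun i _ => hsNormSq_nonneg _)
  have hre : ∑ a, ∑ b, ∑ i, ∫ x, conj (lieD (X i) (f a b) x) * H i x a b ∂μ =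
      ∑ a, ∑ b, ∑ i, ∫ x, conj (K a b i x) * G i x a b ∂μ :=
    Finset.sum_congr rfl fun a _ => Finset.sum_congr rfl fun b _ => hrel a b _ (hf a b) _ (hK a b)
  rw [hre, ← hpair.2]
  exact hmain.trans (add_le_add_right (mul_le_mul_of_nonneg_left
    (mul_le_mul_of_nonneg_left hσN hC0) (inv_pos.2 ht).le) _)

theorem tendsto_cut (A : 𝕄) : ∀ᶠ j in atTop, cut j A = A := by
  obtain ⟨j₀, hj₀⟩ := exists_nat_ge (hsNormSq A)
  filter_upwards [eventually_ge_atTop j₀] with j hj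
  exact if_pos (hj₀.trans (Nat.cast_le.2 hj))

theorem hsNormSq_logDeriv_sub_cut_le {A : 𝕄} (hδ : 0 < δ)
    (hA : (A - (δ : ℂ) • 1).PosSemidef) (j : ℕ)
    (G : 𝕄) : hsNormSq (logDeriv A G - logDeriv A (cut j G)) ≤
      δ⁻¹ ^ 2 * (hsNormSq G - hsNormSq (cut j G)) := by
  unfold cut
  have h0 : hsNormSq (0 : 𝕄) = 0 := by simp [hsNormSq]
  split_ifs
  · simp [h0]
  · rw [logDeriv_zero hδ hA, sub_zero, h0, sub_zero]
    exact hsNormSq_logDeriv_le' hA hδ G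

theorem integral_hsNormSq {A : M → 𝕄} (hA : ∀ a b, MemLp (fun x => A x a b) 2 μ) :
    ∫ x, hsNormSq (A x) ∂μ = ∑ a, ∑ b, ∫ x, ‖A x a b‖ ^ 2 ∂μ := by
  have hi : ∀ a b, Integrable (fun x => ‖A x a b‖ ^ 2) μ := fun a b =>
    (memLp_two_iff_integrable_sq (hA a b).1.norm).1 (hA a b).norm
  unfold hsNormSq
  rw [integral_finsetSum _ fun a _ => integrable_finsetSum _ fun b _ => hi a b]
  exact Finset.sum_congr rfl fun a _ => integral_finsetSum _ fun b _ => hi a b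

include hX

/-- Two errors are controlled: the distance of the test gradients to the gradient of the logarithm,
small by assumption, and the part removed by the cut, small by dominated convergence and the bound
`δ⁻¹` for the logarithmic derivative. -/
theorem IsNice.tendsto_error (hσ : IsNice μ X δ m σ H)
    {f : ℕ → Fin n → Fin n → M → ℂ} (hf : ∀ j a b, IsTest d (f j a b))
    (hlim : ∀ a b i, Tendsto (fun j => eLpNorm (lieD (X i) (f j a b) -
      fun x => logDeriv (σ x) (H i x) a b) 2 μ) atTop (𝓝 0)) :
    Tendsto (fun j => ∫ x, ∑ i, hsNormSq (lieMat (X i) (f j) x -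
      logDeriv (σ x) (cut j (H i x))) ∂μ) atTop (𝓝 0) := by
  have hH : ∀ i a b, MemLp (fun x => H i x a b) 2 μ := fun i a b => (hσ.grad a b).2.1 i
  have hT := fun i => hσ.memLp_logDeriv (hσ.meas_grad i) (hH i)
  have hV : ∀ j i a b, MemLp (fun x => lieMat (X i) (f j) x a b) 2 μ := fun j i a b =>
    ((hf j a b).lieD (hX i)).memLp 2
  have hHi := fun i => integrable_hsNormSq (hH i)
  have hci : ∀ j i, Integrable (fun x => hsNormSq (cut j (H i x))) μ := fun j i => by
    refine (hHi i).mono' (measurable_hsNormSq (measurable_cut (hσ.meas_grad i) j)).aestronglyMeasurable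
      (ae_of_all _ fun x => ?_)
    rw [Real.norm_of_nonneg (hsNormSq_nonneg _)]
    unfold cut
    split_ifs
    · exact le_rfl
    · simpa [hsNormSq] using hsNormSq_nonneg (H i x)
  have hVT : ∀ j i a b, MemLp (fun x => (lieMat (X i) (f j) x - logDeriv (σ x) (H i x)) a b) 2 μ :=
    fun j i a b => (hV j i a b).sub (hT i a b)
  have hb : Tendsto (fun j => ∑ i, (2 * ∫ x, hsNormSq (lieMat (X i) (f j) x -
      logDeriv (σ x) (H i x)) ∂μ + 2 * (δ⁻¹ ^ 2 * (∫ x, hsNormSq (H i x) ∂μ -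
        ∫ x, hsNormSq (cut j (H i x)) ∂μ)))) atTop
      (𝓝 (∑ _i : Fin k, ((2 : ℝ) * 0 + 2 * (δ⁻¹ ^ 2 * 0)))) := by
    refine tendsto_finsetSum _ fun i _ => Tendsto.add (Tendsto.const_mul _ ?_)
      (Tendsto.const_mul _ (Tendsto.const_mul _ ?_))
    · simp only [integral_hsNormSq (hVT _ i)]
      have : Tendsto (fun j => ∑ a, ∑ b, ∫ x, ‖(lieMat (X i) (f j) x -
          logDeriv (σ x) (H i x)) a b‖ ^ 2 ∂μ) atTop (𝓝 (∑ _a : Fin n, ∑ _b : Fin n, (0 : ℝ))) :=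
        tendsto_finsetSum _ fun a _ => tendsto_finsetSum _ fun b _ =>
          tendsto_integral_norm_sq (fun j => hVT j i a b) (hlim a b i)
      simpa using this
    · have h1 : Tendsto (fun j => ∫ x, hsNormSq (cut j (H i x)) ∂μ) atTop
          (𝓝 (∫ x, hsNormSq (H i x) ∂μ)) := by
        refine tendsto_integral_of_dominated_convergence _ (fun j => (hci j i).1) (hHi i)
          (fun j => ae_of_all _ fun x => ?_) (ae_of_all _ fun x => ?_)
        · rw [Real.norm_of_nonneg (hsNormSq_nonneg _)]
          unfold cut
          split_ifs
          · exact le_rfl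
          · simpa [hsNormSq] using hsNormSq_nonneg (H i x)
        · exact tendsto_const_nhds.congr' ((tendsto_cut (H i x)).mono fun j hj => by simp only [hj])
      simpa using (tendsto_const_nhds (x := ∫ x, hsNormSq (H i x) ∂μ)).sub h1
  simp only [mul_zero, add_zero, Finset.sum_const_zero] at hb
  refine tendsto_of_tendsto_of_tendsto_of_le_of_le tendsto_const_nhds hb
    (fun j => integral_nonneg fun x => Finset.sum_nonneg fun i _ => hsNormSq_nonneg _) fun j => ?_
  have hs : ∀ i, Integrable (fun x => hsNormSq (H i x) - hsNormSq (cut j (H i x))) μ := fun i =>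
    (hHi i).sub (hci j i)
  have hbi : ∀ i, Integrable (fun x => 2 * hsNormSq (lieMat (X i) (f j) x - logDeriv (σ x) (H i x)) +
      2 * (δ⁻¹ ^ 2 * (hsNormSq (H i x) - hsNormSq (cut j (H i x))))) μ := fun i =>
    ((integrable_hsNormSq (hVT j i)).const_mul 2).add
      (((hs i).const_mul _).const_mul _)
  have e : ∀ i, 2 * ∫ x, hsNormSq (lieMat (X i) (f j) x - logDeriv (σ x) (H i x)) ∂μ +
      2 * (δ⁻¹ ^ 2 * (∫ x, hsNormSq (H i x) ∂μ - ∫ x, hsNormSq (cut j (H i x)) ∂μ)) =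
      ∫ x, (2 * hsNormSq (lieMat (X i) (f j) x - logDeriv (σ x) (H i x)) +
        2 * (δ⁻¹ ^ 2 * (hsNormSq (H i x) - hsNormSq (cut j (H i x))))) ∂μ := fun i => by
    rw [integral_add ((integrable_hsNormSq (hVT j i)).const_mul 2)
      (((hs i).const_mul _).const_mul _), integral_const_mul, integral_const_mul,
      integral_const_mul, integral_sub (hHi i) (hci j i)]
  simp only [e]
  rw [← integral_finsetSum _ fun i _ => hbi i]
  refine integral_mono_of_nonneg (ae_of_all _ fun x => Finset.sum_nonneg fun i _ =>
    hsNormSq_nonneg _) (integrable_finsetSum _ fun i _ => hbi i) (hσ.le.mono fun x hx => ?_)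
  refine Finset.sum_le_sum fun i _ => ?_
  have h1 := hsNormSq_add_le (lieMat (X i) (f j) x - logDeriv (σ x) (H i x))
    (logDeriv (σ x) (H i x) - logDeriv (σ x) (cut j (H i x)))
  rw [sub_add_sub_cancel] at h1
  linarith [hsNormSq_logDeriv_sub_cut_le hσ.pos hx j (H i x)]

-- Formally, `t = C` and `ε = 0` give the claim.
omit hX in
theorem le_mul_of_forall_le {a b C : ℝ} (ha : 0 ≤ a) (hb : 0 ≤ b) (hC : 0 ≤ C)
    (h : ∀ t ε : ℝ, 0 < t → 0 < ε → 2 * a ≤ t * b + t⁻¹ * (C * ((1 + ε) * a))) : a ≤ C * b := by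
  refine le_of_forall_pos_le_add fun ε hε => ?_
  set η := min 1 (ε / ((b + 1) * (C + 2))) with hη
  have hη0 : 0 < η := lt_min one_pos (by positivity)
  have hη1 : η ≤ 1 := min_le_left _ _
  have hη2 : η * ((b + 1) * (C + 2)) ≤ ε := (le_div_iff₀ (by positivity)).1 (min_le_right _ _)
  -- This choice of `t` is positive even when `C = 0`, and it makes the second term at most `a`.
  have h1 := h ((C + η) * (1 + η)) η (by positivity) hη0
  have h2 : ((C + η) * (1 + η))⁻¹ * (C * ((1 + η) * a)) ≤ a := by
    rw [inv_mul_le_iff₀ (by positivity)]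
    have : 0 ≤ η * ((1 + η) * a) := by positivity
    nlinarith
  have h3 : η * η * b ≤ η * b := by nlinarith [mul_nonneg hη0.le hb]
  have h4 : 0 ≤ η * (C + 2) := by positivity
  nlinarith

include hμ hL hP hC

-- Test functions converging to the entries of `ln σ` in the graph norm are inserted into
-- `IsNice.pairing_le`. The pairing tends to the Fisher information of `σ` and the error disappears
-- for fixed `ε`, leaving an inequality in `t` and `ε` to be optimised.
include hC0 in
theorem IsNice.fisherReal_le
    (hρ : IsNice μ X δ m ρ G) (hσ : IsNice μ X δ m σ H) (had : IsAdjointImage μ P ρ σ)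
    (hrel : ∀ a b φ, IsTest d φ → ∀ K, IsClosedGrad μ X (markovApply P φ) K →
      ∑ i, ∫ x, conj (lieD (X i) φ x) * H i x a b ∂μ = ∑ i, ∫ x, conj (K i x) * G i x a b ∂μ) :
    ∫ x, ∑ i, fisherReal (σ x) (H i x) ∂μ ≤ C * ∫ x, ∑ i, fisherReal (ρ x) (G i x) ∂μ := by
  have hlog := fun a b => hσ.log hμ hX hL a b
  choose f hf _ hlim using fun a b => (hlog a b).2.2
  have herr := hσ.tendsto_error hX (f := fun j a b => f a b j) (fun j a b => hf a b j) hlim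
  have hnn : ∀ {τ : M → 𝕄} {K : Fin k → M → 𝕄},
      IsNice μ X δ m τ K → 0 ≤ ∫ x, ∑ i, fisherReal (τ x) (K i x) ∂μ := fun h =>
    integral_nonneg_of_ae (h.le.mono fun x hx => Finset.sum_nonneg fun i _ =>
      SubLaplacian.fisherReal_nonneg hx h.pos _)
  refine le_mul_of_forall_le (hnn hσ) (hnn hρ) hC0 fun t ε ht hε => ?_
  have hl : Tendsto (fun j => 2 * (∑ a, ∑ b, ∑ i, ∫ x, conj (lieD (X i) (f a b j) x) *
      H i x a b ∂μ).re) atTop (𝓝 (2 * ∫ x, ∑ i, fisherReal (σ x) (H i x) ∂μ)) := by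
    rw [hσ.integrable_fisherReal.2]
    refine Tendsto.const_mul _ ((Complex.continuous_re.tendsto _).comp ?_)
    exact tendsto_finsetSum _ fun a _ => tendsto_finsetSum _ fun b _ => tendsto_finsetSum _
      fun i _ => tendsto_integral_conj_mul_two (fun j => ((hf a b j).lieD (hX i)).memLp 2)
        ((hlog a b).2.1 i) ((hσ.grad a b).2.1 i) (hlim a b i)
  have hr : Tendsto (fun j => t * ∫ x, ∑ i, fisherReal (ρ x) (G i x) ∂μ +
      t⁻¹ * (C * ((1 + ε) * ∫ x, ∑ i, fisherReal (σ x) (H i x) ∂μ + (1 + ε⁻¹) * (n * m *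
        ∫ x, ∑ i, hsNormSq (lieMat (X i) (fun a b => f a b j) x -
          logDeriv (σ x) (cut j (H i x))) ∂μ)))) atTop
      (𝓝 (t * ∫ x, ∑ i, fisherReal (ρ x) (G i x) ∂μ +
      t⁻¹ * (C * ((1 + ε) * ∫ x, ∑ i, fisherReal (σ x) (H i x) ∂μ + (1 + ε⁻¹) * (n * m * 0))))) :=
    tendsto_const_nhds.add (((tendsto_const_nhds.add ((herr.const_mul _).const_mul _)).const_mul
      _).const_mul _)
  rw [mul_zero, mul_zero, add_zero] at hr
  exact le_of_tendsto_of_tendsto' hl hr fun j =>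
    IsNice.pairing_le hμ hX hL hP hC0 hC hρ hσ had hrel ht hε (fun a b => hf a b j) j

include hPL in
/-- `P^†` preserves nice matrix-valued functions and decreases their Fisher information. -/
theorem IsNice.exists_adjoint (hρ : IsNice μ X δ m ρ G) (had : IsAdjointImage μ P ρ σ)
    (hσm : ∀ a b, Measurable fun x => σ x a b) : ∃ H, IsNice μ X δ m σ H ∧
      ∫ x, ∑ i, fisherReal (σ x) (H i x) ∂μ ≤ max C 0 * ∫ x, ∑ i, fisherReal (ρ x) (G i x) ∂μ := by
  have hρi := fun a b => (hρ.memLp_apply a b).integrable le_top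
  choose H' hH' hrel using fun a b =>
    (isAdjointImage_iff.1 had a b).exists_closedGrad hμ hX hL hP hC hPL (hρ.grad a b)
  set H : Fin k → M → 𝕄 := fun i x => Matrix.of fun a b => ((hH' a b).2.1 i).1.mk _ x
  have hHH : ∀ i a b, H' a b i =ᵐ[μ] fun x => H i x a b := fun i a b => ((hH' a b).2.1 i).1.ae_eq_mk
  have hbd : ∀ {A : 𝕄}, ∀ a b, Integrable (fun _ : M => A a b) μ := fun a b => integrable_const _
  have hσ : IsNice μ X δ m σ H :=
    { meas := hσm
      meas_grad := fun i a b => ((hH' a b).2.1 i).1.stronglyMeasurable_mk.measurable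
      pos := hρ.pos
      le := (had.sub hρi hbd (IsAdjointImage.const hP _)).posSemidef hP
        (fun a b => (hρi a b).sub (hbd a b)) hρ.le
      ge := ((IsAdjointImage.const hP _).sub hbd hρi had).posSemidef hP
        (fun a b => (hbd a b).sub (hρi a b)) hρ.ge
      grad := fun a b => (hH' a b).congr (ae_eq_refl _) fun i => hHH i a b }
  refine ⟨H, hσ, IsNice.fisherReal_le hμ hX hL hP (le_max_right C 0) (hC.max_zero hP) hρ hσ had
    fun a b φ hφ K hK => ?_⟩
  rw [← hrel a b φ hφ K hK]
  refine Finset.sum_congr rfl fun i _ => integral_congr_ae ((hHH i a b).mono fun x hx => ?_)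
  simp only [hx]

/-! ### The Fisher information as the integral of its density. -/

omit hL hP hC

omit hμ hX in
theorem ae_eq_matrix {A B : M → 𝕄}
    (h : ∀ a b, (fun x => A x a b) =ᵐ[μ] fun x => B x a b) : A =ᵐ[μ] B := by
  filter_upwards [ae_all_iff.2 fun a => ae_all_iff.2 (h a)] with x hx
  ext a b
  exact hx a b

/-- Any two weak gradients agree almost everywhere, so the infimum runs over equal values; Tonelli's
theorem then exchanges the integrals over `s` and `x`. -/
theorem fisherInfo_eq (hρ : ∀ a b, Measurable fun x => ρ x a b)
    (hG : ∀ i a b, Measurable fun x => G i x a b) (h : IsMatrixWeakGrad μ X ρ G) :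
    fisherInfo μ X ρ = ∫⁻ x, ∑ i, fisherDensity (ρ x) (G i x) ∂μ := by
  let F : (Fin k → M → 𝕄) → ℝ → Fin k → M → ℝ≥0∞ := fun G s i x =>
    ENNReal.ofReal (((G i x)ᴴ * (ρ x + (s : ℂ) • 1)⁻¹ * G i x * (ρ x + (s : ℂ) • 1)⁻¹).trace.re)
  have key : ∀ G', (∀ i, G' i =ᵐ[μ] G i) → ∫⁻ s in Set.Ioi (0 : ℝ), ∑ i, ∫⁻ x, F G' s i x ∂μ =
      ∫⁻ x, ∑ i, fisherDensity (ρ x) (G i x) ∂μ := fun G' hG' => by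
    have hm := fun i => measurable_fisherIntegrand hρ (hG i)
    have e : ∫⁻ s in Set.Ioi (0 : ℝ), ∑ i, ∫⁻ x, F G' s i x ∂μ =
        ∫⁻ s in Set.Ioi (0 : ℝ), ∑ i, ∫⁻ x, F G s i x ∂μ :=
      lintegral_congr fun s => Finset.sum_congr rfl fun i _ =>
        lintegral_congr_ae ((hG' i).mono fun x hx => by simp only [F, hx])
    rw [e, lintegral_finsetSum _ fun i _ => measurable_fisherDensity hρ (hG i),
      lintegral_finsetSum _ fun i _ => (hm i).lintegral_prod_left']
    exact Finset.sum_congr rfl fun i _ =>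
      lintegral_lintegral_swap ((hm i).comp measurable_swap).aemeasurable
  refine le_antisymm ((iInf₂_le G h).trans_eq (key G fun i => ae_eq_refl _))
    (le_iInf₂ fun G' h' => (key G' fun i => ?_).ge)
  exact ae_eq_matrix fun a b => (h' a b).ae_unique hμ hX (h a b) i

omit hμ hX

theorem fisherInfo_congr {ρ' : M → 𝕄} (h : ρ =ᵐ[μ] ρ') : fisherInfo μ X ρ = fisherInfo μ X ρ' := by
  have hw : ∀ {ρ ρ' : M → 𝕄} {G : Fin k → M → 𝕄},
      ρ =ᵐ[μ] ρ' → IsMatrixWeakGrad μ X ρ G → IsMatrixWeakGrad μ X ρ' G := fun h hG a b =>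
    (hG a b).congr (h.mono fun x hx => by simp only [hx]) fun i => ae_eq_refl _
  refine iInf_congr fun G => iInf_congr_Prop ⟨hw h, hw h.symm⟩ fun _ => ?_
  refine lintegral_congr fun s => Finset.sum_congr rfl fun i _ => lintegral_congr_ae ?_
  exact h.mono fun x hx => by simp only [hx]

theorem lintegral_fisherDensity (hδ : 0 < δ) (h : ∀ᵐ x ∂μ, (ρ x - (δ : ℂ) • 1).PosSemidef)
    (hi : Integrable (fun x => ∑ i, fisherReal (ρ x) (G i x)) μ) :
    ∫⁻ x, ∑ i, fisherDensity (ρ x) (G i x) ∂μ =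
      ENNReal.ofReal (∫ x, ∑ i, fisherReal (ρ x) (G i x) ∂μ) := by
  rw [ofReal_integral_eq_lintegral_ofReal hi (h.mono fun x hx =>
    Finset.sum_nonneg fun i _ => fisherReal_nonneg hx hδ _)]
  refine lintegral_congr_ae (h.mono fun x hx => ?_)
  simp only
  rw [ENNReal.ofReal_sum_of_nonneg fun i _ => fisherReal_nonneg hx hδ _]
  exact Finset.sum_congr rfl fun i _ => fisherDensity_eq_ofReal hx hδ _

/-! ### Lower semicontinuity of the Fisher information. -/

theorem exists_weak_limit (U : Ultrafilter ℕ) {h : ℕ → M → ℂ} (hh : ∀ j, MemLp (h j) 2 μ) {K : ℝ}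
    (hK : ∀ j, ∫ x, ‖h j x‖ ^ 2 ∂μ ≤ K) : ∃ g, MemLp g 2 μ ∧ ∀ (f : ℕ → M → ℂ) (f' : M → ℂ),
      (∀ j, MemLp (f j) 2 μ) → MemLp f' 2 μ →
      Tendsto (fun j => ∫ x, ‖f j x - f' x‖ ^ 2 ∂μ) U (𝓝 0) →
      Tendsto (fun j => ∫ x, conj (f j x) * h j x ∂μ) U (𝓝 (∫ x, conj (f' x) * g x ∂μ)) := by
  have hn : ∀ {u : M → ℂ} (hu : MemLp u 2 μ), ‖hu.toLp u‖ = √(∫ x, ‖u x‖ ^ 2 ∂μ) := fun hu => by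
    rw [← Real.sqrt_sq (norm_nonneg (hu.toLp _)), norm_sq_Lp]
    congr 1
    exact integral_congr_ae (hu.coeFn_toLp.mono fun x hx => by simp only [hx])
  have hb : ∀ j, ‖(hh j).toLp (h j)‖ ≤ √K := fun j => (hn (hh j)).trans_le (Real.sqrt_le_sqrt (hK j))
  set ψ : ℕ → WeakDual ℂ (Lp ℂ 2 μ) := fun j =>
    StrongDual.toWeakDual (InnerProductSpace.toDual ℂ _ ((hh j).toLp (h j)))
  -- Banach–Alaoglu. The limit is taken along a given ultrafilter, so all matrix entries and all
  -- fields converge together without choosing subsequences.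
  obtain ⟨y, -, hy⟩ := (WeakDual.isCompact_closedBall (0 : StrongDual ℂ (Lp ℂ 2 μ))
    (√K)).ultrafilter_le_nhds' (U.map ψ) (Filter.mem_map.2 (univ_mem' fun j => by
      simpa [ψ] using hb j))
  set g : Lp ℂ 2 μ := (InnerProductSpace.toDual ℂ _).symm (WeakDual.toStrongDual y)
  have hlim : ∀ f : Lp ℂ 2 μ, Tendsto (fun j => inner ℂ f ((hh j).toLp (h j))) U
      (𝓝 (inner ℂ f g)) := fun f => by
    have h1 : Tendsto (fun j => ψ j f) U (𝓝 (y f)) := ((WeakDual.eval_continuous f).tendsto y).comp hy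
    have h2 : y f = inner ℂ g f := by
      rw [← InnerProductSpace.toDual_apply_apply, LinearIsometryEquiv.apply_symm_apply]; rfl
    rw [← inner_conj_symm f g, ← h2]
    refine ((Complex.continuous_conj.tendsto _).comp h1).congr fun j => ?_
    exact inner_conj_symm f _
  refine ⟨g, Lp.memLp g, fun f f' hf hf' hff => ?_⟩
  have h1 : Tendsto (fun j => inner ℂ ((hf j).toLp (f j) - hf'.toLp f') ((hh j).toLp (h j))) U
      (𝓝 0) := by
    refine squeeze_zero_norm (a := fun j => √(∫ x, ‖f j x - f' x‖ ^ 2 ∂μ) * √K) (fun j => ?_) ?_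
    · rw [← MemLp.toLp_sub]
      exact (norm_inner_le_norm _ _).trans (mul_le_mul (hn ((hf j).sub hf')).le (hb j)
        (norm_nonneg _) (Real.sqrt_nonneg _))
    · simpa using (Real.continuous_sqrt.tendsto 0).comp hff |>.mul_const (√K)
  have h2 := h1.add (hlim (hf'.toLp f'))
  have h3 : inner ℂ (hf'.toLp f') g = ∫ x, conj (f' x) * g x ∂μ := by
    rw [← inner_toLp hf' (Lp.memLp g), Lp.toLp_coeFn]
  rw [zero_add, h3] at h2
  refine h2.congr fun j => ?_
  rw [← inner_add_left, sub_add_cancel, inner_toLp]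

theorem tendsto_integral_norm {f : ι → M → ℂ}
    (hf : ∀ j, Integrable (f j) μ) (h : Tendsto (fun j => eLpNorm (f j) 1 μ) l (𝓝 0)) :
    Tendsto (fun j => ∫ x, ‖f j x‖ ∂μ) l (𝓝 0) := by
  refine ((ENNReal.tendsto_toReal ENNReal.zero_ne_top).comp h).congr fun j => ?_
  rw [Function.comp, eLpNorm_one_eq_lintegral_enorm, integral_norm_eq_lintegral_enorm (hf j).1]

/-- Turns `L¹` convergence of traces into `L²` convergence of their square roots. -/
theorem sq_sqrt_sub_sqrt_le {a b : ℝ} (ha : 0 ≤ a) (hb : 0 ≤ b) : (√a - √b) ^ 2 ≤ |a - b| := by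
  have h : |a - b| = |√a - √b| * (√a + √b) := by
    rw [← abs_of_nonneg (add_nonneg (Real.sqrt_nonneg a) (Real.sqrt_nonneg b)), ← abs_mul]
    congr 1
    linear_combination -(Real.sq_sqrt ha) + Real.sq_sqrt hb
  rw [h, ← sq_abs, sq]
  refine mul_le_mul_of_nonneg_left (abs_le.2 ⟨?_, ?_⟩) (abs_nonneg _) <;>
    linarith [Real.sqrt_nonneg a, Real.sqrt_nonneg b]

/-- All eigenvalues are at most the trace, so the kernel is at least its inverse. The resulting
bound does not involve the constants `δ` and `m`, which degenerate along the approximation. -/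
theorem IsNice.norm_sq_le (h : IsNice μ X δ m ρ G) (i : Fin k) (a b : Fin n) :
    ∀ᵐ x ∂μ, 0 < (ρ x).trace.re ∧
      ‖G i x a b‖ ^ 2 ≤ (ρ x).trace.re * ∑ i, fisherReal (ρ x) (G i x) := by
  filter_upwards [h.le] with x hx
  have hp := posSemidef_of_sub h.pos.le hx
  have ht : 0 < (ρ x).trace.re := by
    have h1 := (Complex.nonneg_iff.1 hx.trace_nonneg).1
    have hn : (0 : ℝ) < n := Nat.cast_pos.2 (Fin.pos a)
    have := mul_pos h.pos hn
    simp [Matrix.trace_sub, Matrix.trace_smul] at h1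
    linarith
  refine ⟨ht, (norm_sq_le_hsNormSq _ a b).trans ?_⟩
  have h2 := ofReal_hsNormSq_le (G := G i x) hp ht (trace_sub_posSemidef hp)
  rw [fisherDensity_eq_ofReal hx h.pos, ← ENNReal.ofReal_mul ht.le,
    ENNReal.ofReal_le_ofReal_iff (mul_nonneg ht.le (fisherReal_nonneg hx h.pos _))] at h2
  exact h2.trans (mul_le_mul_of_nonneg_left (Finset.single_le_sum
    (f := fun i => fisherReal (ρ x) (G i x)) (fun i _ => fisherReal_nonneg hx h.pos _)
      (Finset.mem_univ i)) ht.le)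

/-- Gradients of bounded Fisher information converge weakly in `L¹` along an ultrafilter. -/
theorem exists_weak_limit_grad (U : Ultrafilter ℕ) {σs : ℕ → M → 𝕄}
    {H : ℕ → Fin k → M → 𝕄} {δ m : ℕ → ℝ} {K : ℝ}
    (hs : ∀ j, IsNice μ X (δ j) (m j) (σs j) (H j))
    (hK : ∀ j, ∫ x, ∑ i, fisherReal (σs j x) (H j i x) ∂μ ≤ K) (hσ : ∀ᵐ x ∂μ, (σ x).PosSemidef)
    (hσi : ∀ a b, Integrable (fun x => σ x a b) μ)
    (hlim : ∀ a b, Tendsto (fun j => eLpNorm ((fun x => σs j x a b) - fun x => σ x a b) 1 μ) U (𝓝 0))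
    (i : Fin k) (a b : Fin n) : ∃ g, Measurable g ∧ Integrable g μ ∧ ∀ φ : M → ℂ, MemLp φ ∞ μ →
      Tendsto (fun j => ∫ x, conj (φ x) * H j i x a b ∂μ) U (𝓝 (∫ x, conj (φ x) * g x ∂μ)) := by
  set τ : ℕ → M → ℝ := fun j x => (σs j x).trace.re
  set t : M → ℝ := fun x => (σ x).trace.re
  have hsi : ∀ j a b, Integrable (fun x => σs j x a b) μ := fun j a b =>
    ((hs j).memLp_apply a b).integrable le_top
  have hτi : ∀ j, Integrable (τ j) μ := fun j => (integrable_finsetSum _ fun a _ => hsi j a a).re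
  have hti : Integrable t μ := (integrable_finsetSum _ fun a _ => hσi a a).re
  have ht0 : ∀ᵐ x ∂μ, 0 ≤ t x := hσ.mono fun x hx => (Complex.nonneg_iff.1 hx.trace_nonneg).1
  have hsq : ∀ {u : M → ℝ}, Integrable u μ → (∀ᵐ x ∂μ, 0 ≤ u x) →
      MemLp (fun x => ((√(u x) : ℝ) : ℂ)) 2 μ := fun hu h0 => by
    refine memLp_two_of_sq_le (Complex.continuous_ofReal.comp_aestronglyMeasurable
      (Real.continuous_sqrt.comp_aestronglyMeasurable hu.1)) hu (h0.mono fun x hx => ?_)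
    rw [Complex.norm_real, Real.norm_eq_abs, sq_abs, Real.sq_sqrt hx]
  have hτ0 : ∀ j, ∀ᵐ x ∂μ, 0 ≤ τ j x := fun j => ((hs j).norm_sq_le i a b).mono fun x hx => hx.1.le
  -- Divided by the square root of the trace, the gradients are bounded in `L²` by the Fisher
  -- information. The square roots converge strongly in `L²`, so the products converge weakly.
  set h : ℕ → M → ℂ := fun j x => H j i x a b / ((√(τ j x) : ℝ) : ℂ)
  have hhb : ∀ j, ∀ᵐ x ∂μ, ‖h j x‖ ^ 2 ≤ ∑ i, fisherReal (σs j x) (H j i x) := fun j =>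
    ((hs j).norm_sq_le i a b).mono fun x hx => by
      rw [norm_div, div_pow, Complex.norm_real, Real.norm_eq_abs, sq_abs, Real.sq_sqrt hx.1.le,
        div_le_iff₀' hx.1]
      exact hx.2
  have hh : ∀ j, MemLp (h j) 2 μ := fun j => memLp_two_of_sq_le
    (((hs j).meas_grad i a b).div (Complex.measurable_ofReal.comp (Complex.measurable_re.comp
      (measurable_trace (hs j).meas)).sqrt)).aestronglyMeasurable
    (hs j).integrable_fisherReal.1 (hhb j)
  obtain ⟨g, hg, hglim⟩ := exists_weak_limit U hh fun j => (integral_mono_of_nonneg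
    (ae_of_all _ fun x => sq_nonneg _) (hs j).integrable_fisherReal.1 (hhb j)).trans (hK j)
  have hgi : Integrable (fun x => ((√(t x) : ℝ) : ℂ) * g x) μ := by
    simpa using integrable_conj_mul_two (hsq hti ht0) hg
  refine ⟨hgi.1.mk _, hgi.1.stronglyMeasurable_mk.measurable, hgi.congr hgi.1.ae_eq_mk,
    fun φ hφ => ?_⟩
  obtain ⟨c, hc0, hc⟩ := exists_bound_of_memLp_top hφ
  have hdiff : Tendsto (fun j => ∫ x, |τ j x - t x| ∂μ) U (𝓝 0) := by
    have h1 : Tendsto (fun j => ∑ a, ∫ x, ‖((fun x => σs j x a a) - fun x => σ x a a) x‖ ∂μ) U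
        (𝓝 (∑ _a : Fin n, 0)) := tendsto_finsetSum _ fun a _ =>
      tendsto_integral_norm (fun j => (hsi j a a).sub (hσi a a)) (hlim a a)
    rw [Finset.sum_const_zero] at h1
    refine squeeze_zero (fun j => integral_nonneg fun x => abs_nonneg _) (fun j => ?_) h1
    rw [← integral_finsetSum _ fun a _ => ((hsi j a a).sub (hσi a a)).norm]
    refine integral_mono ((hτi j).sub hti).abs (integrable_finsetSum _ fun a _ =>
      ((hsi j a a).sub (hσi a a)).norm) fun x => ?_
    simp only [τ, t, ← Complex.sub_re, ← Matrix.trace_sub]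
    exact (Complex.abs_re_le_norm _).trans (norm_sum_le _ _)
  have hmul : ∀ {u : M → ℝ}, Integrable u μ → (∀ᵐ x ∂μ, 0 ≤ u x) →
      MemLp (fun x => φ x * ((√(u x) : ℝ) : ℂ)) 2 μ := fun hu h0 =>
    (hsq hu h0).mul hφ
  have h1 := hglim (fun j x => φ x * ((√(τ j x) : ℝ) : ℂ)) (fun x => φ x * ((√(t x) : ℝ) : ℂ))
    (fun j => hmul (hτi j) (hτ0 j)) (hmul hti ht0) ?_
  · refine (h1.congr fun j => integral_congr_ae ?_).trans_eq (congrArg 𝓝 (integral_congr_ae ?_))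
    · filter_upwards [(hs j).norm_sq_le i a b] with x hx
      have : ((√(τ j x) : ℝ) : ℂ) ≠ 0 := Complex.ofReal_ne_zero.2 (Real.sqrt_pos.2 hx.1).ne'
      simp only [h, map_mul, Complex.conj_ofReal]
      field_simp
    · filter_upwards [hgi.1.ae_eq_mk] with x hx
      rw [← hx, map_mul, Complex.conj_ofReal, mul_assoc]
  · have h2 : Tendsto (fun j => c ^ 2 * ∫ x, |τ j x - t x| ∂μ) U (𝓝 0) := by
      simpa using hdiff.const_mul (c ^ 2)
    refine squeeze_zero (fun j => integral_nonneg fun x => sq_nonneg _) (fun j => ?_) h2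
    rw [← integral_const_mul]
    refine integral_mono_of_nonneg (ae_of_all _ fun x => sq_nonneg _)
      (((hτi j).sub hti).abs.const_mul _) ?_
    filter_upwards [hc, hτ0 j, ht0] with x h3 h4 h5
    rw [← mul_sub, norm_mul, mul_pow, ← Complex.ofReal_sub, Complex.norm_real, Real.norm_eq_abs, sq_abs]
    gcongr
    exact sq_sqrt_sub_sqrt_le h4 h5

theorem fisherReal_zero (A : 𝕄) : fisherReal A 0 = 0 := by simp [fisherReal]

/-- The dual functional at its maximiser for `A + δ`. Replacing `A + δ` by `A` in the linear term
can only increase it, as the dual matrix has nonnegative trace, and pairing with `G` or with its cut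
is the same. -/
theorem two_mul_sub_cut {A : 𝕄} (hA : A.PosSemidef) (hδ : 0 < δ) (j : ℕ) (G : Fin k → 𝕄) :
    ∑ i, fisherReal (A + (δ : ℂ) • 1) (cut j (G i)) ≤
      2 * ∑ i, ((logDeriv (A + (δ : ℂ) • 1) (cut j (G i)))ᴴ * G i).trace.re -
        (A * ∑ i, dualN (A + (δ : ℂ) • 1) (cut j (G i))).trace.re := by
  set B := A + (δ : ℂ) • 1 with hB
  have hBδ : (B - (δ : ℂ) • 1).PosSemidef := by rwa [hB, add_sub_cancel_right]
  have h1 : ∀ i, ((logDeriv B (cut j (G i)))ᴴ * G i).trace.re = fisherReal B (cut j (G i)) := fun i => by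
    unfold cut
    split_ifs
    · rfl
    · rw [fisherReal_zero, logDeriv_zero hδ hBδ]
      simp
  have h2 : ∑ i, fisherReal B (cut j (G i)) = (A * ∑ i, dualN B (cut j (G i))).trace.re +
      δ * ∑ i, (dualN B (cut j (G i))).trace.re := by
    rw [Finset.sum_congr rfl fun i _ => (re_trace_mul_dualN hBδ hδ (cut j (G i))).symm]
    simp [hB, Matrix.add_mul, Matrix.trace_sum, Matrix.trace_add, Finset.sum_add_distrib,
      Finset.mul_sum, Matrix.trace_smul]
  rw [Finset.sum_congr rfl fun i _ => h1 i]
  have h3 : 0 ≤ δ * ∑ i, (dualN B (cut j (G i))).trace.re :=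
    mul_nonneg hδ.le (Finset.sum_nonneg fun i _ => re_trace_dualN_nonneg' hBδ hδ _)
  linarith

-- For fixed bounded `V` and `N` with `Dominates V N`, the functional `2 ∫ Re tr(V* H) - ∫ Re tr(σ
-- N)` lies below the Fisher information and passes to the limit under weak convergence of the
-- gradients. The pair optimal for the regularised limit `σ + ε j` with cut gradient yields the
-- bound for that regularisation; Fatou's lemma removes the regularisation.
include hX in
theorem exists_weakGrad_of_fisherReal_le {σs : ℕ → M → 𝕄}
    {H : ℕ → Fin k → M → 𝕄} {δ m : ℕ → ℝ} {K : ℝ} (hs : ∀ j, IsNice μ X (δ j) (m j) (σs j) (H j))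
    (hK : ∀ j, ∫ x, ∑ i, fisherReal (σs j x) (H j i x) ∂μ ≤ K) (hσ : ∀ᵐ x ∂μ, (σ x).PosSemidef)
    (hσi : ∀ a b, Integrable (fun x => σ x a b) μ) (hσm : ∀ a b, Measurable fun x => σ x a b)
    (hlim : ∀ a b, Tendsto (fun j => eLpNorm ((fun x => σs j x a b) - fun x => σ x a b) 1 μ) atTop
      (𝓝 0)) :
    ∃ G : Fin k → M → 𝕄, (∀ i a b, Measurable fun x => G i x a b) ∧
      IsMatrixWeakGrad μ X σ G ∧ ∫⁻ x, ∑ i, fisherDensity (σ x) (G i x) ∂μ ≤ ENNReal.ofReal K := by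
  set U : Ultrafilter ℕ := hyperfilter ℕ
  have hU : (U : Filter ℕ) ≤ atTop := Nat.hyperfilter_le_atTop
  choose g hgm hgi hglim using exists_weak_limit_grad U hs hK hσ hσi fun a b => (hlim a b).mono_left hU
  set G : Fin k → M → 𝕄 := fun i x => Matrix.of fun a b => g i a b x
  have hsi : ∀ j a b, Integrable (fun x => σs j x a b) μ := fun j a b =>
    ((hs j).memLp_apply a b).integrable le_top
  have hHi : ∀ j i a b, Integrable (fun x => H j i x a b) μ := fun j i a b =>
    (((hs j).grad a b).2.1 i).integrable one_le_two
  refine ⟨G, hgm, fun a b => ⟨hσi a b, fun i => ⟨hgi i a b, fun φ ψ hφ hψ => ?_⟩⟩, ?_⟩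
  · refine tendsto_nhds_unique (hglim i a b φ (hφ.memLp ∞)) (((hψ.1.tendsto_integral
      (fun j => hsi j a b) (hσi a b) (hlim a b)).mono_left hU).congr fun j => ?_)
    exact ((((hs j).grad a b).isWeakGrad hX).2 i |>.2 φ ψ hφ hψ).symm
  set ε : ℕ → ℝ := fun j => 1 / ((j : ℝ) + 1) with hε
  have hε0 : ∀ j, 0 < ε j := fun j => Nat.one_div_pos_of_nat
  set A : ℕ → M → 𝕄 := fun j x => σ x + (ε j : ℂ) • 1 with hA
  have hAm : ∀ j a b, Measurable fun x => A j x a b := fun j a b => (hσm a b).add_const _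
  have hAp : ∀ j, ∀ᵐ x ∂μ, (A j x - (ε j : ℂ) • 1).PosSemidef := fun j =>
    hσ.mono fun x hx => by rwa [hA, add_sub_cancel_right]
  have hcm : ∀ j i a b, Measurable fun x => cut j (G i x) a b := fun j i => measurable_cut (hgm i) j
  have main : ∀ j, ∫⁻ x, ∑ i, fisherDensity (A j x) (cut j (G i x)) ∂μ ≤ ENNReal.ofReal K := by
    intro j
    set V : Fin k → M → 𝕄 := fun i x => logDeriv (A j x) (cut j (G i x))
    set N : M → 𝕄 := fun x => ∑ i, dualN (A j x) (cut j (G i x)) with hN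
    have hV : ∀ i a b, MemLp (fun x => V i x a b) ∞ μ := fun i a b =>
      memLp_top_of_hsNormSq_le (measurable_logDeriv_apply (hAm j) (hcm j i))
        ((hAp j).mono fun x hx => (hsNormSq_logDeriv_le' hx (hε0 j) _).trans
          (mul_le_mul_of_nonneg_left (hsNormSq_cut_le j _) (by positivity))) a b
    have hNm : ∀ a b, MemLp (fun x => N x a b) ∞ μ := fun a b => by
      simp only [hN, Matrix.sum_apply]
      refine memLp_finsetSum _ fun i _ => memLp_top_of_bound (measurable_dualN_apply (hAm j)
        (hcm j i) a b).aestronglyMeasurable ((ε j)⁻¹ ^ 2 * j) ((hAp j).mono fun x hx => ?_)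
      exact (norm_dualN_apply_le' hx (hε0 j) _ a b).trans
          (mul_le_mul_of_nonneg_left (hsNormSq_cut_le j _) (by positivity))
    have hVH := fun l => integral_re_trace_mul (V := V) (W := H l) fun i a b =>
      integrable_conj_mul_of_memLp_top (hV i a b) (hHi l i a b)
    have hVG := integral_re_trace_mul (V := V) (W := G) fun i a b =>
      integrable_conj_mul_of_memLp_top (hV i a b) (hgi i a b)
    have hre : ∀ {τ : M → 𝕄}, (∀ a b, Integrable (fun x => τ x a b) μ) →
        Integrable (fun x => (τ x * N x).trace.re) μ ∧ ∫ x, (τ x * N x).trace.re ∂μ =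
          (∑ a, ∑ b, ∫ x, conj (conj (N x b a)) * τ x a b ∂μ).re := fun {τ} hτ => by
      have hi := integrable_trace_mul hτ hNm
      have hre' : Integrable (fun x => (τ x * N x).trace.re) μ := hi.re
      refine ⟨hre', ?_⟩
      have hab : ∀ a b, Integrable (fun x => τ x a b * N x b a) μ := fun a b => by
        simpa [mul_comm] using integrable_conj_mul_of_memLp_top (memLp_conj (hNm b a)) (hτ a b)
      have h1 := Complex.reCLM.integral_comp_comm hi
      simp only [Complex.reCLM_apply] at h1
      rw [h1]
      congr 1
      simp only [Matrix.trace, Matrix.diag, Matrix.mul_apply, Complex.conj_conj]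
      rw [integral_finsetSum _ fun a _ => integrable_finsetSum _ fun b _ => hab a b]
      -- Both sides are now compared for one row of the trace.
      refine Finset.sum_congr rfl fun a _ => ?_
      rw [integral_finsetSum _ fun b _ => hab a b]
      exact Finset.sum_congr rfl fun b _ => integral_congr_ae (ae_of_all _ fun x => mul_comm _ _)
    have hl : ∀ l, 2 * ∫ x, ∑ i, ((V i x)ᴴ * H l i x).trace.re ∂μ -
        ∫ x, (σs l x * N x).trace.re ∂μ ≤ K := fun l => by
      refine le_trans ?_ (hK l)
      rw [← integral_const_mul, ← integral_sub ((hVH l).1.const_mul 2) (hre (hsi l)).1]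
      refine integral_mono_ae (((hVH l).1.const_mul 2).sub (hre (hsi l)).1)
        (hs l).integrable_fisherReal.1 ?_
      filter_upwards [hAp j, (hs l).le] with x h1 h2
      have := (dominates_logDeriv' h1 (hε0 j) fun i => cut j (G i x)).two_re_trace_le' h2 (hs l).pos
        (fun i => H l i x) one_pos
      rw [inv_one, one_mul, one_mul] at this
      linarith
    have ht : Tendsto (fun l => 2 * ∫ x, ∑ i, ((V i x)ᴴ * H l i x).trace.re ∂μ -
        ∫ x, (σs l x * N x).trace.re ∂μ) U (𝓝 (2 * ∫ x, ∑ i, ((V i x)ᴴ * G i x).trace.re ∂μ -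
          ∫ x, (σ x * N x).trace.re ∂μ)) := by
      simp only [(hVH _).2, hVG.2, (hre (hsi _)).2, (hre hσi).2]
      refine (((Complex.continuous_re.tendsto _).comp ?_).const_mul 2).sub
        ((Complex.continuous_re.tendsto _).comp ?_)
      · exact tendsto_finsetSum _ fun a _ => tendsto_finsetSum _ fun b _ => tendsto_finsetSum _
          fun i _ => hglim i a b _ (hV i a b)
      · exact tendsto_finsetSum _ fun a _ => tendsto_finsetSum _ fun b _ =>
          (tendsto_integral_conj_mul (memLp_conj (hNm b a)) (fun l => hsi l a b) (hσi a b)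
            (hlim a b)).mono_left hU
    have hfin := le_of_tendsto' ht hl
    rw [← integral_const_mul, ← integral_sub (hVG.1.const_mul 2) (hre hσi).1] at hfin
    have hnn : ∀ᵐ x ∂μ, ∀ i, 0 ≤ fisherReal (A j x) (cut j (G i x)) := (hAp j).mono fun x hx i =>
      fisherReal_nonneg hx (hε0 j) _
    have hle : ∀ᵐ x ∂μ, ∑ i, fisherReal (A j x) (cut j (G i x)) ≤
        2 * ∑ i, ((V i x)ᴴ * G i x).trace.re - (σ x * N x).trace.re :=
      hσ.mono fun x hx => two_mul_sub_cut hx (hε0 j) j fun i => G i x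
    have hint := (hVG.1.const_mul 2).sub (hre hσi).1
    refine le_trans (lintegral_mono_ae (g := fun x => ENNReal.ofReal
      (2 * ∑ i, ((V i x)ᴴ * G i x).trace.re - (σ x * N x).trace.re)) ?_)
      ((ofReal_integral_eq_lintegral_ofReal hint ?_).symm.trans_le (ENNReal.ofReal_le_ofReal hfin))
    · filter_upwards [hAp j, hle, hnn] with x h1 h2 h3
      rw [Finset.sum_congr rfl fun i _ => fisherDensity_eq_ofReal h1 (hε0 j) _,
        ← ENNReal.ofReal_sum_of_nonneg fun i _ => h3 i]
      exact ENNReal.ofReal_le_ofReal h2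
    · filter_upwards [hle, hnn] with x h2 h3 using (Finset.sum_nonneg fun i _ => h3 i).trans h2
  have hfd : ∀ᵐ x ∂μ, Tendsto (fun j => ∑ i, fisherDensity (A j x) (cut j (G i x))) atTop
      (𝓝 (∑ i, fisherDensity (σ x) (G i x))) := hσ.mono fun x hx => tendsto_finsetSum _ fun i _ =>
    (tendsto_fisherDensity_add hx (G i x) hε0 (fun a b h => Nat.one_div_le_one_div h)
      tendsto_one_div_add_atTop_nhds_zero_nat).congr' ((tendsto_cut (G i x)).mono fun j hj => by
        simp only [hA, hj])
  calc ∫⁻ x, ∑ i, fisherDensity (σ x) (G i x) ∂μ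
      = ∫⁻ x, liminf (fun j => ∑ i, fisherDensity (A j x) (cut j (G i x))) atTop ∂μ :=
        lintegral_congr_ae (hfd.mono fun x hx => hx.liminf_eq.symm)
    _ ≤ liminf (fun j => ∫⁻ x, ∑ i, fisherDensity (A j x) (cut j (G i x)) ∂μ) atTop :=
        lintegral_liminf_le fun j => Finset.measurable_sum _ fun i _ =>
          measurable_fisherDensity (hAm j) (hcm j i)
    _ ≤ liminf (fun _ : ℕ => ENNReal.ofReal K) atTop := liminf_le_liminf (Eventually.of_forall main)
    _ = ENNReal.ofReal K := liminf_const _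

/-! ### Monotonicity for general densities. -/

theorem exists_measurable_matrix (hρ : ∀ a b, AEStronglyMeasurable (fun x => ρ x a b) μ) :
    ∃ ρ' : M → 𝕄, (∀ a b, Measurable fun x => ρ' x a b) ∧ ρ =ᵐ[μ] ρ' :=
  ⟨fun x => Matrix.of fun a b => (hρ a b).mk _ x,
    fun a b => (hρ a b).stronglyMeasurable_mk.measurable, ae_eq_matrix fun a b => (hρ a b).ae_eq_mk⟩

theorem IsAdjointImage.congr {ρ' σ' : M → 𝕄} (h : IsAdjointImage μ P ρ σ)
    (hρ : ρ =ᵐ[μ] ρ') (hσ : σ =ᵐ[μ] σ') : IsAdjointImage μ P ρ' σ' := fun a b =>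
  (isAdjointImage_iff.1 h a b).congr (hρ.mono fun x hx => by simp only [hx])
    (hσ.mono fun x hx => by simp only [hx])

include hμ hX hL

/-- The approximation lies between `ε` and `R + ε`, so its squared gradient is at most `R + ε` times
the Fisher density, which is integrable by assumption. A bounded function with such a gradient is in
the closed domain. -/
theorem isNice_yosida (hρm : ∀ a b, Measurable fun x => ρ x a b)
    (hGm : ∀ i a b, Measurable fun x => G i x a b) (hρ : ∀ᵐ x ∂μ, (ρ x).PosSemidef)
    (h : IsMatrixWeakGrad μ X ρ G) (hfin : ∫⁻ x, ∑ i, fisherDensity (ρ x) (G i x) ∂μ ≠ ⊤)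
    (hR : 0 < R) (hε : 0 < ε) :
    IsNice μ X ε (R + ε) (fun x => yosida R ε (ρ x)) (fun i x => yosidaGrad R (ρ x) (G i x)) ∧
      ∫ x, ∑ i, fisherReal (yosida R ε (ρ x)) (yosidaGrad R (ρ x) (G i x)) ∂μ ≤
        (∫⁻ x, ∑ i, fisherDensity (ρ x) (G i x) ∂μ).toReal := by
  have hm : ∀ a b, Measurable fun x => yosida R ε (ρ x) a b := fun a b => by
    simp only [yosida, Matrix.sub_apply, Matrix.smul_apply, smul_eq_mul]
    exact (((measurable_resolvent_apply hρm a b).comp (measurable_id.prodMk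
      measurable_const)).const_mul _).const_sub _
  have hGm' : ∀ i a b, Measurable fun x => yosidaGrad R (ρ x) (G i x) a b := fun i a b => by
    simp only [yosidaGrad, Matrix.smul_apply, smul_eq_mul]
    exact ((measurable_resolvent_mul_apply hρm (hGm i) a b).comp (measurable_id.prodMk
      measurable_const)).const_mul _
  have hle : ∀ᵐ x ∂μ, (yosida R ε (ρ x) - (ε : ℂ) • 1).PosSemidef :=
    hρ.mono fun x hx => yosida_sub_posSemidef hx hR
  have hge : ∀ᵐ x ∂μ, (((R + ε : ℝ) : ℂ) • 1 -
      yosida R ε (ρ x)).PosSemidef := hρ.mono fun x hx => sub_yosida_posSemidef hx hR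
  have hbd : ∀ᵐ x ∂μ, ∀ i, ENNReal.ofReal (hsNormSq (yosidaGrad R (ρ x) (G i x))) ≤
      ENNReal.ofReal (R + ε) * fisherDensity (ρ x) (G i x) := by
    filter_upwards [hρ, hle, hge] with x h1 h2 h3 i
    exact (ofReal_hsNormSq_le (posSemidef_of_sub hε.le h2) (add_pos hR hε) h3).trans
      (mul_le_mul_right (fisherDensity_yosida_le h1 hR hε.le) _)
  have hint : ∀ i, Integrable (fun x => hsNormSq (yosidaGrad R (ρ x) (G i x))) μ := fun i => by
    refine ⟨(measurable_hsNormSq (hGm' i)).aestronglyMeasurable, ?_⟩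
    rw [hasFiniteIntegral_iff_ofReal (ae_of_all _ fun x => hsNormSq_nonneg _)]
    refine (lintegral_mono_ae (g := fun x => ENNReal.ofReal (R + ε) *
      ∑ i, fisherDensity (ρ x) (G i x)) (hbd.mono fun x hx => (hx i).trans ?_)).trans_lt ?_
    · exact mul_le_mul_right (Finset.single_le_sum
        (f := fun i => fisherDensity (ρ x) (G i x)) (fun _ _ => zero_le) (Finset.mem_univ i)) _
    · rw [lintegral_const_mul' _ _ ENNReal.ofReal_ne_top]
      exact ENNReal.mul_lt_top ENNReal.ofReal_lt_top hfin.lt_top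
  have hN : IsNice μ X ε (R + ε) (fun x => yosida R ε (ρ x))
      (fun i x => yosidaGrad R (ρ x) (G i x)) :=
    { meas := hm
      meas_grad := hGm'
      pos := hε
      le := hle
      ge := hge
      grad := fun a b => (h.yosida hμ hX hρ hR ε a b).isClosedGrad hμ hX hL
        (c := n * (R + ε)) (by
          filter_upwards [hle, hge] with x h2 h3
          exact (norm_apply_le_trace (posSemidef_of_sub hε.le h2) a b).trans
            (re_trace_le_of_sub h3))
        fun i => memLp_two_of_sq_le (hGm' i a b).aestronglyMeasurable (hint i)
          (ae_of_all _ fun x => norm_sq_le_hsNormSq _ a b) }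
  refine ⟨hN, ENNReal.ofReal_le_iff_le_toReal hfin |>.1 ?_⟩
  rw [← lintegral_fisherDensity hε hle hN.integrable_fisherReal.1]
  exact lintegral_mono_ae (hρ.mono fun x hx => Finset.sum_le_sum fun i _ =>
    fisherDensity_yosida_le hx hR hε.le)

omit hμ hX hL in
theorem tendsto_eLpNorm_yosida (hρ : ∀ᵐ x ∂μ, (ρ x).PosSemidef)
    (hρi : ∀ a b, Integrable (fun x => ρ x a b) μ) {R ε : ℕ → ℝ} (hR : ∀ j, 0 < R j)
    (hRt : Tendsto R atTop atTop) (hε : ∀ j, 0 ≤ ε j) (hε1 : ∀ j, ε j ≤ 1)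
    (hεt : Tendsto ε atTop (𝓝 0)) (a b : Fin n)
    (hm : ∀ j, AEStronglyMeasurable (fun x => yosida (R j) (ε j) (ρ x) a b) μ) :
    Tendsto (fun j => eLpNorm ((fun x => yosida (R j) (ε j) (ρ x) a b) - fun x => ρ x a b) 1 μ)
      atTop (𝓝 0) := by
  refine tendsto_eLpNorm_zero_of_dominated (b := fun x => (ρ x).trace + n) one_ne_zero
    ENNReal.one_ne_top (fun j => (hm j).sub (hρi a b).1) (memLp_one_iff_integrable.2
      ((integrable_finsetSum _ fun a _ => hρi a a).add (integrable_const _)))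
    (fun j => hρ.mono fun x hx => ?_) (hρ.mono fun x hx => ?_)
  · refine (norm_yosida_sub_le hx (hR j) (hε j) a b).trans (le_trans ?_ (Complex.re_le_norm _))
    rw [Complex.add_re, Complex.natCast_re]
    nlinarith [hε1 j, (n.cast_nonneg : (0 : ℝ) ≤ n)]
  · simpa using (tendsto_yosida hx hR hRt hεt a b).sub_const (ρ x a b)

include hP hC hPL

/-- The Yosida approximations with `R = j + 1` and `ε = 1 / (j + 1)` satisfy the inequality. They
converge to `ρ` in `L¹`, hence so do their adjoint images to `σ` by contraction, and lower
semicontinuity concludes. -/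
theorem IsAdjointImage.fisherInfo_le_of_ne_top (had : IsAdjointImage μ P ρ σ)
    (hρ : ∀ᵐ x ∂μ, (ρ x).PosSemidef) (hρi : ∀ a b, Integrable (fun x => ρ x a b) μ)
    (hfin : fisherInfo μ X ρ ≠ ⊤) : fisherInfo μ X σ ≤ ENNReal.ofReal C * fisherInfo μ X ρ := by
  obtain ⟨ρ', hρm, hρe⟩ := exists_measurable_matrix fun a b => (hρi a b).1
  obtain ⟨σ', hσm, hσe⟩ := exists_measurable_matrix fun a b => (had a b).1.1
  have hσ := had.posSemidef hP hρi hρ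
  have hσi := fun a b => (had a b).1
  rw [fisherInfo_congr hρe] at hfin ⊢
  rw [fisherInfo_congr hσe]
  replace had := had.congr hρe hσe
  replace hρ : ∀ᵐ x ∂μ, (ρ' x).PosSemidef := by filter_upwards [hρ, hρe] with x h1 h2 using h2 ▸ h1
  replace hσ : ∀ᵐ x ∂μ, (σ' x).PosSemidef := by filter_upwards [hσ, hσe] with x h1 h2 using h2 ▸ h1
  replace hρi : ∀ a b, Integrable (fun x => ρ' x a b) μ := fun a b =>
    (hρi a b).congr (hρe.mono fun x hx => by simp only [hx])
  obtain ⟨G₀, hG₀⟩ : ∃ G, IsMatrixWeakGrad μ X ρ' G := by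
    by_contra! hcon
    exact hfin (by simp [fisherInfo, hcon])
  choose G hGm hGe using fun i => exists_measurable_matrix (μ := μ) (ρ := G₀ i) fun a b =>
    ((hG₀ a b).2 i).1.1
  have hG : IsMatrixWeakGrad μ X ρ' G := fun a b => (hG₀ a b).congr (ae_eq_refl _) fun i =>
    (hGe i).mono fun x hx => by simp only [hx]
  rw [fisherInfo_eq hμ hX hρm hGm hG] at hfin ⊢
  set K := ∫⁻ x, ∑ i, fisherDensity (ρ' x) (G i x) ∂μ
  have hN := fun j : ℕ => isNice_yosida hμ hX hL hρm hGm hρ hG hfin (R := j + 1)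
    (ε := 1 / ((j : ℝ) + 1)) j.cast_add_one_pos Nat.one_div_pos_of_nat
  have hNi := fun j a b => ((hN j).1.memLp_apply a b).integrable le_top
  have hy := fun a b => tendsto_eLpNorm_yosida (R := fun j : ℕ => (j : ℝ) + 1)
    (ε := fun j : ℕ => 1 / ((j : ℝ) + 1)) hρ hρi (fun j => j.cast_add_one_pos)
    (tendsto_atTop_add_const_right _ _ tendsto_natCast_atTop_atTop)
    (fun j => Nat.one_div_pos_of_nat.le) (fun j => by
      rw [div_le_one j.cast_add_one_pos]; linarith [(j.cast_nonneg : (0 : ℝ) ≤ j)])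
    tendsto_one_div_add_atTop_nhds_zero_nat a b fun j => (hNi j a b).1
  choose s₀ hs₀ using fun j => IsAdjointImage.exists_of_integrable hP (hNi j)
  choose s hsm hse using fun j => exists_measurable_matrix fun a b => (hs₀ j a b).1.1
  have hs := fun j => (hs₀ j).congr (ae_eq_refl _) (hse j)
  choose H hH hHle using fun j => (hN j).1.exists_adjoint hμ hX hL hP hC hPL (hs j) (hsm j)
  obtain ⟨F, hFm, hF, hFle⟩ := exists_weakGrad_of_fisherReal_le hX hH (K := max C 0 * K.toReal)
    (fun j => (hHle j).trans (mul_le_mul_of_nonneg_left (hN j).2 (le_max_right _ _))) hσ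
    (fun a b => (had a b).1) hσm fun a b => (isAdjointImage_iff.1 had a b).tendsto hP
      (fun j => hNi j a b) (hρi a b) (fun j => isAdjointImage_iff.1 (hs j) a b) (hy a b)
  rw [fisherInfo_eq hμ hX hσm hFm hF]
  refine hFle.trans_eq ?_
  rw [ENNReal.ofReal_mul (le_max_right _ _), ENNReal.ofReal_toReal hfin]
  congr 1
  rcases le_total C 0 with h | h
  · rw [max_eq_right h, ENNReal.ofReal_zero, ENNReal.ofReal_of_nonpos h]
  · rw [max_eq_left h]

/-! ### Nonpositive constants and infinite Fisher information. -/

/-- If the gradient estimate holds with a constant `C ≤ 0`, all functions in the range of `P^†` have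
weak gradient zero. -/
theorem IsAdj.isWeakGrad_zero (hC0 : C ≤ 0) {h s : M → ℂ} (hs : IsAdj μ P h s) :
    IsWeakGrad μ X s fun _ _ => 0 := by
  have hC' := hC.max_zero hP
  rw [max_eq_right hC0] at hC'
  have hK : ∀ φ, IsTest d φ → ∃ K : Fin k → M → ℂ, IsClosedGrad μ X (markovApply P φ) K ∧
      ∀ i, K i =ᵐ[μ] 0 := fun φ hφ => by
    obtain ⟨K, hK, h1, -⟩ := hC'.exists_closedGrad hμ hX hL hP le_rfl hφ
    refine ⟨K, hK, fun i => h1.mono fun x hx => ?_⟩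
    rw [zero_mul] at hx
    have := (Finset.sum_eq_zero_iff_of_nonneg fun i _ => sq_nonneg _).1
      (le_antisymm hx (Finset.sum_nonneg fun i _ => sq_nonneg _)) i (Finset.mem_univ i)
    simpa using this
  -- The gradient of `t = P^† r` pairs with test gradients as that of `r` does with `∇ P φ = 0`.
  -- Hence `L t = 0`, and the energy of `t` vanishes.
  have htest : ∀ r, IsTest d r → ∀ t, IsAdj μ P r t → ∃ H, IsClosedGrad μ X t H ∧ ∀ i, H i =ᵐ[μ] 0 := by
    intro r hr t ht
    obtain ⟨H, hH, hrel⟩ := ht.exists_closedGrad hμ hX hL hP hC hPL (hr.isClosedGrad hX)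
    have h1 : IsSubLaplacian μ X t fun _ => 0 := ⟨MemLp.zero', H, hH, fun φ hφ => by
      obtain ⟨K, hK, hK0⟩ := hK φ hφ
      rw [hrel φ hφ K hK]
      simp only [mul_zero, integral_zero, neg_zero]
      refine Finset.sum_eq_zero fun i _ => integral_eq_zero_of_ae ((hK0 i).mono fun x hx => ?_)
      simp [hx]⟩
    have h2 := h1.sum_integral_eq hμ hX hH hH
    have e : ∀ i, ∫ x, conj (H i x) * H i x ∂μ = ((∫ x, ‖H i x‖ ^ 2 ∂μ : ℝ) : ℂ) := fun i => by
      simp only [conj_mul_self_eq]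
      exact integral_ofReal
    simp only [mul_zero, integral_zero, neg_zero, e] at h2
    rw [← Complex.ofReal_sum, Complex.ofReal_eq_zero, Finset.sum_eq_zero_iff_of_nonneg
      fun i _ => integral_nonneg fun x => sq_nonneg _] at h2
    refine ⟨H, hH, fun i => ?_⟩
    have h3 := (integral_eq_zero_iff_of_nonneg (fun x => sq_nonneg _)
      ((memLp_two_iff_integrable_sq (hH.2.1 i).1.norm).1 (hH.2.1 i).norm)).1
        (h2 i (Finset.mem_univ i))
    exact h3.mono fun x hx => by simpa using hx
  refine ⟨hs.1, fun i => ⟨integrable_zero _ _ _, fun φ ψ hφ hψ => ?_⟩⟩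
  -- `P` annihilates every formal adjoint `ψ` of a test function: against a test function `r` the
  -- pairing moves to `P^† r`, whose gradient is zero. By duality this reaches all integrable `h`.
  have hz : markovApply P ψ =ᵐ[μ] 0 := by
    refine ae_eq_zero_of_forall_isTest (d := d) (memLp_markovApply.integrable le_top) fun r hr => ?_
    obtain ⟨t, ht⟩ := IsAdj.exists_adj hP hr.integrable (P := P)
    obtain ⟨H, hH, hH0⟩ := htest r hr t ht
    have h1 := ht.integral_eq (hψ.1.memLp ∞)
    rw [← ((hH.isWeakGrad hX).2 i).2 φ ψ hφ hψ, integral_eq_zero_of_ae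
      ((hH0 i).mono fun x hx => by simp [hx])] at h1
    have h2 := congrArg conj h1.symm
    rw [← integral_conj, map_zero] at h2
    simpa [mul_comm] using h2
  have h0 : ∫ x, conj (markovApply P ψ x) * h x ∂μ = 0 :=
    integral_eq_zero_of_ae (hz.mono fun x hx => by simp [hx])
  rw [hs.integral_eq (hψ.1.memLp ∞), h0]
  simp

theorem IsAdjointImage.fisherInfo_le (had : IsAdjointImage μ P ρ σ)
    (hρ : ∀ᵐ x ∂μ, (ρ x).PosSemidef) (hρi : ∀ a b, Integrable (fun x => ρ x a b) μ) :
    fisherInfo μ X σ ≤ ENNReal.ofReal C * fisherInfo μ X ρ := by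
  by_cases hfin : fisherInfo μ X ρ = ⊤
  -- For `C ≤ 0` the right side is `0 * ∞ = 0`, so the Fisher information of `σ` must be shown to
  -- vanish.
  · rcases le_or_gt C 0 with h | h
    · refine (iInf₂_le (fun _ _ => 0) fun a b => (isAdjointImage_iff.1 had a b).isWeakGrad_zero
        hμ hX hL hP hC hPL h).trans ?_
      simp
    · rw [hfin, ENNReal.mul_top (ENNReal.ofReal_pos.2 h).ne']
      exact le_top
  · exact had.fisherInfo_le_of_ne_top hμ hX hL hP hC hPL hρ hρi hfin

omit hPL

/-! ### Entropy production. -/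

omit hP hC in
/-- The entropy production `-∫ tr((L ρ) ln ρ)` is the Fisher information. -/
theorem IsMatrixSubLaplacian.traceMulLog (hρ : IsUniformlyPositive μ ρ) (h : IsMatrixSubLaplacian μ X ρ u) :
    Integrable (traceMulLog u ρ) μ ∧
      fisherInfo μ X ρ = ENNReal.ofReal (-(∫ x, SubLaplacian.traceMulLog u ρ x ∂μ).re) ∧
      0 ≤ -(∫ x, SubLaplacian.traceMulLog u ρ x ∂μ).re := by
  obtain ⟨δ, hδ, hρδ⟩ := hρ
  choose G₀ hG₀ _ using fun a b => (h a b).2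
  obtain ⟨ρ', hρm, hρe⟩ := exists_measurable_matrix fun a b => (hG₀ a b).1.1
  choose G hGm hGe using fun i => exists_measurable_matrix (μ := μ)
    (ρ := fun x => Matrix.of fun a b => G₀ a b i x) fun a b => ((hG₀ a b).2.1 i).1
  have hρab : ∀ a b, (fun x => ρ x a b) =ᵐ[μ] fun x => ρ' x a b := fun a b =>
    hρe.mono fun x hx => by simp only [hx]
  have hG : ∀ a b, IsClosedGrad μ X (fun x => ρ' x a b) (fun i x => G i x a b) := fun a b =>
    (hG₀ a b).congr (hρab a b) fun i => (hGe i).mono fun x hx => by simp only [← hx, of_apply]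
  have h' : ∀ a b, IsSubLaplacian μ X (fun x => ρ' x a b) (fun x => u x a b) := fun a b =>
    (h a b).congr (hρab a b) (ae_eq_refl _)
  replace hρδ : ∀ᵐ x ∂μ, (ρ' x - (δ : ℂ) • 1).PosSemidef := by
    filter_upwards [hρδ, hρe] with x h1 h2 using h2 ▸ h1
  have hlog := IsClosedGrad.matrix_log hμ hX hL hρm hGm hδ hρδ hG
  have hint := fun a b => integrable_conj_mul_two (hlog a b).1 (h' a b).1
  have he : SubLaplacian.traceMulLog u ρ =ᵐ[μ] fun x =>
      ∑ a, ∑ b, conj (cfc Real.log (ρ' x) a b) * u x a b := by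
    filter_upwards [hρδ, hρe] with x h1 h2
    obtain ⟨U, hU, a, ha, -, hf⟩ := exists_diagConj_of_sub h1
    rw [SubLaplacian.traceMulLog, h2, trace_mul_comm, ← trace_conjTranspose_mul, hf,
      diagConj_conjTranspose]
  have hi : Integrable (SubLaplacian.traceMulLog u ρ) μ := (integrable_finsetSum _ fun a _ =>
    integrable_finsetSum _ fun b _ => hint a b).congr he.symm
  have hF := integral_re_trace_mul (V := fun i x => logDeriv (ρ' x) (G i x)) (W := G) fun i a b =>
    integrable_conj_mul_two ((hlog a b).2.1 i) ((hG a b).2.1 i)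
  -- Integration by parts against the entries of `ln ρ`, which lie in the closed domain; conjugation
  -- is harmless as `ln ρ` is Hermitian.
  have e : -(∫ x, SubLaplacian.traceMulLog u ρ x ∂μ).re = ∫ x, ∑ i, fisherReal (ρ' x) (G i x) ∂μ := by
    refine Eq.trans ?_ hF.2.symm
    rw [← Complex.neg_re, integral_congr_ae he,
      integral_finsetSum _ fun a _ => integrable_finsetSum _ fun b _ => hint a b]
    simp only [integral_finsetSum _ fun b _ => hint _ b]
    simp only [← Finset.sum_neg_distrib, (h' _ _).sum_integral_eq hμ hX (hG _ _) (hlog _ _)]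
  refine ⟨hi, ?_, e ▸ integral_nonneg_of_ae (hρδ.mono fun x hx => Finset.sum_nonneg fun i _ =>
    fisherReal_nonneg hx hδ _)⟩
  rw [e, fisherInfo_congr hρe, fisherInfo_eq hμ hX hρm hGm fun a b => (hG a b).isWeakGrad hX]
  exact lintegral_fisherDensity hδ hρδ hF.1

omit hμ hL

/-- A gradient estimate with negative constant forces all gradients to vanish. -/
theorem GradientEstimate.grad_eq_zero (hC0 : C < 0) {G : Fin k → M → ℂ}
    (h : IsClosedGrad μ X f G) (i : Fin k) : G i =ᵐ[μ] 0 := by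
  have htest : ∀ f, IsTest d f → lieD (X i) f =ᵐ[μ] 0 := by
    intro f hf
    have hS := hf.memLp_carre hX (μ := μ)
    obtain ⟨K, -, hK⟩ := hC f hf ((hf.memLp ∞).toLp f) (hS.toLp _) (MemLp.coeFn_toLp _)
      (MemLp.coeFn_toLp _)
    rw [← markovApply_def hS] at hK
    have h0 : ∀ x, 0 ≤ carre X f x := fun x => Finset.sum_nonneg fun i _ => sq_nonneg _
    -- Both `P Γ(f, f) ≥ 0` and `C P Γ(f, f) ≥ 0` hold with `C < 0`, so `P Γ(f, f) = 0`; invariance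
    -- of `μ` then gives `∫ Γ(f, f) = 0`.
    have hPS : markovApply P (↟(carre X f)) =ᵐ[μ] 0 := by
      filter_upwards [hK, hP.apply_nonneg hS (ae_of_all _ fun x =>
        Complex.zero_le_real.2 (h0 x))] with x h1 h2
      obtain ⟨h3, h4⟩ := Complex.nonneg_iff.1 h2
      refine Complex.ext ?_ h4.symm
      have h5 : 0 ≤ C * (markovApply P (↟(carre X f)) x).re :=
        (Finset.sum_nonneg fun i _ => sq_nonneg _).trans h1
      exact le_antisymm (nonpos_of_mul_nonneg_right h5 hC0) h3
    have h1 := hP.integral_apply hS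
    rw [integral_eq_zero_of_ae hPS, integral_complex_ofReal, eq_comm, Complex.ofReal_eq_zero,
      integral_eq_zero_iff_of_nonneg h0 (by simpa using (hS.integrable le_top).re)] at h1
    refine h1.mono fun x hx => ?_
    have := (Finset.sum_eq_zero_iff_of_nonneg fun i _ => sq_nonneg _).1 hx i (Finset.mem_univ i)
    simpa using this
  obtain ⟨-, hG, v, hv, -, hlim⟩ := h
  have h1 : eLpNorm (G i) 2 μ = 0 := tendsto_nhds_unique (tendsto_const_nhds.congr fun j => by
    rw [← eLpNorm_neg]
    exact eLpNorm_congr_ae ((htest _ (hv j)).mono fun x hx => by simp [hx])) (hlim i)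
  exact (eLpNorm_eq_zero_iff (hG i).1 two_ne_zero).1 h1

omit hX hP hC

theorem fisherInfo_eq_zero (h : ∀ a b, ∃ G, IsWeakGrad μ X (fun x => ρ x a b) G ∧ ∀ i, G i =ᵐ[μ] 0) :
    fisherInfo μ X ρ = 0 := by
  refine le_antisymm ((iInf₂_le (fun _ _ => 0) fun a b => ?_).trans (by simp)) bot_le
  obtain ⟨G, hG, h0⟩ := h a b
  exact hG.congr (ae_eq_refl _) h0

end Manifold

end
end SubLaplacian

theorem mainTheorem7 {d k n : ℕ} {M : Type*} [TopologicalSpace M] [T2Space M]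
    [SecondCountableTopology M] [ChartedSpace (EuclideanSpace ℝ (Fin d)) M]
    [IsManifold (𝓡 d) ∞ M] [MeasurableSpace M] [BorelSpace M]
    (μ : Measure M) [IsProbabilityMeasure μ] (hμ : SubLaplacian.IsSmoothMeasure d μ)
    (X : Fin k → SubLaplacian.VField d M) (hX : ∀ i, SubLaplacian.IsSmoothField (X i))
    (hL : SubLaplacian.IsConservative μ X)
    (P : Lp ℂ ∞ μ →ₗ[ℂ] Lp ℂ ∞ μ) (hP : SubLaplacian.IsMarkovMap μ P)
    (C : ℝ) (hC : SubLaplacian.GradientEstimate μ X P C)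
    (hPL : SubLaplacian.Commutes μ X P)
    (ρ : M → Matrix (Fin n) (Fin n) ℂ) (hρ : SubLaplacian.IsMatrixDensity μ ρ) :
    (∃ σ : M → Matrix (Fin n) (Fin n) ℂ, SubLaplacian.IsAdjointImage μ P ρ σ) ∧
    ∀ σ : M → Matrix (Fin n) (Fin n) ℂ, SubLaplacian.IsAdjointImage μ P ρ σ →
      SubLaplacian.IsMatrixDensity μ σ ∧
      SubLaplacian.fisherInfo μ X σ ≤ ENNReal.ofReal C * SubLaplacian.fisherInfo μ X ρ ∧
      (SubLaplacian.IsUniformlyPositive μ ρ → ∀ u : M → Matrix (Fin n) (Fin n) ℂ,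
        SubLaplacian.IsMatrixSubLaplacian μ X ρ u →
        Integrable (SubLaplacian.traceMulLog u ρ) μ ∧
        (∃ v : M → Matrix (Fin n) (Fin n) ℂ, SubLaplacian.IsMatrixSubLaplacian μ X σ v) ∧
        ∀ v : M → Matrix (Fin n) (Fin n) ℂ, SubLaplacian.IsMatrixSubLaplacian μ X σ v →
          Integrable (SubLaplacian.traceMulLog v σ) μ ∧
          -(∫ x, SubLaplacian.traceMulLog v σ x ∂μ).re ≤
            C * -(∫ x, SubLaplacian.traceMulLog u ρ x ∂μ).re) := by
  have : LocallyCompactSpace M := ChartedSpace.locallyCompactSpace (EuclideanSpace ℝ (Fin d)) M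
  refine ⟨SubLaplacian.IsAdjointImage.exists_of_integrable hP hρ.integrable, fun σ hσ => ?_⟩
  have hle := hσ.fisherInfo_le hμ hX hL hP hC hPL hρ.posSemidef hρ.integrable
  refine ⟨hρ.adjointImage hP hσ, hle, fun hpos u hu => ?_⟩
  obtain ⟨h1, h2, h3⟩ := hu.traceMulLog hμ hX hL hpos
  refine ⟨h1, ?_, fun v hv => ?_⟩
  · obtain ⟨v, hv⟩ := SubLaplacian.IsAdjointImage.exists_of_integrable hP
      fun a b => (hu a b).1.integrable one_le_two
    exact ⟨v, fun a b => (hu a b).adj hμ hX hL hP hC hPL (hσ a b) (hv a b)⟩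
  · obtain ⟨h4, h5, h6⟩ := hv.traceMulLog hμ hX hL (hpos.adjointImage hP hρ.integrable hσ)
    refine ⟨h4, ?_⟩
    rw [h2, h5] at hle
    rcases le_or_gt 0 C with h | h
    · rwa [← ENNReal.ofReal_mul h, ENNReal.ofReal_le_ofReal_iff (mul_nonneg h h3)] at hle
    -- For `C < 0` the bound through `ENNReal.ofReal C = 0` does not give the real inequality by
    -- itself. The gradient of `ρ` vanishes, so its entropy production is zero and the right side is
    -- zero as well.
    · have h7 := SubLaplacian.fisherInfo_eq_zero (X := X) (μ := μ) (ρ := ρ) fun a b => by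
        obtain ⟨-, G, hG, -⟩ := hu a b
        exact ⟨G, hG.isWeakGrad hX, hC.grad_eq_zero hX hP h hG⟩
      rw [h2, ENNReal.ofReal_eq_zero] at h7
      rw [h2.symm.trans (h2.trans (ENNReal.ofReal_eq_zero.2 h7)), mul_zero, nonpos_iff_eq_zero,
        ENNReal.ofReal_eq_zero] at hle
      rw [le_antisymm h7 h3, mul_zero]
      exact hle
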